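/- Let $n,r,s\ge 0$ be integers, let $q$ be an indeterminate, and put $\xi=q-q^{-1}$. Let $\mathtt I=\{\pm1,\dots,\pm n\}$, with $|i|=1$ for $i<0$ and $|i|=0$ for $i>0$. Let $V_q$ be the superspace over $\mathbb C(q)$ with basis $v_i$ ($i\in\mathtt I$) of parity $|i|$, let $\omega_i$ be the dual basis of $V_q^*$, let $E_{ij}$ be the matrix units, of parity $|i|+|j|$, and let ${}^{\mathtt T}$ be the supertranspose $E_{ij}^{\mathtt T}=(-1)^{(|i|+|j|)|i|}E_{ji}$ (applied to each tensor factor of an element of $\mathrm{End}(V_q)^{\otimes2}$). All tensor products are taken in the super sense, and $V_q^*$ is identified with $V_q$ by $\omega_i\mapsto v_i$ when matrix units are applied to it. Put $$S=\sum_{i,j\in\mathtt I}q^{(\delta_{ij}+\delta_{i,-j})(1-2|j|)}E_{ii}\otimes E_{jj}+\xi\sum_{i<j}(-1)^{|i|}(E_{ji}+E_{-j,-i})\otimes E_{ij}=\sum_{i,j}S_{ij}\otimes E_{ij}.$$ The quantum queer superalgebra $\mathfrak U_q(\mathfrak q(n))$ is the associative unital $\mathbb C(q)$-superalgebra generated by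 $u_{ij}$ ($i\le j$ in $\mathtt I$), of parity $|i|+|j|$, with relations $u_{ii}u_{-i,-i}=1=u_{-i,-i}u_{ii}$ and $U^{12}U^{13}S^{23}=S^{23}U^{13}U^{12}$, where $U=\sum_{i\le j}u_{ij}\otimes E_{ij}$. It acts on $V_q$ by $u_{ij}\mapsto S_{ij}$, on $V_q^*$ by the dual action through the antipode $U\mapsto U^{-1}$ (so $U$ acts by the supertranspose of $S^{-1}$ in the first factor), and on $V_q^{r,s}=V_q^{\otimes r}\otimes(V_q^*)^{\otimes s}$ through the iterated coproduct $\Delta(u_{ij})=\sum_k(-1)^{(|i|+|k|)(|k|+|j|)}u_{ik}\otimes u_{kj}$ (for $r=s=0$, by the counit $u_{ij}\mapsto\delta_{ij}$). Let $\mathrm{End}_{\mathfrak U_q(\mathfrak q(n))}(V_q^{r,s})$ be the superalgebra of all sums of homogeneous endomorphisms of $V_q^{r,s}$ that supercommute with this action. The quantum walled Brauer–Clifford superalgebra $\mathsf{BC}_{r,s}(q)$ is the associative unital $\mathbb C(q)$-superalgebra generated by even elements $t_1,\dots,t_{r-1},t_1^*,\dots,t_{s-1}^*$ and $e$ (the latter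 only if $r,s\ge1$) and odd elements $c_1,\dots,c_r,c_1^*,\dots,c_s^*$, with the following relations for all indices for which they make sense: - $t_i^2-\xi t_i-1=0$, $t_it_{i+1}t_i=t_{i+1}t_it_{i+1}$, $t_it_j=t_jt_i$ ($|i-j|>1$), the same relations for the $t_i^*$, and $t_it_j^*=t_j^*t_i$; - $e^2=0$, $et_{r-1}e=e$, $et_j=t_je$ ($j\ne r-1$), $et_1^*e=e$, $et_j^*=t_j^*e$ ($j\neq1$), $et_{r-1}^{-1}t_1^*et_1^*t_{r-1}^{-1}=t_{r-1}^{-1}t_1^*et_1^*t_{r-1}^{-1}e$; - $c_i^2=-1$, $(c_i^*)^2=1$, $c_ic_j=-c_jc_i$ and $c_i^*c_j^*=-c_j^*c_i^*$ ($i\ne j$), $c_ic_j^*=-c_j^*c_i$; - $t_ic_i=c_{i+1}t_i$, $t_ic_j=c_jt_i$ ($j\ne i,i+1$), $t_i^*c_i^*=c_{i+1}^*t_i^*$, $t_i^*c_j^*=c_j^*t_i^*$ ($j\neq i,i+1$), $t_ic_j^*=c_j^*t_i$, $t_i^*c_j=c_jt_i^*$; - $c_re=c_1^*e$, $ec_r=ec_1^*$,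 $c_je=ec_j$ ($j\ne r$), $c_j^*e=ec_j^*$ ($j\ne1$), $ec_re=0$. Put $P=\sum_{i,j}(-1)^{|j|}E_{ij}\otimes E_{ji}$, $\Phi=\sum_i(-1)^{|i|}E_{i,-i}$ and $\cap\cup=q^{-(2n+1)}\sum_{i,j}(-1)^{|i||j|}q^{2j(1-2|j|)}E_{ij}\otimes E_{ij}$. Theorem. The action of $\mathfrak U_q(\mathfrak q(n))$ on $V_q^{r,s}$ is well defined, and there is a homomorphism of superalgebras $$\rho_{n,q}^{r,s}:\mathsf{BC}_{r,s}(q)\to\mathrm{End}_{\mathfrak U_q(\mathfrak q(n))}(V_q^{r,s})$$ given on the generators by $t_i\mapsto\mathrm{id}^{\otimes(i-1)}\otimes PS\otimes\mathrm{id}^{\otimes(r+s-1-i)}$, $c_i\mapsto\mathrm{id}^{\otimes(i-1)}\otimes\Phi\otimes\mathrm{id}^{\otimes(r+s-i)}$, $t_i^*\mapsto\mathrm{id}^{\otimes(r+i-1)}\otimes P^{\mathtt T}S^{\mathtt T}\otimes\mathrm{id}^{\otimes(s-1-i)}$, $c_i^*\mapsto\mathrm{id}^{\otimes(r+i-1)}\otimes\Phi^{\mathtt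 T}\otimes\mathrm{id}^{\otimes(s-i)}$, $e\mapsto\mathrm{id}^{\otimes(r-1)}\otimes\cap\cup\otimes\mathrm{id}^{\otimes(s-1)}$. It is surjective, and it is an isomorphism when $n\ge r+s$. -/

import Mathlib

open scoped TensorProduct

namespace QWBC

noncomputable section

/-! ### The base field, the index set and signs -/

/-- The field `ℂ(q)` of rational functions in the indeterminate `q`. -/
abbrev Cq : Type := RatFunc ℂ

/-- The indeterminate `q`. -/
def q : Cq := RatFunc.X

/-- The index set `{±1, …, ±n}`, with the order inherited from `ℤ`. -/
abbrev Idx (n : ℕ) : Type := {i : ℤ // i ∈ (Finset.Icc (-(n : ℤ)) (n : ℤ)).erase 0}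

/-- The index `-i`. -/
def negIdx {n : ℕ} (i : Idx n) : Idx n :=
  ⟨-i.1, by
    have h := i.2
    simp only [Finset.mem_erase, Finset.mem_Icc, ne_eq] at h ⊢
    omega⟩

/-- The parity `|i|`: it is `1` for `i < 0` and `0` for `i > 0`. -/
def par {n : ℕ} (i : Idx n) : ZMod 2 := if i.1 < 0 then 1 else 0

/-- The integer `1 - 2|i|`. -/
def eps {n : ℕ} (i : Idx n) : ℤ := if i.1 < 0 then -1 else 1

/-- The sign `(-1)^p` for `p` modulo `2`. -/
def sgn (p : ZMod 2) : Cq := if p = 0 then 1 else -1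

/-! ### Elements of `End(V)` and of `End(V) ⊗ End(V)`

An array `x i j` stands for `∑ x i j E_{ij}`, and an array `x i j k l` stands for
`∑ x i j k l E_{ij} ⊗ E_{kl}`. -/

/-- With `z = q` these are the coefficients of
`S = ∑ q^{(δ_{ij}+δ_{i,-j})(1-2|j|)} E_{ii} ⊗ E_{jj}
  + (q-q⁻¹) ∑_{i<j} (-1)^{|i|} (E_{ji}+E_{-j,-i}) ⊗ E_{ij}`;
with `z = q⁻¹` they are the coefficients of the inverse of `S`. -/
def sCoeff {n : ℕ} (z : Cq) (a b i j : Idx n) : Cq :=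
  (if a = b ∧ i = j then
      z ^ (((if a = j then 1 else 0) + (if a = negIdx j then 1 else 0)) * eps j : ℤ) else 0)
  + (if i < j then
      (z - z⁻¹) * sgn (par i) *
        ((if a = j ∧ b = i then 1 else 0) + (if a = negIdx j ∧ b = negIdx i then 1 else 0))
     else 0)

/-- The coefficients of `P = ∑ (-1)^{|j|} E_{ij} ⊗ E_{ji}`. -/
def pCoeff {n : ℕ} (i j k l : Idx n) : Cq := if k = j ∧ l = i then sgn (par j) else 0

/-- The coefficients of `Φ = ∑ (-1)^{|i|} E_{i,-i}`. -/
def phiCoeff {n : ℕ} (i j : Idx n) : Cq := if j = negIdx i then sgn (par i) else 0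

/-- The coefficients of
`∩∪ = q^{-(2n+1)} ∑ (-1)^{|i||j|} q^{2j(1-2|j|)} E_{ij} ⊗ E_{ij}`, that is, of the composite of
`∪(v_i ⊗ ω_j) = (-1)^{|i|} q^{2i(1-2|i|)-(2n+1)} δ_{ij}` and `∩(1) = ∑ v_i ⊗ ω_i`. -/
def capCupCoeff {n : ℕ} (i j k l : Idx n) : Cq :=
  if k = i ∧ l = j then
    q ^ (-(2 * (n : ℤ) + 1)) * sgn (par i * par j) * q ^ (2 * j.1 * eps j)
  else 0

/-- The supertranspose `E_{ij} ↦ (-1)^{(|i|+|j|)|i|} E_{ji}` on `End(V)`. -/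
def superT {n : ℕ} (x : Idx n → Idx n → Cq) (a b : Idx n) : Cq :=
  x b a * sgn ((par b + par a) * par b)

/-- The supertranspose on the first tensor factor of `End(V) ⊗ End(V)`. -/
def superTFirst {n : ℕ} (x : Idx n → Idx n → Idx n → Idx n → Cq) (a b c d : Idx n) : Cq :=
  superT (fun a' b' => x a' b' c d) a b

/-- The supertranspose on both tensor factors of `End(V) ⊗ End(V)`. -/
def superTBoth {n : ℕ} (x : Idx n → Idx n → Idx n → Idx n → Cq) (a b c d : Idx n) : Cq :=
  superT (fun c' d' => superTFirst x a b c' d') c d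

/-! ### Homogeneous components of an algebra with homogeneous generators -/

/-- The span of the products of generators of total degree `p`. -/
def gradedPart {X A : Type} [Ring A] [Algebra Cq A] (gen : X → A) (deg : X → ZMod 2)
    (p : ZMod 2) : Submodule Cq A :=
  Submodule.span Cq {a | ∃ l : List X, (l.map deg).sum = p ∧ a = (l.map gen).prod}

/-! ### The quantum queer superalgebra -/

/-- The generators `u_{ij}`, `i ≤ j`. -/
abbrev UGen (n : ℕ) : Type := {x : Idx n × Idx n // x.1 ≤ x.2}

/-- The free generator `u_{ij}` for `i ≤ j`, and `0` for `i > j`. -/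
def freeU {n : ℕ} (i j : Idx n) : FreeAlgebra Cq (UGen n) :=
  if h : i ≤ j then FreeAlgebra.ι Cq (⟨(i, j), h⟩ : UGen n) else 0

/-- The product of two even elements of the superalgebra `A ⊗ End(V) ⊗ End(V)`, where `Z i j k l`
is the coefficient of `E_{ij} ⊗ E_{kl}` and has degree `|i|+|j|+|k|+|l|`. The sign comes from
moving `E_{ij} ⊗ E_{kl}` past `Y j a l b` and then `E_{kl}` past `E_{ja}`. -/
def tensorMul {n : ℕ} {A : Type} [Ring A] [Algebra Cq A]
    (Z Y : Idx n → Idx n → Idx n → Idx n → A) (i a k b : Idx n) : A :=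
  ∑ j : Idx n, ∑ l : Idx n,
    sgn ((par i + par j + par k + par l) * (par j + par a + par l + par b)
        + (par k + par l) * (par j + par a)) •
      (Z i j k l * Y j a l b)

/-- `U^{12} = ∑ u_{ij} ⊗ E_{ij} ⊗ 1`. -/
def U12 {n : ℕ} (i j k l : Idx n) : FreeAlgebra Cq (UGen n) := if k = l then freeU i j else 0

/-- `U^{13} = ∑ u_{kl} ⊗ 1 ⊗ E_{kl}`. -/
def U13 {n : ℕ} (i j k l : Idx n) : FreeAlgebra Cq (UGen n) := if i = j then freeU k l else 0

/-- `S^{23} = 1 ⊗ S`. -/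
def S23 {n : ℕ} (i j k l : Idx n) : FreeAlgebra Cq (UGen n) :=
  algebraMap Cq _ (sCoeff q i j k l)

/-- The defining relations `u_{ii} u_{-i,-i} = 1` and `U^{12} U^{13} S^{23} = S^{23} U^{13} U^{12}`
(the latter coefficient by coefficient). -/
inductive URel (n : ℕ) : FreeAlgebra Cq (UGen n) → FreeAlgebra Cq (UGen n) → Prop
  | inv (i : Idx n) : URel n (freeU i i * freeU (negIdx i) (negIdx i)) 1
  | rtt (i j k l : Idx n) :
      URel n (tensorMul (tensorMul U12 U13) S23 i j k l)
        (tensorMul (tensorMul S23 U13) U12 i j k l)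

/-- The quantum queer superalgebra `U_q(q(n))`. -/
abbrev Uq (n : ℕ) : Type := RingQuot (URel n)

/-- The generator `u_{ij}` of `U_q(q(n))`. -/
def Uq.gen {n : ℕ} (x : UGen n) : Uq n := RingQuot.mkAlgHom Cq (URel n) (FreeAlgebra.ι Cq x)

/-- The homogeneous components of `U_q(q(n))`, with `u_{ij}` of degree `|i|+|j|`. -/
def Uq.part (n : ℕ) (p : ZMod 2) : Submodule Cq (Uq n) :=
  gradedPart Uq.gen (fun x : UGen n => par x.1.1 + par x.1.2) p

/-! ### The quantum walled Brauer-Clifford superalgebra -/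

/-- The generators. All indices are shifted by one: `t i` is `t_{i+1}` and so on. The generator `e`
is present when `r, s ≥ 1`. -/
inductive BCGen (r s : ℕ) : Type
  | t (i : ℕ) (hi : i + 1 < r)
  | tStar (i : ℕ) (hi : i + 1 < s)
  | e (hr : 0 < r) (hs : 0 < s)
  | c (i : ℕ) (hi : i < r)
  | cStar (i : ℕ) (hi : i < s)

/-- The degrees of the generators. -/
def BCGen.deg {r s : ℕ} : BCGen r s → ZMod 2
  | .t _ _ => 0
  | .tStar _ _ => 0
  | .e _ _ => 0
  | .c _ _ => 1
  | .cStar _ _ => 1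

section Free

variable {r s : ℕ}

/-- The free generator `t_{i+1}`. -/
def ft (i : ℕ) (hi : i + 1 < r) : FreeAlgebra Cq (BCGen r s) := FreeAlgebra.ι Cq (.t i hi)

/-- The free generator `t*_{i+1}`. -/
def ftStar (i : ℕ) (hi : i + 1 < s) : FreeAlgebra Cq (BCGen r s) := FreeAlgebra.ι Cq (.tStar i hi)

/-- The free generator `e`. -/
def fe (hr : 0 < r) (hs : 0 < s) : FreeAlgebra Cq (BCGen r s) := FreeAlgebra.ι Cq (.e hr hs)

/-- The free generator `c_{i+1}`. -/
def fc (i : ℕ) (hi : i < r) : FreeAlgebra Cq (BCGen r s) := FreeAlgebra.ι Cq (.c i hi)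

/-- The free generator `c*_{i+1}`. -/
def fcStar (i : ℕ) (hi : i < s) : FreeAlgebra Cq (BCGen r s) := FreeAlgebra.ι Cq (.cStar i hi)

/-- The scalar `q - q⁻¹`. -/
def fxi : FreeAlgebra Cq (BCGen r s) := algebraMap Cq _ (q - q⁻¹)

/-- `t_{i+1} - (q - q⁻¹)`, the inverse of `t_{i+1}` in view of the quadratic relation. -/
def ftInv (i : ℕ) (hi : i + 1 < r) : FreeAlgebra Cq (BCGen r s) := ft i hi - fxi

end Free

/-- The defining relations of `BC_{r,s}(q)`. -/
inductive BCRel (r s : ℕ) : FreeAlgebra Cq (BCGen r s) → FreeAlgebra Cq (BCGen r s) → Prop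
  -- the Hecke relations
  | t_quad (i : ℕ) (hi : i + 1 < r) : BCRel r s (ft i hi * ft i hi - fxi * ft i hi - 1) 0
  | t_braid (i : ℕ) (hi : i + 1 < r) (hi' : i + 1 + 1 < r) :
      BCRel r s (ft i hi * ft (i + 1) hi' * ft i hi) (ft (i + 1) hi' * ft i hi * ft (i + 1) hi')
  | t_comm (i j : ℕ) (hi : i + 1 < r) (hj : j + 1 < r) (hij : i + 1 < j ∨ j + 1 < i) :
      BCRel r s (ft i hi * ft j hj) (ft j hj * ft i hi)
  | tStar_quad (i : ℕ) (hi : i + 1 < s) :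
      BCRel r s (ftStar i hi * ftStar i hi - fxi * ftStar i hi - 1) 0
  | tStar_braid (i : ℕ) (hi : i + 1 < s) (hi' : i + 1 + 1 < s) :
      BCRel r s (ftStar i hi * ftStar (i + 1) hi' * ftStar i hi)
        (ftStar (i + 1) hi' * ftStar i hi * ftStar (i + 1) hi')
  | tStar_comm (i j : ℕ) (hi : i + 1 < s) (hj : j + 1 < s) (hij : i + 1 < j ∨ j + 1 < i) :
      BCRel r s (ftStar i hi * ftStar j hj) (ftStar j hj * ftStar i hi)
  | t_tStar (i j : ℕ) (hi : i + 1 < r) (hj : j + 1 < s) :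
      BCRel r s (ft i hi * ftStar j hj) (ftStar j hj * ft i hi)
  -- the relations between `e` and the Hecke generators
  | e_sq (hr : 0 < r) (hs : 0 < s) : BCRel r s (fe hr hs * fe hr hs) 0
  | e_t_e (hr : 0 < r) (hs : 0 < s) (i : ℕ) (hi : i + 1 < r) (h : i + 2 = r) :
      BCRel r s (fe hr hs * ft i hi * fe hr hs) (fe hr hs)
  | e_t (hr : 0 < r) (hs : 0 < s) (i : ℕ) (hi : i + 1 < r) (h : i + 2 ≠ r) :
      BCRel r s (fe hr hs * ft i hi) (ft i hi * fe hr hs)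
  | e_tStar_e (hr : 0 < r) (hs : 0 < s) (h : 0 + 1 < s) :
      BCRel r s (fe hr hs * ftStar 0 h * fe hr hs) (fe hr hs)
  | e_tStar (hr : 0 < r) (hs : 0 < s) (i : ℕ) (hi : i + 1 < s) (h : i ≠ 0) :
      BCRel r s (fe hr hs * ftStar i hi) (ftStar i hi * fe hr hs)
  | e_t_tStar_e (hr : 0 < r) (hs : 0 < s) (i : ℕ) (hi : i + 1 < r) (h : i + 2 = r)
      (h0 : 0 + 1 < s) :
      BCRel r s
        (fe hr hs * ftInv i hi * ftStar 0 h0 * fe hr hs * ftStar 0 h0 * ftInv i hi)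
        (ftInv i hi * ftStar 0 h0 * fe hr hs * ftStar 0 h0 * ftInv i hi * fe hr hs)
  -- the Clifford relations
  | c_sq (i : ℕ) (hi : i < r) : BCRel r s (fc i hi * fc i hi) (-1)
  | c_anti (i j : ℕ) (hi : i < r) (hj : j < r) (hij : i ≠ j) :
      BCRel r s (fc i hi * fc j hj) (-(fc j hj * fc i hi))
  | c_cStar (i j : ℕ) (hi : i < r) (hj : j < s) :
      BCRel r s (fc i hi * fcStar j hj) (-(fcStar j hj * fc i hi))
  | cStar_sq (i : ℕ) (hi : i < s) : BCRel r s (fcStar i hi * fcStar i hi) 1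
  | cStar_anti (i j : ℕ) (hi : i < s) (hj : j < s) (hij : i ≠ j) :
      BCRel r s (fcStar i hi * fcStar j hj) (-(fcStar j hj * fcStar i hi))
  -- the relations between the Hecke and the Clifford generators
  | t_c (i : ℕ) (hi : i + 1 < r) (hi' : i < r) :
      BCRel r s (ft i hi * fc i hi') (fc (i + 1) hi * ft i hi)
  | t_c_comm (i j : ℕ) (hi : i + 1 < r) (hj : j < r) (h : j ≠ i) (h' : j ≠ i + 1) :
      BCRel r s (ft i hi * fc j hj) (fc j hj * ft i hi)
  | tStar_cStar (i : ℕ) (hi : i + 1 < s) (hi' : i < s) :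
      BCRel r s (ftStar i hi * fcStar i hi') (fcStar (i + 1) hi * ftStar i hi)
  | tStar_cStar_comm (i j : ℕ) (hi : i + 1 < s) (hj : j < s) (h : j ≠ i) (h' : j ≠ i + 1) :
      BCRel r s (ftStar i hi * fcStar j hj) (fcStar j hj * ftStar i hi)
  | t_cStar (i j : ℕ) (hi : i + 1 < r) (hj : j < s) :
      BCRel r s (ft i hi * fcStar j hj) (fcStar j hj * ft i hi)
  | tStar_c (i j : ℕ) (hi : i + 1 < s) (hj : j < r) :
      BCRel r s (ftStar i hi * fc j hj) (fc j hj * ftStar i hi)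
  -- the relations between `e` and the Clifford generators
  | c_e (hr : 0 < r) (hs : 0 < s) (i : ℕ) (hi : i < r) (h : i + 1 = r) :
      BCRel r s (fc i hi * fe hr hs) (fcStar 0 hs * fe hr hs)
  | e_c (hr : 0 < r) (hs : 0 < s) (i : ℕ) (hi : i < r) (h : i + 1 = r) :
      BCRel r s (fe hr hs * fc i hi) (fe hr hs * fcStar 0 hs)
  | c_e_comm (hr : 0 < r) (hs : 0 < s) (i : ℕ) (hi : i < r) (h : i + 1 ≠ r) :
      BCRel r s (fc i hi * fe hr hs) (fe hr hs * fc i hi)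
  | cStar_e_comm (hr : 0 < r) (hs : 0 < s) (i : ℕ) (hi : i < s) (h : i ≠ 0) :
      BCRel r s (fcStar i hi * fe hr hs) (fe hr hs * fcStar i hi)
  | e_c_e (hr : 0 < r) (hs : 0 < s) (i : ℕ) (hi : i < r) (h : i + 1 = r) :
      BCRel r s (fe hr hs * fc i hi * fe hr hs) 0

/-- The quantum walled Brauer-Clifford superalgebra `BC_{r,s}(q)`. -/
abbrev BC (r s : ℕ) : Type := RingQuot (BCRel r s)

/-- The image of a generator in `BC_{r,s}(q)`. -/
def BC.gen {r s : ℕ} (g : BCGen r s) : BC r s :=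
  RingQuot.mkAlgHom Cq (BCRel r s) (FreeAlgebra.ι Cq g)

/-- The homogeneous components of `BC_{r,s}(q)`. -/
def BC.part (r s : ℕ) (p : ZMod 2) : Submodule Cq (BC r s) :=
  gradedPart BC.gen (BCGen.deg (r := r) (s := s)) p

/-! ### The mixed tensor space -/

/-- The vector representation space `V_q`, with standard basis `v_i`, `i ∈ {±1, …, ±n}`. -/
abbrev Vq (n : ℕ) : Type := Idx n → Cq

/-- The mixed tensor space `V_q^{⊗ r} ⊗ (V_q^*)^{⊗ s}`. -/
abbrev MixedTensor (n r s : ℕ) : Type :=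
  (⨂[Cq] _ : Fin r, Vq n) ⊗[Cq] (⨂[Cq] _ : Fin s, Module.Dual Cq (Vq n))

/-- The endomorphism algebra of the mixed tensor space. -/
abbrev EndMixed (n r s : ℕ) : Type := Module.End Cq (MixedTensor n r s)

/-- The basis `v_{w_1} ⊗ ⋯ ⊗ v_{w_r} ⊗ ω_{w_{r+1}} ⊗ ⋯ ⊗ ω_{w_{r+s}}` of the mixed tensor space,
indexed by words `w` of length `r + s`. -/
def mixedBasis (n r s : ℕ) : Module.Basis (Fin (r + s) → Idx n) Cq (MixedTensor n r s) :=
  ((Basis.piTensorProduct fun _ : Fin r => Pi.basisFun Cq (Idx n)).tensorProduct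
    (Basis.piTensorProduct fun _ : Fin s => (Pi.basisFun Cq (Idx n)).dualBasis)).reindex
      (Fin.appendEquiv r s)

/-- The homogeneous components of the mixed tensor space. -/
def mixedPart (n r s : ℕ) (p : ZMod 2) : Submodule Cq (MixedTensor n r s) :=
  Submodule.span Cq {x | ∃ w : Fin (r + s) → Idx n, ∑ l, par (w l) = p ∧ x = mixedBasis n r s w}

/-- The homogeneous endomorphisms of degree `p`. -/
def endPart (n r s : ℕ) (p : ZMod 2) : Submodule Cq (EndMixed n r s) where
  carrier := {f | ∀ a, ∀ x ∈ mixedPart n r s a, f x ∈ mixedPart n r s (a + p)}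
  zero_mem' := fun _ _ _ => Submodule.zero_mem _
  add_mem' := fun hf hg a x hx => Submodule.add_mem _ (hf a x hx) (hg a x hx)
  smul_mem' := fun k _ hf a x hx => Submodule.smul_mem _ k (hf a x hx)

/-- The operator `id ⊗ ⋯ ⊗ E_{ij} ⊗ ⋯ ⊗ id` with `E_{ij}` in the tensor factor `m`, with the usual
sign for moving `E_{ij}` past the factors before it. On the dual factors `E_{ij}` is understood
through the identification `v_i ↦ ω_i` of `V_q` with its dual. -/
def siteE (n r s : ℕ) (m : Fin (r + s)) (i j : Idx n) : EndMixed n r s :=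
  (mixedBasis n r s).constr Cq fun w =>
    if w m = j then
      sgn ((par i + par j) * ∑ l ∈ Finset.univ.filter (fun l => l < m), par (w l)) •
        mixedBasis n r s (Function.update w m i)
    else 0

/-- The element `∑ x i j E_{ij}` of `End(V)`, put in the tensor factor `m`. -/
def oneSite (n r s : ℕ) (m : Fin (r + s)) (x : Idx n → Idx n → Cq) : EndMixed n r s :=
  ∑ i : Idx n, ∑ j : Idx n, x i j • siteE n r s m i j

/-- The element `∑ x i j k l E_{ij} ⊗ E_{kl}` of `End(V) ⊗ End(V)`, put in the tensor factors
`m < m'`. -/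
def twoSite (n r s : ℕ) (m m' : Fin (r + s)) (x : Idx n → Idx n → Idx n → Idx n → Cq) :
    EndMixed n r s :=
  ∑ i : Idx n, ∑ j : Idx n, ∑ k : Idx n, ∑ l : Idx n,
    x i j k l • (siteE n r s m i j * siteE n r s m' k l)

/-! ### The action of `U_q(q(n))` on the mixed tensor space -/

/-- The action of `u_{ij}` on the tensor factor `m`. With `S = ∑ S_{ij} ⊗ E_{ij}`, it is `S_{ij}` on
`V_q`. On `V_q^*` it is the dual action through the antipode `U ↦ U⁻¹`, that is, `U` acts by
the supertranspose of `S⁻¹` on the first tensor factor. -/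
def uSite (n r s : ℕ) (m : Fin (r + s)) (i j : Idx n) : EndMixed n r s :=
  if (m : ℕ) < r then oneSite n r s m (fun a b => sCoeff q a b i j)
  else oneSite n r s m (fun a b => superTFirst (sCoeff q⁻¹) a b i j)

/-- The rule of the coproduct
`Δ(u_{ij}) = ∑_k (-1)^{(|i|+|k|)(|k|+|j|)} u_{ik} ⊗ u_{kj}`. -/
def coprodMul {n : ℕ} {A : Type} [Semiring A] [Algebra Cq A] (X Y : Idx n → Idx n → A)
    (i j : Idx n) : A :=
  ∑ k : Idx n, sgn ((par i + par k) * (par k + par j)) • (X i k * Y k j)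

/-- The action of `u_{ij}` on the mixed tensor space through the iterated coproduct (and the counit
`u_{ij} ↦ δ_{ij}` for the empty tensor product). -/
def uAction (n r s : ℕ) : Idx n → Idx n → EndMixed n r s :=
  ((List.finRange (r + s)).map (uSite n r s)).foldr coprodMul (fun i j => if i = j then 1 else 0)

/-! ### The supercentralizer -/

/-- The homogeneous endomorphisms `f` of degree `p` that supercommute with the action `τ`:
`f τ(u) = (-1)^{|f||u|} τ(u) f` for all homogeneous `u`. -/
def centPart {n r s : ℕ} (τ : Uq n →ₐ[Cq] EndMixed n r s) (p : ZMod 2) :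
    Submodule Cq (EndMixed n r s) where
  carrier := {f | f ∈ endPart n r s p ∧
    ∀ a, ∀ u ∈ Uq.part n a, f * τ u = sgn (p * a) • (τ u * f)}
  zero_mem' := ⟨Submodule.zero_mem _, fun a u _ => by simp⟩
  add_mem' := fun hf hg => ⟨Submodule.add_mem _ hf.1 hg.1, fun a u hu => by
    rw [add_mul, mul_add, smul_add, hf.2 a u hu, hg.2 a u hu]⟩
  smul_mem' := fun k f hf => ⟨Submodule.smul_mem _ k hf.1, fun a u hu => by
    rw [smul_mul_assoc, mul_smul_comm, hf.2 a u hu, smul_comm]⟩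

theorem sgn_add (a b : ZMod 2) : sgn (a + b) = sgn a * sgn b := by
  have h : ∀ x : ZMod 2, x = 0 ∨ x = 1 := by decide
  have h1 : (1 : ZMod 2) + 1 = 0 := by decide
  rcases h a with rfl | rfl <;> rcases h b with rfl | rfl <;> simp [sgn, h1]

theorem centPart_mul {n r s : ℕ} (τ : Uq n →ₐ[Cq] EndMixed n r s) {p p' : ZMod 2}
    {f g : EndMixed n r s} (hf : f ∈ centPart τ p) (hg : g ∈ centPart τ p') :
    f * g ∈ centPart τ (p + p') := by
  refine ⟨fun a x hx => ?_, fun a u hu => ?_⟩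
  · have := hf.1 _ _ (hg.1 a x hx)
    rwa [add_assoc, add_comm p' p] at this
  · rw [mul_assoc, hg.2 a u hu, mul_smul_comm, ← mul_assoc, hf.2 a u hu, smul_mul_assoc, smul_smul,
      mul_assoc, add_mul, add_comm, sgn_add]

theorem centPart_one {n r s : ℕ} (τ : Uq n →ₐ[Cq] EndMixed n r s) : 1 ∈ centPart τ 0 :=
  ⟨fun a x hx => by simpa using hx, fun a u _ => by simp [sgn]⟩

/-- The centralizer superalgebra `End_{U_q(q(n))}(V_q^{⊗ r} ⊗ (V_q^*)^{⊗ s})`: the sums of an even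
and an odd endomorphism that supercommute with the action. -/
def superCentralizer {n r s : ℕ} (τ : Uq n →ₐ[Cq] EndMixed n r s) :
    Subalgebra Cq (EndMixed n r s) where
  carrier := {f | f ∈ centPart τ 0 ⊔ centPart τ 1}
  mul_mem' := by
    intro f g hf hg
    obtain ⟨f0, hf0, f1, hf1, rfl⟩ := Submodule.mem_sup.1 hf
    obtain ⟨g0, hg0, g1, hg1, rfl⟩ := Submodule.mem_sup.1 hg
    have h00 := centPart_mul τ hf0 hg0
    have h01 := centPart_mul τ hf0 hg1
    have h10 := centPart_mul τ hf1 hg0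
    have h11 := centPart_mul τ hf1 hg1
    have e : (1 : ZMod 2) + 1 = 0 := by decide
    rw [add_zero] at h00 h10
    rw [zero_add] at h01
    rw [e] at h11
    refine Submodule.mem_sup.2 ⟨_, Submodule.add_mem _ h00 h11, _, Submodule.add_mem _ h01 h10, ?_⟩
    noncomm_ring
  add_mem' := fun hf hg => Submodule.add_mem (centPart τ 0 ⊔ centPart τ 1) hf hg
  algebraMap_mem' := fun k => by
    rw [Algebra.algebraMap_eq_smul_one]
    exact Submodule.smul_mem _ k (Submodule.mem_sup_left (centPart_one τ))

/-! ### The operators by which the generators of `BC_{r,s}(q)` act -/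

/-- The images of the generators:
`t_i ↦ id^{⊗(i-1)} ⊗ PS ⊗ id^{⊗(r+s-1-i)}`, `t*_i ↦ id^{⊗(r+i-1)} ⊗ PᵀSᵀ ⊗ id^{⊗(s-1-i)}`,
`e ↦ id^{⊗(r-1)} ⊗ ∩∪ ⊗ id^{⊗(s-1)}`,
`c_i ↦ id^{⊗(i-1)} ⊗ Φ ⊗ id^{⊗(r+s-i)}`, `c*_i ↦ id^{⊗(r+i-1)} ⊗ Φᵀ ⊗ id^{⊗(s-i)}`. -/
def bcAction (n : ℕ) {r s : ℕ} : BCGen r s → EndMixed n r s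
  | .t i hi =>
      twoSite n r s ⟨i, by omega⟩ ⟨i + 1, by omega⟩ pCoeff *
        twoSite n r s ⟨i, by omega⟩ ⟨i + 1, by omega⟩ (sCoeff q)
  | .tStar i hi =>
      twoSite n r s ⟨r + i, by omega⟩ ⟨r + i + 1, by omega⟩ (superTBoth pCoeff) *
        twoSite n r s ⟨r + i, by omega⟩ ⟨r + i + 1, by omega⟩ (superTBoth (sCoeff q))
  | .e hr hs => twoSite n r s ⟨r - 1, by omega⟩ ⟨r, by omega⟩ capCupCoeff
  | .c i hi => oneSite n r s ⟨i, by omega⟩ phiCoeff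
  | .cStar i hi => oneSite n r s ⟨r + i, by omega⟩ (superT phiCoeff)

end

end QWBC

set_option linter.unusedSectionVars false
set_option linter.unusedSimpArgs false
set_option linter.unusedVariables false

namespace QWBC

noncomputable section

open Finset (sum_congr mul_sum sum_eq_single sum_comm sum_mul smul_sum sum_add_distrib sum_eq_zero mem_univ sum_insert)
open Function (update update_of_ne update_self update_apply update_comm update_eq_self update_idem)
open Matrix (of_apply single single_apply diagonal matrix_eq_sum_single smul_single one_apply_ne diagonal_apply)
open Submodule (subset_span span_induction map_le_iff_le_comap)
open List (finRange)

/-! ### Signs -/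

/-- The sign `(-1)^p` in an arbitrary ring. -/
def sg (R : Type) [Ring R] (p : ZMod 2) : R := if p = 0 then 1 else -1

theorem sgn_eq_sg (p : ZMod 2) : sgn p = sg Cq p := rfl

theorem zmod2_cases (a : ZMod 2) : a = 0 ∨ a = 1 := by revert a; decide

section sg
variable {R : Type} [Ring R]

@[simp] theorem sg_zero : sg R 0 = 1 := by simp [sg]
@[simp] theorem sg_one : sg R 1 = -1 := by simp [sg]

theorem sg_add (a b : ZMod 2) : sg R (a + b) = sg R a * sg R b := by
  have h1 : (1 : ZMod 2) + 1 = 0 := by decide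
  rcases zmod2_cases a with rfl | rfl <;> rcases zmod2_cases b with rfl | rfl <;> simp [h1]

@[simp] theorem sg_mul_self (a : ZMod 2) : sg R a * sg R a = 1 := by
  rcases zmod2_cases a with rfl | rfl <;> simp

theorem sg_ne_zero [Nontrivial R] (a : ZMod 2) : sg R a ≠ 0 := by
  rcases zmod2_cases a with rfl | rfl <;> simp

end sg

@[simp] theorem sgn_zero : sgn 0 = 1 := by simp [sgn]
@[simp] theorem sgn_one : sgn 1 = -1 := by simp [sgn]
@[simp] theorem sgn_mul_self (a : ZMod 2) : sgn a * sgn a = 1 := sg_mul_self a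

theorem zmod2_add_self (a : ZMod 2) : a + a = 0 := by revert a; decide
theorem zmod2_mul_self (a : ZMod 2) : a * a = a := by revert a; decide

/-! ### The index set -/

section idx
variable {n : ℕ}

@[simp] theorem negIdx_val (i : Idx n) : (negIdx i).1 = -i.1 := rfl
@[simp] theorem negIdx_negIdx (i : Idx n) : negIdx (negIdx i) = i := Subtype.ext (neg_neg _)

theorem idx_ne_zero (i : Idx n) : i.1 ≠ 0 := (Finset.mem_erase.1 i.2).1

theorem idx_le (i : Idx n) : i.1 ≤ n := (Finset.mem_Icc.1 (Finset.mem_erase.1 i.2).2).2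

theorem negIdx_ne (i : Idx n) : negIdx i ≠ i := fun h => by
  have h1 := congrArg Subtype.val h
  have h2 := idx_ne_zero i
  simp only [negIdx_val] at h1
  omega

theorem ne_negIdx (i : Idx n) : i ≠ negIdx i := (negIdx_ne i).symm

theorem negIdx_inj {i j : Idx n} : negIdx i = negIdx j ↔ i = j :=
  ⟨fun h => by simpa using congrArg negIdx h, fun h => h ▸ rfl⟩

theorem negIdx_eq_iff {i j : Idx n} : negIdx i = j ↔ i = negIdx j :=
  ⟨fun h => by simp [← h], fun h => by simp [h]⟩

theorem negIdx_lt_iff {i j : Idx n} : negIdx i < j ↔ negIdx j < i := by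
  rw [← Subtype.coe_lt_coe, ← Subtype.coe_lt_coe]; simp only [negIdx_val]; omega

@[simp] theorem par_negIdx (i : Idx n) : par (negIdx i) = par i + 1 := by
  have h := idx_ne_zero i
  have h1 : (1 : ZMod 2) + 1 = 0 := by decide
  unfold par
  rw [negIdx_val]
  split_ifs <;> first | omega | simp [h1]

@[simp] theorem eps_negIdx (i : Idx n) : eps (negIdx i) = -eps i := by
  have h := idx_ne_zero i
  unfold eps
  rw [negIdx_val]
  split_ifs <;> first | omega | simp

theorem eps_cases (i : Idx n) : (0 < i.1 ∧ par i = 0 ∧ eps i = 1) ∨ (i.1 < 0 ∧ par i = 1 ∧ eps i = -1) := by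
  have h := idx_ne_zero i
  unfold par eps
  rcases lt_or_gt_of_ne h with h1 | h1
  · right; simp [h1]
  · left; simp [h1, not_lt.2 h1.le]

end idx

/-! ### Lenses and local operators -/

/-- A coordinate projection `get` together with the replacement of that coordinate. -/
structure Lens (X Y : Type) where
  /-- The value of the coordinate. -/
  get : X → Y
  /-- The replacement of the coordinate. -/
  set : X → Y → X
  get_set : ∀ x y, get (set x y) = y
  set_get : ∀ x, set x (get x) = x
  set_set : ∀ x y z, set (set x y) z = set x z

namespace Lens
variable {X Y Z : Type}

attribute [simp] get_set set_get set_set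

/-- The composition of coordinate projections. -/
def comp (L : Lens X Y) (M : Lens Y Z) : Lens X Z where
  get x := M.get (L.get x)
  set x z := L.set x (M.set (L.get x) z)
  get_set := by simp
  set_get := by simp
  set_set := by simp

theorem set_injective (L : Lens X Y) (x : X) : Function.Injective (L.set x) := fun y z h => by
  simpa using congrArg L.get h

/-- Independence of two coordinates. -/
structure Indep (L : Lens X Y) (M : Lens X Z) : Prop where
  get_left : ∀ x z, L.get (M.set x z) = L.get x
  get_right : ∀ x y, M.get (L.set x y) = M.get x
  set_comm : ∀ x y z, L.set (M.set x z) y = M.set (L.set x y) z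

end Lens

section amp
variable {R : Type} [CommRing R] {X Y Z : Type} [DecidableEq X] [DecidableEq Y] [DecidableEq Z]
  [Fintype X] [Fintype Y] [Fintype Z]

open Matrix

theorem matrix_ext_vecMul {A B : Matrix X X R} (h : ∀ (f : X → R) x, (f ᵥ* A) x = (f ᵥ* B) x) :
    A = B := by
  ext i j
  simpa using h (Pi.single i 1) j

/-- The operator acting by the matrix `A` on one coordinate and trivially on the others. -/
def amp (L : Lens X Y) (A : Matrix Y Y R) : Matrix X X R :=
  fun x' x => if x' = L.set x (L.get x') then A (L.get x') (L.get x) else 0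

theorem vecMul_amp (L : Lens X Y) (A : Matrix Y Y R) (f : X → R) (x : X) :
    (f ᵥ* amp L A) x = ((fun y => f (L.set x y)) ᵥ* A) (L.get x) := by
  simp only [vecMul, dotProduct]
  symm
  refine Fintype.sum_of_injective (L.set x) (L.set_injective x) _ _ ?_ ?_
  · intro x' hx'
    have : ¬ x' = L.set x (L.get x') := fun h => hx' ⟨_, h.symm⟩
    simp [amp, this]
  · intro y
    simp [amp]

theorem vecMul_amp_sum (L : Lens X Y) (A : Matrix Y Y R) (f : X → R) (x : X) :
    (f ᵥ* amp L A) x = ∑ y, f (L.set x y) * A y (L.get x) := vecMul_amp L A f x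

theorem amp_mul (L : Lens X Y) (A B : Matrix Y Y R) : amp L (A * B) = amp L A * amp L B := by
  refine matrix_ext_vecMul fun f x => ?_
  rw [← vecMul_vecMul, vecMul_amp, vecMul_amp, ← vecMul_vecMul]
  simp only [vecMul_amp, Lens.get_set, Lens.set_set]

theorem amp_one (L : Lens X Y) : amp L (1 : Matrix Y Y R) = 1 := by
  refine matrix_ext_vecMul fun f x => ?_
  rw [vecMul_amp]
  simp

theorem amp_add (L : Lens X Y) (A B : Matrix Y Y R) : amp L (A + B) = amp L A + amp L B := by
  ext x' x
  by_cases h : x' = L.set x (L.get x')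
  · simp only [amp, Matrix.add_apply, if_pos h]
  · simp only [amp, Matrix.add_apply, if_neg h, add_zero]

theorem amp_smul (L : Lens X Y) (k : R) (A : Matrix Y Y R) : amp L (k • A) = k • amp L A := by
  ext x' x
  by_cases h : x' = L.set x (L.get x')
  · simp only [amp, Matrix.smul_apply, if_pos h]
  · simp only [amp, Matrix.smul_apply, if_neg h, smul_zero]

/-- `amp` as a homomorphism of algebras. -/
def ampHom (L : Lens X Y) : Matrix Y Y R →ₐ[R] Matrix X X R :=
  AlgHom.ofLinearMap
    { toFun := amp L, map_add' := amp_add L, map_smul' := fun k A => amp_smul L k A }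
    (amp_one L) (amp_mul L)

theorem ampHom_apply (L : Lens X Y) (A : Matrix Y Y R) : ampHom L A = amp L A := rfl

theorem amp_comp (L : Lens X Y) (M : Lens Y Z) (A : Matrix Z Z R) :
    amp (L.comp M) A = amp L (amp M A) := by
  refine matrix_ext_vecMul fun f x => ?_
  rw [vecMul_amp, vecMul_amp, vecMul_amp]
  rfl

theorem amp_congr {L L' : Lens X Y} (A : Matrix Y Y R) (hg : ∀ x, L.get x = L'.get x)
    (hs : ∀ x y, L.set x y = L'.set x y) : amp L A = amp L' A := by
  ext x' x
  simp only [amp, hg, hs]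

theorem amp_commute {L : Lens X Y} {M : Lens X Z} (h : L.Indep M) (A : Matrix Y Y R)
    (B : Matrix Z Z R) : Commute (amp L A) (amp M B) := by
  refine matrix_ext_vecMul fun f x => ?_
  simp only [← vecMul_vecMul, vecMul_amp_sum, h.get_left, h.get_right, h.set_comm,
    sum_mul]
  rw [sum_comm]
  exact sum_congr rfl fun _ _ => sum_congr rfl fun _ _ => by ring

theorem amp_commute_diagonal (L : Lens X Y) (A : Matrix Y Y R) (g : X → R)
    (h : ∀ x y, A y (L.get x) ≠ 0 → g (L.set x y) = g x) :
    Commute (amp L A) (diagonal g) := by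
  ext x' x
  rw [Matrix.mul_diagonal, Matrix.diagonal_mul]
  by_cases h1 : x' = L.set x (L.get x')
  · by_cases h2 : A (L.get x') (L.get x) = 0
    · simp [amp, h2]
    · rw [← h _ _ h2, ← h1, mul_comm]
  · simp [amp, h1]

end amp

section siteLens
variable {ι J : Type} [DecidableEq ι]

/-- The letter at one site. -/
def site (m : ι) : Lens (ι → J) J where
  get w := w m
  set w y := update w m y
  get_set := by simp
  set_get := by simp
  set_set := by simp

/-- The letters at two sites. -/
def pair (m m' : ι) (h : m ≠ m') : Lens (ι → J) (J × J) where
  get w := (w m, w m')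
  set w y := update (update w m y.1) m' y.2
  get_set w y := by simp [h]
  set_get w := by simp
  set_set w y z := by
    rw [update_comm h, update_idem, update_comm h.symm,
      update_idem]

/-- The letters at three sites. -/
def triple (a b c : ι) (hab : a ≠ b) (hac : a ≠ c) (hbc : b ≠ c) : Lens (ι → J) (J × J × J) where
  get w := (w a, w b, w c)
  set w y := update (update (update w a y.1) b y.2.1) c y.2.2
  get_set w y := by simp [hab, hac, hbc]
  set_get w := by simp
  set_set w y z := by
    funext l
    simp only [update_apply]
    split_ifs <;> rfl

/-- The letters at four sites. -/
def quad (a b c d : ι) (hab : a ≠ b) (hac : a ≠ c) (had : a ≠ d) (hbc : b ≠ c) (hbd : b ≠ d)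
    (hcd : c ≠ d) : Lens (ι → J) (J × J × J × J) where
  get w := (w a, w b, w c, w d)
  set w y := update (update (update (update w a y.1) b y.2.1)
    c y.2.2.1) d y.2.2.2
  get_set w y := by simp [hab, hac, had, hbc, hbd, hcd]
  set_get w := by simp
  set_set w y z := by
    funext l
    simp only [update_apply]
    split_ifs <;> rfl

/-- The first two of three coordinates. -/
def l12 : Lens (J × J × J) (J × J) :=
  ⟨fun x => (x.1, x.2.1), fun x y => (y.1, y.2, x.2.2), fun _ _ => rfl, fun _ => rfl,
    fun _ _ _ => rfl⟩

/-- The last two of several coordinates. -/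
def lTail {Y : Type} : Lens (J × Y) Y :=
  ⟨fun x => x.2, fun x y => (x.1, y), fun _ _ => rfl, fun _ => rfl, fun _ _ _ => rfl⟩

/-- The first three of four coordinates. -/
def l123 : Lens (J × J × J × J) (J × J × J) :=
  ⟨fun x => (x.1, x.2.1, x.2.2.1), fun x y => (y.1, y.2.1, y.2.2, x.2.2.2), fun _ _ => rfl,
    fun _ => rfl, fun _ _ _ => rfl⟩

/-- The first of two coordinates. -/
def lFst : Lens (J × J) J :=
  ⟨fun x => x.1, fun x y => (y, x.2), fun _ _ => rfl, fun _ => rfl, fun _ _ _ => rfl⟩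

end siteLens

/-! ### The braid operator on two letters -/

section braid
variable {n : ℕ}
open Matrix

theorem q_ne_zero : q ≠ 0 := RatFunc.X_ne_zero

/-- The scalar `q - q⁻¹`. -/
def xi : Cq := q - q⁻¹

/-- The coefficient of `v_b ⊗ v_a` in the image of `v_a ⊗ v_b`. -/
def alp (a b : Idx n) : Cq :=
  sgn (par a * par b) * q ^ (((if a = b then 1 else 0) + (if a = negIdx b then 1 else 0)) * eps b : ℤ)

/-- The coefficient of `v_a ⊗ v_b` in the image of `v_a ⊗ v_b`. -/
def bet (a b : Idx n) : Cq := if a < b then xi else 0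

/-- The coefficient of `v_{-a} ⊗ v_{-b}` in the image of `v_a ⊗ v_b`. -/
def gam (a b : Idx n) : Cq := if negIdx a < b then xi * sgn (par b) else 0

/-- The matrix of the braid operator `PS`. -/
def tM : Matrix (Idx n × Idx n) (Idx n × Idx n) Cq := fun y x =>
  (if y = (x.2, x.1) then alp x.1 x.2 else 0) + (if y = x then bet x.1 x.2 else 0)
    + (if y = (negIdx x.1, negIdx x.2) then gam x.1 x.2 else 0)

theorem vecMul_tM (f : Idx n × Idx n → Cq) (a b : Idx n) :
    (f ᵥ* tM) (a, b) = alp a b * f (b, a) + bet a b * f (a, b)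
      + gam a b * f (negIdx a, negIdx b) := by
  simp only [vecMul, dotProduct, tM, mul_add, sum_add_distrib, mul_ite, mul_zero,
    Finset.sum_ite_eq', mem_univ, if_true]
  ring

section values
variable {x y : Idx n}

theorem par_eq_zero_iff : par x = 0 ↔ 0 < x.1 := by
  rcases eps_cases x with h | h <;> simp [h.2.1] <;> omega

theorem bet_of_lt (h : |x.1| < |y.1|) : bet x y = if par y = 0 then xi else 0 := by
  have := idx_ne_zero y
  simp only [bet, par_eq_zero_iff, ← Subtype.coe_lt_coe]
  congr 1
  rw [abs_lt] at h
  rcases abs_cases y.1 with h1 | h1 <;> rw [eq_iff_iff] <;> omega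

theorem bet_of_gt (h : |y.1| < |x.1|) : bet x y = if par x = 0 then 0 else xi := by
  have := idx_ne_zero x
  simp only [bet, par_eq_zero_iff, ← Subtype.coe_lt_coe]
  rw [abs_lt] at h
  rcases abs_cases x.1 with h1 | h1
  · rw [if_neg (by omega), if_pos (by omega)]
  · rw [if_pos (by omega), if_neg (by omega)]

theorem gam_of_lt (h : |x.1| < |y.1|) : gam x y = if par y = 0 then xi else 0 := by
  have := idx_ne_zero y
  simp only [gam, ← Subtype.coe_lt_coe, negIdx_val]
  rw [abs_lt] at h
  rcases eps_cases y with ⟨h1, h2, h3⟩ | ⟨h1, h2, h3⟩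
  · rw [abs_of_pos h1] at h
    rw [if_pos (by omega), if_pos h2, h2]; simp
  · rw [abs_of_neg h1] at h
    rw [if_neg (by omega), if_neg (by rw [h2]; decide)]

theorem gam_of_gt (h : |y.1| < |x.1|) :
    gam x y = if par x = 0 then xi * sgn (par y) else 0 := by
  have := idx_ne_zero x
  simp only [gam, ← Subtype.coe_lt_coe, negIdx_val]
  rw [abs_lt] at h
  rcases eps_cases x with ⟨h1, h2, h3⟩ | ⟨h1, h2, h3⟩
  · rw [abs_of_pos h1] at h
    rw [if_pos (by omega), if_pos h2]
  · rw [abs_of_neg h1] at h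
    rw [if_neg (by omega), if_neg (by rw [h2]; decide)]

theorem alp_of_ne (h : |x.1| ≠ |y.1|) : alp x y = sgn (par x * par y) := by
  have h1 : x ≠ y := fun e => h (by rw [e])
  have h2 : x ≠ negIdx y := fun e => h (by rw [e]; simp)
  simp [alp, h1, h2]

theorem alp_of_lt (h : |x.1| < |y.1|) : alp x y = sgn (par x * par y) := alp_of_ne h.ne
theorem alp_of_gt (h : |y.1| < |x.1|) : alp x y = sgn (par x * par y) := alp_of_ne h.ne'

theorem alp_self (x : Idx n) : alp x x = sgn (par x) * q ^ eps x := by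
  simp [alp, ne_negIdx, zmod2_mul_self]

theorem alp_neg_right (x : Idx n) : alp x (negIdx x) = q ^ (-eps x) := by
  have : par x * (par x + 1) = 0 := by generalize par x = p; revert p; decide
  simp [alp, ne_negIdx, this]

theorem alp_neg_left (x : Idx n) : alp (negIdx x) x = q ^ eps x := by
  have := alp_neg_right (negIdx x)
  simpa using this

theorem bet_self (x : Idx n) : bet x x = 0 := by simp [bet]

theorem bet_neg_right (x : Idx n) : bet x (negIdx x) = if par x = 0 then 0 else xi := by
  have := idx_ne_zero x
  simp only [bet, par_eq_zero_iff, ← Subtype.coe_lt_coe, negIdx_val]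
  split_ifs <;> first | rfl | omega

theorem bet_neg_left (x : Idx n) : bet (negIdx x) x = if par x = 0 then xi else 0 := by
  have := idx_ne_zero x
  simp only [bet, par_eq_zero_iff, ← Subtype.coe_lt_coe, negIdx_val]
  split_ifs <;> first | rfl | omega

theorem gam_self (x : Idx n) : gam x x = if par x = 0 then xi else 0 := by
  have := idx_ne_zero x
  simp only [gam, ← Subtype.coe_lt_coe, negIdx_val]
  rcases eps_cases x with ⟨h1, h2, h3⟩ | ⟨h1, h2, h3⟩
  · rw [if_pos (by omega), if_pos h2, h2]; simp
  · rw [if_neg (by omega), if_neg (by rw [h2]; decide)]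

theorem gam_neg_right (x : Idx n) : gam x (negIdx x) = 0 := by simp [gam]
theorem gam_neg_left (x : Idx n) : gam (negIdx x) x = 0 := by simp [gam]

theorem xi_eq : xi = q - q⁻¹ := rfl

theorem eps_of_par (x : Idx n) : eps x = if par x = 0 then 1 else -1 := by
  rcases eps_cases x with ⟨h1, h2, h3⟩ | ⟨h1, h2, h3⟩ <;> simp [h2, h3]

theorem abs_trichotomy (x y : Idx n) :
    |x.1| < |y.1| ∨ |y.1| < |x.1| ∨ y = x ∨ y = negIdx x := by
  rcases lt_trichotomy |x.1| |y.1| with h | h | h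
  · exact Or.inl h
  · rcases abs_eq_abs.1 h.symm with h | h
    · exact Or.inr (Or.inr (Or.inl (Subtype.ext h)))
    · exact Or.inr (Or.inr (Or.inr (Subtype.ext h)))
  · exact Or.inr (Or.inl h)

end values

theorem one_add_one_zmod2 : (1 : ZMod 2) + 1 = 0 := by decide

theorem tM_quad : (tM : Matrix (Idx n × Idx n) _ Cq) * tM = xi • tM + 1 := by
  refine matrix_ext_vecMul fun f x => ?_
  obtain ⟨a, b⟩ := x
  have hq := q_ne_zero
  rw [← vecMul_vecMul, vecMul_add, vecMul_smul, vecMul_one]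
  simp only [Pi.add_apply, Pi.smul_apply, smul_eq_mul, vecMul_tM, negIdx_negIdx]
  rcases abs_trichotomy a b with h | h | rfl | rfl
  · rcases zmod2_cases (par a) with ha | ha <;> rcases zmod2_cases (par b) with hb | hb <;>
    simp [bet_of_lt, bet_of_gt, gam_of_lt, gam_of_gt, alp_of_lt, alp_of_gt, h, ha, hb,
      one_add_one_zmod2] <;> ring
  · rcases zmod2_cases (par a) with ha | ha <;> rcases zmod2_cases (par b) with hb | hb <;>
    simp [bet_of_lt, bet_of_gt, gam_of_lt, gam_of_gt, alp_of_lt, alp_of_gt, h, ha, hb,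
      one_add_one_zmod2] <;> ring
  · rcases zmod2_cases (par b) with ha | ha <;>
    simp [alp_self, bet_self, gam_self, ha, eps_of_par, one_add_one_zmod2, xi_eq] <;>
    field_simp <;> ring
  · rcases zmod2_cases (par a) with ha | ha <;>
    simp [alp_neg_left, alp_neg_right, bet_neg_left, bet_neg_right, gam_neg_right, gam_neg_left, ha,
      eps_of_par, one_add_one_zmod2, xi_eq] <;>
    field_simp <;> ring

attribute [local simp] bet_of_lt bet_of_gt gam_of_lt gam_of_gt alp_of_lt alp_of_gt alp_self bet_self gam_self
  alp_neg_left alp_neg_right bet_neg_left bet_neg_right gam_neg_right gam_neg_left one_add_one_zmod2 eps_of_par in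
set_option maxHeartbeats 4000000 in
theorem tM_braid : amp l12 (tM : Matrix (Idx n × Idx n) _ Cq) * amp lTail tM * amp l12 tM
    = amp lTail tM * amp l12 tM * amp lTail tM := by
  refine matrix_ext_vecMul fun f x => ?_
  obtain ⟨a, b, c⟩ := x
  have hq := q_ne_zero
  simp only [← vecMul_vecMul, vecMul_amp, l12, lTail, vecMul_tM]
  rcases abs_trichotomy a b with h | h | rfl | rfl
  · rcases abs_trichotomy b c with h' | h' | rfl | rfl
    · have h'' := h.trans h'
      rcases zmod2_cases (par a) with ha | ha <;> rcases zmod2_cases (par b) with hb | hb <;>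
      rcases zmod2_cases (par c) with hc | hc <;>
      simp [h, h', h'', ha, hb, hc] <;> ring
    · rcases abs_trichotomy a c with h'' | h'' | rfl | rfl
      · rcases zmod2_cases (par a) with ha | ha <;> rcases zmod2_cases (par b) with hb | hb <;>
        rcases zmod2_cases (par c) with hc | hc <;>
        simp [h, h', h'', ha, hb, hc] <;> ring
      · rcases zmod2_cases (par a) with ha | ha <;> rcases zmod2_cases (par b) with hb | hb <;>
        rcases zmod2_cases (par c) with hc | hc <;>
        simp [h, h', h'', ha, hb, hc] <;> ring
      · rcases zmod2_cases (par c) with ha | ha <;> rcases zmod2_cases (par b) with hb | hb <;>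
        simp [h, ha, hb] <;>
        (first | done | (simp only [xi_eq]; field_simp <;> ring))
      · rcases zmod2_cases (par a) with ha | ha <;> rcases zmod2_cases (par b) with hb | hb <;>
        simp [h, ha, hb] <;>
        (first | done | (simp only [xi_eq]; field_simp <;> ring))
    · rcases zmod2_cases (par a) with ha | ha <;> rcases zmod2_cases (par c) with hb | hb <;>
      simp [h, ha, hb] <;>
      (first | done | (simp only [xi_eq]; field_simp <;> ring))
    · rcases zmod2_cases (par a) with ha | ha <;> rcases zmod2_cases (par b) with hb | hb <;>
      simp [h, ha, hb] <;>
      (first | done | (simp only [xi_eq]; field_simp <;> ring))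
  · rcases abs_trichotomy b c with h' | h' | rfl | rfl
    · rcases abs_trichotomy a c with h'' | h'' | rfl | rfl
      · rcases zmod2_cases (par a) with ha | ha <;> rcases zmod2_cases (par b) with hb | hb <;>
        rcases zmod2_cases (par c) with hc | hc <;>
        simp [h, h', h'', ha, hb, hc] <;> ring
      · rcases zmod2_cases (par a) with ha | ha <;> rcases zmod2_cases (par b) with hb | hb <;>
        rcases zmod2_cases (par c) with hc | hc <;>
        simp [h, h', h'', ha, hb, hc] <;> ring
      · rcases zmod2_cases (par c) with ha | ha <;> rcases zmod2_cases (par b) with hb | hb <;>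
        simp [h, ha, hb] <;>
        (first | done | (simp only [xi_eq]; field_simp <;> ring))
      · rcases zmod2_cases (par a) with ha | ha <;> rcases zmod2_cases (par b) with hb | hb <;>
        simp [h, ha, hb] <;>
        (first | done | (simp only [xi_eq]; field_simp <;> ring))
    · have h'' := h'.trans h
      rcases zmod2_cases (par a) with ha | ha <;> rcases zmod2_cases (par b) with hb | hb <;>
      rcases zmod2_cases (par c) with hc | hc <;>
      simp [h, h', h'', ha, hb, hc] <;> ring
    · rcases zmod2_cases (par a) with ha | ha <;> rcases zmod2_cases (par c) with hb | hb <;>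
      simp [h, ha, hb] <;>
      (first | done | (simp only [xi_eq]; field_simp <;> ring))
    · rcases zmod2_cases (par a) with ha | ha <;> rcases zmod2_cases (par b) with hb | hb <;>
      simp [h, ha, hb] <;>
      (first | done | (simp only [xi_eq]; field_simp <;> ring))
  · rcases abs_trichotomy b c with h' | h' | rfl | rfl
    · rcases zmod2_cases (par b) with ha | ha <;> rcases zmod2_cases (par c) with hb | hb <;>
      simp [h', ha, hb] <;>
      (first | done | (simp only [xi_eq]; field_simp <;> ring))
    · rcases zmod2_cases (par b) with ha | ha <;> rcases zmod2_cases (par c) with hb | hb <;>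
      simp [h', ha, hb] <;>
      (first | done | (simp only [xi_eq]; field_simp <;> ring))
    · rcases zmod2_cases (par c) with ha | ha <;>
      simp [ha] <;>
      (first | done | (simp only [xi_eq]; field_simp <;> ring))
    · rcases zmod2_cases (par b) with ha | ha <;>
      simp [ha] <;>
      (first | done | (simp only [xi_eq]; field_simp <;> ring))
  · rcases abs_trichotomy a c with h' | h' | rfl | rfl
    · rcases zmod2_cases (par a) with ha | ha <;> rcases zmod2_cases (par c) with hb | hb <;>
      simp [h', ha, hb] <;>
      (first | done | (simp only [xi_eq]; field_simp <;> ring))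
    · rcases zmod2_cases (par a) with ha | ha <;> rcases zmod2_cases (par c) with hb | hb <;>
      simp [h', ha, hb] <;>
      (first | done | (simp only [xi_eq]; field_simp <;> ring))
    · rcases zmod2_cases (par c) with ha | ha <;>
      simp [ha] <;>
      (first | done | (simp only [xi_eq]; field_simp <;> ring))
    · rcases zmod2_cases (par a) with ha | ha <;>
      simp [ha] <;>
      (first | done | (simp only [xi_eq]; field_simp <;> ring))

end braid

section kernel
variable {n : ℕ}
open Matrix

/-- The inverse of the braid operator. -/
def tI : Matrix (Idx n × Idx n) (Idx n × Idx n) Cq := tM - xi • 1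

theorem tM_mul_tI : (tM : Matrix (Idx n × Idx n) _ Cq) * tI = 1 := by
  rw [tI, mul_sub, tM_quad]; simp

theorem tI_mul_tM : (tI : Matrix (Idx n × Idx n) _ Cq) * tM = 1 := by
  rw [tI, sub_mul, tM_quad]; simp

/-- The coefficient of `v_b ⊗ v_a` in the image of `v_a ⊗ v_b` under the inverse. -/
def alp' (a b : Idx n) : Cq :=
  sgn (par a * par b) *
    (q⁻¹) ^ (((if b = a then 1 else 0) + (if b = negIdx a then 1 else 0)) * eps a : ℤ)

/-- The coefficient of `v_a ⊗ v_b` in the image of `v_a ⊗ v_b` under the inverse. -/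
def bet' (a b : Idx n) : Cq := if b < a then -xi else 0

/-- The coefficient of `v_{-a} ⊗ v_{-b}` in the image of `v_a ⊗ v_b` under the inverse. -/
def gam' (a b : Idx n) : Cq := if negIdx b < a then xi * sgn (par b) else 0

theorem tI_apply (y x : Idx n × Idx n) : tI y x =
    (if y = (x.2, x.1) then alp' x.1 x.2 else 0) + (if y = x then bet' x.1 x.2 else 0)
    + (if y = (negIdx x.1, negIdx x.2) then gam' x.1 x.2 else 0) := by
  obtain ⟨a, b⟩ := x
  have hq := q_ne_zero
  have hg : gam' a b = gam a b := by simp [gam, gam', negIdx_lt_iff (i := a)]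
  simp only [tI, Matrix.sub_apply, tM, Matrix.smul_apply, Matrix.one_apply, smul_eq_mul, hg]
  rcases abs_trichotomy a b with h | h | rfl | rfl
  · have h1 : b ≠ a := fun e => h.ne (by rw [e])
    have h2 : b ≠ negIdx a := fun e => h.ne (by rw [e]; simp)
    have hb : bet a b - xi = bet' a b := by
      have : a < b ∨ b < a := lt_or_gt_of_ne h1.symm
      rcases this with h | h <;> simp [bet, bet', h, h.le, not_lt.2 h.le]
    simp only [alp_of_lt h, alp', h1, h2, ← hb]
    simp
    split_ifs <;> ring
  · have h1 : b ≠ a := fun e => h.ne (by rw [e])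
    have h2 : b ≠ negIdx a := fun e => h.ne (by rw [e]; simp)
    have hb : bet a b - xi = bet' a b := by
      have : a < b ∨ b < a := lt_or_gt_of_ne h1.symm
      rcases this with h | h <;> simp [bet, bet', h, h.le, not_lt.2 h.le]
    simp only [alp_of_gt h, alp', h1, h2, ← hb]
    simp
    split_ifs <;> ring
  · have : alp b b - xi = alp' b b := by
      rw [alp_self, alp']
      rcases zmod2_cases (par b) with h | h <;> simp [h, eps_of_par, ne_negIdx, xi_eq]
      ring
    simp only [← this, bet, bet', lt_irrefl, if_false]
    split_ifs <;> ring
  · have : alp a (negIdx a) = alp' a (negIdx a) := by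
      have h0 : par a * (par a + 1) = 0 := by generalize par a = p; revert p; decide
      rw [alp_neg_right, alp']
      simp [h0, negIdx_ne]
    have hb : bet a (negIdx a) - xi = bet' a (negIdx a) := by
      have : a < negIdx a ∨ negIdx a < a := lt_or_gt_of_ne (ne_negIdx a)
      rcases this with h | h <;> simp [bet, bet', h, h.le, not_lt.2 h.le]
    simp only [← this, ← hb]
    split_ifs <;> ring

/-- The weight `(-1)^{|a|} q^{2|a|}` of a letter. -/
def wt (a : Idx n) : Cq := sgn (par a) * q ^ (2 * a.1 * eps a)

theorem wt_negIdx (a : Idx n) : wt (negIdx a) = -wt a := by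
  simp [wt, sgn_add]

theorem wt_ne_zero (a : Idx n) : wt a ≠ 0 :=
  mul_ne_zero (sg_ne_zero (R := Cq) _) (zpow_ne_zero _ q_ne_zero)

theorem tM_conserve {y x : Idx n × Idx n} (h : tM y x ≠ 0) :
    par y.1 + par y.2 = par x.1 + par x.2 ∧ wt y.1 * wt y.2 = wt x.1 * wt x.2 := by
  by_cases h1 : y = (x.2, x.1)
  · subst h1; exact ⟨add_comm _ _, mul_comm _ _⟩
  by_cases h2 : y = x
  · subst h2; exact ⟨rfl, rfl⟩
  by_cases h3 : y = (negIdx x.1, negIdx x.2)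
  · subst h3
    refine ⟨?_, by simp [wt_negIdx]⟩
    simp only [par_negIdx]
    generalize par x.1 = a, par x.2 = b
    revert a b; decide
  simp [tM, h1, h2, h3] at h

theorem tI_conserve {y x : Idx n × Idx n} (h : tI y x ≠ 0) :
    par y.1 + par y.2 = par x.1 + par x.2 ∧ wt y.1 * wt y.2 = wt x.1 * wt x.2 := by
  by_cases h1 : y = x
  · subst h1; exact ⟨rfl, rfl⟩
  · refine tM_conserve ?_
    simpa [tI, Matrix.one_apply, h1] using h

theorem sum_Ico_int_telescope (h : ℤ → Cq) (a b : ℤ) (hab : a ≤ b) :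
    ∑ k ∈ Finset.Ico a b, (h (k + 1) - h k) = h b - h a := by
  induction b, hab using Int.leInduction with
  | base => simp
  | succ b hb ih =>
    rw [← Finset.insert_Ico_right_eq_Ico_add_one hb, sum_insert (by simp), ih]
    ring

theorem xi_mul_wt (k : Idx n) : xi * wt k = q ^ |2 * k.1 + 1| - q ^ |2 * k.1 - 1| := by
  have hq := q_ne_zero
  rcases eps_cases k with ⟨h1, h2, h3⟩ | ⟨h1, h2, h3⟩
  · rw [abs_of_pos (by omega), abs_of_pos (by omega), wt, h2, h3, zpow_sub₀ hq, zpow_add₀ hq, xi]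
    simp; ring
  · rw [abs_of_neg (by omega), abs_of_neg (by omega), wt, h2, h3,
      show -(2 * k.1 + 1) = 2 * k.1 * (-1) - 1 by ring,
      show -(2 * k.1 - 1) = 2 * k.1 * (-1) + 1 by ring, zpow_sub₀ hq, zpow_add₀ hq, xi]
    simp; ring

theorem sum_idx_Ico (a b : ℤ) (ha : -(n : ℤ) ≤ a) (hb : b ≤ n + 1) (hab : a ≤ b) :
    xi * ∑ k : Idx n, (if a ≤ k.1 ∧ k.1 < b then wt k else 0)
      = q ^ |2 * b - 1| - q ^ |2 * a - 1| := by
  rw [← sum_Ico_int_telescope (fun k => q ^ |2 * k - 1|) a b hab, mul_sum]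
  have : ∀ k : Idx n, xi * (if a ≤ k.1 ∧ k.1 < b then wt k else 0)
      = (fun k : ℤ => if a ≤ k ∧ k < b then q ^ |2 * (k + 1) - 1| - q ^ |2 * k - 1| else 0) k.1 := by
    intro k
    by_cases h : a ≤ k.1 ∧ k.1 < b
    · simp only [if_pos h]
      rw [xi_mul_wt, show 2 * (k.1 + 1) - 1 = 2 * k.1 + 1 by ring]
    · simp only [if_neg h, mul_zero]
  rw [sum_congr rfl fun k _ => this k]
  rw [Finset.sum_coe_sort ((Finset.Icc (-(n : ℤ)) (n : ℤ)).erase 0)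
    (fun k : ℤ => if a ≤ k ∧ k < b then q ^ |2 * (k + 1) - 1| - q ^ |2 * k - 1| else 0)]
  rw [← Finset.sum_filter]
  refine Finset.sum_subset_zero_on_sdiff (fun k hk => ?_) (fun k hk => ?_) fun _ _ => rfl
  · simp only [Finset.mem_filter, Finset.mem_Ico] at hk ⊢
    exact hk.2
  · simp only [Finset.mem_sdiff, Finset.mem_filter, Finset.mem_erase, Finset.mem_Icc,
      Finset.mem_Ico, not_and] at hk
    obtain ⟨⟨h1, h2⟩, h3⟩ := hk
    have : k = 0 := by
      by_contra h0
      exact h3 ⟨h0, by omega, by omega⟩ h1 h2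
    subst this
    simp

theorem wt_mul_upper (a : Idx n) : sgn (par a) * q ^ eps a * wt a = q ^ |2 * a.1 + 1| := by
  have hq := q_ne_zero
  rcases eps_cases a with ⟨h1, h2, h3⟩ | ⟨h1, h2, h3⟩
  · rw [abs_of_pos (by omega), wt, h2, h3, zpow_add₀ hq]; simp; ring
  · rw [abs_of_neg (by omega), wt, h2, h3, show -(2 * a.1 + 1) = 2 * a.1 * (-1) - 1 by ring,
      zpow_sub₀ hq]; simp; ring

theorem wt_mul_lower (a : Idx n) : sgn (par a) * q ^ (-eps a) * wt a = q ^ |2 * a.1 - 1| := by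
  have hq := q_ne_zero
  rcases eps_cases a with ⟨h1, h2, h3⟩ | ⟨h1, h2, h3⟩
  · rw [abs_of_pos (by omega), wt, h2, h3, zpow_sub₀ hq]; simp; ring
  · rw [abs_of_neg (by omega), wt, h2, h3, show -(2 * a.1 - 1) = 2 * a.1 * (-1) + 1 by ring,
      zpow_add₀ hq]; simp; ring

theorem idx_ge (i : Idx n) : -(n : ℤ) ≤ i.1 := (Finset.mem_Icc.1 (Finset.mem_erase.1 i.2).2).1

theorem sum_wt_between {a b : Idx n} (h : a < b) :
    xi * ∑ k : Idx n, (if a < k ∧ k < b then wt k else 0)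
      = sgn (par b) * q ^ (-eps b) * wt b - sgn (par a) * q ^ eps a * wt a := by
  have h' : a.1 < b.1 := h
  have := sum_idx_Ico (n := n) (a.1 + 1) b.1 (by have := idx_ge a; omega)
    (by have := idx_le b; omega) (by omega)
  rw [wt_mul_lower, wt_mul_upper]
  rw [show 2 * (a.1 + 1) - 1 = 2 * a.1 + 1 by ring] at this
  rw [← this]
  rfl

theorem sum_wt_above (a : Idx n) :
    xi * ∑ k : Idx n, (if a < k then wt k else 0)
      = q ^ (2 * (n : ℤ) + 1) - sgn (par a) * q ^ eps a * wt a := by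
  have := sum_idx_Ico (n := n) (a.1 + 1) (n + 1) (by have := idx_ge a; omega)
    (by omega) (by have := idx_le a; omega)
  rw [wt_mul_upper]
  rw [show 2 * (a.1 + 1) - 1 = 2 * a.1 + 1 by ring,
    show 2 * ((n : ℤ) + 1) - 1 = 2 * n + 1 by ring, abs_of_pos (a := 2 * (n : ℤ) + 1) (by omega)] at this
  rw [← this]
  congr 1
  refine sum_congr rfl fun k _ => ?_
  have hk := idx_le k
  simp only [show (a < k) = (a.1 + 1 ≤ k.1 ∧ k.1 < (n : ℤ) + 1) by
    rw [eq_iff_iff, ← Subtype.coe_lt_coe]; omega]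

theorem sum_wt : ∑ k : Idx n, wt k = 0 := by
  have := Equiv.sum_comp (Function.Involutive.toPerm (negIdx (n := n)) negIdx_negIdx) (wt (n := n))
  have h1 : ∑ k : Idx n, wt (negIdx k) = ∑ k : Idx n, wt k := this
  rw [sum_congr rfl fun k _ => wt_negIdx k, Finset.sum_neg_distrib] at h1
  have h2 : (2 : Cq) * ∑ k : Idx n, wt k = 0 := by linear_combination -h1
  exact (mul_eq_zero.1 h2).resolve_left two_ne_zero

theorem sum_tM_left (i a : Idx n) (g : Idx n → Idx n → Cq) :
    ∑ c, ∑ k, tM (i, c) (a, k) * g c k = alp a i * g a i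
      + (if i = a then ∑ k, bet a k * g k k else 0)
      + (if i = negIdx a then ∑ k, gam a k * g (negIdx k) k else 0) := by
  simp only [tM, Prod.mk.injEq, ite_and, add_mul, sum_add_distrib, ite_mul, zero_mul]
  congr 1
  · congr 1
    · rw [sum_comm]
      simp
    · split_ifs with h
      · rw [sum_comm]; simp
      · simp
  · split_ifs with h
    · rw [sum_comm]; simp
    · simp

theorem crossing (i j a b : Idx n) :
    ∑ c, ∑ k, tM (i, c) (a, k) * (wt c * tI (b, k) (j, c))
      = if i = j ∧ a = b then wt a else 0 := by
  have hq := q_ne_zero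
  rw [sum_tM_left i a fun c k => wt c * tI (b, k) (j, c)]
  have e1 : (if i = a then ∑ k, bet a k * (wt k * tI (b, k) (j, k)) else 0)
      = if i = a ∧ b = j then wt j * bet a j * alp' j j + ∑ k, wt k * bet a k * bet' j k else 0 := by
    by_cases h1 : i = a
    · by_cases h2 : b = j
      · subst h2
        simp only [h1, tI_apply, Prod.mk.injEq, ite_and, if_true, true_and, ne_negIdx, if_false,
          add_zero, mul_add, sum_add_distrib, mul_ite, mul_zero]
        congr 1
        · simp only [eq_comm (a := b)]
          simp; ring
        · exact sum_congr rfl fun k _ => by ring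
      · have : ∀ k, tI (b, k) (j, k) = 0 := fun k => by
          simp only [tI_apply, Prod.mk.injEq, h2, false_and, if_false, ne_negIdx, and_false,
            add_zero]
          rw [if_neg]
          rintro ⟨h3, h4⟩
          exact h2 (h3.trans h4)
        simp [h2, this]
    · simp [h1]
  have e2 : (if i = negIdx a then ∑ k, gam a k * (wt (negIdx k) * tI (b, k) (j, negIdx k)) else 0)
      = if i = negIdx a ∧ b = negIdx j then
        -(wt j * gam a j * alp' j (negIdx j)) + ∑ k, wt (negIdx k) * gam a k * gam' j (negIdx k)
        else 0 := by
    by_cases h1 : i = negIdx a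
    · by_cases h2 : b = negIdx j
      · subst h2
        simp only [h1, tI_apply, Prod.mk.injEq, ite_and, if_true, true_and, ne_negIdx, if_false,
          add_zero, mul_add, sum_add_distrib, mul_ite, mul_zero, negIdx_ne, negIdx_negIdx,
          negIdx_inj]
        congr 1
        · simp only [eq_comm (a := j)]
          simp [wt_negIdx]; ring
        · exact sum_congr rfl fun k _ => by ring
      · have : ∀ k, tI (b, k) (j, negIdx k) = 0 := fun k => by
          simp only [tI_apply, Prod.mk.injEq, h2, false_and, if_false, ne_negIdx, and_false,
            add_zero]
          rw [if_neg]
          rintro ⟨h3, h4⟩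
          exact h2 (by rw [h3, h4])
        simp [h2, this]
    · simp [h1]
  rw [e1, e2]
  have g2 : wt a * (alp a a * bet' j a) + (wt j * bet a j * alp' j j
      + ∑ k, wt k * bet a k * bet' j k) = 0 := by
    by_cases h : a < j
    · have hs : ∑ k, wt k * bet a k * bet' j k
          = -(xi * (xi * ∑ k : Idx n, (if a < k ∧ k < j then wt k else 0))) := by
        rw [mul_sum, mul_sum, ← Finset.sum_neg_distrib]
        refine sum_congr rfl fun k _ => ?_
        by_cases h1 : a < k <;> by_cases h2 : k < j <;> simp [bet, bet', h1, h2]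
        ring
      have e3 : alp' j j = sgn (par j) * q ^ (-eps j) := by
        simp [alp', ne_negIdx, zmod2_mul_self]
      rw [hs, sum_wt_between h, alp_self, e3]
      simp [bet, bet', h]
      ring
    · have hs : ∀ k, wt k * bet a k * bet' j k = 0 := fun k => by
        by_cases h1 : a < k <;> by_cases h2 : k < j <;> simp [bet, bet', h1, h2]
        exact absurd (h1.trans h2) h
      rw [sum_congr rfl fun k _ => hs k]
      simp [bet, bet', h]
  have g3 : wt a * (alp a (negIdx a) * gam' j a) + (-(wt j * gam a j * alp' j (negIdx j))
      + ∑ k, wt (negIdx k) * gam a k * gam' j (negIdx k)) = 0 := by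
    by_cases h : negIdx a < j
    · have hs : ∑ k, wt (negIdx k) * gam a k * gam' j (negIdx k)
          = xi * (xi * ∑ k : Idx n, (if negIdx a < k ∧ k < j then wt k else 0)) := by
        rw [mul_sum, mul_sum]
        refine sum_congr rfl fun k _ => ?_
        have := sgn_mul_self (par k)
        by_cases h1 : negIdx a < k <;> by_cases h2 : k < j <;>
          simp [gam, gam', h1, h2, wt_negIdx, sgn_add]
        linear_combination (wt k * xi ^ 2) * this
      have e3 : alp' j (negIdx j) = q ^ (-eps j) := by
        have h0 : par j * (par j + 1) = 0 := by generalize par j = p; revert p; decide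
        simp [alp', negIdx_ne, h0]
      rw [hs, sum_wt_between h, alp_neg_right, e3, wt_negIdx]
      simp [gam, gam', h, sgn_add]
      ring
    · have hs : ∀ k, wt (negIdx k) * gam a k * gam' j (negIdx k) = 0 := fun k => by
        by_cases h1 : negIdx a < k <;> by_cases h2 : k < j <;> simp [gam, gam', h1, h2]
        exact absurd (h1.trans h2) h
      rw [sum_congr rfl fun k _ => hs k]
      simp [gam, gam', h]
  have e4 : alp a i * (wt a * tI (b, i) (j, a))
      = (if i = j ∧ a = b then wt a else 0) + (if i = a ∧ b = j then wt a * (alp a a * bet' j a) else 0)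
        + (if i = negIdx a ∧ b = negIdx j then wt a * (alp a (negIdx a) * gam' j a) else 0) := by
    have e5 : alp a j * alp' j a = 1 := by
      have : par a * par j = par j * par a := mul_comm _ _
      simp only [alp, alp', this]
      rw [_root_.inv_zpow', _root_.zpow_neg]
      have h2 := zpow_ne_zero ((((if a = j then 1 else 0) + if a = negIdx j then 1 else 0) * eps j : ℤ)) hq
      have h3 := sgn_mul_self (par j * par a)
      field_simp
      linear_combination h3
    simp only [tI_apply, Prod.mk.injEq, mul_add, mul_ite, mul_zero]
    congr 1
    · congr 1
      · by_cases h : i = j ∧ a = b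
        · obtain ⟨rfl, rfl⟩ := h
          simp only [and_self, if_true]
          linear_combination wt a * e5
        · rw [if_neg h, if_neg (fun h' => h ⟨h'.2, h'.1.symm⟩)]
      · by_cases h : i = a ∧ b = j
        · obtain ⟨rfl, rfl⟩ := h
          simp only [and_self, if_true]; ring
        · rw [if_neg h, if_neg (fun h' => h h'.symm)]
    · by_cases h : i = negIdx a ∧ b = negIdx j
      · obtain ⟨rfl, rfl⟩ := h
        simp only [and_self, if_true]; ring
      · rw [if_neg h, if_neg (fun h' => h h'.symm)]
  rw [e4]
  have k2 : (if i = a ∧ b = j then wt a * (alp a a * bet' j a) else 0)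
      + (if i = a ∧ b = j then wt j * bet a j * alp' j j + ∑ k, wt k * bet a k * bet' j k else 0)
      = 0 := by
    split_ifs
    · exact g2
    · simp
  have k3 : (if i = negIdx a ∧ b = negIdx j then wt a * (alp a (negIdx a) * gam' j a) else 0)
      + (if i = negIdx a ∧ b = negIdx j then
        -(wt j * gam a j * alp' j (negIdx j)) + ∑ k, wt (negIdx k) * gam a k * gam' j (negIdx k)
        else 0) = 0 := by
    split_ifs
    · exact g3
    · simp
  linear_combination k2 + k3

end kernel

/-! ### Operators on words with Koszul signs -/

section sites
variable {n N : ℕ} {R : Type} [CommRing R]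
open Matrix

/-- Words of length `N`. -/
abbrev Word (n N : ℕ) : Type := Fin N → Idx n

/-- The parity of the letters before a site. -/
def pre (m : Fin N) (w : Word n N) : ZMod 2 := ∑ l ∈ Finset.univ.filter (fun l => l < m), par (w l)

/-- The parity of the letters after a site. -/
def suf (m : Fin N) (w : Word n N) : ZMod 2 := ∑ l ∈ Finset.univ.filter (fun l => m < l), par (w l)

/-- The parity of a word. -/
def tot (w : Word n N) : ZMod 2 := ∑ l, par (w l)

theorem tot_eq (m : Fin N) (w : Word n N) : tot w = pre m w + par (w m) + suf m w := by
  have : (Finset.univ : Finset (Fin N)) = Finset.univ.filter (fun l => l < m) ∪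
      ({m} ∪ Finset.univ.filter (fun l => m < l)) := by
    ext l
    simp only [mem_univ, Finset.mem_union, Finset.mem_filter, true_and, Finset.mem_singleton,
      true_iff]
    rcases lt_trichotomy l m with h | h | h <;> simp [h]
  rw [tot, this, Finset.sum_union, Finset.sum_union, Finset.sum_singleton, pre, suf, add_assoc]
  · simp
  · rw [Finset.disjoint_left]
    intro l hl
    simp only [Finset.mem_filter, mem_univ, true_and] at hl
    simp only [Finset.mem_union, Finset.mem_singleton, Finset.mem_filter, mem_univ, true_and,
      not_or]
    exact ⟨hl.ne, not_lt.2 hl.le⟩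

theorem sum_update_par (s : Finset (Fin N)) (w : Word n N) (m : Fin N) (a : Idx n) :
    ∑ l ∈ s, par (update w m a l)
      = ∑ l ∈ s, par (w l) + if m ∈ s then par a + par (w m) else 0 := by
  by_cases h : m ∈ s
  · rw [if_pos h, ← Finset.add_sum_erase _ _ h, ← Finset.add_sum_erase s (fun l => par (w l)) h]
    have : ∑ l ∈ s.erase m, par (update w m a l) = ∑ l ∈ s.erase m, par (w l) :=
      sum_congr rfl fun l hl => by rw [update_of_ne (Finset.ne_of_mem_erase hl)]
    rw [this, update_self]
    generalize par a = x, par (w m) = y, ∑ l ∈ s.erase m, par (w l) = z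
    revert x y z; decide
  · rw [if_neg h, add_zero]
    exact sum_congr rfl fun l hl => by
      rw [update_of_ne (by rintro rfl; exact h hl)]

theorem pre_update (m m' : Fin N) (w : Word n N) (a : Idx n) :
    pre m (update w m' a) = pre m w + if m' < m then par a + par (w m') else 0 := by
  simp [pre, sum_update_par]

theorem suf_update (m m' : Fin N) (w : Word n N) (a : Idx n) :
    suf m (update w m' a) = suf m w + if m < m' then par a + par (w m') else 0 := by
  simp [suf, sum_update_par]

theorem tot_update (m' : Fin N) (w : Word n N) (a : Idx n) :
    tot (update w m' a) = tot w + (par a + par (w m')) := by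
  simp [tot, sum_update_par]

/-- The endomorphism `x` of the letter at the site `m`, with the sign for moving it past the letters
before. -/
def oS (m : Fin N) (x : Matrix (Idx n) (Idx n) R) : Matrix (Word n N) (Word n N) R := fun w' w =>
  if w' = update w m (w' m) then
    x (w' m) (w m) * sg R ((par (w' m) + par (w m)) * pre m w) else 0

theorem vecMul_oS (m : Fin N) (x : Matrix (Idx n) (Idx n) R) (f : Word n N → R) (w : Word n N) :
    (f ᵥ* oS m x) w = ∑ i, f (update w m i) *
      (x i (w m) * sg R ((par i + par (w m)) * pre m w)) := by
  simp only [vecMul, dotProduct]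
  symm
  refine Fintype.sum_of_injective (fun i => update w m i)
    (Function.update_injective w m) _ _ ?_ ?_
  · intro w' hw'
    have : ¬ w' = update w m (w' m) := fun h => hw' ⟨_, h.symm⟩
    simp [oS, this]
  · intro i
    simp [oS]

/-- A matrix of letters that is homogeneous of degree `p`. -/
def IsHom (x : Matrix (Idx n) (Idx n) R) (p : ZMod 2) : Prop := ∀ i j, x i j ≠ 0 → par i + par j = p

theorem vecMul_oS_hom {m : Fin N} {x : Matrix (Idx n) (Idx n) R} {p : ZMod 2} (hx : IsHom x p)
    (f : Word n N → R) (w : Word n N) :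
    (f ᵥ* oS m x) w = sg R (p * pre m w) * ∑ i, f (update w m i) * x i (w m) := by
  rw [vecMul_oS, mul_sum]
  refine sum_congr rfl fun i _ => ?_
  by_cases h : x i (w m) = 0
  · simp [h]
  · rw [hx _ _ h]; ring

theorem oS_mul (m : Fin N) (x y : Matrix (Idx n) (Idx n) R) : oS m x * oS m y = oS m (x * y) := by
  refine matrix_ext_vecMul fun f w => ?_
  rw [← vecMul_vecMul]
  simp only [vecMul_oS, Matrix.mul_apply, sum_mul, mul_sum, update_self,
    update_idem, pre_update, lt_irrefl, if_false, add_zero]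
  rw [sum_comm]
  refine sum_congr rfl fun i _ => sum_congr rfl fun j _ => ?_
  have : sg R ((par i + par (w m)) * pre m w)
      = sg R ((par i + par j) * pre m w) * sg R ((par j + par (w m)) * pre m w) := by
    rw [← sg_add]
    congr 1
    generalize par i = a, par j = b, par (w m) = c, pre m w = d
    revert a b c d; decide
  rw [this]; ring

theorem oS_one (m : Fin N) : oS m (1 : Matrix (Idx n) (Idx n) R) = 1 := by
  refine matrix_ext_vecMul fun f w => ?_
  rw [vecMul_oS, vecMul_one, sum_eq_single (w m)]
  · simp [zmod2_add_self]
  · intro b _ hb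
    simp [Matrix.one_apply, hb]
  · simp

theorem oS_add (m : Fin N) (x y : Matrix (Idx n) (Idx n) R) : oS m (x + y) = oS m x + oS m y := by
  ext w' w
  by_cases h : w' = update w m (w' m)
  · simp only [oS, Matrix.add_apply, if_pos h, add_mul]
  · simp only [oS, Matrix.add_apply, if_neg h, add_zero]

theorem oS_smul (m : Fin N) (k : R) (x : Matrix (Idx n) (Idx n) R) : oS m (k • x) = k • oS m x := by
  ext w' w
  by_cases h : w' = update w m (w' m)
  · simp only [oS, Matrix.smul_apply, if_pos h, smul_eq_mul, mul_assoc]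
  · simp only [oS, Matrix.smul_apply, if_neg h, smul_zero]

/-- `oS m` as a homomorphism of algebras. -/
def oSHom (m : Fin N) : Matrix (Idx n) (Idx n) R →ₐ[R] Matrix (Word n N) (Word n N) R :=
  AlgHom.ofLinearMap
    { toFun := oS m, map_add' := oS_add m, map_smul' := fun k A => oS_smul m k A }
    (oS_one m) (fun x y => (oS_mul m x y).symm)

theorem oSHom_apply (m : Fin N) (x : Matrix (Idx n) (Idx n) R) : oSHom m x = oS m x := rfl

theorem oS_supercomm {m m' : Fin N} (hm : m ≠ m') {x y : Matrix (Idx n) (Idx n) R} {p p' : ZMod 2}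
    (hx : IsHom x p) (hy : IsHom y p') :
    oS m x * oS m' y = sg R (p * p') • (oS m' y * oS m x) := by
  refine matrix_ext_vecMul fun f w => ?_
  rw [vecMul_smul, ← vecMul_vecMul, ← vecMul_vecMul]
  simp only [Pi.smul_apply, smul_eq_mul]
  rw [vecMul_oS_hom hy, vecMul_oS_hom hx]
  simp only [vecMul_oS_hom hy, vecMul_oS_hom hx, update_of_ne hm,
    update_of_ne hm.symm, mul_sum, sum_mul, pre_update]
  rw [sum_comm]
  refine sum_congr rfl fun i _ => sum_congr rfl fun j _ => ?_
  rw [update_comm hm.symm]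
  by_cases h1 : x i (w m) = 0
  · simp [h1]
  by_cases h2 : y j (w m') = 0
  · simp [h2]
  rw [hx _ _ h1, hy _ _ h2]
  have : sg R (p' * pre m' w) * sg R (p * (pre m w + if m' < m then p' else 0))
      = sg R (p * p') * (sg R (p * pre m w) * sg R (p' * (pre m' w + if m < m' then p else 0))) := by
    rw [← sg_add, ← sg_add, ← sg_add]
    congr 1
    generalize pre m w = a, pre m' w = b
    rcases lt_or_gt_of_ne hm with h | h
    · simp only [h, h.le, not_lt.2 h.le, if_true, if_false]; clear * -; revert p p' a b; decide
    · simp only [h, h.le, not_lt.2 h.le, if_true, if_false]; clear * -; revert p p' a b; decide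
  linear_combination (f (update (update w m i) m' j) * x i (w m) * y j (w m')) * this

/-- A matrix of words that is homogeneous of degree `p`. -/
def HomM (A : Matrix (Word n N) (Word n N) R) (p : ZMod 2) : Prop :=
  ∀ w' w, A w' w ≠ 0 → tot w' = tot w + p

/-- The operator `(-1)^{p |w|}`. -/
def Zd (n N : ℕ) (R : Type) [CommRing R] (p : ZMod 2) : Matrix (Word n N) (Word n N) R :=
  diagonal fun w => sg R (p * tot w)

theorem Zd_zero : Zd n N R 0 = 1 := by
  rw [Zd, ← Matrix.diagonal_one]; congr 1; ext w; simp

theorem Zd_add (p p' : ZMod 2) : Zd n N R (p + p') = Zd n N R p * Zd n N R p' := by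
  rw [Zd, Zd, Zd, Matrix.diagonal_mul_diagonal]; congr 1; ext w; rw [add_mul, sg_add]

theorem Zd_mul_self (p : ZMod 2) : Zd n N R p * Zd n N R p = 1 := by
  rw [← Zd_add, zmod2_add_self, Zd_zero]

theorem Zd_mul_hom {A : Matrix (Word n N) (Word n N) R} {p : ZMod 2} (hA : HomM A p) (p' : ZMod 2) :
    Zd n N R p' * A = sg R (p' * p) • (A * Zd n N R p') := by
  ext w' w
  rw [Zd, Matrix.diagonal_mul, Matrix.smul_apply, Matrix.mul_diagonal, smul_eq_mul]
  by_cases h : A w' w = 0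
  · simp [h]
  · rw [hA _ _ h, mul_add, sg_add]; ring

theorem HomM.mul {A B : Matrix (Word n N) (Word n N) R} {p p' : ZMod 2} (hA : HomM A p)
    (hB : HomM B p') : HomM (A * B) (p + p') := by
  intro w' w h
  rw [Matrix.mul_apply] at h
  obtain ⟨v, _, hv⟩ := Finset.exists_ne_zero_of_sum_ne_zero h
  rw [hA _ _ (left_ne_zero_of_mul hv), hB _ _ (right_ne_zero_of_mul hv)]
  ring

theorem HomM.smul {A : Matrix (Word n N) (Word n N) R} {p : ZMod 2} (hA : HomM A p) (k : R) :
    HomM (k • A) p := fun w' w h => hA _ _ (right_ne_zero_of_mul h)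

theorem HomM.add {A B : Matrix (Word n N) (Word n N) R} {p : ZMod 2} (hA : HomM A p)
    (hB : HomM B p) : HomM (A + B) p := fun w' w h => by
  by_cases h1 : A w' w = 0
  · exact hB _ _ (by simpa [h1] using h)
  · exact hA _ _ h1

theorem HomM_zero (p : ZMod 2) : HomM (0 : Matrix (Word n N) (Word n N) R) p :=
  fun w' w h => absurd rfl h

theorem HomM.sum {ι : Type} (s : Finset ι) {A : ι → Matrix (Word n N) (Word n N) R} {p : ZMod 2}
    (h : ∀ i ∈ s, HomM (A i) p) : HomM (∑ i ∈ s, A i) p := by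
  classical
  induction s using Finset.induction_on with
  | empty => simpa using HomM_zero p
  | insert a s ha ih =>
    rw [sum_insert ha]
    exact (h a (by simp)).add (ih fun i hi => h i (by simp [hi]))

theorem HomM_one : HomM (1 : Matrix (Word n N) (Word n N) R) 0 := fun w' w h => by
  by_cases e : w' = w
  · simp [e]
  · simp [Matrix.one_apply, e] at h

theorem HomM_oS {m : Fin N} {x : Matrix (Idx n) (Idx n) R} {p : ZMod 2} (hx : IsHom x p) :
    HomM (oS m x) p := by
  intro w' w h
  by_cases e : w' = update w m (w' m)
  · rw [oS, if_pos e] at h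
    rw [e, tot_update, hx _ _ (left_ne_zero_of_mul h)]
  · simp [oS, e] at h

/-- The matrix unit `E_{ij}` at the site `m`. -/
def sE (R : Type) [CommRing R] (m : Fin N) (i j : Idx n) : Matrix (Word n N) (Word n N) R :=
  oS m (single i j 1)

theorem sE_apply (m : Fin N) (i j : Idx n) (w' w : Word n N) : sE R m i j w' w =
    if w m = j ∧ w' = update w m i then sg R ((par i + par j) * pre m w) else 0 := by
  rw [sE, oS]
  by_cases h : w m = j ∧ w' = update w m i
  · obtain ⟨rfl, rfl⟩ := h
    simp
  · rw [if_neg h]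
    split_ifs with h1
    · by_cases h2 : i = w' m ∧ j = w m
      · exact absurd ⟨h2.2.symm, by rw [h2.1]; exact h1⟩ h
      · rw [single_apply, if_neg h2, zero_mul]
    · rfl

theorem IsHom_single (i j : Idx n) : IsHom (single i j (1 : R)) (par i + par j) := by
  intro a b h
  rw [single_apply] at h
  split_ifs at h with h1
  · rw [h1.1, h1.2]
  · exact absurd rfl h

theorem oS_eq_sum (m : Fin N) (x : Matrix (Idx n) (Idx n) R) :
    oS m x = ∑ i, ∑ j, x i j • sE R m i j := by
  conv_lhs => rw [matrix_eq_sum_single x, ← oSHom_apply, map_sum]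
  refine sum_congr rfl fun i _ => ?_
  rw [map_sum]
  refine sum_congr rfl fun j _ => ?_
  rw [sE, ← oSHom_apply, ← map_smul, smul_single, smul_eq_mul, mul_one]

/-- `∑ x i j k l E_{ij} ⊗ E_{kl}` at two sites. -/
def tS (m m' : Fin N) (x : Idx n → Idx n → Idx n → Idx n → R) :
    Matrix (Word n N) (Word n N) R :=
  ∑ i, ∑ j, ∑ k, ∑ l, x i j k l • (sE R m i j * sE R m' k l)

theorem vecMul_sE (m : Fin N) (i j : Idx n) (f : Word n N → R) (w : Word n N) :
    (f ᵥ* sE R m i j) w = if w m = j then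
      sg R ((par i + par j) * pre m w) * f (update w m i) else 0 := by
  rw [sE, vecMul_oS_hom (IsHom_single i j)]
  by_cases h : w m = j
  · subst h
    rw [if_pos rfl, sum_eq_single i]
    · simp
    · intro b _ hb
      simp [single_apply, hb.symm]
    · simp
  · rw [if_neg h, sum_eq_zero, mul_zero]
    intro b _
    simp [single_apply, Ne.symm h]

theorem tS_adjacent {m m' : Fin N} (hm : (m : ℕ) + 1 = m')
    {x : Idx n → Idx n → Idx n → Idx n → R}
    (hx : ∀ i j k l, x i j k l ≠ 0 → par i + par j = par k + par l) :
    tS m m' x = amp (pair m m' (by rintro rfl; omega))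
      (Matrix.of fun y z => x y.1 z.1 y.2 z.2 * sg R ((par y.2 + par z.2) * par z.1)) := by
  have hne : m ≠ m' := by rintro rfl; omega
  have hlt : m < m' := by rw [Fin.lt_def]; omega
  refine matrix_ext_vecMul fun f w => ?_
  rw [vecMul_amp_sum, Fintype.sum_prod_type]
  simp only [tS, vecMul_sum, vecMul_smul, Finset.sum_apply, Pi.smul_apply, smul_eq_mul,
    ← vecMul_vecMul, vecMul_sE]
  have hpre : pre m' w = pre m w + par (w m) := by
    have : Finset.univ.filter (fun l : Fin N => l < m') =
        insert m (Finset.univ.filter (fun l : Fin N => l < m)) := by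
      ext l
      simp only [Finset.mem_filter, mem_univ, true_and, Finset.mem_insert, Fin.lt_def,
        Fin.ext_iff]
      omega
    rw [pre, this, sum_insert (by simp), pre, add_comm]
  refine sum_congr rfl fun i _ => ?_
  rw [sum_eq_single (w m)]
  · refine sum_congr rfl fun k _ => ?_
    rw [sum_eq_single (w m')]
    · simp only [pair, of_apply, if_true, update_of_ne hne, pre_update, not_lt.2 hlt.le, if_false,
        add_zero]
      rw [update_comm hne.symm]
      by_cases h : x i (w m) k (w m') = 0
      · simp [h]
      · have h1 := hx _ _ _ _ h
        rw [h1, hpre]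
        have : sg R ((par k + par (w m')) * (pre m w + par (w m))) * sg R ((par k + par (w m')) * pre m w)
            = sg R ((par k + par (w m')) * par (w m)) := by
          rw [← sg_add]
          congr 1
          generalize par k + par (w m') = a, pre m w = b, par (w m) = c
          revert a b c; decide
        linear_combination (x i (w m) k (w m') * f (update (update w m i) m' k)) * this
    · intro l _ hl
      simp [hl.symm]
    · simp
  · intro j _ hj
    refine sum_eq_zero fun k _ => sum_eq_zero fun l _ => ?_
    simp only [update_of_ne hne, hj.symm, if_false]
    simp
  · simp

end sites

/-! ### Passage to matrices -/

section toMatrix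
variable (n r s : ℕ)

/-- The matrix of an operator on the mixed tensor space. -/
def toM : EndMixed n r s ≃ₐ[Cq] Matrix (Word n (r + s)) (Word n (r + s)) Cq :=
  LinearMap.toMatrixAlgEquiv (mixedBasis n r s)

theorem toM_apply (f : EndMixed n r s) (w' w : Word n (r + s)) :
    toM n r s f w' w = (mixedBasis n r s).repr (f (mixedBasis n r s w)) w' :=
  LinearMap.toMatrixAlgEquiv_apply _ _ _ _

theorem toM_siteE (m : Fin (r + s)) (i j : Idx n) : toM n r s (siteE n r s m i j) = sE Cq m i j := by
  ext w' w
  rw [toM_apply, siteE, Module.Basis.constr_basis, sE_apply]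
  by_cases h : w m = j
  · rw [if_pos h, map_smul, Module.Basis.repr_self, Finsupp.smul_apply, Finsupp.single_apply,
      smul_eq_mul]
    by_cases h' : update w m i = w'
    · rw [if_pos h', if_pos ⟨h, h'.symm⟩, mul_one]
      rfl
    · rw [if_neg h', if_neg (fun e => h' e.2.symm), mul_zero]
  · rw [if_neg h, if_neg (fun e => h e.1)]
    simp

theorem toM_oneSite (m : Fin (r + s)) (x : Idx n → Idx n → Cq) :
    toM n r s (oneSite n r s m x) = oS m (Matrix.of x) := by
  rw [oS_eq_sum, oneSite, map_sum]
  refine sum_congr rfl fun i _ => ?_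
  rw [map_sum]
  exact sum_congr rfl fun j _ => by rw [map_smul, toM_siteE]; rfl

theorem toM_twoSite (m m' : Fin (r + s)) (x : Idx n → Idx n → Idx n → Idx n → Cq) :
    toM n r s (twoSite n r s m m' x) = tS m m' x := by
  simp only [twoSite, tS, map_sum, map_smul, map_mul, toM_siteE]

theorem mem_endPart_iff (f : EndMixed n r s) (p : ZMod 2) :
    f ∈ endPart n r s p ↔ HomM (toM n r s f) p := by
  have key : ∀ (a : ZMod 2) (x : MixedTensor n r s), x ∈ mixedPart n r s a ↔
      ∀ w, (mixedBasis n r s).repr x w ≠ 0 → tot w = a := by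
    intro a x
    have : mixedPart n r s a = Submodule.span Cq (mixedBasis n r s '' {w | tot w = a}) := by
      unfold mixedPart
      congr 1
      ext y
      simp only [Set.mem_ofPred_eq, Set.mem_image, tot]
      exact ⟨fun ⟨w, h1, h2⟩ => ⟨w, h1, h2.symm⟩, fun ⟨w, h1, h2⟩ => ⟨w, h1, h2.symm⟩⟩
    rw [this, Module.Basis.mem_span_image]
    constructor
    · intro h w hw
      exact h (Finsupp.mem_support_iff.2 hw)
    · intro h w hw
      exact h w (Finsupp.mem_support_iff.1 hw)
  constructor
  · intro hf w' w h
    rw [toM_apply] at h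
    have h1 : mixedBasis n r s w ∈ mixedPart n r s (tot w) :=
      subset_span ⟨w, rfl, rfl⟩
    exact (key _ _).1 (hf _ _ h1) w' h
  · intro hf a x hx
    induction hx using span_induction with
    | mem x hx =>
      obtain ⟨w, hw, rfl⟩ := hx
      rw [key]
      intro w' h
      rw [← toM_apply] at h
      rw [hf _ _ h, ← hw]
      rfl
    | zero => rw [map_zero]; exact Submodule.zero_mem _
    | add x y _ _ hx hy => rw [map_add]; exact Submodule.add_mem _ hx hy
    | smul k x _ hx => rw [map_smul]; exact Submodule.smul_mem _ _ hx

end toMatrix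

/-! ### The action of the quantum queer superalgebra -/

section kernels
variable {n : ℕ}
open Matrix

theorem amp_l12_apply {R : Type} [CommRing R] (A : Matrix (Idx n × Idx n) (Idx n × Idx n) R)
    (i k d x y z : Idx n) :
    amp l12 A (i, k, d) (x, y, z) = if d = z then A (i, k) (x, y) else 0 := by
  simp [amp, l12]

theorem amp_lTail_apply {R : Type} [CommRing R] (A : Matrix (Idx n × Idx n) (Idx n × Idx n) R)
    (i k d x y z : Idx n) :
    amp lTail A (i, k, d) (x, y, z) = if i = x then A (k, d) (y, z) else 0 := by
  simp [amp, lTail]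

theorem entry_121 (A B C : Matrix (Idx n × Idx n) (Idx n × Idx n) Cq) (i k d c j l : Idx n) :
    (amp l12 A * amp lTail B * amp l12 C : Matrix (Idx n × Idx n × Idx n) (Idx n × Idx n × Idx n) Cq) (i, k, d) (c, j, l)
      = ∑ a, ∑ b, ∑ e, A (i, k) (a, b) * B (b, d) (e, l) * C (a, e) (c, j) := by
  rw [mul_assoc]
  simp only [Matrix.mul_apply, Fintype.sum_prod_type, amp_l12_apply, amp_lTail_apply]
  refine sum_congr rfl fun a _ => sum_congr rfl fun b _ => ?_
  simp [-Finset.univ_eq_attach, mul_sum, mul_assoc]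

theorem entry_212 (A B C : Matrix (Idx n × Idx n) (Idx n × Idx n) Cq) (c i k j l d : Idx n) :
    (amp lTail A * amp l12 B * amp lTail C : Matrix (Idx n × Idx n × Idx n) (Idx n × Idx n × Idx n) Cq) (c, i, k) (j, l, d)
      = ∑ a, ∑ b, ∑ e, A (i, k) (a, b) * B (c, a) (j, e) * C (e, b) (l, d) := by
  rw [mul_assoc]
  simp only [Matrix.mul_apply, Fintype.sum_prod_type, amp_l12_apply, amp_lTail_apply]
  rw [sum_eq_single c]
  · refine sum_congr rfl fun a _ => sum_congr rfl fun b _ => ?_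
    simp only [if_true]
    rw [sum_eq_single j]
    · simp [-Finset.univ_eq_attach, mul_sum, mul_assoc]
    · intro x _ hx
      simp [hx]
    · simp
  · intro x _ hx
    simp [hx.symm]
  · simp

/-- The kernels `K i j d c` describing the action of `u_{ij}` on one letter. -/
structure SiteKer (K : Idx n → Idx n → Idx n → Idx n → Cq) : Prop where
  par_eq : ∀ i j d c, K i j d c ≠ 0 → par i + par d = par c + par j
  rtt : ∀ i k j l d c, ∑ a, ∑ b, ∑ e, tM (i, k) (a, b) * (K b l d e * K a j e c)
    = ∑ a, ∑ b, ∑ e, tM (a, b) (j, l) * (K k b d e * K i a e c)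

/-- The kernel of the vector representation. -/
def kV (i j d c : Idx n) : Cq := tM (i, d) (c, j)

/-- The kernel of the dual representation. -/
def kD (i j d c : Idx n) : Cq := tI (c, i) (j, d)

theorem amp_inv {A B : Matrix (Idx n × Idx n) (Idx n × Idx n) Cq} (h : A * B = 1)
    (L : Lens (Idx n × Idx n × Idx n) (Idx n × Idx n)) : amp L A * amp L B = 1 := by
  rw [← amp_mul, h, amp_one]

theorem braid_inv_left :
    (amp lTail tM * amp l12 tI * amp lTail tI : Matrix (Idx n × Idx n × Idx n) (Idx n × Idx n × Idx n) Cq)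
    = amp l12 tI * amp lTail tI * amp l12 tM := by
  have h1 := amp_inv (n := n) tM_mul_tI l12
  have h2 := amp_inv (n := n) tI_mul_tM l12
  have h3 := amp_inv (n := n) tM_mul_tI lTail
  have h4 := amp_inv (n := n) tI_mul_tM lTail
  have h := tM_braid (n := n)
  set a := amp l12 (tM : Matrix (Idx n × Idx n) _ Cq)
  set a' := amp l12 (tI : Matrix (Idx n × Idx n) _ Cq)
  set b := amp (lTail : Lens (Idx n × Idx n × Idx n) (Idx n × Idx n)) (tM : Matrix (Idx n × Idx n) _ Cq)
  set b' := amp (lTail : Lens (Idx n × Idx n × Idx n) (Idx n × Idx n)) (tI : Matrix (Idx n × Idx n) _ Cq)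
  calc b * a' * b' = (a' * (b' * b) * a) * b * a' * b' := by rw [h4, mul_one, h2, one_mul]
    _ = a' * b' * (b * a * b) * a' * b' := by noncomm_ring
    _ = a' * b' * (a * b * a) * a' * b' := by rw [h]
    _ = a' * b' * a * (b * (a * a') * b') := by noncomm_ring
    _ = a' * b' * a := by rw [h1, mul_one, h3, mul_one]

theorem braid_inv_right :
    (amp l12 tM * amp lTail tI * amp l12 tI : Matrix (Idx n × Idx n × Idx n) (Idx n × Idx n × Idx n) Cq)
    = amp lTail tI * amp l12 tI * amp lTail tM := by
  have h1 := amp_inv (n := n) tM_mul_tI l12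
  have h2 := amp_inv (n := n) tI_mul_tM l12
  have h3 := amp_inv (n := n) tM_mul_tI lTail
  have h4 := amp_inv (n := n) tI_mul_tM lTail
  have h := tM_braid (n := n)
  set a := amp l12 (tM : Matrix (Idx n × Idx n) _ Cq)
  set a' := amp l12 (tI : Matrix (Idx n × Idx n) _ Cq)
  set b := amp (lTail : Lens (Idx n × Idx n × Idx n) (Idx n × Idx n)) (tM : Matrix (Idx n × Idx n) _ Cq)
  set b' := amp (lTail : Lens (Idx n × Idx n × Idx n) (Idx n × Idx n)) (tI : Matrix (Idx n × Idx n) _ Cq)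
  calc a * b' * a' = (b' * (a' * a) * b) * a * b' * a' := by rw [h2, mul_one, h4, one_mul]
    _ = b' * a' * (a * b * a) * b' * a' := by noncomm_ring
    _ = b' * a' * (b * a * b) * b' * a' := by rw [h]
    _ = b' * a' * b * (a * (b * b') * a') := by noncomm_ring
    _ = b' * a' * b := by rw [h3, mul_one, h1, mul_one]

theorem siteKer_kV : SiteKer (kV (n := n)) where
  par_eq i j d c h := (tM_conserve h).1
  rtt i k j l d c := by
    have h := congrFun (congrFun (tM_braid (n := n)) (i, k, d)) (c, j, l)
    rw [entry_121, entry_212] at h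
    simp only [kV, ← mul_assoc]
    rw [h]
    rw [sum_congr rfl fun a _ => sum_comm, sum_comm,
      sum_congr rfl fun a _ => sum_comm]
    exact sum_congr rfl fun a _ => sum_congr rfl fun b _ =>
      sum_congr rfl fun e _ => by ring

theorem siteKer_kD : SiteKer (kD (n := n)) where
  par_eq i j d c h := by
    have := (tI_conserve h).1
    simp only at this
    generalize par i = x1 at *
    generalize par j = x2 at *
    generalize par d = x3 at *
    generalize par c = x4 at *
    clear h
    revert x1 x2 x3 x4; decide
  rtt i k j l d c := by
    have h := congrFun (congrFun (braid_inv_left (n := n)) (c, i, k)) (j, l, d)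
    rw [entry_121, entry_212] at h
    simp only [kD]
    have e1 : ∑ a, ∑ b, ∑ e, tM (i, k) (a, b) * (tI (e, b) (l, d) * tI (c, a) (j, e))
        = ∑ a, ∑ b, ∑ e, tM (i, k) (a, b) * tI (c, a) (j, e) * tI (e, b) (l, d) :=
      sum_congr rfl fun a _ => sum_congr rfl fun b _ =>
        sum_congr rfl fun e _ => by ring
    rw [e1, h]
    rw [sum_congr rfl fun a _ => sum_comm]
    exact sum_congr rfl fun a _ => sum_congr rfl fun b _ =>
      sum_congr rfl fun e _ => by ring

/-- The combined action on two adjacent letters. -/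
def kk (K K' : Idx n → Idx n → Idx n → Idx n → Cq) (i j : Idx n) :
    Matrix (Idx n × Idx n) (Idx n × Idx n) Cq :=
  Matrix.of fun y z => ∑ k, K i k y.1 z.1 * K' k j y.2 z.2

/-- The braid operator on two dual letters. -/
def tDM : Matrix (Idx n × Idx n) (Idx n × Idx n) Cq :=
  Matrix.of fun y x => tM (x.2, x.1) (y.2, y.1)

/-- The cap-cup operator. -/
def eM : Matrix (Idx n × Idx n) (Idx n × Idx n) Cq :=
  Matrix.of fun y x => if y.1 = y.2 ∧ x.1 = x.2 then q ^ (-(2 * (n : ℤ) + 1)) * wt x.1 else 0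

theorem kk_commute_tM (i j : Idx n) : Commute (kk kV kV i j) tM := by
  ext ⟨c', d'⟩ ⟨c, d⟩
  have h := congrFun (congrFun (tM_braid (n := n)) (i, c', d')) (c, d, j)
  rw [entry_121, entry_212] at h
  simp only [Matrix.mul_apply, Fintype.sum_prod_type, kk, of_apply, kV, sum_mul,
    mul_sum]
  rw [sum_congr rfl fun a _ => sum_comm, h]
  exact sum_congr rfl fun a _ => sum_congr rfl fun b _ =>
    sum_congr rfl fun e _ => by ring

theorem kk_commute_tDM (i j : Idx n) : Commute (kk kD kD i j) tDM := by
  ext ⟨c', d'⟩ ⟨c, d⟩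
  have h := congrFun (congrFun (braid_inv_right (n := n)) (d, c, i)) (j, d', c')
  rw [entry_121, entry_212] at h
  simp only [Matrix.mul_apply, Fintype.sum_prod_type, kk, of_apply, kD, sum_mul,
    mul_sum, tDM]
  have e1 : ∑ x, ∑ y, ∑ k, tI (x, i) (k, c') * tI (y, k) (j, d') * tM (d, c) (y, x)
      = ∑ a, ∑ b, ∑ e, tM (d, c) (a, b) * tI (b, i) (e, c') * tI (a, e) (j, d') := by
    rw [sum_comm]
    exact sum_congr rfl fun a _ => sum_congr rfl fun b _ =>
      sum_congr rfl fun e _ => by ring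
  rw [e1, h]
  rw [sum_comm, sum_congr rfl fun a _ => sum_comm,
    sum_congr rfl fun a _ => sum_congr rfl fun b _ => rfl]
  refine sum_congr rfl fun a _ => ?_
  rw [sum_comm, sum_comm]
  exact sum_congr rfl fun b _ => sum_congr rfl fun e _ => by ring

theorem kk_kV_kD_diag (i j c' d' : Idx n) :
    ∑ x, ∑ k, kV i k c' x * kD k j d' x = if i = j ∧ c' = d' then 1 else 0 := by
  have h := congrFun (congrFun (tM_mul_tI (n := n)) (i, c')) (j, d')
  rw [Matrix.mul_apply, Fintype.sum_prod_type, Matrix.one_apply] at h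
  simp only [Prod.mk.injEq] at h
  exact h

theorem kk_commute_eM (i j : Idx n) : Commute (kk kV kD i j) eM := by
  ext ⟨c', d'⟩ ⟨c, d⟩
  simp only [Matrix.mul_apply, Fintype.sum_prod_type, kk, of_apply, eM]
  have e1 : ∑ x, ∑ y, (∑ k, kV i k c' x * kD k j d' y) *
      (if x = y ∧ c = d then q ^ (-(2 * (n : ℤ) + 1)) * wt c else 0)
      = if c = d then (if i = j ∧ c' = d' then 1 else 0) * (q ^ (-(2 * (n : ℤ) + 1)) * wt c) else 0 := by
    rw [← kk_kV_kD_diag, sum_mul]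
    split_ifs with h
    · subst h
      refine sum_congr rfl fun x _ => ?_
      simp [-Finset.univ_eq_attach]
    · simp [h]
  have e2 : ∑ x, ∑ y, (if c' = d' ∧ x = y then q ^ (-(2 * (n : ℤ) + 1)) * wt x else 0) *
      (∑ k, kV i k x c * kD k j y d)
      = if c' = d' then q ^ (-(2 * (n : ℤ) + 1)) * (if i = j ∧ c = d then wt c else 0) else 0 := by
    rw [← crossing, mul_sum]
    split_ifs with h
    · subst h
      refine sum_congr rfl fun x _ => ?_
      rw [sum_eq_single x (fun y _ hy => by simp [hy.symm]) (by simp)]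
      simp only [true_and, if_true, mul_sum, kV, kD]
      exact sum_congr rfl fun k _ => by ring
    · simp [h]
  rw [e1, e2]
  by_cases h1 : c = d <;> by_cases h2 : c' = d' <;> simp [h1, h2]

theorem sCoeff_eq (i j d c : Idx n) :
    sCoeff q d c i j = sgn (par j * par c + par i + par i * par j) * kV i j d c := by
  simp only [kV, tM, sCoeff, Prod.mk.injEq, mul_add, mul_ite, mul_zero, mul_one, add_assoc]
  congr 1
  · by_cases h : i = j ∧ d = c
    · obtain ⟨rfl, rfl⟩ := h
      have : par i * par d + (par i + par i * par i) = par d * par i := by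
        generalize par i = x, par d = y
        revert x y; decide
      have h2 := sgn_mul_self (par d * par i)
      simp only [and_self, if_true]
      rw [this, alp, ← mul_assoc, h2, one_mul]
    · have h' : ¬(d = c ∧ i = j) := fun e => h ⟨e.2, e.1⟩
      simp only [if_neg h, if_neg h']
  · have e1 : (if i = c ∧ d = j then sgn (par j * par c + (par i + par i * par j)) * bet c j else 0)
        = if i < j then (if d = j ∧ c = i then xi * sgn (par i) else 0) else 0 := by
      by_cases h : i = c ∧ d = j
      · obtain ⟨rfl, rfl⟩ := h
        have : par d * par i + (par i + par i * par d) = par i := by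
          generalize par i = x, par d = y
          revert x y; decide
        simp only [and_self, if_true, this, bet]
        split_ifs <;> ring
      · have h' : ¬(d = j ∧ c = i) := fun e => h ⟨e.2.symm, e.1⟩
        simp only [if_neg h, if_neg h', ite_self]
    have e2 : (if i = negIdx c ∧ d = negIdx j then
          sgn (par j * par c + (par i + par i * par j)) * gam c j else 0)
        = if i < j then (if d = negIdx j ∧ c = negIdx i then xi * sgn (par i) else 0) else 0 := by
      by_cases h : i = negIdx c ∧ d = negIdx j
      · obtain ⟨rfl, rfl⟩ := h
        have : sgn (par j * par c + (par (negIdx c) + par (negIdx c) * par j)) * sgn (par j)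
            = sgn (par (negIdx c)) := by
          rw [← sgn_add, par_negIdx]
          congr 1
          generalize par c = x, par j = y
          revert x y; decide
        simp only [and_self, if_true, gam, negIdx_negIdx]
        split_ifs
        · linear_combination xi * this
        · ring
      · have h' : ¬(d = negIdx j ∧ c = negIdx i) := fun e => h ⟨by rw [e.2]; simp, e.1⟩
        simp only [if_neg h, if_neg h', ite_self]
    rw [e1, e2]
    by_cases h : i < j
    · simp only [if_pos h, ← xi_eq]
    · simp [h]

theorem sCoeff_inv_eq (i j c d : Idx n) :
    sCoeff q⁻¹ c d i j = sgn (par i * par d) * tI (c, i) (j, d) := by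
  simp only [tI_apply, sCoeff, Prod.mk.injEq, mul_add, mul_ite, mul_zero, mul_one, add_assoc]
  congr 1
  · by_cases h : i = j ∧ c = d
    · obtain ⟨rfl, rfl⟩ := h
      have h2 := sgn_mul_self (par i * par c)
      simp only [and_self, if_true]
      rw [alp', ← mul_assoc, h2, one_mul]
    · have h' : ¬(c = d ∧ i = j) := fun e => h ⟨e.2, e.1⟩
      simp only [if_neg h, if_neg h']
  · have e1 : (if c = j ∧ i = d then sgn (par i * par d) * bet' j d else 0)
        = if i < j then (if c = j ∧ d = i then -xi * sgn (par i) else 0) else 0 := by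
      by_cases h : c = j ∧ i = d
      · obtain ⟨rfl, rfl⟩ := h
        simp only [and_self, if_true, bet', zmod2_mul_self]
        split_ifs <;> ring
      · have h' : ¬(c = j ∧ d = i) := fun e => h ⟨e.1, e.2.symm⟩
        simp only [if_neg h, if_neg h', ite_self]
    have e2 : (if c = negIdx j ∧ i = negIdx d then sgn (par i * par d) * gam' j d else 0)
        = if i < j then (if c = negIdx j ∧ d = negIdx i then -xi * sgn (par i) else 0) else 0 := by
      by_cases h : c = negIdx j ∧ i = negIdx d
      · obtain ⟨rfl, rfl⟩ := h
        have : sgn (par (negIdx d) * par d) * sgn (par d) = -sgn (par (negIdx d)) := by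
          rw [par_negIdx, sgn_add]
          rcases zmod2_cases (par d) with h | h <;> simp [h, one_add_one_zmod2]
        simp only [and_self, if_true, gam', negIdx_negIdx]
        split_ifs
        · linear_combination xi * this
        · ring
      · have h' : ¬(c = negIdx j ∧ d = negIdx i) := fun e => h ⟨e.1, by rw [e.2]; simp⟩
        simp only [if_neg h, if_neg h', ite_self]
    rw [e1, e2]
    by_cases h : i < j
    · simp only [if_pos h]
      by_cases h1 : c = j ∧ d = i <;> by_cases h2 : c = negIdx j ∧ d = negIdx i <;>
        simp [h1, h2, xi_eq]
    · simp [h]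

theorem superT_sCoeff_eq (i j d c : Idx n) : superTFirst (sCoeff q⁻¹) d c i j
    = sgn (par j * par c + par i + par i * par j) * kD i j d c := by
  rw [superTFirst, superT, sCoeff_inv_eq, kD]
  by_cases h : tI (c, i) (j, d) = 0
  · simp [h]
  · have h1 := (tI_conserve h).1
    have : sgn (par i * par d) * sgn ((par c + par d) * par c)
        = sgn (par j * par c + par i + par i * par j) := by
      rw [← sgn_add]
      congr 1
      simp only at h1
      generalize par i = x1 at *
      generalize par j = x2 at *
      generalize par d = x3 at *
      generalize par c = x4 at *
      clear h
      revert x1 x2 x3 x4; decide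
    linear_combination tI (c, i) (j, d) * this

end kernels

/-! ### Site operators of the quantum queer superalgebra -/

section uhat
variable {n N : ℕ}
open Matrix

/-- The endomorphism of one letter with kernel `K`. -/
def xK (K : Idx n → Idx n → Idx n → Idx n → Cq) (i j : Idx n) : Matrix (Idx n) (Idx n) Cq :=
  Matrix.of fun d c => sg Cq (par j * par c + par i + par i * par j) * K i j d c

theorem IsHom_xK {K : Idx n → Idx n → Idx n → Idx n → Cq} (hK : SiteKer K) (i j : Idx n) :
    IsHom (xK K i j) (par i + par j) := by
  intro d c h
  have h1 := hK.par_eq _ _ _ _ (right_ne_zero_of_mul h)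
  generalize par i = x1 at *
  generalize par j = x2 at *
  generalize par d = x3 at *
  generalize par c = x4 at *
  clear h
  revert x1 x2 x3 x4; decide

/-- The operator by which `u_{ij}` acts on one letter, multiplied by the parity operator. -/
def uh (K : Idx n → Idx n → Idx n → Idx n → Cq) (m : Fin N) :
    Matrix (Idx n) (Idx n) (Matrix (Word n N) (Word n N) Cq) :=
  Matrix.of fun i j => oS m (xK K i j) * Zd n N Cq (par i + par j)

theorem vecMul_Zd (f : Word n N → Cq) (p : ZMod 2) (w : Word n N) :
    (f ᵥ* Zd n N Cq p) w = f w * sg Cq (p * tot w) := by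
  rw [Zd, Matrix.vecMul_diagonal]

theorem vecMul_uh {K : Idx n → Idx n → Idx n → Idx n → Cq} (hK : SiteKer K) (m : Fin N) (i j : Idx n)
    (f : Word n N → Cq) (w : Word n N) :
    (f ᵥ* uh K m i j) w
      = sg Cq (par i * (par (w m) + 1 + par j) + (par i + par j) * suf m w) *
        ∑ d, f (update w m d) * K i j d (w m) := by
  rw [uh, of_apply, ← vecMul_vecMul, vecMul_Zd, vecMul_oS_hom (IsHom_xK hK i j)]
  simp only [xK, of_apply, mul_sum, sum_mul]
  refine sum_congr rfl fun d _ => ?_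
  have : sg Cq ((par i + par j) * pre m w) * sg Cq (par j * par (w m) + par i + par i * par j)
      * sg Cq ((par i + par j) * tot w)
      = sg Cq (par i * (par (w m) + 1 + par j) + (par i + par j) * suf m w) := by
    rw [← sg_add, ← sg_add, tot_eq m w]
    congr 1
    generalize par i = x1, par j = x2, par (w m) = x3, pre m w = x4, suf m w = x5
    revert x1 x2 x3 x4 x5; decide
  linear_combination (f (update w m d) * K i j d (w m)) * this

theorem HomM_Zd (p : ZMod 2) : HomM (Zd n N Cq p) 0 := fun w' w h => by
  by_cases e : w' = w
  · simp [e]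
  · simp [Zd, diagonal_apply, e] at h

theorem HomM_uh {K : Idx n → Idx n → Idx n → Idx n → Cq} (hK : SiteKer K) (m : Fin N) (i j : Idx n) :
    HomM (uh K m i j) (par i + par j) := by
  have := (HomM_oS (m := m) (IsHom_xK hK i j)).mul (HomM_Zd (par i + par j))
  rwa [add_zero] at this

theorem uh_supercomm {K K' : Idx n → Idx n → Idx n → Idx n → Cq} (hK : SiteKer K) (hK' : SiteKer K')
    {m m' : Fin N} (hm : m ≠ m') (i j k l : Idx n) :
    uh K m i j * uh K' m' k l
      = sg Cq ((par i + par j) * (par k + par l)) • (uh K' m' k l * uh K m i j) := by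
  simp only [uh, of_apply]
  set p := par i + par j
  set p' := par k + par l
  have hx := IsHom_xK hK i j
  have hy := IsHom_xK hK' k l
  calc oS m (xK K i j) * Zd n N Cq p * (oS m' (xK K' k l) * Zd n N Cq p')
      = oS m (xK K i j) * (Zd n N Cq p * oS m' (xK K' k l)) * Zd n N Cq p' := by noncomm_ring
    _ = sg Cq (p * p') • (oS m (xK K i j) * oS m' (xK K' k l) * (Zd n N Cq p * Zd n N Cq p')) := by
        rw [Zd_mul_hom (HomM_oS hy)]
        simp only [mul_smul_comm, smul_mul_assoc, mul_assoc]
        rfl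
    _ = oS m' (xK K' k l) * oS m (xK K i j) * (Zd n N Cq p' * Zd n N Cq p) := by
        rw [oS_supercomm hm hx hy, smul_mul_assoc, smul_smul, sg_mul_self, one_smul, ← Zd_add,
          ← Zd_add, add_comm]
    _ = sg Cq (p * p') • (oS m' (xK K' k l) * (Zd n N Cq p' * oS m (xK K i j)) * Zd n N Cq p) := by
        rw [Zd_mul_hom (HomM_oS hx)]
        simp only [mul_smul_comm, smul_mul_assoc, mul_assoc, smul_smul]
        rw [mul_comm p' p, sg_mul_self, one_smul]
    _ = _ := by simp only [mul_assoc]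

/-- The matrix with entries `± X k l * X i j`. -/
def boxM {A : Type} [Ring A] [Algebra Cq A] (X : Matrix (Idx n) (Idx n) A) :
    Matrix (Idx n × Idx n) (Idx n × Idx n) A :=
  Matrix.of fun y z => sg Cq ((par y.2 + par z.2) * par y.1) • (X y.2 z.2 * X y.1 z.1)

/-- The braid operator with entries in an algebra. -/
def tA (n : ℕ) (A : Type) [Ring A] [Algebra Cq A] : Matrix (Idx n × Idx n) (Idx n × Idx n) A :=
  tM.map (algebraMap Cq A)

theorem boxM_mul {A : Type} [Ring A] [Algebra Cq A] {X Y : Matrix (Idx n) (Idx n) A}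
    (h : ∀ i j k l, Y i j * X k l
      = sg Cq ((par i + par j) * (par k + par l)) • (X k l * Y i j)) :
    boxM (X * Y) = boxM X * boxM Y := by
  ext ⟨i, k⟩ ⟨j, l⟩
  simp only [boxM, of_apply, Matrix.mul_apply, Fintype.sum_prod_type, sum_mul,
    mul_sum, smul_sum]
  refine sum_congr rfl fun y _ => sum_congr rfl fun x _ => ?_
  rw [show X k x * Y x l * (X i y * Y y j) = X k x * (Y x l * X i y) * Y y j by noncomm_ring, h]
  simp only [mul_smul_comm, smul_mul_assoc, smul_smul, mul_assoc]
  congr 1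
  rw [← sg_add, ← sg_add]
  congr 1
  generalize par i = x1, par k = x2, par l = x3, par x = x4, par y = x5
  revert x1 x2 x3 x4 x5; decide

theorem uh_rtt {K : Idx n → Idx n → Idx n → Idx n → Cq} (hK : SiteKer K) (m : Fin N) :
    Commute (tA n _) (boxM (uh K m)) := by
  have key : ∀ (i k j l : Idx n) (f : Word n N → Cq) (w : Word n N),
      (f ᵥ* boxM (uh K m) (i, k) (j, l)) w
        = sg Cq ((par i + par k) * (par (w m) + 1 + par j + par l)
            + (par i + par j + par k + par l) * suf m w) *
          ∑ d, ∑ e, f (update w m d) * (K k l d e * K i j e (w m)) := by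
    intro i k j l f w
    simp only [boxM, of_apply]
    rw [vecMul_smul, Pi.smul_apply, smul_eq_mul, ← vecMul_vecMul, vecMul_uh hK]
    simp only [vecMul_uh hK, update_self, update_idem, suf_update, lt_irrefl,
      if_false, add_zero, mul_sum, sum_mul]
    rw [sum_comm]
    refine sum_congr rfl fun d _ => sum_congr rfl fun e _ => ?_
    by_cases h : K i j e (w m) = 0
    · simp [h]
    have h1 := hK.par_eq _ _ _ _ h
    have : sg Cq ((par k + par l) * par i) *
        (sg Cq (par i * (par (w m) + 1 + par j) + (par i + par j) * suf m w) *
          sg Cq (par k * (par e + 1 + par l) + (par k + par l) * suf m w))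
        = sg Cq ((par i + par k) * (par (w m) + 1 + par j + par l)
            + (par i + par j + par k + par l) * suf m w) := by
      rw [← sg_add, ← sg_add]
      congr 1
      have h2 : par e = par i + par (w m) + par j := by
        clear h
        generalize par i = x1 at *
        generalize par e = x2 at *
        generalize par j = x3 at *
        generalize par (w m) = x4 at *
        revert x1 x2 x3 x4; decide
      rw [h2]
      generalize par i = x1, par k = x2, par l = x3, par j = x4, par (w m) = x5, suf m w = x6
      revert x1 x2 x3 x4 x5 x6; decide
    linear_combination (f (update w m d) * (K k l d e * K i j e (w m))) * this
  ext1 ⟨i, k⟩ ⟨j, l⟩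
  refine matrix_ext_vecMul fun f w => ?_
  simp only [Matrix.mul_apply, vecMul_sum, Finset.sum_apply, Fintype.sum_prod_type, tA,
    Matrix.map_apply, ← Algebra.commutes, ← Algebra.smul_def, vecMul_smul, Pi.smul_apply,
    smul_eq_mul, key]
  have hL : ∀ a b, tM (i, k) (a, b) * (sg Cq ((par a + par b) * (par (w m) + 1 + par j + par l)
            + (par a + par j + par b + par l) * suf m w) *
          ∑ d, ∑ e, f (update w m d) * (K b l d e * K a j e (w m)))
      = sg Cq ((par i + par k) * (par (w m) + 1 + par j + par l)
            + (par i + par j + par k + par l) * suf m w) *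
        (tM (i, k) (a, b) * ∑ d, ∑ e, f (update w m d) * (K b l d e * K a j e (w m))) := by
    intro a b
    by_cases h : tM (i, k) (a, b) = 0
    · simp [h]
    · have h1 : par i + par k = par a + par b := (tM_conserve h).1
      rw [h1, show par a + par j + par b + par l = (par a + par b) + par j + par l by ring, ← h1,
        show par i + par j + par k + par l = (par i + par k) + par j + par l by ring]
      ring
  have hR : ∀ a b, tM (a, b) (j, l) * (sg Cq ((par i + par k) * (par (w m) + 1 + par a + par b)
            + (par i + par a + par k + par b) * suf m w) *
          ∑ d, ∑ e, f (update w m d) * (K k b d e * K i a e (w m)))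
      = sg Cq ((par i + par k) * (par (w m) + 1 + par j + par l)
            + (par i + par j + par k + par l) * suf m w) *
        (tM (a, b) (j, l) * ∑ d, ∑ e, f (update w m d) * (K k b d e * K i a e (w m))) := by
    intro a b
    by_cases h : tM (a, b) (j, l) = 0
    · simp [h]
    · have h1 : par a + par b = par j + par l := (tM_conserve h).1
      rw [show par i + par a + par k + par b = (par i + par k) + (par a + par b) by ring,
        show par i + par j + par k + par l = (par i + par k) + (par j + par l) by ring,
        show par (w m) + 1 + par a + par b = par (w m) + 1 + (par a + par b) by ring,
        show par (w m) + 1 + par j + par l = par (w m) + 1 + (par j + par l) by ring, h1]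
      ring
  refine (sum_congr rfl fun a _ => sum_congr rfl fun b _ => hL a b).trans
    (Eq.trans ?_ (sum_congr rfl fun a _ => sum_congr rfl fun b _ => hR a b).symm)
  have pull : ∀ (z : Cq) (F : Idx n → Idx n → Cq), ∑ a, ∑ b, z * F a b = z * ∑ a, ∑ b, F a b := by
    intro z F
    simp only [mul_sum]
  rw [pull, pull]
  congr 1
  simp only [mul_sum]
  have swap : ∀ F : Idx n → Idx n → Idx n → Idx n → Cq,
      ∑ a, ∑ b, ∑ d, ∑ e, F a b d e = ∑ d, ∑ a, ∑ b, ∑ e, F a b d e := by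
    intro F
    rw [sum_congr rfl fun a _ => sum_comm, sum_comm]
  refine (swap _).trans (Eq.trans ?_ (swap _).symm)
  refine sum_congr rfl fun d _ => ?_
  have h := congrArg (fun x => f (update w m d) * x) (hK.rtt i k j l d (w m))
  simp only [mul_sum] at h
  refine Eq.trans ?_ (h.trans ?_)
  · exact sum_congr rfl fun a _ => sum_congr rfl fun b _ =>
      sum_congr rfl fun e _ => by ring
  · exact sum_congr rfl fun a _ => sum_congr rfl fun b _ =>
      sum_congr rfl fun e _ => by ring

/-- The ordered product of the site operators. -/
def uprod (K : Fin N → Idx n → Idx n → Idx n → Idx n → Cq) (l : List (Fin N)) :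
    Matrix (Idx n) (Idx n) (Matrix (Word n N) (Word n N) Cq) :=
  (l.map fun m => uh (K m) m).prod

variable {K : Fin N → Idx n → Idx n → Idx n → Idx n → Cq}

theorem uprod_nil : uprod K [] = 1 := rfl

theorem uprod_cons (m : Fin N) (l : List (Fin N)) : uprod K (m :: l) = uh (K m) m * uprod K l := by
  simp [uprod]

theorem HomM_uprod (hK : ∀ m, SiteKer (K m)) (l : List (Fin N)) (i j : Idx n) :
    HomM (uprod K l i j) (par i + par j) := by
  induction l generalizing i j with
  | nil =>
    rw [uprod_nil, Matrix.one_apply]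
    split_ifs with h
    · rw [h, zmod2_add_self]; exact HomM_one
    · exact HomM_zero _
  | cons m l ih =>
    rw [uprod_cons, Matrix.mul_apply]
    refine HomM.sum _ fun k _ => ?_
    have := (HomM_uh (hK m) m i k).mul (ih k j)
    rwa [show par i + par k + (par k + par j) = par i + par j + (par k + par k) by ring,
      zmod2_add_self, add_zero] at this

theorem uprod_supercomm (hK : ∀ m, SiteKer (K m)) {m : Fin N} {l : List (Fin N)} (hm : m ∉ l)
    (i j a b : Idx n) : uprod K l i j * uh (K m) m a b
      = sg Cq ((par i + par j) * (par a + par b)) • (uh (K m) m a b * uprod K l i j) := by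
  induction l generalizing i j with
  | nil =>
    rw [uprod_nil, Matrix.one_apply]
    split_ifs with h
    · rw [h, zmod2_add_self]; simp
    · simp
  | cons m' l ih =>
    simp only [List.mem_cons, not_or] at hm
    rw [uprod_cons, Matrix.mul_apply, sum_mul, mul_sum, smul_sum]
    refine sum_congr rfl fun k _ => ?_
    rw [mul_assoc, ih hm.2, mul_smul_comm, ← mul_assoc, uh_supercomm (hK _) (hK _) (Ne.symm hm.1),
      smul_mul_assoc, smul_smul, mul_assoc, ← sg_add, ← add_mul]
    congr 3
    rw [show par k + par j + (par i + par k) = par i + par j + (par k + par k) by ring,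
      zmod2_add_self, add_zero]

theorem uprod_rtt (hK : ∀ m, SiteKer (K m)) {l : List (Fin N)} (hl : l.Nodup) :
    Commute (tA n _) (boxM (uprod K l)) := by
  induction l with
  | nil =>
    have : boxM (uprod K []) = 1 := by
      ext1 ⟨i, k⟩ ⟨j, l⟩
      rw [uprod_nil, boxM, of_apply, Matrix.one_apply, Matrix.one_apply, Matrix.one_apply]
      by_cases h1 : k = l <;> by_cases h2 : i = j <;> simp [h1, h2, zmod2_add_self]
    rw [this]
    exact Commute.one_right _
  | cons m l ih =>
    rw [List.nodup_cons] at hl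
    rw [uprod_cons, boxM_mul fun i j k l' => uprod_supercomm hK hl.1 i j k l']
    exact (uh_rtt (hK m) m).mul_right (ih hl.2)

theorem commute_uprod {f : Matrix (Word n N) (Word n N) Cq} {l : List (Fin N)}
    (h : ∀ m ∈ l, ∀ i j, Commute f (uh (K m) m i j)) (i j : Idx n) : Commute f (uprod K l i j) := by
  induction l generalizing i j with
  | nil =>
    rw [uprod_nil, Matrix.one_apply]
    split_ifs
    · exact Commute.one_right _
    · exact Commute.zero_right _
  | cons m l ih =>
    rw [uprod_cons, Matrix.mul_apply]
    refine Commute.sum_right _ _ _ fun k _ => ?_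
    exact (h m (by simp) i k).mul_right (ih (fun m' hm' => h m' (by simp [hm'])) k j)

theorem uprod_lower (h : ∀ m i j, j < i → uh (K m) m i j = 0) (l : List (Fin N)) {i j : Idx n}
    (hij : j < i) : uprod K l i j = 0 := by
  induction l generalizing i j with
  | nil => rw [uprod_nil, one_apply_ne hij.ne']
  | cons m l ih =>
    rw [uprod_cons, Matrix.mul_apply]
    refine sum_eq_zero fun k _ => ?_
    rcases lt_or_ge k i with h1 | h1
    · rw [h _ _ _ h1, zero_mul]
    · rw [ih (hij.trans_le h1), mul_zero]

theorem uprod_cons_diag (h : ∀ m i j, j < i → uh (K m) m i j = 0) (m : Fin N) (l : List (Fin N))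
    (i : Idx n) : uprod K (m :: l) i i = uh (K m) m i i * uprod K l i i := by
  rw [uprod_cons, Matrix.mul_apply, sum_eq_single i]
  · intro k _ hk
    rcases lt_or_gt_of_ne hk with h1 | h1
    · rw [h _ _ _ h1, zero_mul]
    · rw [uprod_lower h _ h1, mul_zero]
  · simp

theorem uprod_diag_inv (hK : ∀ m, SiteKer (K m)) (h : ∀ m i j, j < i → uh (K m) m i j = 0)
    (hd : ∀ m i, uh (K m) m i i * uh (K m) m (negIdx i) (negIdx i) = 1) {l : List (Fin N)}
    (hl : l.Nodup) (i : Idx n) : uprod K l i i * uprod K l (negIdx i) (negIdx i) = 1 := by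
  induction l with
  | nil => simp [uprod_nil]
  | cons m l ih =>
    rw [List.nodup_cons] at hl
    have hc : uprod K l i i * uh (K m) m (negIdx i) (negIdx i)
        = uh (K m) m (negIdx i) (negIdx i) * uprod K l i i := by
      rw [uprod_supercomm hK hl.1, zmod2_add_self]; simp
    rw [uprod_cons_diag h, uprod_cons_diag h, mul_assoc, ← mul_assoc (uprod K l i i), hc, mul_assoc,
      ih hl.2, mul_one, hd]

end uhat

/-! ### Local operators commuting with the action -/

section local_commute
variable {n N : ℕ} {K : Fin N → Idx n → Idx n → Idx n → Idx n → Cq}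
open Matrix

/-- A parity preserving operator on two letters. -/
def EvenQ {R : Type} [CommRing R] (Q : Matrix (Idx n × Idx n) (Idx n × Idx n) R) : Prop :=
  ∀ y z, Q y z ≠ 0 → par y.1 + par y.2 = par z.1 + par z.2

theorem tot_pair_set {m m' : Fin N} (h : m ≠ m') (w : Word n N) (y : Idx n × Idx n) :
    tot ((pair m m' h).set w y) = tot w + ((par y.1 + par y.2) + (par (w m) + par (w m'))) := by
  simp only [pair]
  rw [tot_update, tot_update, update_of_ne h.symm]
  ring

theorem pair_sum_eq {m m' : Fin N} (h : m ≠ m') (w : Word n N) (y : Idx n × Idx n)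
    (hy : par y.1 + par y.2 = par (w m) + par (w m')) (s : Finset (Fin N)) (hs : m ∈ s ↔ m' ∈ s) :
    ∑ l ∈ s, par ((pair m m' h).set w y l) = ∑ l ∈ s, par (w l) := by
  simp only [pair]
  rw [sum_update_par, sum_update_par, update_of_ne h.symm]
  by_cases h1 : m ∈ s
  · rw [if_pos h1, if_pos (hs.1 h1)]
    rw [show ∑ l ∈ s, par (w l) + (par y.1 + par (w m)) + (par y.2 + par (w m'))
      = ∑ l ∈ s, par (w l) + ((par y.1 + par y.2) + (par (w m) + par (w m'))) by ring, hy,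
      zmod2_add_self, add_zero]
  · rw [if_neg h1, if_neg (fun e => h1 (hs.2 e)), add_zero, add_zero]

theorem HomM_amp_pair {R : Type} [CommRing R] {Q : Matrix (Idx n × Idx n) (Idx n × Idx n) R}
    (hQ : EvenQ Q) {m m' : Fin N} (h : m ≠ m') : HomM (amp (pair m m' h) Q) 0 := by
  intro w' w hw
  by_cases e : w' = (pair m m' h).set w ((pair m m' h).get w')
  · rw [amp, if_pos e] at hw
    have h1 := hQ _ _ hw
    rw [e, tot_pair_set, h1]
    simp only [pair, zmod2_add_self]
  · simp [amp, e] at hw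

theorem oS_eq_amp {R : Type} [CommRing R] {m : Fin N} {x : Matrix (Idx n) (Idx n) R} {p : ZMod 2}
    (hx : IsHom x p) :
    oS m x = amp (site m) x * diagonal fun w => sg R (p * pre m w) := by
  refine matrix_ext_vecMul fun f w => ?_
  rw [← vecMul_vecMul, vecMul_diagonal, vecMul_oS_hom hx, vecMul_amp_sum, mul_comm]
  rfl

theorem pair_indep_site {J : Type} {m m' : Fin N} (h : m ≠ m') {l : Fin N} (h1 : l ≠ m) (h2 : l ≠ m') :
    (pair m m' h : Lens (Fin N → J) (J × J)).Indep (site l) where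
  get_left w z := by simp [pair, site, h1.symm, h2.symm]
  get_right w y := by simp [pair, site, h1, h2]
  set_comm w y z := by
    simp only [pair, site]
    rw [update_comm h1, update_comm h2]

theorem amp_pair_commute_oS {R : Type} [CommRing R] {Q : Matrix (Idx n × Idx n) (Idx n × Idx n) R}
    (hQ : EvenQ Q) {m m' : Fin N} (hm : (m : ℕ) + 1 = m') (h : m ≠ m') {l : Fin N} (h1 : l ≠ m)
    (h2 : l ≠ m') {x : Matrix (Idx n) (Idx n) R} {p : ZMod 2} (hx : IsHom x p) :
    Commute (amp (pair m m' h) Q) (oS l x) := by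
  rw [oS_eq_amp hx]
  refine (amp_commute (pair_indep_site h h1 h2) Q x).mul_right (amp_commute_diagonal _ _ _ ?_)
  intro w y hy
  congr 2
  refine pair_sum_eq h w y (hQ _ _ hy) _ ?_
  simp only [Finset.mem_filter, mem_univ, true_and, Fin.lt_def]
  have h1' : (l : ℕ) ≠ m := fun e => h1 (Fin.ext e)
  have h2' : (l : ℕ) ≠ m' := fun e => h2 (Fin.ext e)
  omega

theorem commute_Zd {A : Matrix (Word n N) (Word n N) Cq} (hA : HomM A 0) (p : ZMod 2) :
    Commute A (Zd n N Cq p) := by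
  have := Zd_mul_hom hA p
  rw [mul_zero, sg_zero, one_smul] at this
  exact this.symm

theorem uh_mul_uh {K K' : Idx n → Idx n → Idx n → Idx n → Cq} (hK : SiteKer K) (hK' : SiteKer K')
    {m m' : Fin N} (hm : (m : ℕ) + 1 = m') (h : m ≠ m') (i j : Idx n) :
    (uh K m * uh K' m') i j = amp (pair m m' h) (kk K K' i j) *
      diagonal fun w => sg Cq (par i * (par (w m) + par (w m') + 1 + par j)
        + (par i + par j) * suf m' w) := by
  have hlt : m < m' := by rw [Fin.lt_def]; omega
  have hsuf : ∀ w : Word n N, suf m w = par (w m') + suf m' w := by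
    intro w
    have : Finset.univ.filter (fun l : Fin N => m < l) =
        insert m' (Finset.univ.filter (fun l : Fin N => m' < l)) := by
      ext l
      simp only [Finset.mem_filter, mem_univ, true_and, Finset.mem_insert, Fin.lt_def,
        Fin.ext_iff]
      omega
    rw [suf, this, sum_insert (by simp), suf]
  refine matrix_ext_vecMul fun f w => ?_
  rw [← vecMul_vecMul, vecMul_diagonal, vecMul_amp_sum, Matrix.mul_apply, vecMul_sum,
    Finset.sum_apply]
  simp only [← vecMul_vecMul, vecMul_uh hK', vecMul_uh hK, update_of_ne h, kk,
    of_apply, Fintype.sum_prod_type, mul_sum, sum_mul, hsuf,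
    update_self, suf_update, lt_irrefl, if_false, add_zero]
  rw [sum_congr rfl fun k _ => sum_comm, sum_comm]
  refine sum_congr rfl fun c' _ => ?_
  rw [sum_comm]
  refine sum_congr rfl fun d' _ => sum_congr rfl fun k _ => ?_
  simp only [pair]
  rw [update_comm h.symm]
  by_cases h0 : K' k j d' (w m') = 0
  · simp [h0]
  have h1 := hK'.par_eq _ _ _ _ h0
  have h2 : par d' = par k + par (w m') + par j := by
    clear h0
    generalize par k = x1 at *
    generalize par d' = x2 at *
    generalize par j = x3 at *
    generalize par (w m') = x4 at *
    revert x1 x2 x3 x4; decide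
  have : sg Cq (par k * (par (w m') + 1 + par j) + (par k + par j) * suf m' w) *
      sg Cq (par i * (par (w m) + 1 + par k) + (par i + par k) * (par d' + suf m' w))
      = sg Cq (par i * (par (w m) + par (w m') + 1 + par j) + (par i + par j) * suf m' w) := by
    rw [← sg_add, h2]
    congr 1
    generalize par k = x1, par i = x2, par j = x3, par (w m) = x4, par (w m') = x5, suf m' w = x6
    revert x1 x2 x3 x4 x5 x6; decide
  linear_combination (f (update (update w m c') m' d') *
    (K i k c' (w m) * K' k j d' (w m'))) * this

theorem amp_pair_commute_uprod (hK : ∀ m, SiteKer (K m))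
    {Q : Matrix (Idx n × Idx n) (Idx n × Idx n) Cq} (hQ : EvenQ Q) {m m' : Fin N}
    (hm : (m : ℕ) + 1 = m') (h : m ≠ m') (hc : ∀ i j, Commute (kk (K m) (K m') i j) Q)
    {l l' : List (Fin N)} (hl : (l ++ m :: m' :: l').Nodup) (i j : Idx n) :
    Commute (amp (pair m m' h) Q) (uprod K (l ++ m :: m' :: l') i j) := by
  have h1 : ∀ x, x ≠ m → x ≠ m' → ∀ i j, Commute (amp (pair m m' h) Q) (uh (K x) x i j) := by
    intro x hx hx' i j
    exact (amp_pair_commute_oS hQ hm h hx hx' (IsHom_xK (hK x) i j)).mul_right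
      (commute_Zd (HomM_amp_pair hQ h) _)
  have h2 : ∀ i j, Commute (amp (pair m m' h) Q) ((uh (K m) m * uh (K m') m') i j) := by
    intro i j
    rw [uh_mul_uh (hK m) (hK m') hm h]
    refine Commute.mul_right ?_ (amp_commute_diagonal _ _ _ ?_)
    · have := (hc i j).symm
      rw [Commute, SemiconjBy, ← amp_mul, this.eq, amp_mul]
    · intro w y hy
      have e1 := hQ _ _ hy
      have e2 : suf m' ((pair m m' h).set w y) = suf m' w := by
        refine pair_sum_eq h w y e1 _ ?_
        simp only [Finset.mem_filter, mem_univ, true_and, Fin.lt_def]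
        omega
      have e3 : par ((pair m m' h).set w y m) + par ((pair m m' h).set w y m') = par (w m) + par (w m') := by
        simp only [pair, update_self, update_of_ne h]
        exact e1
      rw [e2, e3]
  have e : uprod K (l ++ m :: m' :: l') = uprod K l * (uh (K m) m * uh (K m') m') * uprod K l' := by
    simp [uprod, mul_assoc]
  rw [List.nodup_append] at hl
  obtain ⟨n1, n2, n3⟩ := hl
  simp only [List.nodup_cons, List.mem_cons, not_or] at n2
  rw [e, Matrix.mul_apply]
  refine Commute.sum_right _ _ _ fun b _ => ?_
  rw [Matrix.mul_apply]
  refine Commute.mul_right (Commute.sum_right _ _ _ fun a _ => ?_) ?_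
  · refine (commute_uprod (fun x hx => h1 x ?_ ?_) i a).mul_right (h2 a b)
    · exact n3 x hx m (by simp)
    · exact n3 x hx m' (by simp)
  · refine commute_uprod (fun x hx => h1 x ?_ ?_) b j
    · rintro rfl; exact n2.1.2 hx
    · rintro rfl; exact n2.2.1 hx

theorem oS_commute_uprod (hK : ∀ m, SiteKer (K m)) (m : Fin N) {φ : Matrix (Idx n) (Idx n) Cq}
    {p : ZMod 2} (hφ : IsHom φ p)
    (h : ∀ i j, φ * xK (K m) i j = sg Cq (p * (par i + par j)) • (xK (K m) i j * φ))
    (l : List (Fin N)) (i j : Idx n) : Commute (oS m φ) (uprod K l i j) := by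
  refine commute_uprod (fun x _ a b => ?_) i j
  have h1 : oS m φ * oS x (xK (K x) a b) = sg Cq (p * (par a + par b)) • (oS x (xK (K x) a b) * oS m φ) := by
    by_cases hx : m = x
    · subst hx
      rw [oS_mul, oS_mul, h, oS_smul]
    · exact oS_supercomm hx hφ (IsHom_xK (hK x) a b)
  rw [Commute, SemiconjBy, uh, of_apply, ← mul_assoc, h1, mul_assoc, Zd_mul_hom (HomM_oS hφ),
    mul_smul_comm, smul_mul_assoc, mul_assoc, mul_comm p]

end local_commute

/-! ### The action on the mixed tensor space -/

section tau
variable (n r s : ℕ)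
open Matrix

/-- The kernel of the action at the site `m`. -/
def kS {N : ℕ} (n r : ℕ) (m : Fin N) : Idx n → Idx n → Idx n → Idx n → Cq :=
  if (m : ℕ) < r then kV else kD

theorem siteKer_kS {N : ℕ} (m : Fin N) : SiteKer (kS n r m) := by
  unfold kS
  split_ifs
  · exact siteKer_kV
  · exact siteKer_kD

theorem toM_uSite (m : Fin (r + s)) (i j : Idx n) :
    toM n r s (uSite n r s m i j) = oS m (xK (kS n r m) i j) := by
  unfold uSite kS
  split_ifs
  · rw [toM_oneSite]
    congr 1
    ext a b
    exact sCoeff_eq i j a b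
  · rw [toM_oneSite]
    congr 1
    ext a b
    exact superT_sCoeff_eq i j a b

/-- The parity twisted matrix of the action of `u_{ij}`. -/
def uHat : Matrix (Idx n) (Idx n) (Matrix (Word n (r + s)) (Word n (r + s)) Cq) :=
  uprod (kS n r) (finRange (r + s))

theorem uHat_eq (i j : Idx n) :
    toM n r s (uAction n r s i j) * Zd n (r + s) Cq (par i + par j) = uHat n r s i j := by
  have key : ∀ (l : List (Fin (r + s))) (i j : Idx n),
      toM n r s ((l.map (uSite n r s)).foldr coprodMul (fun i j => if i = j then 1 else 0) i j) *
        Zd n (r + s) Cq (par i + par j) = uprod (kS n r) l i j := by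
    intro l
    induction l with
    | nil =>
      intro i j
      simp only [List.map_nil, List.foldr_nil, uprod_nil, Matrix.one_apply]
      split_ifs with h
      · rw [h, zmod2_add_self, Zd_zero, map_one, one_mul]
      · rw [map_zero, zero_mul]
    | cons m l ih =>
      intro i j
      rw [List.map_cons, List.foldr_cons, coprodMul, uprod_cons, Matrix.mul_apply, map_sum,
        sum_mul]
      refine sum_congr rfl fun k _ => ?_
      rw [← ih, map_smul, map_mul, toM_uSite, uh, of_apply]
      set Y := toM n r s (((l.map (uSite n r s)).foldr coprodMul
        (fun i j => if i = j then 1 else 0)) k j)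
      have hY : HomM Y (par k + par j) := by
        have h1 := (HomM_uprod (siteKer_kS n r) l k j)
        rw [← ih] at h1
        have h2 := h1.mul (HomM_Zd (par k + par j))
        rwa [mul_assoc, Zd_mul_self, mul_one, add_zero] at h2
      rw [show oS m (xK (kS n r m) i k) * Zd n (r + s) Cq (par i + par k) *
          (Y * Zd n (r + s) Cq (par k + par j))
        = oS m (xK (kS n r m) i k) * (Zd n (r + s) Cq (par i + par k) * Y) *
          Zd n (r + s) Cq (par k + par j) by noncomm_ring, Zd_mul_hom hY]
      simp only [mul_smul_comm, smul_mul_assoc, mul_assoc]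
      rw [← Zd_add, show par i + par k + (par k + par j) = par i + par j + (par k + par k) by ring,
        zmod2_add_self, add_zero]
      rfl
  exact key _ i j

theorem toM_uAction (i j : Idx n) :
    toM n r s (uAction n r s i j) = uHat n r s i j * Zd n (r + s) Cq (par i + par j) := by
  rw [← uHat_eq, mul_assoc, Zd_mul_self, mul_one]

theorem HomM_uHat (i j : Idx n) : HomM (uHat n r s i j) (par i + par j) :=
  HomM_uprod (siteKer_kS n r) _ i j

theorem sCoeff_lower (z : Cq) (a b i j : Idx n) (h : j < i) : sCoeff z a b i j = 0 := by
  simp [sCoeff, h.ne', not_lt.2 h.le]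

theorem xK_kS_lower {N : ℕ} (m : Fin N) {i j : Idx n} (h : j < i) : xK (kS n r m) i j = 0 := by
  ext d c
  unfold kS
  split_ifs
  · exact (sCoeff_eq i j d c).symm.trans (sCoeff_lower n _ _ _ _ _ h)
  · refine (superT_sCoeff_eq i j d c).symm.trans ?_
    rw [superTFirst, superT, sCoeff_lower n _ _ _ _ _ h, zero_mul]
    rfl

theorem uh_kS_lower {N : ℕ} (m : Fin N) (i j : Idx n) (h : j < i) : uh (kS n r m) m i j = 0 := by
  rw [uh, of_apply, xK_kS_lower n r m h, ← oSHom_apply, map_zero, zero_mul]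

theorem sCoeff_diag (z : Cq) (a b i : Idx n) : sCoeff z a b i i
    = if a = b then z ^ (((if a = i then 1 else 0) + (if a = negIdx i then 1 else 0)) * eps i : ℤ)
      else 0 := by
  simp [sCoeff]

theorem xK_kS_diag {N : ℕ} (m : Fin N) : ∃ z : Cq, z ≠ 0 ∧ ∀ i, xK (kS n r m) i i
    = diagonal fun a =>
      z ^ (((if a = i then 1 else 0) + (if a = negIdx i then 1 else 0)) * eps i : ℤ) := by
  unfold kS
  split_ifs
  · refine ⟨q, q_ne_zero, fun i => ?_⟩
    ext a b
    refine (sCoeff_eq i i a b).symm.trans ?_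
    rw [sCoeff_diag, diagonal_apply]
  · refine ⟨q⁻¹, inv_ne_zero q_ne_zero, fun i => ?_⟩
    ext a b
    refine (superT_sCoeff_eq i i a b).symm.trans ?_
    rw [superTFirst, superT, sCoeff_diag, diagonal_apply]
    by_cases h : a = b
    · subst h
      rw [zmod2_add_self, zero_mul, sgn_eq_sg, sg_zero, mul_one]
    · rw [if_neg h, if_neg (Ne.symm h), zero_mul]

theorem uh_kS_diag {N : ℕ} (m : Fin N) (i : Idx n) :
    uh (kS n r m) m i i * uh (kS n r m) m (negIdx i) (negIdx i) = 1 := by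
  obtain ⟨z, hz, h⟩ := xK_kS_diag n r m
  rw [uh, of_apply, of_apply, zmod2_add_self, zmod2_add_self, Zd_zero, mul_one, mul_one,
    oS_mul, h, h, Matrix.diagonal_mul_diagonal]
  have : (fun a : Idx n =>
      z ^ (((if a = i then 1 else 0) + (if a = negIdx i then 1 else 0)) * eps i : ℤ) *
      z ^ (((if a = negIdx i then 1 else 0) + (if a = negIdx (negIdx i) then 1 else 0)) *
        eps (negIdx i) : ℤ)) = fun _ => 1 := by
    ext a
    rw [negIdx_negIdx, eps_negIdx, ← zpow_add₀ hz, add_comm (if a = negIdx i then (1 : ℤ) else 0)]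
    rw [mul_neg, add_neg_cancel, zpow_zero]
  rw [this, Matrix.diagonal_one, oS_one]

theorem uHat_lower {i j : Idx n} (h : j < i) : uHat n r s i j = 0 :=
  uprod_lower (uh_kS_lower n r) _ h

theorem uHat_diag_inv (i : Idx n) : uHat n r s i i * uHat n r s (negIdx i) (negIdx i) = 1 :=
  uprod_diag_inv (siteKer_kS n r) (uh_kS_lower n r) (uh_kS_diag n r) (List.nodup_finRange _) i

/-- The homomorphism from the free algebra. -/
def tauFree : FreeAlgebra Cq (UGen n) →ₐ[Cq] Matrix (Word n (r + s)) (Word n (r + s)) Cq :=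
  FreeAlgebra.lift Cq fun x => toM n r s (uAction n r s x.1.1 x.1.2)

theorem tauFree_freeU (i j : Idx n) :
    tauFree n r s (freeU i j) = uHat n r s i j * Zd n (r + s) Cq (par i + par j) := by
  rw [freeU]
  split_ifs with h
  · rw [tauFree, FreeAlgebra.lift_ι_apply, toM_uAction]
  · rw [map_zero, uHat_lower n r s (not_le.1 h), zero_mul]

theorem uHat_Zd_mul (i j k l : Idx n) :
    uHat n r s i j * Zd n (r + s) Cq (par i + par j) * (uHat n r s k l * Zd n (r + s) Cq (par k + par l))
      = sg Cq ((par i + par j) * (par k + par l)) •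
        (uHat n r s i j * uHat n r s k l * Zd n (r + s) Cq (par i + par j + par k + par l)) := by
  rw [show uHat n r s i j * Zd n (r + s) Cq (par i + par j) *
      (uHat n r s k l * Zd n (r + s) Cq (par k + par l))
    = uHat n r s i j * (Zd n (r + s) Cq (par i + par j) * uHat n r s k l) *
      Zd n (r + s) Cq (par k + par l) by noncomm_ring, Zd_mul_hom (HomM_uHat n r s k l),
    add_assoc (par i + par j), Zd_add (par i + par j)]
  simp only [mul_smul_comm, smul_mul_assoc, mul_assoc]

theorem U12_mul_U13 (i a k b : Idx n) : tensorMul U12 U13 i a k b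
    = sgn ((par i + par a) * (par k + par b)) • (freeU i a * freeU k b) := by
  rw [tensorMul, sum_eq_single a, sum_eq_single k]
  · simp only [U12, U13, if_true]
    congr 2
    generalize par i = x1, par k = x2, par a = x3, par b = x4
    revert x1 x2 x3 x4; decide
  · intro l _ hl
    simp [U12, Ne.symm hl]
  · simp
  · intro j _ hj
    simp [U13, hj]
  · simp

theorem sCoeff_conserve {a b i j : Idx n} (h : sCoeff q a b i j ≠ 0) :
    par i + par a = par b + par j := by
  rw [sCoeff_eq] at h
  exact siteKer_kV.par_eq _ _ _ _ (right_ne_zero_of_mul h)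

theorem S23_mul_U13 (i a k b : Idx n) : tensorMul S23 U13 i a k b
    = ∑ l, sCoeff q i a k l • freeU l b := by
  rw [tensorMul, sum_eq_single a]
  · refine sum_congr rfl fun l _ => ?_
    simp only [S23, U13, if_true, ← Algebra.smul_def]
    by_cases h : sCoeff q i a k l = 0
    · simp [h]
    · have h1 := sCoeff_conserve n h
      rw [smul_smul]
      have : (par i + par a + par k + par l) * (par a + par a + par l + par b) +
          (par k + par l) * (par a + par a) = 0 := by
        clear h
        generalize par i = x1 at *
        generalize par k = x2 at *
        generalize par a = x3 at *
        generalize par b = x4 at *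
        generalize par l = x5 at *
        revert x1 x2 x3 x4 x5; decide
      rw [this, sgn_eq_sg, sg_zero, one_mul]
  · intro j _ hj
    simp [U13, hj]
  · simp

theorem tau_rtt (i j k l : Idx n) :
    tauFree n r s (tensorMul (tensorMul U12 U13) S23 i j k l)
      = tauFree n r s (tensorMul (tensorMul S23 U13) U12 i j k l) := by
  have h := congrFun (congrFun (uprod_rtt (siteKer_kS n r) (List.nodup_finRange (r + s))).eq (k, i)) (j, l)
  rw [← uHat] at h
  have h' := congrArg (fun M => sg Cq (par k * par i + par k * par j + par l * par j) •
    (M * Zd n (r + s) Cq (par i + par j + par k + par l))) h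
  simp only [Matrix.mul_apply, Fintype.sum_prod_type, boxM, tA, Matrix.map_apply, of_apply,
    ← Algebra.commutes, ← Algebra.smul_def, sum_mul, smul_sum] at h'
  refine Eq.trans ?_ (h'.symm.trans ?_)
  · rw [tensorMul, map_sum, sum_comm]
    refine sum_congr rfl fun b _ => ?_
    rw [map_sum]
    refine sum_congr rfl fun a _ => ?_
    rw [U12_mul_U13, S23, ← Algebra.commutes, ← Algebra.smul_def, map_smul, map_smul, map_smul, map_mul,
      tauFree_freeU, tauFree_freeU, uHat_Zd_mul]
    simp only [smul_smul, smul_mul_assoc]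
    rw [sCoeff_eq]
    by_cases h0 : kV a l b j = 0
    · have h0' : tM (a, b) (j, l) = 0 := h0
      simp [h0, h0']
    · have h1 := siteKer_kV.par_eq _ _ _ _ h0
      rw [show par i + par b + par k + par a = par i + par k + (par a + par b) by ring, h1,
        show par i + par k + (par j + par l) = par i + par j + par k + par l by ring]
      congr 1
      change _ = _ * (kV a l b j * _)
      have hs : sg Cq ((par i + par j + par k + par l) * (par b + par j + par a + par l) +
            (par k + par a) * (par b + par j)) * (sg Cq (par l * par j + par a + par a * par l) *
            (sg Cq ((par i + par b) * (par k + par a)) * sg Cq ((par i + par b) * (par k + par a))))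
          = sg Cq (par k * par i + par k * par j + par l * par j) *
            sg Cq ((par i + par b) * par k) := by
        rw [sg_mul_self, mul_one, ← sg_add, ← sg_add]
        congr 1
        have h2 : par b = par a + par j + par l := by
          clear h0 h h'
          generalize par a = x1 at *
          generalize par b = x2 at *
          generalize par j = x3 at *
          generalize par l = x4 at *
          revert x1 x2 x3 x4; decide
        rw [h2]
        generalize par a = x1, par i = x2, par j = x3, par l = x4, par k = x5
        revert x1 x2 x3 x4 x5; decide
      simp only [sgn_eq_sg]
      linear_combination kV a l b j * hs
  · symm
    rw [tensorMul, map_sum]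
    refine sum_congr rfl fun a _ => ?_
    rw [map_sum, sum_eq_single l]
    · simp only [U12, if_true, S23_mul_U13, sum_mul, map_smul, map_sum, smul_sum,
        smul_mul_assoc, map_mul, tauFree_freeU, uHat_Zd_mul, smul_smul]
      refine sum_congr rfl fun m _ => ?_
      rw [sCoeff_eq]
      by_cases h0 : kV k m i a = 0
      · have h0' : tM (k, i) (a, m) = 0 := h0
        simp [h0, h0']
      · have h1 := siteKer_kV.par_eq _ _ _ _ h0
        rw [show par m + par l + par a + par j = par l + par j + (par a + par m) by ring, ← h1,
          show par l + par j + (par k + par i) = par i + par j + par k + par l by ring]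
        congr 1
        change _ = _ * (kV k m i a * _)
        have hs : sg Cq ((par i + par a + par k + par l) * (par a + par j + par l + par l) +
              (par k + par l) * (par a + par j)) * (sg Cq (par m * par a + par k + par k * par m) *
              sg Cq ((par m + par l) * (par a + par j)))
            = sg Cq (par k * par i + par k * par j + par l * par j) *
              sg Cq ((par m + par l) * par a) := by
          rw [← sg_add, ← sg_add, ← sg_add]
          congr 1
          have h2 : par m = par a + par k + par i := by
            clear h0 h h'
            generalize par a = x1 at *
            generalize par m = x2 at *
            generalize par k = x3 at *
            generalize par i = x4 at *
            revert x1 x2 x3 x4; decide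
          rw [h2]
          generalize par a = x1, par i = x2, par j = x3, par l = x4, par k = x5
          revert x1 x2 x3 x4 x5; decide
        simp only [sgn_eq_sg]
        linear_combination kV k m i a * hs
    · intro b _ hb
      simp [U12, hb]
    · simp

/-- The action of the quantum queer superalgebra on the mixed tensor space. -/
def tau : Uq n →ₐ[Cq] EndMixed n r s :=
  ((toM n r s).symm : _ →ₐ[Cq] _).comp (RingQuot.liftAlgHom Cq ⟨tauFree n r s, by
    intro x y h
    cases h with
    | inv i =>
      rw [map_mul, map_one, tauFree_freeU, tauFree_freeU, zmod2_add_self, zmod2_add_self, Zd_zero,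
        mul_one, mul_one, uHat_diag_inv]
    | rtt i j k l => exact tau_rtt n r s i j k l⟩)

theorem tau_gen (x : UGen n) : tau n r s (Uq.gen x) = uAction n r s x.1.1 x.1.2 := by
  simp [tau, Uq.gen, tauFree]

theorem mem_centPart_iff (f : EndMixed n r s) (p : ZMod 2) :
    f ∈ centPart (tau n r s) p ↔
      HomM (toM n r s f) p ∧ ∀ i j, Commute (toM n r s f) (uHat n r s i j) := by
  have key : HomM (toM n r s f) p → ∀ i j : Idx n,
      (f * uAction n r s i j = sgn (p * (par i + par j)) • (uAction n r s i j * f) ↔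
        Commute (toM n r s f) (uHat n r s i j)) := by
    intro hf i j
    rw [← (toM n r s).injective.eq_iff, map_mul, map_smul, map_mul, Commute, SemiconjBy, ← uHat_eq,
      mul_assoc, Zd_mul_hom hf, mul_comm _ p, mul_smul_comm, ← mul_assoc, ← mul_assoc]
    rw [← smul_mul_assoc (sg Cq _) (_ * _)]
    have hu : IsUnit (Zd n (r + s) Cq (par i + par j)) :=
      IsUnit.of_mul_eq_one _ (Zd_mul_self _)
    rw [hu.mul_left_inj]
    rfl
  constructor
  · rintro ⟨h1, h2⟩
    rw [mem_endPart_iff] at h1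
    refine ⟨h1, fun i j => ?_⟩
    rcases lt_or_ge j i with h | h
    · rw [uHat_lower n r s h]; exact Commute.zero_right _
    · rw [← key h1]
      have := h2 (par i + par j) (Uq.gen ⟨(i, j), h⟩)
        (subset_span ⟨[⟨(i, j), h⟩], by simp, by simp⟩)
      rwa [tau_gen] at this
  · rintro ⟨h1, h2⟩
    refine ⟨(mem_endPart_iff n r s f p).2 h1, fun a u hu => ?_⟩
    induction hu using span_induction with
    | mem u hu =>
      obtain ⟨l, hl, rfl⟩ := hu
      subst hl
      induction l with
      | nil => simp [sgn_eq_sg]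
      | cons x l ih =>
        rw [List.map_cons, List.prod_cons, List.map_cons, List.sum_cons, map_mul, tau_gen, ← mul_assoc,
          (key h1 _ _).2 (h2 _ _), smul_mul_assoc, mul_assoc, ih, mul_smul_comm, smul_smul, ← sgn_add,
          ← mul_add, mul_assoc]
    | zero => simp
    | add x y _ _ hx hy => rw [map_add, mul_add, hx, hy, add_mul, smul_add]
    | smul k x _ hx => rw [map_smul, mul_smul_comm, hx, smul_mul_assoc, smul_comm]

end tau

/-! ### The matrices of the generators of the quantum walled Brauer-Clifford superalgebra -/

section gens
variable {n r s : ℕ}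
open Matrix

theorem EvenQ_tM : EvenQ (tM (n := n)) := fun y z h => (tM_conserve h).1

theorem EvenQ_tDM : EvenQ (tDM (n := n)) := fun y z h => by
  have := (tM_conserve (show tM (z.2, z.1) (y.2, y.1) ≠ 0 from h)).1
  simp only at this
  rw [add_comm (par y.1), add_comm (par z.1), this]

theorem EvenQ_eM : EvenQ (eM (n := n)) := fun y z h => by
  simp only [eM, of_apply] at h
  split_ifs at h with h1
  · rw [h1.1, h1.2, zmod2_add_self, zmod2_add_self]
  · exact absurd rfl h

/-- The flip of two letters with its sign. -/
def fM : Matrix (Idx n × Idx n) (Idx n × Idx n) Cq :=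
  Matrix.of fun y z => if y = (z.2, z.1) then sg Cq (par z.1 * par z.2) else 0

theorem fM_mul (A : Matrix (Idx n × Idx n) (Idx n × Idx n) Cq) (y z : Idx n × Idx n) :
    (fM * A : Matrix (Idx n × Idx n) (Idx n × Idx n) Cq) y z = sg Cq (par y.1 * par y.2) * A (y.2, y.1) z := by
  rw [Matrix.mul_apply, sum_eq_single (y.2, y.1)]
  · simp only [fM, of_apply, Prod.mk.eta, if_true]
    rw [mul_comm (par y.2)]
  · intro x _ hx
    have : ¬ y = (x.2, x.1) := by
      rintro rfl
      exact hx rfl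
    simp [fM, this]
  · simp

theorem pCoeff_kernel : (Matrix.of fun y z : Idx n × Idx n =>
    pCoeff y.1 z.1 y.2 z.2 * sg Cq ((par y.2 + par z.2) * par z.1)) = fM := by
  ext ⟨y1, y2⟩ ⟨z1, z2⟩
  simp only [fM, of_apply, pCoeff, Prod.mk.injEq]
  by_cases h : y2 = z1 ∧ z2 = y1
  · obtain ⟨rfl, rfl⟩ := h
    simp only [and_self, if_true, sgn_eq_sg]
    rw [← sg_add]
    congr 1
    generalize par z2 = x1, par y2 = x2
    revert x1 x2; decide
  · have h' : ¬(y1 = z2 ∧ y2 = z1) := fun e => h ⟨e.2, e.1.symm⟩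
    rw [if_neg h, if_neg h', zero_mul]

theorem pCoeff_conserve {i j k l : Idx n} (h : pCoeff i j k l ≠ 0) :
    par i + par j = par k + par l := by
  simp only [pCoeff] at h
  split_ifs at h with h1
  · rw [h1.1, h1.2, add_comm]
  · exact absurd rfl h

theorem superTBoth_pCoeff : superTBoth (pCoeff (n := n)) = pCoeff := by
  funext a b c d
  simp only [superTBoth, superT, superTFirst, pCoeff]
  by_cases h : c = b ∧ d = a
  · obtain ⟨rfl, rfl⟩ := h
    simp only [and_self, if_true, sgn_eq_sg]
    rw [← sg_add, ← sg_add]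
    congr 1
    generalize par c = x1, par d = x2
    revert x1 x2; decide
  · have h' : ¬(d = a ∧ c = b) := fun e => h ⟨e.2, e.1⟩
    rw [if_neg h, if_neg h', zero_mul, zero_mul]

theorem fM_mul_sCoeff : (fM : Matrix (Idx n × Idx n) (Idx n × Idx n) Cq) * (Matrix.of fun y z : Idx n × Idx n =>
    sCoeff q y.1 z.1 y.2 z.2 * sg Cq ((par y.2 + par z.2) * par z.1)) = tM := by
  ext ⟨y1, y2⟩ ⟨z1, z2⟩
  rw [fM_mul]
  simp only [of_apply]
  rw [sCoeff_eq, kV]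
  by_cases h : tM (y1, y2) (z1, z2) = 0
  · simp [h]
  · have h1 := (tM_conserve h).1
    simp only at h1
    have : sg Cq (par y1 * par y2) * (sg Cq (par z2 * par z1 + par y1 + par y1 * par z2) *
        sg Cq ((par y1 + par z2) * par z1)) = 1 := by
      rw [← sg_add, ← sg_add]
      have h2 : par y2 = par y1 + par z1 + par z2 := by
        clear h
        generalize par y1 = x1 at *
        generalize par y2 = x2 at *
        generalize par z1 = x3 at *
        generalize par z2 = x4 at *
        revert x1 x2 x3 x4; decide
      rw [h2, ← sg_zero (R := Cq)]
      congr 1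
      generalize par y1 = x1, par z1 = x3, par z2 = x4
      revert x1 x3 x4; decide
    rw [sgn_eq_sg]
    linear_combination tM (y1, y2) (z1, z2) * this

theorem fM_mul_superT_sCoeff : (fM : Matrix (Idx n × Idx n) (Idx n × Idx n) Cq) * (Matrix.of fun y z : Idx n × Idx n =>
    superTBoth (sCoeff q) y.1 z.1 y.2 z.2 * sg Cq ((par y.2 + par z.2) * par z.1)) = tDM := by
  ext ⟨y1, y2⟩ ⟨z1, z2⟩
  rw [fM_mul]
  simp only [of_apply, superTBoth, superT, superTFirst, tDM]
  rw [sCoeff_eq, kV]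
  by_cases h : tM (z2, z1) (y2, y1) = 0
  · simp [h]
  · have h1 := (tM_conserve h).1
    simp only at h1
    have : sg Cq (par y1 * par y2) * (sg Cq (par y1 * par y2 + par z2 + par z2 * par y1) *
        sg Cq ((par z1 + par y2) * par z1) * sg Cq ((par z2 + par y1) * par z2) *
        sg Cq ((par y1 + par z2) * par z1)) = 1 := by
      rw [← sg_add, ← sg_add, ← sg_add, ← sg_add]
      have h2 : par y2 = par y1 + par z1 + par z2 := by
        clear h
        generalize par y1 = x1 at *
        generalize par y2 = x2 at *
        generalize par z1 = x3 at *
        generalize par z2 = x4 at *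
        revert x1 x2 x3 x4; decide
      rw [h2, ← sg_zero (R := Cq)]
      congr 1
      generalize par y1 = x1, par z1 = x3, par z2 = x4
      revert x1 x3 x4; decide
    simp only [sgn_eq_sg]
    linear_combination tM (z2, z1) (y2, y1) * this

theorem capCup_kernel : (Matrix.of fun y z : Idx n × Idx n =>
    capCupCoeff y.1 z.1 y.2 z.2 * sg Cq ((par y.2 + par z.2) * par z.1)) = eM := by
  ext ⟨y1, y2⟩ ⟨z1, z2⟩
  simp only [eM, of_apply, capCupCoeff, wt]
  by_cases h : y2 = y1 ∧ z2 = z1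
  · obtain ⟨rfl, rfl⟩ := h
    simp only [and_self, if_true, sgn_eq_sg]
    have : sg Cq (par y2 * par z2) * sg Cq ((par y2 + par z2) * par z2) = sg Cq (par z2) := by
      rw [← sg_add]
      congr 1
      generalize par y2 = x1, par z2 = x2
      revert x1 x2; decide
    linear_combination (q ^ (-(2 * (n : ℤ) + 1)) * q ^ (2 * z2.1 * eps z2)) * this
  · have h' : ¬(y1 = y2 ∧ z1 = z2) := fun e => h ⟨e.1.symm, e.2.symm⟩
    rw [if_neg h, if_neg h', zero_mul]

theorem capCup_conserve {i j k l : Idx n} (h : capCupCoeff i j k l ≠ 0) :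
    par i + par j = par k + par l := by
  simp only [capCupCoeff] at h
  split_ifs at h with h1
  · rw [h1.1, h1.2]
  · exact absurd rfl h

theorem sCoeff_parity {i j k l : Idx n} (h : sCoeff q i j k l ≠ 0) :
    par i + par j = par k + par l := by
  have := sCoeff_conserve n h
  clear h
  generalize par i = x1 at *
  generalize par j = x2 at *
  generalize par k = x3 at *
  generalize par l = x4 at *
  revert x1 x2 x3 x4; decide

theorem superTBoth_parity {x : Idx n → Idx n → Idx n → Idx n → Cq}
    (hx : ∀ i j k l, x i j k l ≠ 0 → par i + par j = par k + par l) {i j k l : Idx n}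
    (h : superTBoth x i j k l ≠ 0) : par i + par j = par k + par l := by
  have := hx j i l k (left_ne_zero_of_mul (left_ne_zero_of_mul h))
  rw [add_comm, this, add_comm]

/-- The matrix of `Φ`. -/
def phM (n : ℕ) : Matrix (Idx n) (Idx n) Cq := Matrix.of phiCoeff

/-- The matrix of the supertranspose of `Φ`. -/
def phTM (n : ℕ) : Matrix (Idx n) (Idx n) Cq := Matrix.of fun a b => if a = negIdx b then 1 else 0

theorem superT_phiCoeff : (Matrix.of (superT phiCoeff) : Matrix (Idx n) (Idx n) Cq) = phTM n := by
  ext a b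
  simp only [superT, phiCoeff, phTM, of_apply]
  split_ifs with h
  · subst h
    rw [par_negIdx, sgn_eq_sg, sgn_eq_sg, ← sg_add, ← sg_zero (R := Cq)]
    congr 1
    generalize par b = x
    revert x; decide
  · rw [zero_mul]

theorem IsHom_phM : IsHom (phM n) 1 := fun i j h => by
  simp only [phM, of_apply, phiCoeff] at h
  split_ifs at h with h1
  · rw [h1, par_negIdx, ← add_assoc, zmod2_add_self, zero_add]
  · exact absurd rfl h

theorem IsHom_phTM : IsHom (phTM n) 1 := fun i j h => by
  simp only [phTM, of_apply] at h
  split_ifs at h with h1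
  · rw [h1, par_negIdx, add_comm, ← add_assoc, zmod2_add_self, zero_add]
  · exact absurd rfl h

/-- The letters at the sites `m` and `m + 1`. -/
def adj {N : ℕ} (m : ℕ) (h : m + 1 < N) : Lens (Word n N) (Idx n × Idx n) :=
  pair ⟨m, by omega⟩ ⟨m + 1, h⟩ (by simp [Fin.ext_iff])

theorem toM_t (i : ℕ) (hi : i + 1 < r) : toM n r s (bcAction n (.t i hi))
    = amp (adj i (by omega)) tM := by
  rw [bcAction, map_mul, toM_twoSite, toM_twoSite,
    tS_adjacent (m := ⟨i, by omega⟩) (m' := ⟨i + 1, by omega⟩) rfl fun i j k l h => pCoeff_conserve h,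
    tS_adjacent (m := ⟨i, by omega⟩) (m' := ⟨i + 1, by omega⟩) rfl fun i j k l h => sCoeff_parity h,
    ← amp_mul, pCoeff_kernel, fM_mul_sCoeff, adj]

theorem toM_tStar (i : ℕ) (hi : i + 1 < s) : toM n r s (bcAction n (.tStar i hi))
    = amp (adj (r + i) (by omega)) tDM := by
  rw [bcAction, map_mul, toM_twoSite, toM_twoSite, superTBoth_pCoeff,
    tS_adjacent (m := ⟨r + i, by omega⟩) (m' := ⟨r + i + 1, by omega⟩) rfl
      fun i j k l h => pCoeff_conserve h,
    tS_adjacent (m := ⟨r + i, by omega⟩) (m' := ⟨r + i + 1, by omega⟩) rfl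
      fun i j k l h => superTBoth_parity (fun _ _ _ _ h => sCoeff_parity h) h,
    ← amp_mul, pCoeff_kernel, fM_mul_superT_sCoeff, adj]

theorem toM_e (hr : 0 < r) (hs : 0 < s) : toM n r s (bcAction n (.e hr hs))
    = amp (adj (r - 1) (by omega)) eM := by
  have h : (⟨r, by omega⟩ : Fin (r + s)) = ⟨r - 1 + 1, by omega⟩ := by
    simp only [Fin.mk.injEq]; omega
  rw [bcAction, toM_twoSite, h,
    tS_adjacent (m := ⟨r - 1, by omega⟩) (m' := ⟨r - 1 + 1, by omega⟩) rfl
      fun i j k l h => capCup_conserve h, capCup_kernel, adj]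

theorem toM_c (i : ℕ) (hi : i < r) : toM n r s (bcAction n (.c i hi)) = oS ⟨i, by omega⟩ (phM n) := by
  rw [bcAction, toM_oneSite]; rfl

theorem toM_cStar (i : ℕ) (hi : i < s) :
    toM n r s (bcAction n (.cStar i hi)) = oS ⟨r + i, by omega⟩ (phTM n) := by
  rw [bcAction, toM_oneSite, superT_phiCoeff]

theorem HomM_bcAction (g : BCGen r s) : HomM (toM n r s (bcAction n g)) g.deg := by
  cases g with
  | t i hi => rw [toM_t]; exact HomM_amp_pair EvenQ_tM _
  | tStar i hi => rw [toM_tStar]; exact HomM_amp_pair EvenQ_tDM _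
  | e hr hs => rw [toM_e]; exact HomM_amp_pair EvenQ_eM _
  | c i hi => rw [toM_c]; exact HomM_oS IsHom_phM
  | cStar i hi => rw [toM_cStar]; exact HomM_oS IsHom_phTM

theorem finRange_split {N : ℕ} {m m' : Fin N} (h : (m : ℕ) + 1 = m') :
    ∃ l l' : List (Fin N), finRange N = l ++ m :: m' :: l' := by
  refine ⟨(finRange N).take m, (finRange N).drop (m + 2), ?_⟩
  have h1 : (m : ℕ) < (finRange N).length := by simp
  have h2 : (m : ℕ) + 1 < (finRange N).length := by simp; omega
  have e1 := List.drop_eq_getElem_cons h1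
  have e2 := List.drop_eq_getElem_cons h2
  conv_lhs => rw [← List.take_append_drop (m : ℕ) (finRange N), e1, e2]
  congr 3
  · simp
  · congr 1
    simp [Fin.ext_iff, h]

theorem amp_pair_commute_uHat {m m' : Fin (r + s)} (hm : (m : ℕ) + 1 = m') (h : m ≠ m')
    {Q : Matrix (Idx n × Idx n) (Idx n × Idx n) Cq} (hQ : EvenQ Q)
    (hc : ∀ i j, Commute (kk (kS n r m) (kS n r m') i j) Q) (i j : Idx n) :
    Commute (amp (pair m m' h) Q) (uHat n r s i j) := by
  obtain ⟨l, l', hl⟩ := finRange_split hm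
  have hn := List.nodup_finRange (r + s)
  rw [uHat, hl]
  rw [hl] at hn
  exact amp_pair_commute_uprod (siteKer_kS n r) hQ hm h hc hn i j

theorem sCoeff_negIdx (z : Cq) (a b i j : Idx n) :
    sCoeff z (negIdx a) (negIdx b) i j = sCoeff z a b i j := by
  have e : ∀ {a b : Idx n}, negIdx a = b ↔ a = negIdx b := negIdx_eq_iff
  simp only [sCoeff, negIdx_inj, e, negIdx_negIdx]
  rw [add_comm (if a = negIdx j then (1 : ℤ) else 0),
    add_comm (if a = negIdx j ∧ b = negIdx i then (1 : Cq) else 0)]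

theorem phM_mul_xK (i j : Idx n) :
    phM n * xK kV i j = sg Cq (1 * (par i + par j)) • (xK kV i j * phM n) := by
  ext d c
  have e1 : (phM n * xK kV i j) d c = sg Cq (par d) * sCoeff q (negIdx d) c i j := by
    rw [Matrix.mul_apply, sum_eq_single (negIdx d)]
    · simp only [phM, of_apply, phiCoeff, if_true]
      rw [sCoeff_eq]; rfl
    · intro x _ hx
      simp [phM, phiCoeff, hx]
    · simp
  have e2 : (xK kV i j * phM n) d c = sCoeff q d (negIdx c) i j * sg Cq (par c + 1) := by
    rw [Matrix.mul_apply, sum_eq_single (negIdx c)]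
    · simp only [phM, of_apply, phiCoeff, negIdx_negIdx, if_true]
      rw [sCoeff_eq, ← par_negIdx c]; rfl
    · intro x _ hx
      have : ¬ c = negIdx x := fun h => hx (by rw [h]; simp)
      simp [phM, phiCoeff, this]
    · simp
  have e3 : sCoeff q (negIdx d) c i j = sCoeff q d (negIdx c) i j := by
    rw [← sCoeff_negIdx, negIdx_negIdx]
  rw [e1, Matrix.smul_apply, e2, e3, smul_eq_mul]
  by_cases h : sCoeff q d (negIdx c) i j = 0
  · simp [h]
  · have h1 := sCoeff_parity h
    rw [par_negIdx] at h1
    rw [← h1, one_mul, show par d + (par c + 1) = par d + (par c + 1) from rfl, sg_add]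
    linear_combination (-sg Cq (par d) * sCoeff q d (negIdx c) i j) * sg_mul_self (R := Cq) (par c + 1)

theorem sCoeff_inv_parity {i j k l : Idx n} (h : sCoeff q⁻¹ i j k l ≠ 0) :
    par i + par j = par k + par l := by
  rw [sCoeff_inv_eq] at h
  have := (tI_conserve (right_ne_zero_of_mul h)).1
  simp only at this
  clear h
  generalize par i = x1 at *
  generalize par j = x2 at *
  generalize par k = x3 at *
  generalize par l = x4 at *
  revert x1 x2 x3 x4; decide

theorem phTM_mul_xK (i j : Idx n) :
    phTM n * xK kD i j = sg Cq (1 * (par i + par j)) • (xK kD i j * phTM n) := by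
  ext d c
  have e1 : (phTM n * xK kD i j) d c = superTFirst (sCoeff q⁻¹) (negIdx d) c i j := by
    rw [Matrix.mul_apply, sum_eq_single (negIdx d)]
    · simp only [phTM, of_apply, negIdx_negIdx, if_true, one_mul]
      rw [superT_sCoeff_eq]; rfl
    · intro x _ hx
      have : ¬ d = negIdx x := fun h => hx (by rw [h]; simp)
      simp [phTM, this]
    · simp
  have e2 : (xK kD i j * phTM n) d c = superTFirst (sCoeff q⁻¹) d (negIdx c) i j := by
    rw [Matrix.mul_apply, sum_eq_single (negIdx c)]
    · simp only [phTM, of_apply, if_true, mul_one]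
      rw [superT_sCoeff_eq]; rfl
    · intro x _ hx
      simp [phTM, hx]
    · simp
  have e3 : sCoeff q⁻¹ c (negIdx d) i j = sCoeff q⁻¹ (negIdx c) d i j := by
    rw [← sCoeff_negIdx, negIdx_negIdx]
  rw [e1, Matrix.smul_apply, e2, smul_eq_mul, superTFirst, superTFirst, superT, superT, e3]
  by_cases h : sCoeff q⁻¹ (negIdx c) d i j = 0
  · simp [h]
  · have h1 := sCoeff_inv_parity h
    rw [← h1, par_negIdx, par_negIdx, sgn_eq_sg, sgn_eq_sg]
    have : sg Cq ((par c + (par d + 1)) * par c)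
        = sg Cq (1 * (par c + 1 + par d)) * sg Cq ((par c + 1 + par d) * (par c + 1)) := by
      rw [← sg_add]
      congr 1
      generalize par c = x1, par d = x2
      revert x1 x2; decide
    linear_combination sCoeff q⁻¹ (negIdx c) d i j * this

theorem bcAction_mem (g : BCGen r s) : bcAction n g ∈ centPart (tau n r s) g.deg := by
  rw [mem_centPart_iff]
  refine ⟨HomM_bcAction g, fun i j => ?_⟩
  cases g with
  | t i hi =>
    rw [toM_t]
    refine amp_pair_commute_uHat rfl _ EvenQ_tM (fun a b => ?_) _ _
    rw [kS, kS, if_pos (by simp; omega), if_pos (by simp; omega)]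
    exact kk_commute_tM a b
  | tStar i hi =>
    rw [toM_tStar]
    refine amp_pair_commute_uHat rfl _ EvenQ_tDM (fun a b => ?_) _ _
    rw [kS, kS, if_neg (by simp), if_neg (by simp; omega)]
    exact kk_commute_tDM a b
  | e hr hs =>
    rw [toM_e]
    refine amp_pair_commute_uHat rfl _ EvenQ_eM (fun a b => ?_) _ _
    rw [kS, kS, if_pos (by simp; omega), if_neg (by simp; omega)]
    exact kk_commute_eM a b
  | c i hi =>
    rw [toM_c]
    refine oS_commute_uprod (siteKer_kS n r) _ IsHom_phM (fun a b => ?_) _ _ _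
    rw [kS, if_pos (by simpa using hi)]
    exact phM_mul_xK a b
  | cStar i hi =>
    rw [toM_cStar]
    refine oS_commute_uprod (siteKer_kS n r) _ IsHom_phTM (fun a b => ?_) _ _ _
    rw [kS, if_neg (by simp)]
    exact phTM_mul_xK a b

end gens

/-! ### Relations between operators on few letters -/

section localrel
variable {n : ℕ}
open Matrix

/-- Operators on two letters. -/
abbrev M2 (n : ℕ) : Type := Matrix (Idx n × Idx n) (Idx n × Idx n) Cq

/-- The odd operator `x` on the first of two letters. -/
def od1 (x : Matrix (Idx n) (Idx n) Cq) : M2 n := amp lFst x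

/-- The odd operator `x` on the second of two letters. -/
def od2 (x : Matrix (Idx n) (Idx n) Cq) : M2 n :=
  amp lTail x * diagonal fun z => sg Cq (par z.1)

theorem vecMul_phM (f : Idx n → Cq) (a : Idx n) :
    (f ᵥ* phM n) a = f (negIdx a) * sg Cq (par a + 1) := by
  simp only [vecMul, dotProduct]
  rw [sum_eq_single (negIdx a)]
  · simp [phM, phiCoeff, sgn_eq_sg]
  · intro x _ hx
    have : ¬ a = negIdx x := fun h => hx (by rw [h]; simp)
    simp [phM, phiCoeff, this]
  · simp

theorem vecMul_phTM (f : Idx n → Cq) (a : Idx n) : (f ᵥ* phTM n) a = f (negIdx a) := by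
  simp only [vecMul, dotProduct]
  rw [sum_eq_single (negIdx a)]
  · simp [phTM]
  · intro x _ hx
    simp [phTM, hx]
  · simp

theorem vecMul_od1_phM (f : Idx n × Idx n → Cq) (a b : Idx n) :
    (f ᵥ* od1 (phM n)) (a, b) = f (negIdx a, b) * sg Cq (par a + 1) := by
  rw [od1, vecMul_amp, vecMul_phM]; rfl

theorem vecMul_od2_phM (f : Idx n × Idx n → Cq) (a b : Idx n) :
    (f ᵥ* od2 (phM n)) (a, b) = f (a, negIdx b) * sg Cq (par b + 1) * sg Cq (par a) := by
  rw [od2, ← vecMul_vecMul, vecMul_diagonal, vecMul_amp, vecMul_phM]; rfl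

theorem vecMul_od1_phTM (f : Idx n × Idx n → Cq) (a b : Idx n) :
    (f ᵥ* od1 (phTM n)) (a, b) = f (negIdx a, b) := by
  rw [od1, vecMul_amp, vecMul_phTM]; rfl

theorem vecMul_od2_phTM (f : Idx n × Idx n → Cq) (a b : Idx n) :
    (f ᵥ* od2 (phTM n)) (a, b) = f (a, negIdx b) * sg Cq (par a) := by
  rw [od2, ← vecMul_vecMul, vecMul_diagonal, vecMul_amp, vecMul_phTM]; rfl

theorem tM_mul_phM : (tM * od1 (phM n) : M2 n) = od2 (phM n) * tM := by
  refine matrix_ext_vecMul fun f => ?_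
  rintro ⟨a, b⟩
  rw [← vecMul_vecMul, ← vecMul_vecMul, vecMul_od1_phM, vecMul_tM, vecMul_tM]
  simp only [vecMul_od2_phM, negIdx_negIdx, par_negIdx]
  have e1 : alp (negIdx a) b * sg Cq (par a + 1) = alp a b * (sg Cq (par a + 1) * sg Cq (par b)) := by
    simp only [alp, negIdx_eq_iff, negIdx_negIdx, par_negIdx, sgn_eq_sg]
    rw [add_comm (if a = negIdx b then (1 : ℤ) else 0),
      show (par a + 1) * par b = par a * par b + par b by ring, sg_add]
    ring
  have e2 : gam (negIdx a) b * sg Cq (par a + 1)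
      = bet a b * (sg Cq (par b + 1) * sg Cq (par a)) := by
    simp only [gam, bet, negIdx_negIdx, sgn_eq_sg, sg_add]
    split_ifs <;> ring
  have e3 : bet (negIdx a) b * sg Cq (par a + 1)
      = gam a b * (sg Cq (par b + 1 + 1) * sg Cq (par a + 1)) := by
    simp only [gam, bet, sgn_eq_sg, sg_add, sg_one]
    split_ifs
    · linear_combination (-xi * sg Cq (par a) * -1) * sg_mul_self (R := Cq) (par b)
    · ring
  linear_combination f (b, negIdx a) * e1 + f (a, negIdx b) * e2 + f (negIdx a, b) * e3

/-- The transpose combined with the flip of the two letters. -/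
def flipT (A : M2 n) : M2 n := Matrix.of fun y x => A (x.2, x.1) (y.2, y.1)

theorem flipT_mul (A B : M2 n) : flipT (A * B) = flipT B * flipT A := by
  ext y x
  simp only [flipT, of_apply, Matrix.mul_apply]
  rw [← Equiv.sum_comp (Equiv.prodComm (Idx n) (Idx n))]
  exact sum_congr rfl fun z _ => mul_comm _ _

theorem flipT_tM : flipT (tM : M2 n) = tDM := rfl

theorem flipT_add (A B : M2 n) : flipT (A + B) = flipT A + flipT B := rfl

theorem flipT_smul (k : Cq) (A : M2 n) : flipT (k • A) = k • flipT A := rfl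

theorem flipT_one : flipT (1 : M2 n) = 1 := by
  ext ⟨a, b⟩ ⟨c, d⟩
  simp only [flipT, of_apply, Matrix.one_apply, Prod.mk.injEq]
  congr 1
  simp only [eq_iff_iff]
  constructor <;> rintro ⟨rfl, rfl⟩ <;> exact ⟨rfl, rfl⟩

theorem flipT_od1 : flipT (od1 (phTM n)) = amp lTail (phTM n) := by
  ext ⟨a, b⟩ ⟨c, d⟩
  simp only [flipT, of_apply, od1, amp, lFst, lTail, phTM, Prod.mk.injEq, and_true, true_and]
  by_cases h : a = c
  · subst h
    simp only [if_true]
    congr 1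
    exact propext ⟨fun h => by rw [h]; simp, fun h => by rw [h]; simp⟩
  · rw [if_neg h, if_neg (Ne.symm h)]

theorem flipT_diag (g : Idx n × Idx n → Cq) :
    flipT (diagonal g) = diagonal fun z => g (z.2, z.1) := by
  ext ⟨a, b⟩ ⟨c, d⟩
  simp only [flipT, of_apply, diagonal_apply, Prod.mk.injEq]
  by_cases h : a = c ∧ b = d
  · obtain ⟨rfl, rfl⟩ := h
    simp
  · have h' : ¬ (d = b ∧ c = a) := fun e => h ⟨e.2.symm, e.1.symm⟩
    rw [if_neg h, if_neg h']

theorem flipT_tail : flipT (amp lTail (phTM n)) = od1 (phTM n) := by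
  rw [← flipT_od1]; rfl

theorem tDM_mul_phTM : (tDM * od1 (phTM n) : M2 n) = od2 (phTM n) * tDM := by
  have h : (amp lTail (phTM n) * tM : M2 n)
      = tM * (diagonal (fun z => sg Cq (par z.2)) * od1 (phTM n)) := by
    refine matrix_ext_vecMul fun f => ?_
    rintro ⟨a, b⟩
    have h0 := congrFun (congrArg (fun M => (fun z => f z * sg Cq (par z.1 + par z.2)) ᵥ* M)
      (tM_mul_phM (n := n))) (a, b)
    simp only [← vecMul_vecMul] at h0
    rw [vecMul_od1_phM, vecMul_tM, vecMul_tM] at h0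
    simp only [vecMul_od2_phM, negIdx_negIdx, par_negIdx] at h0
    rw [← vecMul_vecMul, ← vecMul_vecMul, vecMul_tM, ← vecMul_vecMul, vecMul_od1_phTM,
      vecMul_diagonal, vecMul_tM]
    simp only [vecMul_amp, vecMul_phTM]
    simp only [lTail, negIdx_negIdx]
    rcases zmod2_cases (par a) with ha | ha <;> rcases zmod2_cases (par b) with hb | hb <;>
      simp only [ha, hb, sg_zero, sg_one, zero_add, add_zero, one_add_one_zmod2] at h0 ⊢ <;>
      first | linear_combination h0 | linear_combination -h0
  have h1 := congrArg flipT h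
  rw [flipT_mul, flipT_mul, flipT_mul, flipT_tM, flipT_tail, flipT_od1, flipT_diag] at h1
  rw [h1, od2]

theorem vecMul_eM (f : Idx n × Idx n → Cq) (a b : Idx n) : (f ᵥ* eM) (a, b)
    = if a = b then q ^ (-(2 * (n : ℤ) + 1)) * wt a * ∑ i, f (i, i) else 0 := by
  simp only [vecMul, dotProduct, Fintype.sum_prod_type, eM, of_apply]
  split_ifs with h
  · rw [mul_sum]
    refine sum_congr rfl fun i _ => ?_
    rw [sum_eq_single i]
    · simp [h]; ring
    · intro j _ hj
      simp [hj.symm]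
    · simp
  · simp [h]

theorem sum_negIdx {A : Type} [AddCommMonoid A] (f : Idx n → A) : ∑ i, f (negIdx i) = ∑ i, f i :=
  Equiv.sum_comp (Function.Involutive.toPerm (negIdx (n := n)) negIdx_negIdx) f

theorem eM_mul_eM : (eM * eM : M2 n) = 0 := by
  refine matrix_ext_vecMul fun f => ?_
  rintro ⟨a, b⟩
  rw [← vecMul_vecMul, vecMul_eM]
  simp only [vecMul_eM, if_true, vecMul_zero, Pi.zero_apply]
  rw [← sum_mul, ← mul_sum, sum_wt]
  simp

theorem ph_mul_eM : (od1 (phM n) * eM : M2 n) = od2 (phTM n) * eM := by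
  refine matrix_ext_vecMul fun f => ?_
  rintro ⟨a, b⟩
  rw [← vecMul_vecMul, ← vecMul_vecMul, vecMul_eM, vecMul_eM]
  simp only [vecMul_od1_phM, vecMul_od2_phTM]
  rw [← sum_negIdx fun i => f (i, negIdx i) * sg Cq (par i)]
  simp only [negIdx_negIdx, par_negIdx]

theorem eM_mul_ph : (eM * od1 (phM n) : M2 n) = eM * od2 (phTM n) := by
  refine matrix_ext_vecMul fun f => ?_
  rintro ⟨a, b⟩
  rw [← vecMul_vecMul, ← vecMul_vecMul, vecMul_od1_phM, vecMul_od2_phTM, vecMul_eM, vecMul_eM]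
  by_cases h : a = negIdx b
  · rw [if_pos (negIdx_eq_iff.2 h), if_pos h]
    rw [wt_negIdx, sg_add, sg_one]; ring
  · rw [if_neg (fun e => h (negIdx_eq_iff.1 e)), if_neg h, zero_mul, zero_mul]

theorem eM_ph_eM : (eM * od1 (phM n) * eM : M2 n) = 0 := by
  refine matrix_ext_vecMul fun f => ?_
  rintro ⟨a, b⟩
  rw [← vecMul_vecMul, ← vecMul_vecMul, vecMul_eM]
  simp only [vecMul_od1_phM, vecMul_eM, negIdx_ne, if_false, zero_mul, vecMul_zero, Pi.zero_apply,
    Finset.sum_const_zero, mul_zero, ite_self]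

theorem trace_tM (c j : Idx n) :
    ∑ a, wt a * tM (c, a) (j, a) = if c = j then q ^ (2 * (n : ℤ) + 1) else 0 := by
  have h := sum_tM_left c j fun a k => if a = k then wt a else 0
  have e : ∑ x, ∑ k, tM (c, x) (j, k) * (if x = k then wt x else 0)
      = ∑ a, wt a * tM (c, a) (j, a) := by
    refine sum_congr rfl fun a _ => ?_
    rw [sum_eq_single a]
    · simp [mul_comm]
    · intro k _ hk
      simp [hk.symm]
    · simp
  rw [e] at h
  rw [h]
  by_cases hc : c = j
  · subst hc
    have := sum_wt_above c
    simp only [if_true, negIdx_ne, ne_negIdx, if_false, add_zero]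
    have e2 : ∑ k, bet c k * wt k = xi * ∑ k, (if c < k then wt k else 0) := by
      rw [mul_sum]
      exact sum_congr rfl fun k _ => by unfold bet; split_ifs <;> ring
    rw [e2, this]
    have e3 : alp c c = sgn (par c) * q ^ eps c := by
      simp [alp, zmod2_mul_self, ne_negIdx]
    rw [e3]; ring
  · rw [if_neg (Ne.symm hc), if_neg hc, if_neg hc]
    by_cases hc' : c = negIdx j
    · subst hc'
      simp [negIdx_ne]
    · simp [hc']

/-- Operators on three letters. -/
abbrev M3 (n : ℕ) : Type := Matrix (Idx n × Idx n × Idx n) (Idx n × Idx n × Idx n) Cq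

theorem eM_tM_eM : (amp lTail eM * amp l12 tM * amp lTail eM : M3 n) = amp lTail eM := by
  ext ⟨c, i, k⟩ ⟨j, l, d⟩
  rw [entry_212, amp_lTail_apply]
  by_cases h1 : i = k
  swap
  · simp [eM, h1]
  by_cases h2 : l = d
  swap
  · simp [eM, h2]
  subst h1 h2
  have hq : q ^ (-(2 * (n : ℤ) + 1)) * q ^ (2 * (n : ℤ) + 1) = 1 := by
    rw [← zpow_add₀ q_ne_zero]; simp
  have : ∑ a, ∑ b, ∑ e, eM (i, i) (a, b) * tM (c, a) (j, e) * eM (e, b) (l, l)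
      = q ^ (-(2 * (n : ℤ) + 1)) * (q ^ (-(2 * (n : ℤ) + 1)) * wt l) * ∑ a, wt a * tM (c, a) (j, a) := by
    rw [mul_sum]
    refine sum_congr rfl fun a _ => ?_
    rw [sum_eq_single a, sum_eq_single a]
    · simp [eM]; ring
    · intro e _ he
      simp [eM, he]
    · simp
    · intro b _ hb
      simp [eM, hb.symm]
    · simp
  rw [this, trace_tM]
  split_ifs with h
  · simp only [eM, of_apply, and_self, if_true]
    linear_combination (q ^ (-(2 * (n : ℤ) + 1)) * wt l) * hq
  · simp

theorem eM_tDM_eM : (amp l12 eM * amp lTail tDM * amp l12 eM : M3 n) = amp l12 eM := by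
  ext ⟨i, k, d⟩ ⟨c, j, l⟩
  rw [entry_121, amp_l12_apply]
  by_cases h1 : i = k
  swap
  · simp [eM, h1]
  by_cases h2 : c = j
  swap
  · simp [eM, h2]
  subst h1 h2
  have hq : q ^ (-(2 * (n : ℤ) + 1)) * q ^ (2 * (n : ℤ) + 1) = 1 := by
    rw [← zpow_add₀ q_ne_zero]; simp
  have : ∑ a, ∑ b, ∑ e, eM (i, i) (a, b) * tDM (b, d) (e, l) * eM (a, e) (c, c)
      = q ^ (-(2 * (n : ℤ) + 1)) * (q ^ (-(2 * (n : ℤ) + 1)) * wt c) * ∑ a, wt a * tM (l, a) (d, a) := by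
    rw [mul_sum]
    refine sum_congr rfl fun a _ => ?_
    rw [sum_eq_single a, sum_eq_single a]
    · simp [eM, tDM]; ring
    · intro e _ he
      simp [eM, he.symm]
    · simp
    · intro b _ hb
      simp [eM, hb.symm]
    · simp
  rw [this, trace_tM]
  by_cases h : d = l
  · rw [if_pos h, if_pos h.symm]
    simp only [eM, of_apply, and_self, if_true]
    linear_combination (q ^ (-(2 * (n : ℤ) + 1)) * wt c) * hq
  · rw [if_neg h, if_neg (Ne.symm h), mul_zero]

theorem tDM_quad : (tDM * tDM : M2 n) = xi • tDM + 1 := by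
  rw [← flipT_tM, ← flipT_mul, tM_quad, flipT_add, flipT_smul, flipT_one]

theorem sum_rot (F : Idx n → Idx n → Idx n → Cq) :
    ∑ a, ∑ b, ∑ e, F a b e = ∑ e, ∑ a, ∑ b, F a b e := by
  rw [sum_congr rfl fun a _ => sum_comm, sum_comm]

theorem tDM_braid : (amp l12 tDM * amp lTail tDM * amp l12 tDM : M3 n)
    = amp lTail tDM * amp l12 tDM * amp lTail tDM := by
  ext ⟨i, k, d⟩ ⟨c, j, l⟩
  have h := congrFun (congrFun (tM_braid (n := n)) (l, j, c)) (d, k, i)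
  rw [entry_121, entry_212] at h
  rw [entry_121, entry_212]
  simp only [tDM, of_apply]
  refine Eq.trans ?_ (h.symm.trans ?_)
  · refine (sum_rot _).trans ?_
    exact sum_congr rfl fun a _ => sum_congr rfl fun b _ =>
      sum_congr rfl fun e _ => by ring
  · refine (sum_rot _).trans ?_
    exact sum_congr rfl fun a _ => sum_congr rfl fun b _ =>
      sum_congr rfl fun e _ => by ring

/-- Operators on four letters. -/
abbrev M4 (n : ℕ) : Type :=
  Matrix (Idx n × Idx n × Idx n × Idx n) (Idx n × Idx n × Idx n × Idx n) Cq

/-- The first two of four letters. -/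
def q12 {J : Type} : Lens (J × J × J × J) (J × J) := l123.comp l12

/-- The middle two of four letters. -/
def q23 {J : Type} : Lens (J × J × J × J) (J × J) := lTail.comp l12

/-- The last two of four letters. -/
def q34 {J : Type} : Lens (J × J × J × J) (J × J) := lTail.comp lTail

theorem vecMul_q12 (A : M2 n) (f : Idx n × Idx n × Idx n × Idx n → Cq) (a b c d : Idx n) :
    (f ᵥ* amp q12 A) (a, b, c, d) = ∑ x, ∑ y, f (x, y, c, d) * A (x, y) (a, b) := by
  rw [vecMul_amp_sum, Fintype.sum_prod_type]; rfl

theorem vecMul_q34 (A : M2 n) (f : Idx n × Idx n × Idx n × Idx n → Cq) (a b c d : Idx n) :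
    (f ᵥ* amp q34 A) (a, b, c, d) = ∑ x, ∑ y, f (a, b, x, y) * A (x, y) (c, d) := by
  rw [vecMul_amp_sum, Fintype.sum_prod_type]; rfl

theorem vecMul_q23_eM (f : Idx n × Idx n × Idx n × Idx n → Cq) (a b c d : Idx n) :
    (f ᵥ* amp q23 eM) (a, b, c, d)
      = if b = c then q ^ (-(2 * (n : ℤ) + 1)) * wt b * ∑ i, f (a, i, i, d) else 0 := by
  rw [vecMul_amp]
  exact vecMul_eM _ _ _

theorem crossing_right (a a' d d' : Idx n) :
    ∑ x, ∑ u, wt x * tI (a, x) (a', u) * tDM (x, d) (u, d')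
      = if a = d ∧ a' = d' then wt d' else 0 := by
  have h := crossing d' a' d a
  have e : ∀ u x, wt d * (wt x * tI (a, x) (a', u) * tDM (x, d) (u, d'))
      = wt d' * (tM (d', u) (d, x) * (wt u * tI (a, x) (a', u))) := by
    intro u x
    by_cases h0 : tM (d', u) (d, x) = 0
    · simp [tDM, h0]
    · have h1 := (tM_conserve h0).2
      simp only at h1
      simp only [tDM, of_apply]
      linear_combination (-tI (a, x) (a', u) * tM (d', u) (d, x)) * h1
  have h2 : wt d * ∑ x, ∑ u, wt x * tI (a, x) (a', u) * tDM (x, d) (u, d')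
      = wt d' * (if d' = a' ∧ d = a then wt d else 0) := by
    rw [← h, sum_comm]
    simp only [mul_sum]
    exact sum_congr rfl fun u _ => sum_congr rfl fun x _ => e u x
  refine mul_left_cancel₀ (wt_ne_zero d) (h2.trans ?_)
  by_cases hh : a = d ∧ a' = d'
  · rw [if_pos hh, if_pos ⟨hh.2.symm, hh.1.symm⟩, mul_comm]
  · rw [if_neg hh, if_neg (fun e => hh ⟨e.2.symm, e.1.symm⟩), mul_zero, mul_zero]

/-- Two nested caps and cups. -/
def nest : M4 n := amp q23 eM * amp q12 tI * amp q34 tDM * amp q23 eM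

theorem vecMul_nest (f : Idx n × Idx n × Idx n × Idx n → Cq) (a b c d : Idx n) :
    (f ᵥ* nest) (a, b, c, d) = if b = c ∧ a = d then
      (q ^ (-(2 * (n : ℤ) + 1))) ^ 2 * (wt a * wt b) * ∑ k, ∑ i, f (k, i, i, k) else 0 := by
  rw [nest, ← vecMul_vecMul, ← vecMul_vecMul, ← vecMul_vecMul, vecMul_q23_eM]
  by_cases hb : b = c
  swap
  · rw [if_neg hb, if_neg (fun e => hb e.1)]
  subst hb
  simp only [if_true, true_and, vecMul_q34, vecMul_q12, vecMul_q23_eM]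
  have e : ∑ u, ∑ x, ∑ y, (∑ k, ∑ v, (if v = x then
      q ^ (-(2 * (n : ℤ) + 1)) * wt v * ∑ i, f (k, i, i, y) else 0) * tI (k, v) (a, u)) * tDM (x, y) (u, d)
      = ∑ k, ∑ y, (q ^ (-(2 * (n : ℤ) + 1)) * ∑ i, f (k, i, i, y)) *
        ∑ x, ∑ u, wt x * tI (k, x) (a, u) * tDM (x, y) (u, d) := by
    have e1 : ∀ u x y, (∑ k, ∑ v, (if v = x then
      q ^ (-(2 * (n : ℤ) + 1)) * wt v * ∑ i, f (k, i, i, y) else 0) * tI (k, v) (a, u)) * tDM (x, y) (u, d)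
      = ∑ k, (q ^ (-(2 * (n : ℤ) + 1)) * ∑ i, f (k, i, i, y)) *
        (wt x * tI (k, x) (a, u) * tDM (x, y) (u, d)) := by
      intro u x y
      rw [sum_mul]
      refine sum_congr rfl fun k _ => ?_
      rw [sum_eq_single x]
      · simp only [if_true]; ring
      · intro v _ hv
        simp [hv]
      · simp
    simp only [e1]
    have e2 : ∀ F : Idx n → Idx n → Idx n → Idx n → Cq,
        ∑ u, ∑ x, ∑ y, ∑ k, F u x y k = ∑ k, ∑ y, ∑ x, ∑ u, F u x y k := by
      intro F
      calc ∑ u, ∑ x, ∑ y, ∑ k, F u x y k = ∑ u, ∑ x, ∑ k, ∑ y, F u x y k :=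
            sum_congr rfl fun u _ => sum_congr rfl fun x _ => sum_comm
        _ = ∑ k, ∑ u, ∑ x, ∑ y, F u x y k := sum_rot fun u x k => ∑ y, F u x y k
        _ = ∑ k, ∑ y, ∑ u, ∑ x, F u x y k :=
            sum_congr rfl fun k _ => sum_rot fun u x y => F u x y k
        _ = _ := sum_congr rfl fun k _ => sum_congr rfl fun y _ => sum_comm
    rw [e2]
    exact sum_congr rfl fun k _ => sum_congr rfl fun y _ => by simp only [mul_sum]
  rw [e]
  simp only [crossing_right]
  have e3 : ∑ k, ∑ y, (q ^ (-(2 * (n : ℤ) + 1)) * ∑ i, f (k, i, i, y)) *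
      (if k = y ∧ a = d then wt d else 0)
      = if a = d then q ^ (-(2 * (n : ℤ) + 1)) * wt a * ∑ k, ∑ i, f (k, i, i, k) else 0 := by
    split_ifs with h
    · subst h
      rw [mul_sum]
      refine sum_congr rfl fun k _ => ?_
      rw [sum_eq_single k]
      · simp; ring
      · intro y _ hy
        simp [hy.symm]
      · simp
    · simp [h]
  rw [e3]
  split_ifs <;> ring

theorem nest_mul_t : (nest * amp q34 tDM : M4 n) = nest * amp q12 tM := by
  refine matrix_ext_vecMul fun f => ?_
  rintro ⟨a, b, c, d⟩
  rw [← vecMul_vecMul, ← vecMul_vecMul, vecMul_q34, vecMul_q12]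
  simp only [vecMul_nest]
  have e1 : ∀ G : Cq, ∑ x, ∑ y, (if b = x ∧ a = y then
      (q ^ (-(2 * (n : ℤ) + 1))) ^ 2 * (wt a * wt b) * G else 0) * tDM (x, y) (c, d)
      = (q ^ (-(2 * (n : ℤ) + 1))) ^ 2 * (wt a * wt b) * G * tM (d, c) (a, b) := by
    intro G
    rw [sum_eq_single b, sum_eq_single a]
    · simp [tDM]
    · intro y _ hy
      simp [hy.symm]
    · simp
    · intro x _ hx
      simp [hx.symm]
    · simp
  have e2 : ∀ G : Cq, ∑ x, ∑ y, (if y = c ∧ x = d then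
      (q ^ (-(2 * (n : ℤ) + 1))) ^ 2 * (wt x * wt y) * G else 0) * tM (x, y) (a, b)
      = (q ^ (-(2 * (n : ℤ) + 1))) ^ 2 * (wt d * wt c) * G * tM (d, c) (a, b) := by
    intro G
    rw [sum_eq_single d, sum_eq_single c]
    · simp
    · intro y _ hy
      simp [hy]
    · simp
    · intro x _ hx
      simp [hx]
    · simp
  rw [e1, e2]
  by_cases h0 : tM (d, c) (a, b) = 0
  · simp [h0]
  · have h1 := (tM_conserve h0).2
    simp only at h1
    rw [h1]

theorem t_mul_nest : (amp q34 tDM * nest : M4 n) = amp q12 tM * nest := by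
  refine matrix_ext_vecMul fun f => ?_
  rintro ⟨a, b, c, d⟩
  rw [← vecMul_vecMul, ← vecMul_vecMul, vecMul_nest, vecMul_nest]
  simp only [vecMul_q34, vecMul_q12]
  have e : ∑ k, ∑ i, ∑ x, ∑ y, f (k, i, x, y) * tDM (x, y) (i, k)
      = ∑ k, ∑ i, ∑ x, ∑ y, f (x, y, i, k) * tM (x, y) (k, i) := by
    have e2 : ∀ F : Idx n → Idx n → Idx n → Idx n → Cq,
        ∑ k, ∑ i, ∑ x, ∑ y, F k i x y = ∑ k, ∑ i, ∑ x, ∑ y, F x y i k := by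
      intro F
      calc ∑ k, ∑ i, ∑ x, ∑ y, F k i x y = ∑ k, ∑ y, ∑ i, ∑ x, F k i x y :=
            sum_congr rfl fun k _ => sum_rot fun i x y => F k i x y
        _ = ∑ y, ∑ k, ∑ i, ∑ x, F k i x y := sum_comm
        _ = ∑ y, ∑ x, ∑ k, ∑ i, F k i x y :=
            sum_congr rfl fun y _ => sum_rot fun k i x => F k i x y
        _ = _ := rfl
    rw [e2]
    rfl
  rw [e]

theorem nest_relation : (amp q23 eM * amp q12 tI * amp q34 tDM * amp q23 eM * amp q34 tDM * amp q12 tI : M4 n)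
    = amp q12 tI * amp q34 tDM * amp q23 eM * amp q34 tDM * amp q12 tI * amp q23 eM := by
  have hc : ∀ A B : M2 n, (amp q34 A * amp q12 B : M4 n) = amp q12 B * amp q34 A := by
    intro A B
    exact amp_commute ⟨fun _ _ => rfl, fun _ _ => rfl, fun _ _ _ => rfl⟩ A B
  have h1 : (amp q12 tM * amp q12 tI : M4 n) = 1 := by rw [← amp_mul, tM_mul_tI, amp_one]
  have h2 : (amp q12 tI * amp q12 tM : M4 n) = 1 := by rw [← amp_mul, tI_mul_tM, amp_one]
  have l : (amp q23 eM * amp q12 tI * amp q34 tDM * amp q23 eM * amp q34 tDM * amp q12 tI : M4 n) = nest := by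
    rw [← nest, nest_mul_t, mul_assoc, h1, mul_one]
  have r : (amp q12 tI * amp q34 tDM * amp q23 eM * amp q34 tDM * amp q12 tI * amp q23 eM : M4 n)
      = amp q12 tI * (amp q34 tDM * nest) := by
    rw [nest]
    simp only [mul_assoc]
    rw [← mul_assoc (amp q34 tDM) (amp q12 tI), hc, mul_assoc]
  rw [l, r, t_mul_nest, ← mul_assoc, h2, one_mul]

end localrel

/-! ### The homomorphism to the centralizer -/

section rho
variable {n N : ℕ}
open Matrix

theorem adj_indep {m m' : ℕ} (h : m + 1 < N) (h' : m' + 1 < N) (hm : m + 1 < m' ∨ m' + 1 < m) :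
    (adj (n := n) m h).Indep (adj m' h') where
  get_left w z := by
    simp only [adj, pair]
    rw [update_of_ne, update_of_ne, update_of_ne, update_of_ne] <;>
      simp only [ne_eq, Fin.mk.injEq] <;> omega
  get_right w z := by
    simp only [adj, pair]
    rw [update_of_ne, update_of_ne, update_of_ne, update_of_ne] <;>
      simp only [ne_eq, Fin.mk.injEq] <;> omega
  set_comm w y z := by
    simp only [adj, pair]
    funext l
    simp only [update_apply, Fin.ext_iff]
    split_ifs <;> first | rfl | omega

theorem adj_commute {m m' : ℕ} (h : m + 1 < N) (h' : m' + 1 < N) (hm : m + 1 < m' ∨ m' + 1 < m)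
    (A B : M2 n) : amp (adj m h) A * amp (adj m' h') B = amp (adj m' h') B * amp (adj m h) A :=
  amp_commute (adj_indep h h' hm) A B

/-- The letters at the sites `m`, `m + 1`, `m + 2`. -/
def adj3 (m : ℕ) (h : m + 1 + 1 < N) : Lens (Word n N) (Idx n × Idx n × Idx n) :=
  triple ⟨m, by omega⟩ ⟨m + 1, by omega⟩ ⟨m + 1 + 1, h⟩ (by simp [Fin.ext_iff]) (by simp [Fin.ext_iff]; omega)
    (by simp [Fin.ext_iff])

theorem amp_adj_left (m : ℕ) (h : m + 1 + 1 < N) (A : M2 n) :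
    amp (adj m (by omega)) A = amp (adj3 m h) (amp l12 A) := by
  rw [← amp_comp]
  refine amp_congr _ (fun w => rfl) fun w y => ?_
  simp only [adj, pair, adj3, triple, Lens.comp, l12]
  funext l
  simp only [update_apply]
  split_ifs <;> simp_all <;> omega

theorem amp_adj_right (m : ℕ) (h : m + 1 + 1 < N) (A : M2 n) :
    amp (adj (m + 1) h) A = amp (adj3 m h) (amp lTail A) := by
  rw [← amp_comp]
  refine amp_congr _ (fun w => rfl) fun w y => ?_
  simp only [adj, pair, adj3, triple, Lens.comp, lTail]
  funext l
  simp only [update_apply]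
  split_ifs <;> simp_all <;> omega

/-- The letters at the sites `m`, `m + 1`, `m + 2`, `m + 3`. -/
def adj4 (m : ℕ) (h : m + 1 + 1 + 1 < N) : Lens (Word n N) (Idx n × Idx n × Idx n × Idx n) :=
  quad ⟨m, by omega⟩ ⟨m + 1, by omega⟩ ⟨m + 1 + 1, by omega⟩ ⟨m + 1 + 1 + 1, h⟩ (by simp [Fin.ext_iff])
    (by simp [Fin.ext_iff] <;> omega) (by simp [Fin.ext_iff] <;> omega) (by simp [Fin.ext_iff])
    (by simp [Fin.ext_iff] <;> omega) (by simp [Fin.ext_iff])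

theorem amp_adj_q12 (m : ℕ) (h : m + 1 + 1 + 1 < N) (A : M2 n) :
    amp (adj m (by omega)) A = amp (adj4 m h) (amp q12 A) := by
  rw [← amp_comp]
  refine amp_congr _ (fun w => rfl) fun w y => ?_
  simp only [adj, pair, adj4, quad, Lens.comp, q12, l123, l12]
  funext l
  simp only [update_apply]
  split_ifs <;> simp_all <;> omega

theorem amp_adj_q23 (m : ℕ) (h : m + 1 + 1 + 1 < N) (A : M2 n) :
    amp (adj (m + 1) (by omega)) A = amp (adj4 m h) (amp q23 A) := by
  rw [← amp_comp]
  refine amp_congr _ (fun w => rfl) fun w y => ?_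
  simp only [adj, pair, adj4, quad, Lens.comp, q23, lTail, l12]
  funext l
  simp only [update_apply]
  split_ifs <;> simp_all <;> omega

theorem amp_adj_q34 (m : ℕ) (h : m + 1 + 1 + 1 < N) (A : M2 n) :
    amp (adj (m + 1 + 1) (by omega)) A = amp (adj4 m h) (amp q34 A) := by
  rw [← amp_comp]
  refine amp_congr _ (fun w => rfl) fun w y => ?_
  simp only [adj, pair, adj4, quad, Lens.comp, q34, lTail]
  funext l
  simp only [update_apply]
  split_ifs <;> simp_all <;> omega

/-- The sign of the letters before a site. -/
def preD (n : ℕ) (m : Fin N) : Matrix (Word n N) (Word n N) Cq :=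
  diagonal fun w => sg Cq (pre m w)

theorem preD_commute {m : ℕ} (h : m + 1 < N) (A : M2 n) :
    amp (adj m h) A * preD n ⟨m, by omega⟩ = preD n ⟨m, by omega⟩ * amp (adj m h) A := by
  refine amp_commute_diagonal _ _ _ fun w y _ => ?_
  simp only [adj, pair]
  rw [pre_update, pre_update]
  simp

theorem oS_od1 {m : ℕ} (h : m + 1 < N) {x : Matrix (Idx n) (Idx n) Cq} (hx : IsHom x 1) :
    oS ⟨m, by omega⟩ x = amp (adj m h) (od1 x) * preD n ⟨m, by omega⟩ := by
  refine matrix_ext_vecMul fun f w => ?_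
  rw [vecMul_oS_hom hx, ← vecMul_vecMul, preD, vecMul_diagonal, od1, vecMul_amp, vecMul_amp_sum,
    one_mul, mul_comm]
  congr 1
  refine sum_congr rfl fun i _ => ?_
  congr 2
  simp only [adj, pair, lFst]
  funext l
  simp only [update_apply]
  split_ifs <;> simp_all

theorem oS_od2 {m : ℕ} (h : m + 1 < N) {x : Matrix (Idx n) (Idx n) Cq} (hx : IsHom x 1) :
    oS ⟨m + 1, h⟩ x = amp (adj m h) (od2 x) * preD n ⟨m, by omega⟩ := by
  refine matrix_ext_vecMul fun f w => ?_
  have hp : pre (⟨m + 1, h⟩ : Fin N) w = pre ⟨m, by omega⟩ w + par (w ⟨m, by omega⟩) := by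
    have : Finset.univ.filter (fun l : Fin N => l < ⟨m + 1, h⟩) =
        insert ⟨m, by omega⟩ (Finset.univ.filter (fun l : Fin N => l < ⟨m, by omega⟩)) := by
      ext l
      simp only [Finset.mem_filter, mem_univ, true_and, Finset.mem_insert, Fin.lt_def,
        Fin.ext_iff]
      omega
    rw [pre, this, sum_insert (by simp), pre, add_comm]
  rw [vecMul_oS_hom hx, ← vecMul_vecMul, preD, vecMul_diagonal, od2, vecMul_amp, ← vecMul_vecMul,
    vecMul_diagonal, vecMul_amp_sum, one_mul, hp, sg_add]
  have : ∑ i, f (update w ⟨m + 1, h⟩ i) * x i (w ⟨m + 1, h⟩)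
      = ∑ y, f ((adj m h).set w (lTail.set ((adj m h).get w) y)) * x y (lTail.get ((adj m h).get w)) := by
    refine sum_congr rfl fun i _ => ?_
    congr 2
    simp only [adj, pair, lTail]
    funext l
    simp only [update_apply]
    split_ifs <;> simp_all
  rw [this]
  simp only [adj, pair]
  ring

theorem phM_mul_self : phM n * phM n = -1 := by
  refine matrix_ext_vecMul fun f a => ?_
  rw [← vecMul_vecMul, vecMul_phM, vecMul_phM, negIdx_negIdx, par_negIdx, vecMul_neg, vecMul_one,
    Pi.neg_apply]
  rcases zmod2_cases (par a) with h | h <;> simp [h, one_add_one_zmod2]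

theorem phTM_mul_self : phTM n * phTM n = 1 := by
  refine matrix_ext_vecMul fun f a => ?_
  rw [← vecMul_vecMul, vecMul_phTM, vecMul_phTM, negIdx_negIdx, vecMul_one]

theorem oS_anti {m m' : Fin N} (hm : m ≠ m') {x y : Matrix (Idx n) (Idx n) Cq} (hx : IsHom x 1)
    (hy : IsHom y 1) : oS m x * oS m' y = -(oS m' y * oS m x) := by
  rw [oS_supercomm hm hx hy, one_mul, sg_one, neg_one_smul]

theorem adj_commute_oS {m : ℕ} (h : m + 1 < N) {Q : M2 n} (hQ : EvenQ Q) {l : Fin N}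
    (h1 : (l : ℕ) ≠ m) (h2 : (l : ℕ) ≠ m + 1) {x : Matrix (Idx n) (Idx n) Cq} {p : ZMod 2}
    (hx : IsHom x p) : amp (adj m h) Q * oS l x = oS l x * amp (adj m h) Q :=
  amp_pair_commute_oS hQ rfl _ (fun e => h1 (by rw [e])) (fun e => h2 (by rw [e])) hx

theorem adj_oS_comm {m : ℕ} (h : m + 1 < N) {Q : M2 n} {x : Matrix (Idx n) (Idx n) Cq}
    (hx : IsHom x 1) (hQ : Q * od1 x = od2 x * Q) :
    amp (adj m h) Q * oS ⟨m, by omega⟩ x = oS ⟨m + 1, h⟩ x * amp (adj m h) Q := by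
  rw [oS_od1 h hx, oS_od2 h hx, ← mul_assoc, ← amp_mul, hQ, amp_mul, mul_assoc, mul_assoc,
    preD_commute]

variable (n) (r s : ℕ)

/-- The homomorphism from the free algebra on the generators. -/
def rhoFree : FreeAlgebra Cq (BCGen r s) →ₐ[Cq] Matrix (Word n (r + s)) (Word n (r + s)) Cq :=
  FreeAlgebra.lift Cq fun g => toM n r s (bcAction n g)

theorem rhoFree_ft (i : ℕ) (hi : i + 1 < r) :
    rhoFree n r s (ft i hi) = amp (adj i (by omega)) tM := by
  rw [rhoFree, ft, FreeAlgebra.lift_ι_apply, toM_t]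

theorem rhoFree_ftInv (i : ℕ) (hi : i + 1 < r) :
    rhoFree n r s (ftInv i hi) = amp (adj i (by omega)) tI := by
  rw [ftInv, map_sub, rhoFree_ft, fxi, AlgHom.commutes, ← xi_eq, tI, sub_eq_add_neg, sub_eq_add_neg,
    amp_add, ← neg_smul, amp_smul, amp_one, neg_smul, Algebra.algebraMap_eq_smul_one]

theorem rhoFree_ftStar (i : ℕ) (hi : i + 1 < s) :
    rhoFree n r s (ftStar i hi) = amp (adj (r + i) (by omega)) tDM := by
  rw [rhoFree, ftStar, FreeAlgebra.lift_ι_apply, toM_tStar]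

theorem rhoFree_fe (hr : 0 < r) (hs : 0 < s) :
    rhoFree n r s (fe hr hs) = amp (adj (r - 1) (by omega)) eM := by
  rw [rhoFree, fe, FreeAlgebra.lift_ι_apply, toM_e]

theorem rhoFree_fc (i : ℕ) (hi : i < r) : rhoFree n r s (fc i hi) = oS ⟨i, by omega⟩ (phM n) := by
  rw [rhoFree, fc, FreeAlgebra.lift_ι_apply, toM_c]

theorem rhoFree_fcStar (i : ℕ) (hi : i < s) :
    rhoFree n r s (fcStar i hi) = oS ⟨r + i, by omega⟩ (phTM n) := by
  rw [rhoFree, fcStar, FreeAlgebra.lift_ι_apply, toM_cStar]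

theorem rhoFree_fxi (x : FreeAlgebra Cq (BCGen r s)) :
    rhoFree n r s (fxi * x) = xi • rhoFree n r s x := by
  rw [map_mul, fxi, AlgHom.commutes, ← xi_eq, ← Algebra.smul_def]

theorem rhoFree_rel {x y : FreeAlgebra Cq (BCGen r s)} (h : BCRel r s x y) :
    rhoFree n r s x = rhoFree n r s y := by
  cases h with
  | t_quad i hi =>
    rw [map_sub, map_sub, rhoFree_fxi, map_mul, map_one, map_zero, rhoFree_ft, ← amp_mul, tM_quad,
      amp_add, amp_smul, amp_one]
    abel
  | t_braid i hi hi' =>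
    simp only [map_mul, rhoFree_ft]
    rw [amp_adj_left i (by omega), amp_adj_right i (by omega), ← amp_mul, ← amp_mul, tM_braid,
      amp_mul, amp_mul]
  | t_comm i j hi hj hij =>
    simp only [map_mul, rhoFree_ft]
    exact adj_commute _ _ hij _ _
  | tStar_quad i hi =>
    rw [map_sub, map_sub, rhoFree_fxi, map_mul, map_one, map_zero, rhoFree_ftStar, ← amp_mul, tDM_quad,
      amp_add, amp_smul, amp_one]
    abel
  | tStar_braid i hi hi' =>
    simp only [map_mul, rhoFree_ftStar]
    rw [amp_adj_left (r + i) (by omega)]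
    simp only [← add_assoc]
    rw [amp_adj_right (r + i) (by omega), ← amp_mul, ← amp_mul, tDM_braid, amp_mul, amp_mul]
  | tStar_comm i j hi hj hij =>
    simp only [map_mul, rhoFree_ftStar]
    exact adj_commute _ _ (by omega) _ _
  | t_tStar i j hi hj =>
    simp only [map_mul, rhoFree_ft, rhoFree_ftStar]
    exact adj_commute _ _ (by omega) _ _
  | e_sq hr hs =>
    rw [map_mul, map_zero, rhoFree_fe, ← amp_mul, eM_mul_eM, ← ampHom_apply, map_zero]
  | e_t_e hr hs i hi h =>
    subst h
    simp only [map_mul, rhoFree_ft, rhoFree_fe]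
    change amp (adj (i + 1) _) eM * _ * amp (adj (i + 1) _) eM = amp (adj (i + 1) _) eM
    rw [amp_adj_left i (by omega), amp_adj_right i (by omega), ← amp_mul, ← amp_mul, eM_tM_eM]
  | e_t hr hs i hi h =>
    simp only [map_mul, rhoFree_ft, rhoFree_fe]
    exact adj_commute _ _ (by omega) _ _
  | e_tStar_e hr hs h =>
    simp only [map_mul, rhoFree_ftStar, rhoFree_fe]
    obtain ⟨k, rfl⟩ : ∃ k, r = k + 1 := ⟨r - 1, by omega⟩
    change amp (adj k _) eM * amp (adj (k + 1) _) tDM * amp (adj k _) eM = amp (adj k _) eM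
    rw [amp_adj_left k (by omega), amp_adj_right k (by omega), ← amp_mul, ← amp_mul, eM_tDM_eM]
  | e_tStar hr hs i hi h =>
    simp only [map_mul, rhoFree_ftStar, rhoFree_fe]
    exact adj_commute _ _ (by omega) _ _
  | e_t_tStar_e hr hs i hi h h0 =>
    subst h
    simp only [map_mul, rhoFree_ftInv, rhoFree_ftStar, rhoFree_fe]
    change amp (adj (i + 1) _) eM * amp (adj i _) tI * amp (adj (i + 1 + 1) _) tDM *
      amp (adj (i + 1) _) eM * amp (adj (i + 1 + 1) _) tDM * amp (adj i _) tI
      = amp (adj i _) tI * amp (adj (i + 1 + 1) _) tDM *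
      amp (adj (i + 1) _) eM * amp (adj (i + 1 + 1) _) tDM * amp (adj i _) tI * amp (adj (i + 1) _) eM
    rw [amp_adj_q12 i (by omega), amp_adj_q23 i (by omega), amp_adj_q34 i (by omega)]
    simp only [← amp_mul]
    rw [nest_relation]
  | c_sq i hi =>
    rw [map_mul, rhoFree_fc, oS_mul, phM_mul_self, map_neg, map_one, ← oSHom_apply, map_neg, map_one]
  | c_anti i j hi hj hij =>
    rw [map_neg, map_mul, map_mul, rhoFree_fc, rhoFree_fc]
    exact oS_anti (by simp [hij]) IsHom_phM IsHom_phM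
  | c_cStar i j hi hj =>
    rw [map_neg, map_mul, map_mul, rhoFree_fc, rhoFree_fcStar]
    exact oS_anti (by simp; omega) IsHom_phM IsHom_phTM
  | cStar_sq i hi =>
    rw [map_mul, rhoFree_fcStar, oS_mul, phTM_mul_self, map_one, oS_one]
  | cStar_anti i j hi hj hij =>
    rw [map_neg, map_mul, map_mul, rhoFree_fcStar, rhoFree_fcStar]
    exact oS_anti (by simp [hij]) IsHom_phTM IsHom_phTM
  | t_c i hi hi' =>
    rw [map_mul, map_mul, rhoFree_fc, rhoFree_fc, rhoFree_ft]
    exact adj_oS_comm _ IsHom_phM tM_mul_phM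
  | t_c_comm i j hi hj h h' =>
    rw [map_mul, map_mul, rhoFree_fc, rhoFree_ft]
    exact adj_commute_oS _ EvenQ_tM h h' IsHom_phM
  | tStar_cStar i hi hi' =>
    rw [map_mul, map_mul, rhoFree_fcStar, rhoFree_fcStar, rhoFree_ftStar]
    exact adj_oS_comm _ IsHom_phTM tDM_mul_phTM
  | tStar_cStar_comm i j hi hj h h' =>
    rw [map_mul, map_mul, rhoFree_fcStar, rhoFree_ftStar]
    exact adj_commute_oS _ EvenQ_tDM (by simp [h]) (by simp; omega) IsHom_phTM
  | t_cStar i j hi hj =>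
    rw [map_mul, map_mul, rhoFree_fcStar, rhoFree_ft]
    exact adj_commute_oS _ EvenQ_tM (by simp; omega) (by simp; omega) IsHom_phTM
  | tStar_c i j hi hj =>
    rw [map_mul, map_mul, rhoFree_fc, rhoFree_ftStar]
    exact adj_commute_oS _ EvenQ_tDM (by simp; omega) (by simp; omega) IsHom_phM
  | c_e hr hs i hi h =>
    subst h
    rw [map_mul, map_mul, rhoFree_fc, rhoFree_fe, rhoFree_fcStar]
    change oS _ _ * amp (adj i _) eM = oS ⟨i + 1, _⟩ _ * amp (adj i _) eM
    rw [oS_od1 (by omega) IsHom_phM, oS_od2 _ IsHom_phTM, mul_assoc, mul_assoc, ← preD_commute, ← mul_assoc,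
      ← mul_assoc, ← amp_mul, ← amp_mul, ph_mul_eM]
  | e_c hr hs i hi h =>
    subst h
    rw [map_mul, map_mul, rhoFree_fc, rhoFree_fe, rhoFree_fcStar]
    change amp (adj i _) eM * oS _ _ = amp (adj i _) eM * oS ⟨i + 1, _⟩ _
    rw [oS_od1 (by omega) IsHom_phM, oS_od2 _ IsHom_phTM, ← mul_assoc,
      ← mul_assoc, ← amp_mul, ← amp_mul, eM_mul_ph]
  | c_e_comm hr hs i hi h =>
    rw [map_mul, map_mul, rhoFree_fc, rhoFree_fe]
    exact (adj_commute_oS _ EvenQ_eM (by simp; omega) (by simp; omega) IsHom_phM).symm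
  | cStar_e_comm hr hs i hi h =>
    rw [map_mul, map_mul, rhoFree_fcStar, rhoFree_fe]
    exact (adj_commute_oS _ EvenQ_eM (by simp; omega) (by simp; omega) IsHom_phTM).symm
  | e_c_e hr hs i hi h =>
    subst h
    rw [map_mul, map_mul, rhoFree_fc, rhoFree_fe, map_zero]
    change amp (adj i _) eM * oS _ _ * amp (adj i _) eM = 0
    rw [oS_od1 (by omega) IsHom_phM, mul_assoc, mul_assoc, ← preD_commute, ← mul_assoc, ← mul_assoc, ← amp_mul,
      ← amp_mul, eM_ph_eM, ← ampHom_apply, map_zero, zero_mul]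

/-- The action of the quantum walled Brauer-Clifford superalgebra, by matrices. -/
def rhoM : BC r s →ₐ[Cq] Matrix (Word n (r + s)) (Word n (r + s)) Cq :=
  RingQuot.liftAlgHom Cq ⟨rhoFree n r s, fun _ _ h => rhoFree_rel n r s h⟩

theorem rhoM_gen (g : BCGen r s) : rhoM n r s (BC.gen g) = toM n r s (bcAction n g) := by
  simp [rhoM, BC.gen, rhoFree]

/-- The action of the quantum walled Brauer-Clifford superalgebra on the mixed tensor space. -/
def rhoEnd : BC r s →ₐ[Cq] EndMixed n r s := ((toM n r s).symm : _ →ₐ[Cq] _).comp (rhoM n r s)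

theorem rhoEnd_gen (g : BCGen r s) : rhoEnd n r s (BC.gen g) = bcAction n g := by
  simp [rhoEnd, rhoM_gen]

theorem rhoEnd_part (p : ZMod 2) {x : BC r s} (hx : x ∈ BC.part r s p) :
    rhoEnd n r s x ∈ centPart (tau n r s) p := by
  induction hx using span_induction with
  | mem x hx =>
    obtain ⟨l, hl, rfl⟩ := hx
    subst hl
    induction l with
    | nil => simpa using centPart_one (tau n r s)
    | cons g l ih =>
      rw [List.map_cons, List.map_cons, List.prod_cons, List.sum_cons, map_mul, rhoEnd_gen]
      exact centPart_mul _ (bcAction_mem g) ih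
  | zero => rw [map_zero]; exact Submodule.zero_mem _
  | add x y _ _ hx hy => rw [map_add]; exact Submodule.add_mem _ hx hy
  | smul k x _ hx => rw [map_smul]; exact Submodule.smul_mem _ _ hx

theorem bc_induction {r s : ℕ} {S : Subalgebra Cq (BC r s)} (h : ∀ g, BC.gen g ∈ S) : S = ⊤ := by
  rw [eq_top_iff]
  intro x _
  obtain ⟨y, rfl⟩ := RingQuot.mkAlgHom_surjective Cq (BCRel r s) x
  induction y using FreeAlgebra.induction with
  | grade0 k => rw [AlgHom.commutes]; exact S.algebraMap_mem k
  | grade1 g => exact h g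
  | mul a b ha hb => rw [map_mul]; exact S.mul_mem (ha trivial) (hb trivial)
  | add a b ha hb => rw [map_add]; exact S.add_mem (ha trivial) (hb trivial)

theorem rhoEnd_mem (x : BC r s) : rhoEnd n r s x ∈ superCentralizer (tau n r s) := by
  have : (superCentralizer (tau n r s)).comap (rhoEnd n r s) = ⊤ := by
    refine bc_induction fun g => ?_
    change rhoEnd n r s (BC.gen g) ∈ centPart (tau n r s) 0 ⊔ centPart (tau n r s) 1
    rw [rhoEnd_gen]
    rcases zmod2_cases g.deg with h | h
    · exact Submodule.mem_sup_left (h ▸ bcAction_mem g)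
    · exact Submodule.mem_sup_right (h ▸ bcAction_mem g)
  have h : x ∈ (superCentralizer (tau n r s)).comap (rhoEnd n r s) := by rw [this]; trivial
  exact h

/-- The homomorphism to the centralizer superalgebra. -/
def rho : BC r s →ₐ[Cq] superCentralizer (tau n r s) :=
  (rhoEnd n r s).codRestrict _ (rhoEnd_mem n r s)

end rho

/-! ### Subspaces generated by Hecke operators -/

section coset
variable {K M : Type} [Field K] [AddCommGroup M] [Module K M]

/-- Operators satisfying the relations of the Hecke algebra of the symmetric group on `s` letters. -/
structure HeckeOps (T : ℕ → Module.End K M) (z : K) (s : ℕ) : Prop where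
  quad : ∀ j, j + 1 < s → T j * T j = z • T j + 1
  braid : ∀ j, j + 1 + 1 < s → T j * T (j + 1) * T j = T (j + 1) * T j * T (j + 1)
  comm : ∀ i j, i + 1 < j → j + 1 < s → T i * T j = T j * T i

/-- The smallest subspace containing `Y` that is stable under `T 0, …, T (s - 2)`. -/
def clos (T : ℕ → Module.End K M) (s : ℕ) (Y : Submodule K M) : Submodule K M :=
  sInf {U | Y ≤ U ∧ ∀ j, j + 1 < s → U ≤ U.comap (T j)}

variable {T : ℕ → Module.End K M} {z : K} {s : ℕ} {Y : Submodule K M}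

theorem le_clos : Y ≤ clos T s Y := le_sInf fun _ h => h.1

theorem clos_stable {j : ℕ} (hj : j + 1 < s) : clos T s Y ≤ (clos T s Y).comap (T j) := by
  intro m hm
  rw [Submodule.mem_comap, clos, Submodule.mem_sInf]
  intro U hU
  exact hU.2 j hj ((Submodule.mem_sInf.1 hm) U hU)

theorem clos_le {U : Submodule K M} (h : Y ≤ U) (h' : ∀ j, j + 1 < s → U ≤ U.comap (T j)) :
    clos T s Y ≤ U := sInf_le ⟨h, h'⟩

theorem clos_mono {Y' : Submodule K M} (h : Y ≤ clos T s Y') : clos T s Y ≤ clos T s Y' :=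
  clos_le h fun _ hj => clos_stable hj

/-- The product `T (p + l - 1) ⋯ T (p + 1) T p`. -/
def dprod (T : ℕ → Module.End K M) (p : ℕ) : ℕ → Module.End K M
  | 0 => 1
  | l + 1 => T (p + l) * dprod T p l

theorem dprod_succ_right (p l : ℕ) : dprod T p (l + 1) = dprod T (p + 1) l * T p := by
  induction l with
  | zero => simp [dprod]
  | succ l ih => rw [dprod, ih, dprod, mul_assoc, show p + 1 + l = p + (l + 1) by ring]

theorem dprod_comm_low (h : HeckeOps T z s) {i p l : ℕ} (hi : i + 1 < p) (hl : p + l < s) :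
    T i * dprod T p l = dprod T p l * T i := by
  induction l with
  | zero => simp [dprod]
  | succ l ih =>
    rw [dprod, ← mul_assoc, h.comm i (p + l) (by omega) (by omega), mul_assoc, ih (by omega), mul_assoc]

theorem dprod_comm_high (h : HeckeOps T z s) {i p l : ℕ} (hi : p + l < i) (hs : i + 1 < s) :
    T i * dprod T p l = dprod T p l * T i := by
  induction l with
  | zero => simp [dprod]
  | succ l ih =>
    rw [dprod, ← mul_assoc, ← h.comm (p + l) i (by omega) (by omega), mul_assoc, ih (by omega), mul_assoc]

theorem dprod_shift (h : HeckeOps T z s) {j p l : ℕ} (hp : p ≤ j) (hj : j + 1 < p + l) (hl : p + l < s) :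
    T j * dprod T p l = dprod T p l * T (j + 1) := by
  induction l with
  | zero => omega
  | succ l ih =>
    rcases Nat.lt_or_ge (j + 1) (p + l) with h1 | h1
    · rw [dprod, ← mul_assoc, h.comm j (p + l) h1 (by omega), mul_assoc, ih h1 (by omega), mul_assoc]
    · obtain ⟨l, rfl⟩ : ∃ l', l = l' + 1 := ⟨l - 1, by omega⟩
      obtain rfl : j = p + l := by omega
      rw [dprod, dprod, show p + (l + 1) = p + l + 1 by ring]
      calc T (p + l) * (T (p + l + 1) * (T (p + l) * dprod T p l))
          = (T (p + l) * T (p + l + 1) * T (p + l)) * dprod T p l := by noncomm_ring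
        _ = T (p + l + 1) * T (p + l) * (T (p + l + 1) * dprod T p l) := by
            rw [h.braid _ (by omega)]; noncomm_ring
        _ = _ := by rw [dprod_comm_high h (by omega) (by omega)]; noncomm_ring

theorem dprod_dprod (h : HeckeOps T z s) {p l l' : ℕ} (hl : l' ≤ l) (hs : p + l + 1 < s) :
    dprod T p l' * dprod T p (l + 1) = dprod T p (l + 1) * dprod T (p + 1) l' := by
  induction l' with
  | zero => simp [dprod]
  | succ l' ih =>
    change T (p + l') * dprod T p l' * _ = _ * (T (p + 1 + l') * dprod T (p + 1) l')
    rw [mul_assoc, ih (by omega), ← mul_assoc, dprod_shift h (by omega) (by omega) (by omega),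
      mul_assoc, show p + l' + 1 = p + 1 + l' by ring]

theorem map_clos_le (h : HeckeOps T z s) {i s' : ℕ} (hi : s' ≤ i) (hs : i + 1 < s) :
    (clos T s' Y).map (T i) ≤ clos T s' (Y.map (T i)) := by
  rw [map_le_iff_le_comap]
  refine clos_le ?_ fun j hj => ?_
  · rw [← map_le_iff_le_comap]; exact le_clos
  · intro m hm
    rw [Submodule.mem_comap, Submodule.mem_comap]
    have := congrArg (fun f => f m) (h.comm j i (by omega) hs)
    simp only [Module.End.mul_apply] at this
    rw [← this]
    exact clos_stable hj hm

theorem dprod_map_le {p l : ℕ} (hs : p + l < s) : Y.map (dprod T p l) ≤ clos T s Y := by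
  induction l with
  | zero => rw [dprod, Module.End.one_eq_id, Submodule.map_id]; exact le_clos
  | succ l ih =>
    rw [dprod, Module.End.mul_eq_comp, Submodule.map_comp, map_le_iff_le_comap]
    exact (ih (by omega)).trans (clos_stable (by omega))

/-- `Y` is stable under all operators but `T (k - 1)`. -/
def Stab (T : ℕ → Module.End K M) (s k : ℕ) (Y : Submodule K M) : Prop :=
  ∀ j, j + 1 < s → j + 1 ≠ k → Y ≤ Y.comap (T j)

theorem Stab_dprod {k l : ℕ} (h : HeckeOps T z (k + 1 + l + 1)) (hY : Stab T (k + 1 + l + 1) (k + 1) Y) :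
    Stab T (k + 1 + l) k (Y.map (dprod T k (l + 1))) := by
  intro j hj hk
  rw [← map_le_iff_le_comap, ← Submodule.map_comp, ← Module.End.mul_eq_comp]
  rcases Nat.lt_or_ge (j + 1) k with h1 | h1
  · rw [dprod_comm_low h h1 (by omega), Module.End.mul_eq_comp, Submodule.map_comp]
    exact Submodule.map_mono (map_le_iff_le_comap.2 (hY j (by omega) (by omega)))
  · rw [dprod_shift h (by omega) (by omega) (by omega), Module.End.mul_eq_comp, Submodule.map_comp]
    exact Submodule.map_mono (map_le_iff_le_comap.2 (hY _ (by omega) (by omega)))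

theorem clos_eq_self (h : ∀ j, j + 1 < s → Y ≤ Y.comap (T j)) : clos T s Y ≤ Y := clos_le le_rfl h

theorem map_quad {j : ℕ} (h : HeckeOps T z s) (hj : j + 1 < s) (Z : Submodule K M) :
    (Z.map (T j)).map (T j) ≤ Z.map (T j) ⊔ Z := by
  rw [← Submodule.map_comp, ← Module.End.mul_eq_comp, h.quad j hj]
  rintro _ ⟨m, hm, rfl⟩
  exact Submodule.add_mem_sup (Submodule.smul_mem _ _ ⟨m, hm, rfl⟩) hm

theorem HeckeOps.mono {s' : ℕ} (h : HeckeOps T z s) (hs : s' ≤ s) : HeckeOps T z s' :=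
  ⟨fun j hj => h.quad j (by omega), fun j hj => h.braid j (by omega),
    fun i j hij hj => h.comm i j hij (by omega)⟩

theorem clos_step (t : ℕ) : ∀ (k l : ℕ) (Y : Submodule K M), k + l = t → HeckeOps T z (k + 1 + l + 1) →
    Stab T (k + 1 + l + 1) (k + 1) Y →
    clos T (k + 1 + l + 1) Y ≤ clos T (k + 1 + l) Y ⊔ clos T (k + 1 + l) (Y.map (dprod T k (l + 1))) := by
  induction t using Nat.strong_induction_on with
  | _ t ih =>
  intro k l Y ht h hY
  set A := clos T (k + 1 + l) Y
  set B := clos T (k + 1 + l) (Y.map (dprod T k (l + 1)))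
  have hYB : Y.map (dprod T k (l + 1)) ≤ B := le_clos
  have hd : Y.map (dprod T k l) ≤ A := dprod_map_le (by omega)
  have htop : (Y.map (dprod T k (l + 1))).map (T (k + l)) ≤ A ⊔ B := by
    have e : Y.map (dprod T k (l + 1)) = (Y.map (dprod T k l)).map (T (k + l)) := by
      rw [dprod, Module.End.mul_eq_comp, Submodule.map_comp]
    rw [e]
    refine (map_quad h (by omega) _).trans (sup_le ?_ (hd.trans le_sup_left))
    rw [← e]; exact hYB.trans le_sup_right
  have hsub : ∀ {Z : Submodule K M} {s' : ℕ}, s' ≤ k + 1 + l → Z ≤ A ⊔ B → clos T s' Z ≤ A ⊔ B := by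
    intro Z s' hs' hZ
    refine clos_le hZ fun j hj => ?_
    rw [← map_le_iff_le_comap, Submodule.map_sup]
    exact sup_le_sup (map_le_iff_le_comap.2 (clos_stable (by omega)))
      (map_le_iff_le_comap.2 (clos_stable (by omega)))
  have hA : A.map (T (k + l)) ≤ A ⊔ B := by
    rcases l with _ | l
    · have : A ≤ Y := clos_eq_self fun j hj => hY j (by omega) (by omega)
      refine (Submodule.map_mono this).trans (le_trans ?_ (hYB.trans le_sup_right))
      simp [dprod]
    · have := ih (k + l) (by omega) k l Y rfl (h.mono (by omega))
        (fun j hj hk => hY j (by omega) hk)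
      refine (Submodule.map_mono this).trans ?_
      rw [Submodule.map_sup]
      refine sup_le ((map_clos_le h (by omega) (by omega)).trans (hsub (by omega) ?_))
        ((map_clos_le h (by omega) (by omega)).trans (hsub (by omega) ?_))
      · exact (map_le_iff_le_comap.2 (hY _ (by omega) (by omega))).trans
          (le_clos.trans le_sup_left)
      · rw [← Submodule.map_comp, ← Module.End.mul_eq_comp]
        exact hYB.trans le_sup_right
  have hB : B.map (T (k + l)) ≤ A ⊔ B := by
    have hst := Stab_dprod h hY
    rcases k with _ | k
    · have : B ≤ Y.map (dprod T 0 (l + 1)) := clos_eq_self fun j hj => hst j (by omega) (by omega)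
      exact (Submodule.map_mono this).trans htop
    · have hs' : k + 1 + 1 + l = k + 1 + l + 1 := by ring
      have := ih (k + l) (by omega) k l (Y.map (dprod T (k + 1) (l + 1))) rfl (h.mono (by omega))
        (by rw [← hs']; exact hst)
      have hB' : B ≤ clos T (k + 1 + l) (Y.map (dprod T (k + 1) (l + 1))) ⊔
          clos T (k + 1 + l) ((Y.map (dprod T (k + 1) (l + 1))).map (dprod T k (l + 1))) := by
        rw [← hs'] at this; exact this
      refine (Submodule.map_mono hB').trans ?_
      rw [Submodule.map_sup]
      refine sup_le ((map_clos_le h (by omega) (by omega)).trans (hsub (by omega) htop))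
        ((map_clos_le h (by omega) (by omega)).trans (hsub (by omega) ?_))
      have e : T (k + 1 + l) * dprod T k (l + 1) * dprod T (k + 1) (l + 1)
          = dprod T k (l + 1) * dprod T (k + 1) (l + 1) * T k := by
        have h1 := dprod_dprod h (p := k) (l := l + 1) (l' := l + 1) le_rfl (by omega)
        have h2 : T (k + 1 + l) * dprod T k (l + 1) = dprod T k (l + 1 + 1) := by
          change _ = T (k + (l + 1)) * dprod T k (l + 1)
          rw [show k + (l + 1) = k + 1 + l by ring]
        rw [h2, ← h1, mul_assoc, ← dprod_succ_right]
      rw [← Submodule.map_comp, ← Submodule.map_comp, ← Module.End.mul_eq_comp,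
        ← Module.End.mul_eq_comp, e, Module.End.mul_eq_comp, Submodule.map_comp]
      refine (Submodule.map_mono (map_le_iff_le_comap.2 (hY k (by omega) (by omega)))).trans ?_
      rw [Module.End.mul_eq_comp, Submodule.map_comp]
      refine le_trans ?_ le_sup_right
      refine (dprod_map_le (T := T) (s := k + 1 + 1 + l) (by omega)).trans ?_
      exact clos_mono hYB
  refine clos_le (le_clos.trans le_sup_left) fun j hj => ?_
  rw [← map_le_iff_le_comap]
  rcases Nat.lt_or_ge j (k + l) with h1 | h1
  · rw [Submodule.map_sup]
    exact sup_le_sup (map_le_iff_le_comap.2 (clos_stable (by omega)))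
      (map_le_iff_le_comap.2 (clos_stable (by omega)))
  · obtain rfl : j = k + l := by omega
    rw [Submodule.map_sup]
    exact sup_le hA hB

/-- The subspace `Y` is spanned by at most `c` vectors. -/
def DimLE (Y : Submodule K M) (c : ℕ) : Prop := ∃ f : Fin c → M, Y ≤ Submodule.span K (Set.range f)

theorem DimLE.mono {Y Y' : Submodule K M} {c : ℕ} (h : DimLE Y c) (hY : Y' ≤ Y) : DimLE Y' c :=
  ⟨h.choose, hY.trans h.choose_spec⟩

theorem DimLE.map {Y : Submodule K M} {c : ℕ} (h : DimLE Y c) (f : Module.End K M) :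
    DimLE (Y.map f) c := by
  obtain ⟨g, hg⟩ := h
  refine ⟨f ∘ g, (Submodule.map_mono hg).trans ?_⟩
  rw [Submodule.map_span, Set.range_comp]

theorem DimLE.sup {Y Y' : Submodule K M} {c c' : ℕ} (h : DimLE Y c) (h' : DimLE Y' c') :
    DimLE (Y ⊔ Y') (c + c') := by
  obtain ⟨g, hg⟩ := h
  obtain ⟨g', hg'⟩ := h'
  refine ⟨Fin.append g g', sup_le (hg.trans (Submodule.span_mono ?_)) (hg'.trans (Submodule.span_mono ?_))⟩
  · rintro _ ⟨i, rfl⟩; exact ⟨Fin.castAdd c' i, by simp⟩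
  · rintro _ ⟨i, rfl⟩; exact ⟨Fin.natAdd c i, by simp⟩

theorem DimLE_span_singleton (m : M) : DimLE (Submodule.span K {m}) 1 :=
  ⟨fun _ => m, Submodule.span_mono (by rintro _ rfl; exact ⟨0, rfl⟩)⟩

theorem DimLE_bot : DimLE (⊥ : Submodule K M) 0 := ⟨Fin.elim0, bot_le⟩

theorem DimLE_clos (s : ℕ) : ∀ (k : ℕ) (Y : Submodule K M) (c : ℕ), k ≤ s → HeckeOps T z s →
    Stab T s k Y → DimLE Y c → DimLE (clos T s Y) (s.choose k * c) := by
  induction s with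
  | zero =>
    intro k Y c hk h hY hc
    obtain rfl : k = 0 := by omega
    rw [Nat.choose_self, one_mul]
    exact hc.mono (clos_eq_self fun j hj => by omega)
  | succ s ih =>
    intro k Y c hk h hY hc
    rcases k with _ | k
    · rw [Nat.choose_zero_right, one_mul]
      exact hc.mono (clos_eq_self fun j hj => hY j hj (by omega))
    rcases Nat.lt_or_ge k s with h1 | h1
    swap
    · obtain rfl : k = s := by omega
      rw [Nat.choose_self, one_mul]
      exact hc.mono (clos_eq_self fun j hj => hY j hj (by omega))
    obtain ⟨l, rfl⟩ : ∃ l, s = k + 1 + l := ⟨s - (k + 1), by omega⟩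
    have h2 := clos_step _ k l Y rfl h hY
    have h3 := ih (k + 1) Y c (by omega) (h.mono (by omega)) (fun j hj hk => hY j (by omega) hk) hc
    have h4 := ih k (Y.map (dprod T k (l + 1))) c (by omega) (h.mono (by omega)) (Stab_dprod h hY)
      (hc.map _)
    have h5 := (h4.sup h3).mono (h2.trans (sup_comm _ _).le)
    rwa [← add_mul, ← Nat.choose_succ_succ'] at h5

/-- Growing a subspace stepwise. -/
theorem DimLE_clos_factorial (h : HeckeOps T z s) {Y : Submodule K M} {c : ℕ} (hc : DimLE Y c) :
    DimLE (clos T s Y) (s.factorial * c) := by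
  induction s with
  | zero => rw [Nat.factorial_zero, one_mul]; exact hc.mono (clos_eq_self fun j hj => by omega)
  | succ s ih =>
    have h1 := ih (h.mono (by omega))
    have h2 := DimLE_clos (T := T) (s + 1) s (clos T s Y) _ (by omega) h
      (fun j hj hk => clos_stable (by omega)) h1
    rw [Nat.choose_succ_self_right, ← mul_assoc, ← Nat.factorial_succ] at h2
    refine h2.mono (clos_le (le_clos.trans le_clos) fun j hj => clos_stable hj)

end coset

/-! ### The relations of the walled Brauer-Clifford superalgebra, numbered from the wall -/

/-- The relations between the elements `a j = t_{r-1-j}`, `b j = (t*_{j+1})⁻¹`, `x j = c_{r-j}`,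
`y j = c*_{j+1}` and `e`. They are stable under exchanging the two sides of the wall. -/
structure Walled {K A : Type} [Field K] [Ring A] [Algebra K A] (z ζ η : K) (r s : ℕ)
    (a b x y : ℕ → A) (e : A) : Prop where
  aq : ∀ j, j + 1 < r → a j * a j = z • a j + 1
  abr : ∀ j, j + 1 + 1 < r → a j * a (j + 1) * a j = a (j + 1) * a j * a (j + 1)
  acm : ∀ i j, i + 1 < j → j + 1 < r → a i * a j = a j * a i
  bq : ∀ j, j + 1 < s → b j * b j = (-z) • b j + 1
  bbr : ∀ j, j + 1 + 1 < s → b j * b (j + 1) * b j = b (j + 1) * b j * b (j + 1)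
  bcm : ∀ i j, i + 1 < j → j + 1 < s → b i * b j = b j * b i
  ab : ∀ i j, i + 1 < r → j + 1 < s → a i * b j = b j * a i
  ax : ∀ j, j + 1 < r → a j * x (j + 1) = x j * a j
  axc : ∀ i j, i + 1 < r → j < r → j ≠ i → j ≠ i + 1 → a i * x j = x j * a i
  by_ : ∀ j, j + 1 < s → b j * y (j + 1) = y j * b j
  byc : ∀ i j, i + 1 < s → j < s → j ≠ i → j ≠ i + 1 → b i * y j = y j * b i
  ay : ∀ i j, i + 1 < r → j < s → a i * y j = y j * a i
  bx : ∀ i j, i + 1 < s → j < r → b i * x j = x j * b i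
  xx : ∀ i j, i < r → j < r → i ≠ j → x i * x j = -(x j * x i)
  yy : ∀ i j, i < s → j < s → i ≠ j → y i * y j = -(y j * y i)
  xy : ∀ i j, i < r → j < s → x i * y j = -(y j * x i)
  xsq : ∀ i, i < r → x i * x i = ζ • 1
  ysq : ∀ i, i < s → y i * y i = η • 1
  ee : e * e = 0
  eae : 0 + 1 < r → e * a 0 * e = e
  ebe : 0 + 1 < s → e * b 0 * e = e
  ea : ∀ j, j ≠ 0 → j + 1 < r → e * a j = a j * e
  eb : ∀ j, j ≠ 0 → j + 1 < s → e * b j = b j * e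
  xe : 0 < r → 0 < s → x 0 * e = y 0 * e
  ex : 0 < r → 0 < s → e * x 0 = e * y 0
  xec : ∀ j, j ≠ 0 → j < r → x j * e = e * x j
  yec : ∀ j, j ≠ 0 → j < s → y j * e = e * y j
  exe : 0 < r → 0 < s → e * x 0 * e = 0
  nest : 0 + 1 < r → 0 + 1 < s → a 0 * b 0 * (e * a 0 * b 0 * e) = e * a 0 * b 0 * e
  nest' : 0 + 1 < r → 0 + 1 < s → e * a 0 * b 0 * e * (a 0 * b 0) = e * a 0 * b 0 * e

section walled
variable {K A : Type} [Field K] [Ring A] [Algebra K A] {z ζ η : K} {r s : ℕ} {a b x y : ℕ → A} {e : A}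

theorem Walled.symm (W : Walled z ζ η r s a b x y e) : Walled (-z) η ζ s r b a y x e where
  aq := W.bq
  abr := W.bbr
  acm := W.bcm
  bq := by simpa using W.aq
  bbr := W.abr
  bcm := W.acm
  ab i j hi hj := (W.ab j i hj hi).symm
  ax := W.by_
  axc := W.byc
  by_ := W.ax
  byc := W.axc
  ay := W.bx
  bx := W.ay
  xx := W.yy
  yy := W.xx
  xy i j hi hj := by rw [W.xy j i hj hi, neg_neg]
  xsq := W.ysq
  ysq := W.xsq
  ee := W.ee
  eae := W.ebe
  ebe := W.eae
  ea := W.eb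
  eb := W.ea
  xe hr hs := (W.xe hs hr).symm
  ex hr hs := (W.ex hs hr).symm
  xec := W.yec
  yec := W.xec
  exe hr hs := by rw [← W.ex hs hr, W.exe hs hr]
  nest hr hs := by
    rw [mul_assoc e, ← W.ab 0 0 hs hr, ← mul_assoc e, W.nest hs hr]
  nest' hr hs := by
    rw [mul_assoc e, ← W.ab 0 0 hs hr, ← mul_assoc e, W.nest' hs hr]

/-- The product `a p * a (p + 1) * ⋯ * a (p + l - 1)`. -/
def asc (a : ℕ → A) (p : ℕ) : ℕ → A
  | 0 => 1
  | l + 1 => asc a p l * a (p + l)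

theorem asc_succ_left (p l : ℕ) : asc a p (l + 1) = a p * asc a (p + 1) l := by
  induction l with
  | zero => simp [asc]
  | succ l ih =>
    rw [asc, ih, asc, mul_assoc, show p + (l + 1) = p + 1 + l by ring]

theorem commute_asc {u : A} {p l : ℕ} (h : ∀ j, p ≤ j → j < p + l → u * a j = a j * u) :
    u * asc a p l = asc a p l * u := by
  induction l with
  | zero => simp [asc]
  | succ l ih =>
    rw [asc, ← mul_assoc, ih fun j h1 h2 => h j h1 (by omega), mul_assoc, h _ (by omega) (by omega),
      mul_assoc]

theorem asc_shift (W : Walled z ζ η r s a b x y e) {i p l : ℕ} (hp : p ≤ i) (hi : i + 1 < p + l)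
    (hl : p + l < r) : a (i + 1) * asc a p l = asc a p l * a i := by
  induction l with
  | zero => omega
  | succ l ih =>
    rcases Nat.lt_or_ge (i + 1) (p + l) with h | h
    · rw [asc, ← mul_assoc, ih h (by omega), mul_assoc, mul_assoc, W.acm i (p + l) h (by omega)]
    · obtain ⟨m, rfl⟩ : ∃ m, l = m + 1 := ⟨l - 1, by omega⟩
      obtain rfl : i = p + m := by omega
      rw [asc, asc, show p + (m + 1) = p + m + 1 by ring]
      have h1 : a (p + m + 1) * asc a p m = asc a p m * a (p + m + 1) :=
        commute_asc fun j h1 h2 => (W.acm j _ (by omega) (by omega)).symm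
      have h2 := W.abr (p + m) (by omega)
      rw [← mul_assoc, ← mul_assoc, h1, mul_assoc, mul_assoc, ← mul_assoc (a (p + m + 1)), ← h2]
      noncomm_ring

theorem asc_asc (W : Walled z ζ η r s a b x y e) {k l : ℕ} (hl : l < k) (hk : k < r) :
    asc a 0 k * asc a 0 l = asc a 1 l * asc a 0 k := by
  induction l with
  | zero => simp [asc]
  | succ l ih =>
    rw [asc, asc, ← mul_assoc, ih (by omega), mul_assoc, mul_assoc,
      show 1 + l = (0 + l) + 1 by ring, asc_shift W (by omega) (by omega) (by omega)]

/-- The block product `(a 1 ⋯ a m) (a 0 ⋯ a (m - 1))`. -/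
def block (a : ℕ → A) (m : ℕ) : A := asc a 1 m * asc a 0 m

theorem mul_block (W : Walled z ζ η r s a b x y e) {m : ℕ} (hm : m + 1 < r) :
    a 0 * block a m = block a m * a m := by
  rw [block, ← mul_assoc, ← asc_succ_left, asc_asc W (by omega) (by omega), asc, zero_add, mul_assoc]

theorem a_x (W : Walled z ζ η r s a b x y e) {j : ℕ} (hj : j + 1 < r) :
    x (j + 1) * (a j - z • 1) = (a j - z • 1) * x j := by
  have h1 : (a j - z • 1) * a j = 1 := by rw [sub_mul, W.aq j hj, smul_mul_assoc, one_mul]; abel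
  have h2 : a j * (a j - z • 1) = 1 := by rw [mul_sub, W.aq j hj, mul_smul_comm, mul_one]; abel
  calc x (j + 1) * (a j - z • 1) = (a j - z • 1) * (a j * x (j + 1)) * (a j - z • 1) := by
        rw [← mul_assoc (a j - z • 1), h1, one_mul]
    _ = (a j - z • 1) * x j * (a j * (a j - z • 1)) := by rw [W.ax j hj]; noncomm_ring
    _ = _ := by rw [h2, mul_one]

theorem a_x' (W : Walled z ζ η r s a b x y e) {j : ℕ} (hj : j + 1 < r) :
    a j * x j = x (j + 1) * a j - z • x (j + 1) + z • x j := by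
  have h := a_x W hj
  rw [mul_sub, sub_mul, mul_smul_comm, mul_one, smul_mul_assoc, one_mul] at h
  rw [h]; abel

theorem asc_x (W : Walled z ζ η r s a b x y e) {k : ℕ} (hk : k < r) : asc a 0 k * x k = x 0 * asc a 0 k := by
  induction k with
  | zero => simp [asc]
  | succ k ih => rw [asc, zero_add, mul_assoc, W.ax k hk, ← mul_assoc, ih (by omega), mul_assoc]

theorem asc_ab (W : Walled z ζ η r s a b x y e) {p l p' l' : ℕ} (h : p + l < r) (h' : p' + l' < s) :
    asc a p l * asc b p' l' = asc b p' l' * asc a p l :=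
  commute_asc fun j _ h2 => (commute_asc fun i _ h3 => (W.ab i j (by omega) (by omega)).symm).symm

/-- The elements with `k` nested caps and cups at the wall. -/
def nestE (a b : ℕ → A) (e : A) : ℕ → A
  | 0 => 1
  | k + 1 => e * asc a 0 k * asc b 0 k * nestE a b e k

theorem nestE_symm (W : Walled z ζ η r s a b x y e) {k : ℕ} (hr : k ≤ r) (hs : k ≤ s) :
    nestE b a e k = nestE a b e k := by
  induction k with
  | zero => rfl
  | succ k ih =>
    rw [nestE, nestE, ih (by omega) (by omega), mul_assoc e, asc_ab W.symm (by omega) (by omega)]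
    simp only [mul_assoc]

theorem nestE_add_two (W : Walled z ζ η r s a b x y e) {m : ℕ} (hr : m + 2 ≤ r) (hs : m + 2 ≤ s) :
    nestE a b e (m + 2) = e * a 0 * b 0 * e * (block a m * block b m) * nestE a b e m := by
  have h1 : asc a 1 m * e = e * asc a 1 m :=
    (commute_asc fun j h1 h2 => W.ea j (by omega) (by omega)).symm
  have h2 : asc b 1 m * e = e * asc b 1 m :=
    (commute_asc fun j h1 h2 => W.eb j (by omega) (by omega)).symm
  have h3 : asc a 1 m * b 0 = b 0 * asc a 1 m :=
    (commute_asc fun j h1 h2 => (W.ab j 0 (by omega) (by omega)).symm).symm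
  have h4 : asc b 1 m * asc a 0 m = asc a 0 m * asc b 1 m := asc_ab W.symm (by omega) (by omega)
  change e * asc a 0 (m + 1) * asc b 0 (m + 1) * (e * asc a 0 m * asc b 0 m * nestE a b e m) = _
  rw [asc_succ_left, asc_succ_left, block, block]
  calc e * (a 0 * asc a 1 m) * (b 0 * asc b 1 m) * (e * asc a 0 m * asc b 0 m * nestE a b e m)
      = e * a 0 * (asc a 1 m * b 0) * (asc b 1 m * e) * asc a 0 m * asc b 0 m * nestE a b e m := by
        noncomm_ring
    _ = e * a 0 * b 0 * (asc a 1 m * e) * (asc b 1 m * asc a 0 m) * asc b 0 m * nestE a b e m := by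
        rw [h2, h3]; noncomm_ring
    _ = _ := by rw [h1, h4]; noncomm_ring

theorem a_nestE (W : Walled z ζ η r s a b x y e) {k j : ℕ} (hr : k ≤ r) (hs : k ≤ s) (hj : k ≤ j)
    (hj' : j + 1 < r) : a j * nestE a b e k = nestE a b e k * a j := by
  induction k with
  | zero => simp [nestE]
  | succ k ih =>
    have h1 : a j * asc a 0 k = asc a 0 k * a j :=
      commute_asc fun i _ hi => (W.acm i j (by omega) (by omega)).symm
    have h2 : a j * asc b 0 k = asc b 0 k * a j := commute_asc fun i _ hi => W.ab j i (by omega) (by omega)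
    rw [nestE, ← mul_assoc, ← mul_assoc, ← mul_assoc, ← W.ea j (by omega) hj', mul_assoc e, h1,
      ← mul_assoc e, mul_assoc _ (a j), h2, ← mul_assoc, mul_assoc _ (a j), ih (by omega) (by omega) (by omega)]
    simp only [mul_assoc]

theorem x_nestE (W : Walled z ζ η r s a b x y e) {k j : ℕ} (hr : k ≤ r) (hs : k ≤ s) (hj : k ≤ j)
    (hj' : j < r) : x j * nestE a b e k = nestE a b e k * x j := by
  induction k with
  | zero => simp [nestE]
  | succ k ih =>
    have h1 : x j * asc a 0 k = asc a 0 k * x j :=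
      commute_asc fun i _ hi => (W.axc i j (by omega) (by omega) (by omega) (by omega)).symm
    have h2 : x j * asc b 0 k = asc b 0 k * x j :=
      commute_asc fun i _ hi => (W.bx i j (by omega) (by omega)).symm
    rw [nestE, ← mul_assoc, ← mul_assoc, ← mul_assoc, W.xec j (by omega) hj', mul_assoc e, h1,
      ← mul_assoc e, mul_assoc _ (x j), h2, ← mul_assoc, mul_assoc _ (x j), ih (by omega) (by omega) (by omega)]
    simp only [mul_assoc]

theorem b_nestE (W : Walled z ζ η r s a b x y e) {k j : ℕ} (hr : k ≤ r) (hs : k ≤ s) (hj : k ≤ j)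
    (hj' : j + 1 < s) : b j * nestE a b e k = nestE a b e k * b j := by
  rw [← nestE_symm W hr hs]; exact a_nestE W.symm hs hr hj hj'

theorem y_nestE (W : Walled z ζ η r s a b x y e) {k j : ℕ} (hr : k ≤ r) (hs : k ≤ s) (hj : k ≤ j)
    (hj' : j < s) : y j * nestE a b e k = nestE a b e k * y j := by
  rw [← nestE_symm W hr hs]; exact x_nestE W.symm hs hr hj hj'

theorem ab_nestE (W : Walled z ζ η r s a b x y e) {k j : ℕ} (hr : k ≤ r) (hs : k ≤ s) (hj : j + 1 < k) :
    a j * b j * nestE a b e k = nestE a b e k := by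
  induction k generalizing j with
  | zero => omega
  | succ k ih =>
    rcases j with _ | j
    · obtain ⟨m, rfl⟩ : ∃ m, k = m + 1 := ⟨k - 1, by omega⟩
      rw [nestE_add_two W (by omega) (by omega), mul_assoc _ (block a m * block b m), ← mul_assoc,
        W.nest (by omega) (by omega)]
    · have h1 := asc_shift W (i := j) (p := 0) (l := k) (by omega) (by omega) (by omega)
      have h2 := asc_shift W.symm (i := j) (p := 0) (l := k) (by omega) (by omega) (by omega)
      have h3 : b (j + 1) * asc a 0 k = asc a 0 k * b (j + 1) :=
        commute_asc fun i _ hi => (W.ab i _ (by omega) (by omega)).symm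
      have h4 : a j * asc b 0 k = asc b 0 k * a j := commute_asc fun i _ hi => W.ab j i (by omega) (by omega)
      calc a (j + 1) * b (j + 1) * nestE a b e (k + 1)
          = a (j + 1) * (b (j + 1) * e) * asc a 0 k * asc b 0 k * nestE a b e k := by
            rw [nestE]; noncomm_ring
        _ = (a (j + 1) * e) * (b (j + 1) * asc a 0 k) * asc b 0 k * nestE a b e k := by
            rw [← W.eb _ (by omega) (by omega)]; noncomm_ring
        _ = e * (a (j + 1) * asc a 0 k) * (b (j + 1) * asc b 0 k) * nestE a b e k := by
            rw [← W.ea _ (by omega) (by omega), h3]; noncomm_ring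
        _ = e * asc a 0 k * (a j * asc b 0 k) * b j * nestE a b e k := by
            rw [h1, h2]; noncomm_ring
        _ = e * asc a 0 k * asc b 0 k * (a j * b j * nestE a b e k) := by
            rw [h4]; noncomm_ring
        _ = _ := by rw [ih (by omega) (by omega) (by omega), nestE]

theorem nestE_ab (W : Walled z ζ η r s a b x y e) {k j : ℕ} (hr : k ≤ r) (hs : k ≤ s) (hj : j + 1 < k) :
    nestE a b e k * (a j * b j) = nestE a b e k := by
  induction k with
  | zero => omega
  | succ k ih =>
    rcases Nat.lt_or_ge (j + 1) k with h | h
    · rw [nestE, mul_assoc, ih (by omega) (by omega) h]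
    · obtain rfl : k = j + 1 := by omega
      have h1 := a_nestE W (k := j) (j := j) (by omega) (by omega) le_rfl (by omega)
      have h2 := b_nestE W (k := j) (j := j) (by omega) (by omega) le_rfl (by omega)
      have h3 : a j * block b j = block b j * a j := by
        have h5 : ∀ p, p + j < s → a j * asc b p j = asc b p j * a j := fun p hp =>
          commute_asc fun i _ hi => W.ab j i (by omega) (by omega)
        rw [block, ← mul_assoc, h5 1 (by omega), mul_assoc, h5 0 (by omega), mul_assoc]
      have h4 : b 0 * block a j = block a j * b 0 := by
        have h5 : ∀ p, p + j < r → b 0 * asc a p j = asc a p j * b 0 := fun p hp =>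
          commute_asc fun i _ hi => (W.ab i 0 (by omega) (by omega)).symm
        rw [block, ← mul_assoc, h5 1 (by omega), mul_assoc, h5 0 (by omega), mul_assoc]
      rw [nestE_add_two W (by omega) (by omega)]
      calc e * a 0 * b 0 * e * (block a j * block b j) * nestE a b e j * (a j * b j)
          = e * a 0 * b 0 * e * (block a j * block b j) * (nestE a b e j * a j) * b j := by
            noncomm_ring
        _ = e * a 0 * b 0 * e * block a j * (block b j * a j) * (nestE a b e j * b j) := by
            rw [← h1]; noncomm_ring
        _ = e * a 0 * b 0 * e * (block a j * a j) * (block b j * b j) * nestE a b e j := by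
            rw [← h2, ← h3]; noncomm_ring
        _ = e * a 0 * b 0 * e * a 0 * (block a j * b 0) * block b j * nestE a b e j := by
            rw [← mul_block W (by omega), ← mul_block W.symm (by omega)]; noncomm_ring
        _ = e * a 0 * b 0 * e * (a 0 * b 0) * block a j * block b j * nestE a b e j := by
            rw [← h4]; noncomm_ring
        _ = _ := by rw [W.nest' (by omega) (by omega)]; noncomm_ring

/-- The inverse of `a j`. -/
theorem a_inv (W : Walled z ζ η r s a b x y e) {j : ℕ} (hj : j + 1 < r) : a j * (a j - z • 1) = 1 := by
  rw [mul_sub, W.aq j hj, mul_smul_comm, mul_one]; abel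

theorem a_inv' (W : Walled z ζ η r s a b x y e) {j : ℕ} (hj : j + 1 < r) : (a j - z • 1) * a j = 1 := by
  rw [sub_mul, W.aq j hj, smul_mul_assoc, one_mul]; abel

theorem b_nestE_eq (W : Walled z ζ η r s a b x y e) {k j : ℕ} (hr : k ≤ r) (hs : k ≤ s) (hj : j + 1 < k) :
    b j * nestE a b e k = (a j - z • 1) * nestE a b e k := by
  conv_rhs => rw [← ab_nestE W hr hs hj, ← mul_assoc, ← mul_assoc, a_inv' W (by omega), one_mul]

theorem nestE_a_eq (W : Walled z ζ η r s a b x y e) {k j : ℕ} (hr : k ≤ r) (hs : k ≤ s) (hj : j + 1 < k) :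
    nestE a b e k * a j = nestE a b e k * (b j - (-z) • 1) := by
  conv_rhs => rw [← nestE_ab W hr hs hj, mul_assoc, mul_assoc, a_inv W.symm (by omega), mul_one]

theorem a_nestE_eq (W : Walled z ζ η r s a b x y e) {k j : ℕ} (hr : k ≤ r) (hs : k ≤ s) (hj : j + 1 < k) :
    a j * nestE a b e k = (b j - (-z) • 1) * nestE a b e k := by
  have := b_nestE_eq W.symm hs hr hj
  rwa [nestE_symm W hr hs] at this

theorem x_nestE_eq (W : Walled z ζ η r s a b x y e) {k j : ℕ} (hr : k ≤ r) (hs : k ≤ s) (hj : j < k) :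
    x j * nestE a b e k = y j * nestE a b e k := by
  induction j with
  | zero =>
    obtain ⟨m, rfl⟩ : ∃ m, k = m + 1 := ⟨k - 1, by omega⟩
    rw [nestE, ← mul_assoc, ← mul_assoc, ← mul_assoc, W.xe (by omega) (by omega)]
    simp only [mul_assoc]
  | succ j ih =>
    have h1 : x (j + 1) = (a j - z • 1) * x j * a j := by
      rw [← a_x W (by omega), mul_assoc, a_inv' W (by omega), mul_one]
    have h2 : y (j + 1) = (b j - (-z) • 1) * y j * b j := by
      rw [← a_x W.symm (by omega), mul_assoc, a_inv' W.symm (by omega), mul_one]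
    have h3 : x j * (b j - (-z) • 1) = (b j - (-z) • 1) * x j := by
      rw [mul_sub, sub_mul, W.bx j j (by omega) (by omega)]; simp
    have h4 : (a j - z • 1) * y j = y j * (a j - z • 1) := by
      rw [mul_sub, sub_mul, W.ay j j (by omega) (by omega)]; simp
    have hc : Commute (a j) (b j) := W.ab j j (by omega) (by omega)
    have h5 : (a j - z • 1) * (b j - (-z) • 1) = (b j - (-z) • 1) * (a j - z • 1) :=
      (hc.sub_left ((Commute.one_left _).smul_left z)).sub_right ((Commute.one_right _).smul_right (-z))
    rw [h1, h2, mul_assoc _ (a j), a_nestE_eq W hr hs hj, mul_assoc _ (b j), b_nestE_eq W hr hs hj]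
    calc (a j - z • 1) * x j * ((b j - (-z) • 1) * nestE a b e k) = (a j - z • 1) * (x j * (b j - (-z) • 1)) * nestE a b e k := by
          simp only [mul_assoc]
      _ = (a j - z • 1) * (b j - (-z) • 1) * (x j * nestE a b e k) := by rw [h3]; simp only [mul_assoc]
      _ = (b j - (-z) • 1) * ((a j - z • 1) * y j) * nestE a b e k := by
          rw [h5, ih (by omega)]; simp only [mul_assoc]
      _ = _ := by rw [h4]; simp only [mul_assoc]

theorem nestE_x_eq (W : Walled z ζ η r s a b x y e) {k j : ℕ} (hr : k ≤ r) (hs : k ≤ s) (hj : j < k) :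
    nestE a b e k * x j = nestE a b e k * y j := by
  induction k with
  | zero => omega
  | succ k ih =>
    rcases Nat.lt_or_ge j k with h | h
    · rw [nestE, mul_assoc, ih (by omega) (by omega) h]; simp only [mul_assoc]
    · obtain rfl : k = j := by omega
      have h1 : x k * asc b 0 k = asc b 0 k * x k := commute_asc fun i _ hi => (W.bx i k (by omega) (by omega)).symm
      have h2 : y 0 * asc a 0 k = asc a 0 k * y 0 := commute_asc fun i _ hi => (W.ay i 0 (by omega) (by omega)).symm
      calc nestE a b e (k + 1) * x k = e * asc a 0 k * asc b 0 k * (nestE a b e k * x k) := by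
            rw [nestE]; simp only [mul_assoc]
        _ = e * (asc a 0 k * (asc b 0 k * x k)) * nestE a b e k := by
            rw [← x_nestE W (by omega) (by omega) le_rfl (by omega)]; simp only [mul_assoc]
        _ = e * (asc a 0 k * x k) * asc b 0 k * nestE a b e k := by rw [← h1]; simp only [mul_assoc]
        _ = e * (y 0 * asc a 0 k) * asc b 0 k * nestE a b e k := by
            rw [asc_x W (by omega), ← mul_assoc, W.ex (by omega) (by omega)]; simp only [mul_assoc]
        _ = e * asc a 0 k * (asc b 0 k * y k) * nestE a b e k := by
            rw [h2, asc_x W.symm (by omega)]; simp only [mul_assoc]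
        _ = _ := by rw [mul_assoc _ _ (nestE a b e k), mul_assoc (asc b 0 k),
                      y_nestE W (by omega) (by omega) le_rfl (by omega), nestE]; simp only [mul_assoc]

end walled

section walled
variable {K A : Type} [Field K] [Ring A] [Algebra K A] {z ζ η : K} {r s : ℕ} {a b x y : ℕ → A} {e : A}

/-- The generators of index at least `p` other than `e`. -/
def wgens (p r s : ℕ) (a b x y : ℕ → A) : Set A :=
  {g | (∃ j, p ≤ j ∧ j + 1 < r ∧ g = a j) ∨ (∃ j, p ≤ j ∧ j + 1 < s ∧ g = b j) ∨
    (∃ j, p ≤ j ∧ j < r ∧ g = x j) ∨ (∃ j, p ≤ j ∧ j < s ∧ g = y j)}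

theorem wgens_symm (p r s : ℕ) (a b x y : ℕ → A) : wgens p s r b a y x = wgens p r s a b x y := by
  ext g
  constructor <;> rintro (h | h | h | h) <;>
    first
    | exact Or.inl h
    | exact Or.inr (Or.inl h)
    | exact Or.inr (Or.inr (Or.inl h))
    | exact Or.inr (Or.inr (Or.inr h))

theorem wgens_mono {p p' : ℕ} (h : p ≤ p') : wgens p' r s a b x y ⊆ wgens p r s a b x y := by
  rintro g (⟨j, h1, h2, rfl⟩ | ⟨j, h1, h2, rfl⟩ | ⟨j, h1, h2, rfl⟩ | ⟨j, h1, h2, rfl⟩)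
  · exact Or.inl ⟨j, by omega, h2, rfl⟩
  · exact Or.inr (Or.inl ⟨j, by omega, h2, rfl⟩)
  · exact Or.inr (Or.inr (Or.inl ⟨j, by omega, h2, rfl⟩))
  · exact Or.inr (Or.inr (Or.inr ⟨j, by omega, h2, rfl⟩))

/-- The subalgebra generated by `a j` for `p ≤ j`. -/
def aAlg (K : Type) [Field K] [Algebra K A] (p r : ℕ) (a : ℕ → A) : Subalgebra K A :=
  Algebra.adjoin K {g | ∃ j, p ≤ j ∧ j + 1 < r ∧ g = a j}

theorem a_mem_aAlg {p j : ℕ} (h : p ≤ j) (h' : j + 1 < r) : a j ∈ aAlg K p r a :=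
  Algebra.subset_adjoin ⟨j, h, h', rfl⟩

theorem asc_mem_aAlg {p l : ℕ} (h : p + l < r) : asc a p l ∈ aAlg K p r a := by
  induction l with
  | zero => exact one_mem _
  | succ l ih => exact mul_mem (ih (by omega)) (a_mem_aAlg (by omega) (by omega))

theorem commute_adjoin {S : Set A} {u h : A} (hh : h ∈ Algebra.adjoin K S) (hS : ∀ g ∈ S, u * g = g * u) :
    u * h = h * u := by
  induction hh using Algebra.adjoin_induction with
  | mem g hg => exact hS g hg
  | algebraMap k => exact (Algebra.commutes k u).symm
  | add g h _ _ h1 h2 => rw [mul_add, add_mul, h1, h2]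
  | mul g h _ _ h1 h2 => rw [← mul_assoc, h1, mul_assoc, h2, mul_assoc]

theorem adjoin_mul_mem {S : Set A} {B : Submodule K A} (hB : ∀ g ∈ S, ∀ v ∈ B, g * v ∈ B) {h v : A}
    (hh : h ∈ Algebra.adjoin K S) (hv : v ∈ B) : h * v ∈ B := by
  induction hh using Algebra.adjoin_induction generalizing v with
  | mem g hg => exact hB g hg v hv
  | algebraMap k => rw [Algebra.algebraMap_eq_smul_one, smul_mul_assoc, one_mul]; exact B.smul_mem k hv
  | add g h _ _ h1 h2 => rw [add_mul]; exact B.add_mem (h1 hv) (h2 hv)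
  | mul g h _ _ h1 h2 => rw [mul_assoc]; exact h1 (h2 hv)

theorem mul_adjoin_mem {S : Set A} {B : Submodule K A} (hB : ∀ g ∈ S, ∀ v ∈ B, v * g ∈ B) {h v : A}
    (hh : h ∈ Algebra.adjoin K S) (hv : v ∈ B) : v * h ∈ B := by
  induction hh using Algebra.adjoin_induction generalizing v with
  | mem g hg => exact hB g hg v hv
  | algebraMap k => rw [Algebra.algebraMap_eq_smul_one, mul_smul_comm, mul_one]; exact B.smul_mem k hv
  | add g h _ _ h1 h2 => rw [mul_add]; exact B.add_mem (h1 hv) (h2 hv)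
  | mul g h _ _ h1 h2 => rw [← mul_assoc]; exact h2 (h1 hv)

/-- The span of the products `h * (a 0 ⋯ a (i - 1))`, where `h` only involves generators of index at
least one. -/
def aCosets (K : Type) [Field K] [Algebra K A] (r : ℕ) (a : ℕ → A) : Submodule K A :=
  Submodule.span K {w | ∃ h ∈ aAlg K 1 r a, ∃ i < r, w = h * asc a 0 i}

theorem asc_mul_mem (W : Walled z ζ η r s a b x y e) {i l : ℕ} (hi : i < r) (hl : l + 1 < r) :
    asc a 0 i * a l ∈ aCosets K r a := by
  rcases Nat.lt_trichotomy (l + 1) i with h | h | h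
  · rw [← asc_shift W (by omega) (by omega) (by omega)]
    exact subset_span ⟨_, a_mem_aAlg (by omega) (by omega), i, hi, rfl⟩
  · subst h
    rw [asc, zero_add, mul_assoc, W.aq l hl, mul_add, mul_one, mul_smul_comm]
    refine Submodule.add_mem _ (Submodule.smul_mem _ _ (subset_span
      ⟨1, one_mem _, l + 1, hi, ?_⟩)) (subset_span ⟨1, one_mem _, l, by omega, by rw [one_mul]⟩)
    rw [one_mul, asc, zero_add]
  · rcases Nat.eq_or_lt_of_le (Nat.lt_succ_iff.1 h) with h | h
    · subst h
      exact subset_span ⟨1, one_mem _, i + 1, hl, by rw [one_mul, asc, zero_add]⟩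
    · rw [← commute_asc (u := a l) fun j _ hj => (W.acm j l (by omega) (by omega)).symm]
      exact subset_span ⟨_, a_mem_aAlg (by omega) hl, i, hi, rfl⟩

theorem aAlg_le (W : Walled z ζ η r s a b x y e) (hr : 0 < r) {h : A} (hh : h ∈ aAlg K 0 r a) :
    h ∈ aCosets K r a := by
  rw [← one_mul h]
  refine mul_adjoin_mem (S := {g | ∃ j, 0 ≤ j ∧ j + 1 < r ∧ g = a j}) ?_ hh
    (subset_span ⟨1, one_mem _, 0, hr, by rw [asc, one_mul]⟩)
  rintro _ ⟨l, -, hl, rfl⟩ v hv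
  induction hv using span_induction with
  | mem w hw =>
    obtain ⟨h, hh, i, hi, rfl⟩ := hw
    rw [mul_assoc]
    have := asc_mul_mem (K := K) W hi hl
    refine span_induction (p := fun v _ => h * v ∈ aCosets K r a) ?_ ?_ ?_ ?_ this
    · rintro _ ⟨h', hh', i, hi, rfl⟩
      exact subset_span ⟨_, mul_mem hh hh', i, hi, (mul_assoc _ _ _).symm⟩
    · rw [mul_zero]; exact Submodule.zero_mem _
    · intro v w _ _ hv hw; rw [mul_add]; exact Submodule.add_mem _ hv hw
    · intro k v _ hv; rw [mul_smul_comm]; exact Submodule.smul_mem _ _ hv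
  | zero => rw [zero_mul]; exact Submodule.zero_mem _
  | add v w _ _ hv hw => rw [add_mul]; exact Submodule.add_mem _ hv hw
  | smul k v _ hv => rw [smul_mul_assoc]; exact Submodule.smul_mem _ _ hv

/-- The span of the products of an element that only involves generators of index at least one, a
product of `x 0` and `y 0`, and the coset representatives `a 0 ⋯ a (i - 1)` and `b 0 ⋯ b (j - 1)`. -/
def cosets (K : Type) [Field K] [Algebra K A] (r s : ℕ) (a b x y : ℕ → A) : Submodule K A :=
  Submodule.span K {w | ∃ h ∈ Algebra.adjoin K (wgens 1 r s a b x y),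
    ∃ u ∈ Submonoid.closure {x 0, y 0}, ∃ i < r, ∃ j < s, w = h * u * (asc a 0 i * asc b 0 j)}

theorem cosets_symm (W : Walled z ζ η r s a b x y e) : cosets K s r b a y x = cosets K r s a b x y := by
  rw [cosets, cosets]
  congr 1
  ext w
  simp only [Set.mem_ofPred_eq, wgens_symm 1 r s a b x y, Set.pair_comm (y 0)]
  constructor
  · rintro ⟨h, hh, u, hu, i, hi, j, hj, rfl⟩
    exact ⟨h, hh, u, hu, j, hj, i, hi, by rw [asc_ab W (by omega) (by omega)]⟩
  · rintro ⟨h, hh, u, hu, i, hi, j, hj, rfl⟩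
    exact ⟨h, hh, u, hu, j, hj, i, hi, by rw [asc_ab W (by omega) (by omega)]⟩

theorem closure_comm {u v : A} (hu : u ∈ Submonoid.closure {x 0, y 0}) (h1 : x 0 * v = v * x 0)
    (h2 : y 0 * v = v * y 0) : u * v = v * u := by
  induction hu using Submonoid.closure_induction with
  | mem g hg => rcases hg with rfl | rfl <;> assumption
  | one => simp
  | mul g h _ _ h1 h2 => rw [mul_assoc, h2, ← mul_assoc, h1, mul_assoc]

theorem closure_anti {u v : A} (hu : u ∈ Submonoid.closure {x 0, y 0}) (h1 : x 0 * v = -(v * x 0))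
    (h2 : y 0 * v = -(v * y 0)) : u * v = v * u ∨ u * v = -(v * u) := by
  induction hu using Submonoid.closure_induction with
  | mem g hg => rcases hg with rfl | rfl <;> exact Or.inr (by assumption)
  | one => simp
  | mul g h _ _ h1 h2 =>
    rcases h1 with h1 | h1 <;> rcases h2 with h2 | h2
    · left; rw [mul_assoc, h2, ← mul_assoc, h1, mul_assoc]
    · right; rw [mul_assoc, h2, mul_neg, ← mul_assoc, h1, mul_assoc]
    · right; rw [mul_assoc, h2, ← mul_assoc, h1, neg_mul, mul_assoc]
    · left; rw [mul_assoc, h2, mul_neg, ← mul_assoc, h1, neg_mul, neg_neg, mul_assoc]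

theorem aAlg_le_adjoin : aAlg K 1 r a ≤ Algebra.adjoin K (wgens 1 r s a b x y) :=
  Algebra.adjoin_mono fun _ h => Or.inl h

theorem closure_aAlg (W : Walled z ζ η r s a b x y e) (hr : 0 < r) (hs : 0 < s) {u h : A}
    (hu : u ∈ Submonoid.closure {x 0, y 0}) (hh : h ∈ aAlg K 1 r a) : u * h = h * u := by
  refine commute_adjoin hh ?_
  rintro _ ⟨j, hj, hj', rfl⟩
  exact closure_comm hu (W.axc j 0 hj' hr (by omega) (by omega)).symm (W.ay j 0 hj' hs).symm

theorem span_mul_mem {S : Set A} {B : Submodule K A} {g : A} (h : ∀ w ∈ S, w * g ∈ B) :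
    ∀ v ∈ Submodule.span K S, v * g ∈ B := by
  intro v hv
  induction hv using span_induction with
  | mem w hw => exact h w hw
  | zero => rw [zero_mul]; exact Submodule.zero_mem _
  | add v w _ _ hv hw => rw [add_mul]; exact Submodule.add_mem _ hv hw
  | smul k v _ hv => rw [smul_mul_assoc]; exact Submodule.smul_mem _ _ hv

theorem cosets_a (W : Walled z ζ η r s a b x y e) (hr : 0 < r) (hs : 0 < s) {l : ℕ} (hl : l + 1 < r) :
    ∀ v ∈ cosets K r s a b x y, v * a l ∈ cosets K r s a b x y := by
  apply span_mul_mem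
  rintro _ ⟨h, hh, u, hu, i, hi, j, hj, rfl⟩
  have h1 : a l * asc b 0 j = asc b 0 j * a l := commute_asc fun m _ hm => W.ab l m hl (by omega)
  have h2 : h * u * (asc a 0 i * asc b 0 j) * a l = h * u * (asc a 0 i * a l) * asc b 0 j := by
    rw [mul_assoc, mul_assoc (asc a 0 i), ← h1]; simp only [mul_assoc]
  rw [h2]
  refine span_induction (p := fun v _ => h * u * v * asc b 0 j ∈ cosets K r s a b x y)
    ?_ ?_ ?_ ?_ (asc_mul_mem (K := K) W hi hl)
  · rintro _ ⟨h', hh', i, hi, rfl⟩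
    refine subset_span ⟨h * h', mul_mem hh (aAlg_le_adjoin hh'), u, hu, i, hi, j, hj, ?_⟩
    rw [mul_assoc h h', ← closure_aAlg W hr hs hu hh']
    simp only [mul_assoc]
  · simp
  · intro v w _ _ hv hw; rw [mul_add, add_mul]; exact Submodule.add_mem _ hv hw
  · intro k v _ hv; rw [mul_smul_comm, smul_mul_assoc]; exact Submodule.smul_mem _ _ hv

theorem cosets_x (W : Walled z ζ η r s a b x y e) (hr : 0 < r) (hs : 0 < s) {l : ℕ} (hl : l < r) :
    ∀ v ∈ cosets K r s a b x y, v * x l ∈ cosets K r s a b x y := by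
  induction l with
  | succ l ih =>
    intro v hv
    rw [show x (l + 1) = (a l - z • 1) * x l * a l by
      rw [← a_x W hl, mul_assoc, a_inv' W hl, mul_one], ← mul_assoc, ← mul_assoc]
    refine cosets_a W hr hs hl _ (ih (by omega) _ ?_)
    rw [mul_sub, mul_smul_comm, mul_one]
    exact Submodule.sub_mem _ (cosets_a W hr hs hl _ hv) (Submodule.smul_mem _ _ hv)
  | zero =>
    apply span_mul_mem
    rintro _ ⟨h, hh, u, hu, i, hi, j, hj, rfl⟩
    have h1 : x 0 * asc b 0 j = asc b 0 j * x 0 := commute_asc fun m _ hm => (W.bx m 0 (by omega) hr).symm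
    have h2 : h * u * (asc a 0 i * asc b 0 j) * x 0 = h * u * (asc a 0 i * x 0) * asc b 0 j := by
      rw [mul_assoc, mul_assoc (asc a 0 i), ← h1]; simp only [mul_assoc]
    have hux : u * x 0 ∈ Submonoid.closure {x 0, y 0} :=
      mul_mem hu (Submonoid.subset_closure (by simp))
    rw [h2]
    rcases i with _ | i
    · refine subset_span ⟨h, hh, u * x 0, hux, 0, hr, j, hj, ?_⟩
      rw [asc, one_mul, one_mul, mul_assoc h]
    · have hc : asc a 1 i * x 0 = x 0 * asc a 1 i :=
        (commute_asc fun m _ hm => (W.axc m 0 (by omega) hr (by omega) (by omega)).symm).symm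
      have hA : asc a 1 i ∈ aAlg K 1 r a := asc_mem_aAlg (by omega)
      have h3 : asc a 0 (i + 1) * x 0
          = x 1 * asc a 0 (i + 1) - z • (x 1 * asc a 1 i) + z • (asc a 1 i * x 0) := by
        rw [asc_succ_left, mul_assoc, hc, ← mul_assoc, a_x' W (by omega)]
        simp only [add_mul, sub_mul, smul_mul_assoc, mul_assoc, zero_add]
      have hx1 : x 1 ∈ Algebra.adjoin K (wgens 1 r s a b x y) :=
        Algebra.subset_adjoin (Or.inr (Or.inr (Or.inl ⟨1, le_rfl, by omega, rfl⟩)))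
      have key : ∀ v, h * (x 1 * u) * v * asc b 0 j ∈ cosets K r s a b x y →
          h * u * (x 1 * v) * asc b 0 j ∈ cosets K r s a b x y := by
        intro v hv
        rcases closure_anti hu (W.xx 0 1 hr (by omega) (by omega))
          (by rw [W.xy 1 0 (by omega) hs, neg_neg]) with h4 | h4
        · have : h * u * (x 1 * v) = h * (x 1 * u) * v := by rw [← h4]; simp only [mul_assoc]
          rwa [this]
        · have : h * u * (x 1 * v) = -(h * (x 1 * u) * v) := by
            rw [← neg_mul, ← mul_neg, ← h4]; simp only [mul_assoc]
          rw [this, neg_mul]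
          exact Submodule.neg_mem _ hv
      rw [h3, mul_add, mul_sub, add_mul, sub_mul, mul_smul_comm, mul_smul_comm, smul_mul_assoc,
        smul_mul_assoc]
      refine Submodule.add_mem _ (Submodule.sub_mem _ (key _ (subset_span
        ⟨h * x 1, mul_mem hh hx1, u, hu, i + 1, hi, j, hj, ?_⟩)) (Submodule.smul_mem _ _ (key _
        (subset_span ⟨h * x 1 * asc a 1 i, mul_mem (mul_mem hh hx1) (aAlg_le_adjoin hA), u, hu,
          0, hr, j, hj, ?_⟩)))) (Submodule.smul_mem _ _ (subset_span
          ⟨h * asc a 1 i, mul_mem hh (aAlg_le_adjoin hA), u * x 0, hux, 0, hr, j, hj, ?_⟩))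
      · simp only [mul_assoc]
      · have := closure_aAlg W hr hs hu hA
        rw [asc, one_mul, mul_assoc _ (asc a 1 i) u, ← this]
        simp only [mul_assoc]
      · have := closure_aAlg W hr hs hu hA
        rw [asc, one_mul, mul_assoc h (asc a 1 i), ← mul_assoc (asc a 1 i), ← this]
        simp only [mul_assoc]

theorem adjoin_le_cosets (W : Walled z ζ η r s a b x y e) (hr : 0 < r) (hs : 0 < s) {h : A}
    (hh : h ∈ Algebra.adjoin K (wgens 0 r s a b x y)) : h ∈ cosets K r s a b x y := by
  rw [← one_mul h]
  refine mul_adjoin_mem ?_ hh (subset_span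
    ⟨1, one_mem _, 1, one_mem _, 0, hr, 0, hs, by rw [asc, asc, one_mul, one_mul]⟩)
  rintro g (⟨j, h1, h2, rfl⟩ | ⟨j, h1, h2, rfl⟩ | ⟨j, h1, h2, rfl⟩ | ⟨j, h1, h2, rfl⟩)
  · exact cosets_a W hr hs h2
  · rw [← cosets_symm W]; exact cosets_a W.symm hs hr h2
  · exact cosets_x W hr hs h2
  · rw [← cosets_symm W]; exact cosets_x W.symm hs hr h2

theorem asc_nestE (W : Walled z ζ η r s a b x y e) {k j : ℕ} (hr : k ≤ r) (hs : k ≤ s) (hj : j < k) :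
    ∃ h ∈ aAlg K 0 r a, asc b 0 j * nestE a b e k = h * nestE a b e k := by
  induction j with
  | zero => exact ⟨1, one_mem _, rfl⟩
  | succ j ih =>
    obtain ⟨h, hh, h1⟩ := ih (by omega)
    refine ⟨(a j - z • 1) * h, mul_mem (sub_mem (a_mem_aAlg (by omega) (by omega))
      (Subalgebra.smul_mem _ (one_mem _) _)) hh, ?_⟩
    have hc : a j * asc b 0 j = asc b 0 j * a j := commute_asc fun m _ hm => W.ab j m (by omega) (by omega)
    rw [asc, zero_add, mul_assoc, b_nestE_eq W hr hs hj, ← mul_assoc, mul_sub, ← hc, mul_smul_comm,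
      mul_one, mul_assoc _ h, ← h1]
    simp only [sub_mul, smul_mul_assoc, one_mul, mul_assoc]

variable {B : Submodule K A}

theorem e_aAlg_nestE (W : Walled z ζ η r s a b x y e) (hr0 : 0 < r) (hs0 : 0 < s)
    (hL : ∀ g ∈ wgens 0 r s a b x y, ∀ v ∈ B, g * v ∈ B)
    {k : ℕ} (hr : k + 1 ≤ r) (hs : k + 1 ≤ s) (hE : nestE a b e (k + 1) ∈ B) {h : A} (hh : h ∈ aAlg K 0 r a) :
    e * h * nestE a b e (k + 1) ∈ B ∧ e * x 0 * h * nestE a b e (k + 1) ∈ B := by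
  have h0 := aAlg_le W hr0 hh
  have hLA : ∀ h ∈ aAlg K 1 r a, ∀ v ∈ B, h * v ∈ B := fun h hh v hv =>
    adjoin_mul_mem (fun g hg v hv => hL g (wgens_mono (Nat.zero_le 1) (Or.inl hg)) v hv) hh hv
  clear hh
  induction h0 using span_induction with
  | zero => simp
  | add v w _ _ hv hw =>
    simp only [mul_add, add_mul]
    exact ⟨B.add_mem hv.1 hw.1, B.add_mem hv.2 hw.2⟩
  | smul c v _ hv =>
    simp only [mul_smul_comm, smul_mul_assoc]
    exact ⟨B.smul_mem _ hv.1, B.smul_mem _ hv.2⟩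
  | mem w hw =>
    obtain ⟨h, hh, i, hi, rfl⟩ := hw
    have h1 : e * h = h * e := by
      refine commute_adjoin hh ?_
      rintro _ ⟨j, hj, hj', rfl⟩
      exact W.ea j (by omega) hj'
    have h2 : x 0 * h = h * x 0 := by
      refine commute_adjoin hh ?_
      rintro _ ⟨j, hj, hj', rfl⟩
      exact (W.axc j 0 hj' hr0 (by omega) (by omega)).symm
    have e1 : e * (h * asc a 0 i) * nestE a b e (k + 1) = h * (e * asc a 0 i * nestE a b e (k + 1)) := by
      rw [← mul_assoc, h1]; simp only [mul_assoc]
    have e2 : e * x 0 * (h * asc a 0 i) * nestE a b e (k + 1)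
        = h * (e * x 0 * asc a 0 i * nestE a b e (k + 1)) := by
      rw [← mul_assoc, mul_assoc e, h2, ← mul_assoc, h1]; simp only [mul_assoc]
    rw [e1, e2]
    suffices e * asc a 0 i * nestE a b e (k + 1) ∈ B ∧ e * x 0 * asc a 0 i * nestE a b e (k + 1) ∈ B from
      ⟨hLA _ hh _ this.1, hLA _ hh _ this.2⟩
    obtain ⟨w, hw⟩ : ∃ w, nestE a b e (k + 1) = e * w := ⟨_, by rw [nestE, mul_assoc, mul_assoc]⟩
    rcases i with _ | i
    · rw [asc, mul_one, mul_one, hw, ← mul_assoc, ← mul_assoc, W.ee, W.exe hr0 hs0, zero_mul]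
      exact ⟨B.zero_mem, B.zero_mem⟩
    · have h3 : e * asc a 1 i = asc a 1 i * e := commute_asc fun j hj hj' => W.ea j (by omega) (by omega)
      have e3 : e * asc a 0 (i + 1) * nestE a b e (k + 1) = asc a 1 i * nestE a b e (k + 1) := by
        calc e * asc a 0 (i + 1) * nestE a b e (k + 1) = e * a 0 * (asc a 1 i * e) * w := by
              rw [asc_succ_left, hw]; simp only [mul_assoc]
          _ = e * a 0 * e * asc a 1 i * w := by rw [← h3]; simp only [mul_assoc]
          _ = _ := by rw [W.eae (by omega), h3, hw]; simp only [mul_assoc]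
      have e4 : e * x 0 * asc a 0 (i + 1) * nestE a b e (k + 1)
          = x 1 * (asc a 1 i * nestE a b e (k + 1)) := by
        calc e * x 0 * asc a 0 (i + 1) * nestE a b e (k + 1) = e * (x 0 * a 0) * (asc a 1 i * e) * w := by
              rw [asc_succ_left, hw]; simp only [mul_assoc]
          _ = e * a 0 * (x 1 * e) * asc a 1 i * w := by
              rw [← h3, ← W.ax 0 (by omega)]; simp only [mul_assoc, zero_add]
          _ = e * a 0 * e * (x 1 * asc a 1 i) * w := by
              rw [W.xec 1 (by omega) (by omega)]; simp only [mul_assoc]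
          _ = (e * x 1) * asc a 1 i * w := by rw [W.eae (by omega)]; simp only [mul_assoc]
          _ = x 1 * (e * asc a 1 i) * w := by
              rw [← W.xec 1 (by omega) (by omega)]; simp only [mul_assoc]
          _ = _ := by rw [h3, hw]; simp only [mul_assoc]
      rw [e3, e4]
      have := hLA _ (asc_mem_aAlg (p := 1) (l := i) (by omega)) _ hE
      exact ⟨this, hL _ (Or.inr (Or.inr (Or.inl ⟨1, by omega, by omega, rfl⟩))) _ this⟩

theorem asc_split (k l p : ℕ) : asc a p (k + l) = asc a p k * asc a (p + k) l := by
  induction l with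
  | zero => simp [asc]
  | succ l ih => rw [← add_assoc, asc, ih, asc, mul_assoc, add_assoc]

theorem e_asc_nestE (W : Walled z ζ η r s a b x y e) (hr0 : 0 < r) (hs0 : 0 < s)
    (hL : ∀ g ∈ wgens 0 r s a b x y, ∀ v ∈ B, g * v ∈ B)
    (hR : ∀ g ∈ wgens 0 r s a b x y, ∀ v ∈ B, v * g ∈ B)
    (hE : ∀ k, k ≤ r → k ≤ s → nestE a b e k ∈ B) {k i j : ℕ} (hr : k ≤ r) (hs : k ≤ s) (hi : i < r)
    (hj : j < s) :
    e * (asc a 0 i * asc b 0 j) * nestE a b e k ∈ B ∧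
      e * x 0 * (asc a 0 i * asc b 0 j) * nestE a b e k ∈ B := by
  rcases Nat.lt_or_ge j k with hjk | hjk
  · obtain ⟨m, rfl⟩ : ∃ m, k = m + 1 := ⟨k - 1, by omega⟩
    obtain ⟨h, hh, h1⟩ := asc_nestE (K := K) W hr hs hjk
    have := e_aAlg_nestE W hr0 hs0 hL hr hs (hE _ hr hs) (mul_mem (asc_mem_aAlg (by omega)) hh :
      asc a 0 i * h ∈ aAlg K 0 r a)
    simp only [mul_assoc] at this h1 ⊢
    rwa [h1]
  rcases Nat.lt_or_ge i k with hik | hik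
  · obtain ⟨m, rfl⟩ : ∃ m, k = m + 1 := ⟨k - 1, by omega⟩
    obtain ⟨h, hh, h1⟩ := asc_nestE (K := K) W.symm hs hr hik
    rw [nestE_symm W hr hs] at h1
    have := e_aAlg_nestE (B := B) W.symm hs0 hr0 (by rw [wgens_symm]; exact hL) hs hr
      (by rw [nestE_symm W hr hs]; exact hE _ hr hs) (mul_mem (asc_mem_aAlg (by omega)) hh :
      asc b 0 j * h ∈ aAlg K 0 s b)
    rw [nestE_symm W hr hs, ← W.ex hr0 hs0] at this
    rw [asc_ab W (by omega) (by omega)]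
    simp only [mul_assoc] at this h1 ⊢
    rwa [h1]
  obtain ⟨i, rfl⟩ := Nat.exists_eq_add_of_le hik
  obtain ⟨j, rfl⟩ := Nat.exists_eq_add_of_le hjk
  set t := asc a k i * asc b k j
  have hsa : asc a k i * nestE a b e k = nestE a b e k * asc a k i :=
    (commute_asc fun m hm hm' => (a_nestE W hr hs hm (by omega)).symm).symm
  have hsb : asc b k j * nestE a b e k = nestE a b e k * asc b k j :=
    (commute_asc fun m hm hm' => (b_nestE W hr hs hm (by omega)).symm).symm
  have hab : asc a k i * asc b 0 k = asc b 0 k * asc a k i := asc_ab W (by omega) (by omega)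
  have h1 : asc a 0 (k + i) * asc b 0 (k + j) * nestE a b e k
      = asc a 0 k * asc b 0 k * nestE a b e k * t := by
    rw [asc_split, asc_split, zero_add]
    calc asc a 0 k * asc a k i * (asc b 0 k * asc b k j) * nestE a b e k
        = asc a 0 k * (asc a k i * asc b 0 k) * (asc b k j * nestE a b e k) := by simp only [mul_assoc]
      _ = asc a 0 k * asc b 0 k * (asc a k i * nestE a b e k) * asc b k j := by
          rw [hab, hsb]; simp only [mul_assoc]
      _ = _ := by rw [hsa]; simp only [mul_assoc, t]
  have hRA : ∀ h ∈ Algebra.adjoin K (wgens 0 r s a b x y), ∀ v ∈ B, v * h ∈ B := fun h hh v hv =>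
    mul_adjoin_mem hR hh hv
  have ht : t ∈ Algebra.adjoin K (wgens 0 r s a b x y) := by
    refine mul_mem ?_ ?_
    · exact Algebra.adjoin_mono (fun g hg => by
        obtain ⟨m, h1, h2, rfl⟩ := hg; exact Or.inl ⟨m, by omega, h2, rfl⟩) (asc_mem_aAlg (by omega))
    · exact Algebra.adjoin_mono (fun g hg => by
        obtain ⟨m, h1, h2, rfl⟩ := hg; exact Or.inr (Or.inl ⟨m, by omega, h2, rfl⟩))
        (asc_mem_aAlg (by omega))
  have e1 : e * (asc a 0 (k + i) * asc b 0 (k + j)) * nestE a b e k = nestE a b e (k + 1) * t := by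
    rw [mul_assoc, h1, nestE]; simp only [mul_assoc]
  have hxb : x k * asc b 0 k = asc b 0 k * x k :=
    commute_asc fun m _ hm => (W.bx m k (by omega) (by omega)).symm
  have e2 : e * x 0 * (asc a 0 (k + i) * asc b 0 (k + j)) * nestE a b e k
      = nestE a b e (k + 1) * x k * t := by
    calc e * x 0 * (asc a 0 (k + i) * asc b 0 (k + j)) * nestE a b e k
        = e * (x 0 * asc a 0 k) * asc b 0 k * nestE a b e k * t := by
          rw [mul_assoc, h1]; simp only [mul_assoc]
      _ = e * asc a 0 k * (x k * asc b 0 k) * nestE a b e k * t := by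
          rw [← asc_x W (by omega)]; simp only [mul_assoc]
      _ = e * asc a 0 k * asc b 0 k * (x k * nestE a b e k) * t := by
          rw [hxb]; simp only [mul_assoc]
      _ = _ := by rw [x_nestE W hr hs le_rfl (by omega), nestE]; simp only [mul_assoc]
  rw [e1, e2]
  have hE' := hE (k + 1) (by omega) (by omega)
  exact ⟨hRA _ ht _ hE', hRA _ ht _ (hR _ (Or.inr (Or.inr (Or.inl ⟨k, by omega, by omega, rfl⟩))) _ hE')⟩

theorem e_closure (W : Walled z ζ η r s a b x y e) (hr : 0 < r) (hs : 0 < s) {u : A}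
    (hu : u ∈ Submonoid.closure {x 0, y 0}) :
    ∃ c : K, e * u = c • e ∨ e * u = c • (e * x 0) := by
  induction hu using Submonoid.closure_induction_right with
  | one => exact ⟨1, Or.inl (by simp)⟩
  | mul_right u hu v hv ih =>
    obtain ⟨c, h | h⟩ := ih
    · refine ⟨c, Or.inr ?_⟩
      rcases hv with rfl | rfl
      · rw [← mul_assoc, h, smul_mul_assoc]
      · rw [← mul_assoc, h, smul_mul_assoc, W.ex hr hs]
    · rcases hv with rfl | rfl
      · refine ⟨c * ζ, Or.inl ?_⟩
        rw [← mul_assoc, h, smul_mul_assoc, mul_assoc, W.xsq 0 hr, mul_smul_comm, mul_one, smul_smul]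
      · refine ⟨-(c * ζ), Or.inl ?_⟩
        rw [← mul_assoc, h, smul_mul_assoc, mul_assoc, W.xy 0 0 hr hs, mul_neg, ← mul_assoc, ← W.ex hr hs,
          mul_assoc, W.xsq 0 hr, mul_smul_comm, mul_one, smul_neg, smul_smul, neg_smul]

theorem e_adjoin_nestE (W : Walled z ζ η r s a b x y e) (hr0 : 0 < r) (hs0 : 0 < s)
    (hL : ∀ g ∈ wgens 0 r s a b x y, ∀ v ∈ B, g * v ∈ B)
    (hR : ∀ g ∈ wgens 0 r s a b x y, ∀ v ∈ B, v * g ∈ B)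
    (hE : ∀ k, k ≤ r → k ≤ s → nestE a b e k ∈ B) {k : ℕ} (hr : k ≤ r) (hs : k ≤ s) {h : A}
    (hh : h ∈ Algebra.adjoin K (wgens 0 r s a b x y)) : e * h * nestE a b e k ∈ B := by
  have h0 := adjoin_le_cosets W hr0 hs0 hh
  clear hh
  induction h0 using span_induction with
  | zero => simp
  | add v w _ _ hv hw => simp only [mul_add, add_mul]; exact B.add_mem hv hw
  | smul c v _ hv => simp only [mul_smul_comm, smul_mul_assoc]; exact B.smul_mem _ hv
  | mem w hw =>
    obtain ⟨h, hh, u, hu, i, hi, j, hj, rfl⟩ := hw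
    have h1 : e * h = h * e := by
      refine commute_adjoin hh ?_
      rintro g (⟨j, h1, h2, rfl⟩ | ⟨j, h1, h2, rfl⟩ | ⟨j, h1, h2, rfl⟩ | ⟨j, h1, h2, rfl⟩)
      · exact W.ea j (by omega) h2
      · exact W.eb j (by omega) h2
      · exact (W.xec j (by omega) h2).symm
      · exact (W.yec j (by omega) h2).symm
    have h2 : e * (h * u * (asc a 0 i * asc b 0 j)) * nestE a b e k
        = h * (e * u * (asc a 0 i * asc b 0 j) * nestE a b e k) := by
      rw [mul_assoc h u, ← mul_assoc e, h1]; simp only [mul_assoc]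
    rw [h2]
    refine adjoin_mul_mem hL (Algebra.adjoin_mono (wgens_mono (Nat.zero_le 1)) hh) ?_
    have h3 := e_asc_nestE W hr0 hs0 hL hR hE hr hs hi hj
    obtain ⟨c, h | h⟩ := e_closure W hr0 hs0 hu
    · rw [h, smul_mul_assoc, smul_mul_assoc]; exact B.smul_mem _ h3.1
    · rw [h, smul_mul_assoc, smul_mul_assoc]; exact B.smul_mem _ h3.2

end walled

/-! ### Bounding the dimension of the walled Brauer-Clifford superalgebra -/

section clif
variable {K M : Type} [Field K] [AddCommGroup M] [Module K M]
  {C T : ℕ → Module.End K M} {z ζ : K} {s : ℕ} {Y : Submodule K M}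

theorem clos_induction {ι : Type} (g : ι → Module.End K M) (h0 : ∀ i, ∀ v ∈ Y, g i v ∈ clos T s Y)
    (h1 : ∀ i j, j + 1 < s → ∀ v, (∀ i', g i' v ∈ clos T s Y) → g i (T j v) ∈ clos T s Y) (i : ι) {v : M}
    (hv : v ∈ clos T s Y) : g i v ∈ clos T s Y := by
  have : clos T s Y ≤ ⨅ i, (clos T s Y).comap (g i) := by
    refine clos_le (fun v hv => ?_) fun j hj v hv => ?_
    · rw [Submodule.mem_iInf]; exact fun i => h0 i v hv
    · rw [Submodule.mem_comap, Submodule.mem_iInf]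
      exact fun i => h1 i j hj v fun i' => (Submodule.mem_iInf _).1 hv i'
  exact (Submodule.mem_iInf _).1 (this hv) i

theorem clos_commute {g : Module.End K M} (h0 : ∀ v ∈ Y, g v ∈ clos T s Y)
    (h1 : ∀ j, j + 1 < s → ∀ v, g (T j v) = T j (g v)) {v : M} (hv : v ∈ clos T s Y) :
    g v ∈ clos T s Y :=
  clos_induction (fun _ : Unit => g) (fun _ => h0)
    (fun i j hj v hv => by
      have : T j (g v) ∈ clos T s Y := clos_stable hj (hv ())
      rwa [h1 j hj v]) () hv

/-- The sum of the images of `Y` under ordered products of distinct operators. -/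
def clif (C : ℕ → Module.End K M) (Y : Submodule K M) : ℕ → Submodule K M
  | 0 => Y
  | m + 1 => clif C Y m ⊔ (clif C Y m).map (C m)

theorem le_clif (m : ℕ) : Y ≤ clif C Y m := by
  induction m with
  | zero => exact le_rfl
  | succ m ih => exact ih.trans le_sup_left

theorem clif_le {U : Submodule K M} (h0 : Y ≤ U) {m : ℕ} (h1 : ∀ j < m, ∀ v ∈ U, C j v ∈ U) :
    clif C Y m ≤ U := by
  induction m with
  | zero => exact h0
  | succ m ih =>
    have := ih fun j hj => h1 j (by omega)
    refine sup_le this ?_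
    rintro _ ⟨v, hv, rfl⟩
    exact h1 m (by omega) v (this hv)

theorem clif_stable {m j : ℕ} (hj : j < m) (h1 : ∀ i j, i < m → j < m → i ≠ j → ∀ v, C i (C j v) = -C j (C i v))
    (h2 : ∀ i, i < m → ∀ v, C i (C i v) = ζ • v) {v : M} (hv : v ∈ clif C Y m) : C j v ∈ clif C Y m := by
  induction m generalizing v with
  | zero => omega
  | succ m ih =>
    obtain ⟨v1, hv1, _, ⟨v2, hv2, rfl⟩, rfl⟩ := Submodule.mem_sup.1 hv
    rw [map_add]
    rcases Nat.lt_or_ge j m with h | h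
    · have ih' := fun {v} hv => ih (v := v) h (fun i j hi hj => h1 i j (by omega) (by omega))
        (fun i hi => h2 i (by omega)) hv
      refine Submodule.add_mem_sup (ih' hv1) ?_
      rw [h1 j m (by omega) (by omega) (by omega)]
      exact Submodule.neg_mem _ ⟨_, ih' hv2, rfl⟩
    · obtain rfl : j = m := by omega
      rw [h2 j (by omega), add_comm (C j v1)]
      exact Submodule.add_mem_sup (Submodule.smul_mem _ _ hv2) (Submodule.mem_map_of_mem (f := C j) hv1)

theorem DimLE_clif {c : ℕ} (h : DimLE Y c) (m : ℕ) : DimLE (clif C Y m) (2 ^ m * c) := by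
  induction m with
  | zero => simpa [clif] using h
  | succ m ih =>
    have := ih.sup (ih.map (C m))
    rwa [← two_mul, ← mul_assoc, ← pow_succ'] at this

theorem clif_commute {g : Module.End K M} {m : ℕ} (h0 : ∀ v ∈ Y, g v ∈ clif C Y m)
    (hC : ∀ j < m, ∀ v ∈ clif C Y m, C j v ∈ clif C Y m)
    (h1 : ∀ j < m, ∀ v, g (C j v) = C j (g v)) {v : M} (hv : v ∈ clif C Y m) : g v ∈ clif C Y m := by
  have : clif C Y m ≤ (clif C Y m).comap g := clif_le h0 fun j hj v hv => by
    rw [Submodule.mem_comap, h1 j hj]; exact hC j hj _ hv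
  exact this hv

theorem DimLE.le {c c' : ℕ} (h : DimLE Y c) (hc : c ≤ c') : DimLE Y c' := by
  obtain ⟨f, hf⟩ := h
  refine ⟨fun i => if h : i.1 < c then f ⟨i, h⟩ else 0, hf.trans (Submodule.span_mono ?_)⟩
  rintro _ ⟨i, rfl⟩
  exact ⟨⟨i, by omega⟩, by simp⟩

theorem DimLE_sup (Z : ℕ → Submodule K M) (c : ℕ → ℕ) (S : Finset ℕ) (h : ∀ k ∈ S, DimLE (Z k) (c k)) :
    DimLE (S.sup Z) (∑ k ∈ S, c k) := by
  induction S using Finset.induction_on with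
  | empty => simpa using DimLE_bot
  | insert k S hk ih =>
    rw [Finset.sup_insert, sum_insert hk]
    exact (h k (by simp)).sup (ih fun k hk => h k (by simp [hk]))

end clif

section walled
variable {K A : Type} [Field K] [Ring A] [Algebra K A] {z ζ η : K} {r s : ℕ} {a b x y : ℕ → A} {e : A}

local notation "lm" => LinearMap.mulLeft K
local notation "rm" => LinearMap.mulRight K

theorem Walled.hecke_left (W : Walled z ζ η r s a b x y e) : HeckeOps (fun j => lm (a j)) z r where
  quad j hj := by
    ext v; simp only [Module.End.mul_apply, LinearMap.add_apply, LinearMap.smul_apply,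
      LinearMap.mulLeft_apply, Module.End.one_apply]
    rw [← mul_assoc, W.aq j hj, add_mul, smul_mul_assoc, one_mul]
  braid j hj := by
    ext v; simp only [Module.End.mul_apply, LinearMap.mulLeft_apply]
    simp only [← mul_assoc]; rw [W.abr j hj]
  comm i j hij hj := by
    ext v; simp only [Module.End.mul_apply, LinearMap.mulLeft_apply]
    rw [← mul_assoc, W.acm i j hij hj, mul_assoc]

theorem Walled.hecke_right (W : Walled z ζ η r s a b x y e) : HeckeOps (fun j => rm (a j)) z r where
  quad j hj := by
    ext v; simp only [Module.End.mul_apply, LinearMap.add_apply, LinearMap.smul_apply,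
      LinearMap.mulRight_apply, Module.End.one_apply]
    rw [mul_assoc, W.aq j hj, mul_add, mul_smul_comm, mul_one]
  braid j hj := by
    ext v; simp only [Module.End.mul_apply, LinearMap.mulRight_apply]
    rw [mul_assoc, mul_assoc, mul_assoc, mul_assoc, ← mul_assoc (a j), W.abr j hj, mul_assoc (a (j + 1))]
  comm i j hij hj := by
    ext v; simp only [Module.End.mul_apply, LinearMap.mulRight_apply]
    rw [mul_assoc, ← W.acm i j hij hj, mul_assoc]

theorem x_a_mem (W : Walled z ζ η r s a b x y e) {U : Submodule K A} {j i : ℕ} (hj : j + 1 < r) (hi : i < r)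
    (hU : ∀ v ∈ U, a j * v ∈ U) {v : A} (hv : ∀ i < r, x i * v ∈ U) : x i * (a j * v) ∈ U := by
  rw [← mul_assoc]
  by_cases h1 : i = j
  · subst h1; rw [← W.ax i hj, mul_assoc]; exact hU _ (hv _ hj)
  by_cases h2 : i = j + 1
  · subst h2
    have := a_x' W hj
    rw [show x (j + 1) * a j = a j * x j + z • x (j + 1) - z • x j by rw [this]; abel, sub_mul, add_mul,
      smul_mul_assoc, smul_mul_assoc, mul_assoc]
    exact U.sub_mem (U.add_mem (hU _ (hv _ (by omega))) (U.smul_mem _ (hv _ hj)))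
      (U.smul_mem _ (hv _ (by omega)))
  · rw [← W.axc j i hj hi h1 h2, mul_assoc]; exact hU _ (hv _ hi)

theorem a_x_mem (W : Walled z ζ η r s a b x y e) {U : Submodule K A} {j i : ℕ} (hj : j + 1 < r) (hi : i < r)
    (hU : ∀ v ∈ U, v * a j ∈ U) {v : A} (hv : ∀ i < r, v * x i ∈ U) : v * a j * x i ∈ U := by
  rw [mul_assoc]
  by_cases h1 : i = j
  · subst h1
    rw [a_x' W hj, mul_add, mul_sub, mul_smul_comm, mul_smul_comm, ← mul_assoc]
    exact U.add_mem (U.sub_mem (hU _ (hv _ (by omega))) (U.smul_mem _ (hv _ hj)))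
      (U.smul_mem _ (hv _ (by omega)))
  by_cases h2 : i = j + 1
  · subst h2; rw [W.ax j hj, ← mul_assoc]; exact hU _ (hv _ (by omega))
  · rw [W.axc j i hj hi h1 h2, ← mul_assoc]; exact hU _ (hv _ hi)

/-- The bimodule generated by the element with `k` nested caps and cups. -/
theorem exists_bimodule (W : Walled z ζ η r s a b x y e) {k : ℕ} (hr : k ≤ r) (hs : k ≤ s) :
    ∃ Z : Submodule K A, DimLE Z (r.choose k * (s.choose k * (r.factorial * (2 ^ r * (s.factorial * (2 ^ s * 1)))))) ∧
      nestE a b e k ∈ Z ∧ (∀ g ∈ wgens 0 r s a b x y, ∀ v ∈ Z, g * v ∈ Z) ∧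
      (∀ g ∈ wgens 0 r s a b x y, ∀ v ∈ Z, v * g ∈ Z) ∧
      ∀ U : Submodule K A, nestE a b e k ∈ U → (∀ g ∈ wgens 0 r s a b x y, ∀ v ∈ U, g * v ∈ U) →
        (∀ g ∈ wgens 0 r s a b x y, ∀ v ∈ U, v * g ∈ U) → Z ≤ U := by
  set E := nestE a b e k
  set Y1 := clif (fun j => rm (y j)) (Submodule.span K {E}) s
  set Y2 := clos (fun j => rm (b j)) s Y1
  set Y3 := clif (fun j => lm (x j)) Y2 r
  set Y4 := clos (fun j => lm (a j)) r Y3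
  set Y5 := clos (fun j => lm (b j)) s Y4
  set Y6 := clos (fun j => rm (a j)) r Y5
  have min4 : ∀ U : Submodule K A, E ∈ U → (∀ j < s, ∀ v ∈ U, v * y j ∈ U) →
      (∀ j, j + 1 < s → ∀ v ∈ U, v * b j ∈ U) → (∀ j < r, ∀ v ∈ U, x j * v ∈ U) →
      (∀ j, j + 1 < r → ∀ v ∈ U, a j * v ∈ U) → Y4 ≤ U := fun U h0 h1 h2 h3 h4 =>
    clos_le (clif_le (clos_le (clif_le (by rwa [Submodule.span_singleton_le_iff_mem]) h1) h2) h3) h4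
  have ry1 : ∀ j < s, ∀ v ∈ Y1, v * y j ∈ Y1 := fun j hj v hv =>
    clif_stable (C := fun j => rm (y j)) (ζ := η) hj
      (fun i j hi hj hij v => by
        simp only [LinearMap.mulRight_apply]
        rw [mul_assoc, mul_assoc, W.yy i j hi hj hij, mul_neg, neg_neg])
      (fun i hi v => by
        simp only [LinearMap.mulRight_apply]
        rw [mul_assoc, W.ysq i hi, mul_smul_comm, mul_one]) hv
  have rb2 : ∀ j, j + 1 < s → ∀ v ∈ Y2, v * b j ∈ Y2 := fun j hj v hv => clos_stable (T := fun j => rm (b j)) hj hv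
  have ry2 : ∀ j < s, ∀ v ∈ Y2, v * y j ∈ Y2 := fun j hj v hv =>
    clos_induction (T := fun j => rm (b j)) (fun i : Fin s => rm (y i)) (fun i v hv => le_clos (ry1 i i.2 v hv))
      (fun i j hj v hv => a_x_mem W.symm hj i.2 (rb2 j hj) fun i hi => hv ⟨i, hi⟩) ⟨j, hj⟩ hv
  have lx3 : ∀ j < r, ∀ v ∈ Y3, x j * v ∈ Y3 := fun j hj v hv =>
    clif_stable (C := fun j => lm (x j)) (ζ := ζ) hj
      (fun i j hi hj hij v => by
        simp only [LinearMap.mulLeft_apply]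
        rw [← mul_assoc, ← mul_assoc, W.xx i j hi hj hij, neg_mul])
      (fun i hi v => by
        simp only [LinearMap.mulLeft_apply]
        rw [← mul_assoc, W.xsq i hi, smul_mul_assoc, one_mul]) hv
  have r3 : ∀ g, (∀ v ∈ Y2, v * g ∈ Y2) → ∀ v ∈ Y3, v * g ∈ Y3 := fun g hg v hv =>
    clif_commute (C := fun j => lm (x j)) (g := rm g) (fun v hv => le_clif r (hg v hv)) lx3
      (fun j hj v => by simp only [LinearMap.mulLeft_apply, LinearMap.mulRight_apply, mul_assoc]) hv
  have r4 : ∀ g, (∀ v ∈ Y2, v * g ∈ Y2) → ∀ v ∈ Y4, v * g ∈ Y4 := fun g hg v hv =>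
    clos_commute (T := fun j => lm (a j)) (g := rm g) (fun v hv => le_clos (r3 g hg v hv))
      (fun j hj v => by simp only [LinearMap.mulLeft_apply, LinearMap.mulRight_apply, mul_assoc]) hv
  have rb4 := fun j hj => r4 _ (rb2 j hj)
  have ry4 := fun j hj => r4 _ (ry2 j hj)
  have la4 : ∀ j, j + 1 < r → ∀ v ∈ Y4, a j * v ∈ Y4 := fun j hj v hv => clos_stable (T := fun j => lm (a j)) hj hv
  have lx4 : ∀ j < r, ∀ v ∈ Y4, x j * v ∈ Y4 := fun j hj v hv =>
    clos_induction (T := fun j => lm (a j)) (fun i : Fin r => lm (x i)) (fun i v hv => le_clos (lx3 i i.2 v hv))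
      (fun i j hj v hv => x_a_mem W hj i.2 (la4 j hj) fun i hi => hv ⟨i, hi⟩) ⟨j, hj⟩ hv
  have E4 : E ∈ Y4 :=
    le_clos (le_clif _ (le_clos (le_clif _ (Submodule.mem_span_singleton_self E))))
  have lb4 : ∀ j, j + 1 < s → j + 1 ≠ k → ∀ v ∈ Y4, b j * v ∈ Y4 := by
    intro j hj hjk v hv
    refine min4 (Y4.comap (lm (b j))) ?_ ?_ ?_ ?_ ?_ hv
    · change b j * E ∈ Y4
      rcases Nat.lt_or_ge (j + 1) k with h | h
      · rw [b_nestE_eq W hr hs h, sub_mul, smul_mul_assoc, one_mul]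
        exact Y4.sub_mem (la4 j (by omega) _ E4) (Y4.smul_mem _ E4)
      · rw [b_nestE W hr hs (by omega) hj]; exact rb4 j hj _ E4
    · intro i hi v hv; change b j * (v * y i) ∈ Y4; rw [← mul_assoc]; exact ry4 i hi _ hv
    · intro i hi v hv; change b j * (v * b i) ∈ Y4; rw [← mul_assoc]; exact rb4 i hi _ hv
    · intro i hi v hv; change b j * (x i * v) ∈ Y4
      rw [← mul_assoc, W.bx j i hj hi, mul_assoc]; exact lx4 i hi _ hv
    · intro i hi v hv; change b j * (a i * v) ∈ Y4
      rw [← mul_assoc, ← W.ab i j hi hj, mul_assoc]; exact la4 i hi _ hv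
  have ly4 : ∀ j < s, ∀ v ∈ Y4, y j * v ∈ Y4 := by
    intro j hj v hv
    refine min4 (Y4.comap (lm (y j))) ?_ ?_ ?_ ?_ ?_ hv
    · change y j * E ∈ Y4
      rcases Nat.lt_or_ge j k with h | h
      · rw [← x_nestE_eq W hr hs h]; exact lx4 j (by omega) _ E4
      · rw [y_nestE W hr hs h hj]; exact ry4 j hj _ E4
    · intro i hi v hv; change y j * (v * y i) ∈ Y4; rw [← mul_assoc]; exact ry4 i hi _ hv
    · intro i hi v hv; change y j * (v * b i) ∈ Y4; rw [← mul_assoc]; exact rb4 i hi _ hv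
    · intro i hi v hv; change y j * (x i * v) ∈ Y4
      rw [← mul_assoc, W.symm.xy j i hj hi, neg_mul, mul_assoc]; exact Y4.neg_mem (lx4 i hi _ hv)
    · intro i hi v hv; change y j * (a i * v) ∈ Y4
      rw [← mul_assoc, ← W.ay i j hi hj, mul_assoc]; exact la4 i hi _ hv
  have lb5 : ∀ j, j + 1 < s → ∀ v ∈ Y5, b j * v ∈ Y5 := fun j hj v hv => clos_stable (T := fun j => lm (b j)) hj hv
  have la5 : ∀ j, j + 1 < r → ∀ v ∈ Y5, a j * v ∈ Y5 := fun j hj v hv =>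
    clos_commute (T := fun j => lm (b j)) (g := lm (a j)) (fun v hv => le_clos (la4 j hj v hv))
      (fun i hi v => by
        simp only [LinearMap.mulLeft_apply]; rw [← mul_assoc, W.ab j i hj hi, mul_assoc]) hv
  have lx5 : ∀ j < r, ∀ v ∈ Y5, x j * v ∈ Y5 := fun j hj v hv =>
    clos_commute (T := fun j => lm (b j)) (g := lm (x j)) (fun v hv => le_clos (lx4 j hj v hv))
      (fun i hi v => by
        simp only [LinearMap.mulLeft_apply]; rw [← mul_assoc, ← W.bx i j hi hj, mul_assoc]) hv
  have ly5 : ∀ j < s, ∀ v ∈ Y5, y j * v ∈ Y5 := fun j hj v hv =>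
    clos_induction (T := fun j => lm (b j)) (fun i : Fin s => lm (y i)) (fun i v hv => le_clos (ly4 i i.2 v hv))
      (fun i j hj v hv => x_a_mem W.symm hj i.2 (lb5 j hj) fun i hi => hv ⟨i, hi⟩) ⟨j, hj⟩ hv
  have r5 : ∀ g, (∀ v ∈ Y4, v * g ∈ Y4) → ∀ v ∈ Y5, v * g ∈ Y5 := fun g hg v hv =>
    clos_commute (T := fun j => lm (b j)) (g := rm g) (fun v hv => le_clos (hg v hv))
      (fun j hj v => by simp only [LinearMap.mulLeft_apply, LinearMap.mulRight_apply, mul_assoc]) hv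
  have rb5 := fun j hj => r5 _ (rb4 j hj)
  have ry5 := fun j hj => r5 _ (ry4 j hj)
  have E5 : E ∈ Y5 := le_clos E4
  have min5 : ∀ U : Submodule K A, E ∈ U → (∀ j < s, ∀ v ∈ U, v * y j ∈ U) →
      (∀ j, j + 1 < s → ∀ v ∈ U, v * b j ∈ U) → (∀ j < r, ∀ v ∈ U, x j * v ∈ U) →
      (∀ j, j + 1 < r → ∀ v ∈ U, a j * v ∈ U) → (∀ j, j + 1 < s → ∀ v ∈ U, b j * v ∈ U) → Y5 ≤ U :=
    fun U h0 h1 h2 h3 h4 h5 => clos_le (min4 U h0 h1 h2 h3 h4) h5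
  have ra5 : ∀ j, j + 1 < r → j + 1 ≠ k → ∀ v ∈ Y5, v * a j ∈ Y5 := by
    intro j hj hjk v hv
    refine min5 (Y5.comap (rm (a j))) ?_ ?_ ?_ ?_ ?_ ?_ hv
    · change E * a j ∈ Y5
      rcases Nat.lt_or_ge (j + 1) k with h | h
      · rw [nestE_a_eq W hr hs h, mul_sub, mul_smul_comm, mul_one]
        exact Y5.sub_mem (rb5 j (by omega) _ E5) (Y5.smul_mem _ E5)
      · rw [← a_nestE W hr hs (by omega) hj]; exact la5 j hj _ E5
    · intro i hi v hv; change v * y i * a j ∈ Y5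
      rw [mul_assoc, ← W.ay j i hj hi, ← mul_assoc]; exact ry5 i hi _ hv
    · intro i hi v hv; change v * b i * a j ∈ Y5
      rw [mul_assoc, ← W.ab j i hj hi, ← mul_assoc]; exact rb5 i hi _ hv
    · intro i hi v hv; change x i * v * a j ∈ Y5; rw [mul_assoc]; exact lx5 i hi _ hv
    · intro i hi v hv; change a i * v * a j ∈ Y5; rw [mul_assoc]; exact la5 i hi _ hv
    · intro i hi v hv; change b i * v * a j ∈ Y5; rw [mul_assoc]; exact lb5 i hi _ hv
  have rx5 : ∀ j < r, ∀ v ∈ Y5, v * x j ∈ Y5 := by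
    intro j hj v hv
    refine min5 (Y5.comap (rm (x j))) ?_ ?_ ?_ ?_ ?_ ?_ hv
    · change E * x j ∈ Y5
      rcases Nat.lt_or_ge j k with h | h
      · rw [nestE_x_eq W hr hs h]; exact ry5 j (by omega) _ E5
      · rw [← x_nestE W hr hs h hj]; exact lx5 j hj _ E5
    · intro i hi v hv; change v * y i * x j ∈ Y5
      rw [mul_assoc, W.symm.xy i j hi hj, mul_neg, ← mul_assoc]; exact Y5.neg_mem (ry5 i hi _ hv)
    · intro i hi v hv; change v * b i * x j ∈ Y5
      rw [mul_assoc, W.bx i j hi hj, ← mul_assoc]; exact rb5 i hi _ hv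
    · intro i hi v hv; change x i * v * x j ∈ Y5; rw [mul_assoc]; exact lx5 i hi _ hv
    · intro i hi v hv; change a i * v * x j ∈ Y5; rw [mul_assoc]; exact la5 i hi _ hv
    · intro i hi v hv; change b i * v * x j ∈ Y5; rw [mul_assoc]; exact lb5 i hi _ hv
  have ra6 : ∀ j, j + 1 < r → ∀ v ∈ Y6, v * a j ∈ Y6 := fun j hj v hv => clos_stable (T := fun j => rm (a j)) hj hv
  have l6 : ∀ g, (∀ v ∈ Y5, g * v ∈ Y5) → ∀ v ∈ Y6, g * v ∈ Y6 := fun g hg v hv =>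
    clos_commute (T := fun j => rm (a j)) (g := lm g) (fun v hv => le_clos (hg v hv))
      (fun j hj v => by simp only [LinearMap.mulLeft_apply, LinearMap.mulRight_apply, mul_assoc]) hv
  have rb6 : ∀ j, j + 1 < s → ∀ v ∈ Y6, v * b j ∈ Y6 := fun j hj v hv =>
    clos_commute (T := fun j => rm (a j)) (g := rm (b j)) (fun v hv => le_clos (rb5 j hj v hv))
      (fun i hi v => by
        simp only [LinearMap.mulRight_apply]; rw [mul_assoc, W.ab i j hi hj, mul_assoc]) hv
  have ry6 : ∀ j < s, ∀ v ∈ Y6, v * y j ∈ Y6 := fun j hj v hv =>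
    clos_commute (T := fun j => rm (a j)) (g := rm (y j)) (fun v hv => le_clos (ry5 j hj v hv))
      (fun i hi v => by
        simp only [LinearMap.mulRight_apply]; rw [mul_assoc, W.ay i j hi hj, mul_assoc]) hv
  have rx6 : ∀ j < r, ∀ v ∈ Y6, v * x j ∈ Y6 := fun j hj v hv =>
    clos_induction (T := fun j => rm (a j)) (fun i : Fin r => rm (x i)) (fun i v hv => le_clos (rx5 i i.2 v hv))
      (fun i j hj v hv => a_x_mem W hj i.2 (ra6 j hj) fun i hi => hv ⟨i, hi⟩) ⟨j, hj⟩ hv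
  refine ⟨Y6, ?_, le_clos E5, ?_, ?_, ?_⟩
  · refine DimLE_clos r k Y5 _ hr W.hecke_right ra5 (DimLE_clos s k Y4 _ hs W.symm.hecke_left lb4
      (DimLE_clos_factorial W.hecke_left (DimLE_clif (DimLE_clos_factorial W.symm.hecke_right
      (DimLE_clif (DimLE_span_singleton E) s)) r)))
  · rintro g (⟨j, h1, h2, rfl⟩ | ⟨j, h1, h2, rfl⟩ | ⟨j, h1, h2, rfl⟩ | ⟨j, h1, h2, rfl⟩)
    · exact l6 _ (la5 j h2)
    · exact l6 _ (lb5 j h2)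
    · exact l6 _ (lx5 j h2)
    · exact l6 _ (ly5 j h2)
  · rintro g (⟨j, h1, h2, rfl⟩ | ⟨j, h1, h2, rfl⟩ | ⟨j, h1, h2, rfl⟩ | ⟨j, h1, h2, rfl⟩)
    · exact ra6 j h2
    · exact rb6 j h2
    · exact rx6 j h2
    · exact ry6 j h2
  · intro U h0 hL hR
    have ha : ∀ j, j + 1 < r → a j ∈ wgens 0 r s a b x y := fun j hj => Or.inl ⟨j, by omega, hj, rfl⟩
    have hb : ∀ j, j + 1 < s → b j ∈ wgens 0 r s a b x y := fun j hj => Or.inr (Or.inl ⟨j, by omega, hj, rfl⟩)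
    have hx : ∀ j, j < r → x j ∈ wgens 0 r s a b x y := fun j hj =>
      Or.inr (Or.inr (Or.inl ⟨j, by omega, hj, rfl⟩))
    have hy : ∀ j, j < s → y j ∈ wgens 0 r s a b x y := fun j hj =>
      Or.inr (Or.inr (Or.inr ⟨j, by omega, hj, rfl⟩))
    exact clos_le (min5 U h0 (fun j hj => hR _ (hy j hj)) (fun j hj => hR _ (hb j hj))
      (fun j hj => hL _ (hx j hj)) (fun j hj => hL _ (ha j hj)) (fun j hj => hL _ (hb j hj)))
      (fun j hj => hR _ (ha j hj))

theorem sum_choose_le (r s : ℕ) : ∑ k ∈ Finset.range (min r s + 1),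
    r.choose k * (s.choose k * (r.factorial * (2 ^ r * (s.factorial * (2 ^ s * 1)))))
      ≤ 2 ^ (r + s) * (r + s).factorial := by
  have h1 : ∑ k ∈ Finset.range (min r s + 1), r.choose k * s.choose k ≤ (r + s).choose r := by
    conv_rhs =>
      rw [Nat.add_choose_eq, Finset.Nat.sum_antidiagonal_eq_sum_range_succ_mk,
        ← Finset.sum_range_reflect]
    refine (Finset.sum_le_sum_of_subset (Finset.range_mono (by omega : min r s + 1 ≤ r.succ))).trans
      (Finset.sum_le_sum fun k hk => ?_)
    have hk' := Finset.mem_range.1 hk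
    simp only []
    rw [show r.succ - 1 - k = r - k by omega, show r - (r - k) = k by omega,
      Nat.choose_symm (by omega)]
  have h2 : (r + s).choose r * r.factorial * s.factorial = (r + s).factorial := by
    rw [Nat.choose_symm_add]; exact Nat.add_choose_mul_factorial_mul_factorial r s
  calc _ = (∑ k ∈ Finset.range (min r s + 1), r.choose k * s.choose k) *
        (r.factorial * s.factorial * 2 ^ (r + s)) := by
        rw [sum_mul]
        refine sum_congr rfl fun k _ => ?_
        rw [pow_add]; ring
    _ ≤ (r + s).choose r * (r.factorial * s.factorial * 2 ^ (r + s)) := Nat.mul_le_mul_right _ h1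
    _ = _ := by rw [← h2]; ring

theorem Walled.dimLE (W : Walled z ζ η r s a b x y e)
    (h : Algebra.adjoin K (wgens 0 r s a b x y ∪ {g | (0 < r ∧ 0 < s) ∧ g = e}) = ⊤) :
    DimLE (⊤ : Submodule K A) (2 ^ (r + s) * (r + s).factorial) := by
  choose! Z hdim hE hL hR hmin using fun (k : ℕ) (h : k ≤ r ∧ k ≤ s) => exists_bimodule W h.1 h.2
  set B := (Finset.range (min r s + 1)).sup Z
  have hd : DimLE B _ := DimLE_sup Z _ (Finset.range (min r s + 1)) fun k hk =>
    hdim k (by have := Finset.mem_range.1 hk; omega)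
  have hZ : ∀ k, k ≤ r → k ≤ s → Z k ≤ B := fun k h1 h2 =>
    Finset.le_sup (f := Z) (Finset.mem_range.2 (by omega))
  have hB : ∀ U : Submodule K A, (∀ k, k ≤ r → k ≤ s → Z k ≤ U) → B ≤ U := fun U hU =>
    Finset.sup_le fun k hk => by
      have := Finset.mem_range.1 hk
      exact hU k (by omega) (by omega)
  clear_value B
  have BL : ∀ g ∈ wgens 0 r s a b x y, ∀ v ∈ B, g * v ∈ B := fun g hg v hv =>
    hB (B.comap (lm g)) (fun k h1 h2 v hv => hZ k h1 h2 (hL k ⟨h1, h2⟩ g hg v hv)) hv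
  have BR : ∀ g ∈ wgens 0 r s a b x y, ∀ v ∈ B, v * g ∈ B := fun g hg v hv =>
    hB (B.comap (rm g)) (fun k h1 h2 v hv => hZ k h1 h2 (hR k ⟨h1, h2⟩ g hg v hv)) hv
  have BE : ∀ k, k ≤ r → k ≤ s → nestE a b e k ∈ B := fun k h1 h2 => hZ k h1 h2 (hE k ⟨h1, h2⟩)
  have Be : 0 < r → 0 < s → ∀ v ∈ B, e * v ∈ B := by
    intro hr hs v hv
    set H := Algebra.adjoin K (wgens 0 r s a b x y)
    have : B ≤ ⨅ h : H, B.comap (lm (e * h.1)) := by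
      refine hB _ fun k h1 h2 => hmin k ⟨h1, h2⟩ _ ?_ ?_ ?_
      · rw [Submodule.mem_iInf]
        exact fun h => e_adjoin_nestE W hr hs BL BR BE h1 h2 h.2
      · intro g hg v hv
        rw [Submodule.mem_iInf] at hv ⊢
        intro h
        have h3 : e * (h.1 * g) * v ∈ B := hv ⟨h.1 * g, mul_mem h.2 (Algebra.subset_adjoin hg)⟩
        change e * h.1 * (g * v) ∈ B
        rwa [← mul_assoc, mul_assoc e]
      · intro g hg v hv
        rw [Submodule.mem_iInf] at hv ⊢
        intro h
        have h3 : e * h.1 * v ∈ B := hv h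
        change e * h.1 * (v * g) ∈ B
        rw [← mul_assoc]
        exact BR g hg _ h3
    have h3 : e * ((1 : H) : A) * v ∈ B := (Submodule.mem_iInf _).1 (this hv) 1
    rwa [OneMemClass.coe_one, mul_one] at h3
  refine (hd.le (sum_choose_le r s)).mono fun v _ => ?_
  rw [← mul_one v]
  refine adjoin_mul_mem (S := wgens 0 r s a b x y ∪ {g | (0 < r ∧ 0 < s) ∧ g = e}) ?_ (by rw [h]; trivial)
    (BE 0 (by omega) (by omega))
  rintro g (hg | ⟨hrs, rfl⟩)
  · exact BL g hg
  · exact Be hrs.1 hrs.2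

end walled

/-! ### The dimension of `BC_{r,s}(q)` -/

section bc
variable {r s : ℕ}

/-- The generator `t`, numbered from the wall. -/
def bcA (r s j : ℕ) : BC r s := if h : j + 1 < r then BC.gen (.t (r - 2 - j) (by omega)) else 0
/-- The inverse of the generator `t*`. -/
def bcB (r s j : ℕ) : BC r s := if h : j + 1 < s then BC.gen (.tStar j h) - (q - q⁻¹) • 1 else 0
/-- The generator `c`, numbered from the wall. -/
def bcX (r s j : ℕ) : BC r s := if h : j < r then BC.gen (.c (r - 1 - j) (by omega)) else 0
/-- The generator `c*`. -/
def bcY (r s j : ℕ) : BC r s := if h : j < s then BC.gen (.cStar j h) else 0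
/-- The generator `e`, or zero if there is none. -/
def bcE (r s : ℕ) : BC r s := if h : 0 < r ∧ 0 < s then BC.gen (.e h.1 h.2) else 0

theorem bcA_eq {i j : ℕ} (hi : i + 1 < r) (h : j + 2 + i = r) : bcA r s j = BC.gen (.t i hi) := by
  rw [bcA, dif_pos (by omega)]
  congr 2; omega

theorem bcX_eq {i j : ℕ} (hi : i < r) (h : j + 1 + i = r) : bcX r s j = BC.gen (.c i hi) := by
  rw [bcX, dif_pos (by omega)]
  congr 2; omega

theorem bcY_eq {j : ℕ} (hj : j < s) : bcY r s j = BC.gen (.cStar j hj) := dif_pos hj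

theorem bcB_eq {j : ℕ} (hj : j + 1 < s) : bcB r s j = BC.gen (.tStar j hj) - (q - q⁻¹) • 1 := dif_pos hj

theorem bcE_eq (hr : 0 < r) (hs : 0 < s) : bcE r s = BC.gen (.e hr hs) := dif_pos ⟨hr, hs⟩

theorem bcE_zero (h : ¬ (0 < r ∧ 0 < s)) : bcE r s = 0 := dif_neg h

theorem bc_rel {u v : FreeAlgebra Cq (BCGen r s)} (h : BCRel r s u v) :
    RingQuot.mkAlgHom Cq (BCRel r s) u = RingQuot.mkAlgHom Cq (BCRel r s) v :=
  RingQuot.mkAlgHom_rel Cq h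

theorem mk_ft (i : ℕ) (hi : i + 1 < r) :
    RingQuot.mkAlgHom Cq (BCRel r s) (ft i hi) = BC.gen (.t i hi) := rfl
theorem mk_ftStar (i : ℕ) (hi : i + 1 < s) :
    RingQuot.mkAlgHom Cq (BCRel r s) (ftStar i hi) = BC.gen (.tStar i hi) := rfl
theorem mk_fc (i : ℕ) (hi : i < r) :
    RingQuot.mkAlgHom Cq (BCRel r s) (fc i hi) = BC.gen (.c i hi) := rfl
theorem mk_fcStar (i : ℕ) (hi : i < s) :
    RingQuot.mkAlgHom Cq (BCRel r s) (fcStar i hi) = BC.gen (.cStar i hi) := rfl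
theorem mk_fe (hr : 0 < r) (hs : 0 < s) :
    RingQuot.mkAlgHom Cq (BCRel r s) (fe hr hs) = BC.gen (.e hr hs) := rfl
theorem mk_fxi : RingQuot.mkAlgHom Cq (BCRel r s) fxi = (q - q⁻¹) • 1 := by
  rw [fxi, AlgHom.commutes, Algebra.algebraMap_eq_smul_one]

theorem hecke_inv_braid {A : Type} [Ring A] [Algebra Cq A] {z : Cq} {u v : A} (hu : u * u = z • u + 1)
    (hv : v * v = z • v + 1) (h : u * v * u = v * u * v) :
    (u - z • 1) * (v - z • 1) * (u - z • 1) = (v - z • 1) * (u - z • 1) * (v - z • 1) := by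
  simp only [sub_mul, mul_sub, smul_mul_assoc, mul_smul_comm, one_mul, mul_one, smul_sub, hu, hv, h, smul_add]
  abel

theorem hecke_inv_conj {A : Type} [Ring A] [Algebra Cq A] {z : Cq} {u v w : A} (hu : u * u = z • u + 1)
    (h : u * v = w * u) : (u - z • 1) * w = v * (u - z • 1) := by
  have h1 : (u - z • 1) * u = 1 := by rw [sub_mul, hu, smul_mul_assoc, one_mul]; abel
  have h2 : u * (u - z • 1) = 1 := by rw [mul_sub, hu, mul_smul_comm, mul_one]; abel
  calc (u - z • 1) * w = (u - z • 1) * (w * u) * (u - z • 1) := by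
        rw [mul_assoc, mul_assoc w, h2, mul_one]
    _ = (u - z • 1) * u * v * (u - z • 1) := by rw [← h]; simp only [mul_assoc]
    _ = _ := by rw [h1, one_mul]

theorem comm_sub_smul_one {A : Type} [Ring A] [Algebra Cq A] {z : Cq} {u v : A} (h : u * v = v * u) :
    u * (v - z • 1) = (v - z • 1) * u := by
  rw [mul_sub, sub_mul, h, mul_smul_comm, smul_mul_assoc, mul_one, one_mul]

/-- The relation between `e` and the neighbouring Hecke generators as an absorption property. -/
theorem nest_absorb {A : Type} [Ring A] [Algebra Cq A] {z : Cq} {a t e : A} (ha : a * a = z • a + 1)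
    (ht : t * t = z • t + 1) (hat : a * t = t * a) (he : e * e = 0) (hae : e * a * e = e) (hte : e * t * e = e)
    (h : e * (a - z • 1) * t * e * t * (a - z • 1) = (a - z • 1) * t * e * t * (a - z • 1) * e) :
    a * (t - z • 1) * (e * a * (t - z • 1) * e) = e * a * (t - z • 1) * e ∧
      e * a * (t - z • 1) * e * (a * (t - z • 1)) = e * a * (t - z • 1) * e := by
  have a1 : (a - z • 1) * a = 1 := by rw [sub_mul, ha, smul_mul_assoc, one_mul]; abel
  have a2 : a * (a - z • 1) = 1 := by rw [mul_sub, ha, mul_smul_comm, mul_one]; abel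
  have t1 : (t - z • 1) * t = 1 := by rw [sub_mul, ht, smul_mul_assoc, one_mul]; abel
  have t2 : t * (t - z • 1) = 1 := by rw [mul_sub, ht, mul_smul_comm, mul_one]; abel
  have hw : e * (a - z • 1) * t * e = e * a * (t - z • 1) * e := by
    simp only [mul_sub, sub_mul, mul_smul_comm, smul_mul_assoc, mul_one, he, smul_zero, sub_zero, hae, hte]
  have hab := comm_sub_smul_one (z := z) hat
  have hta := comm_sub_smul_one (z := z) hat.symm
  set w := e * a * (t - z • 1) * e
  have h1 : w * (t * (a - z • 1)) = w := by
    calc w * (t * (a - z • 1)) = e * a * e * (a - z • 1) * t * e * t * (a - z • 1) := by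
          rw [← hw, hae]; simp only [mul_assoc]
      _ = e * a * (e * (a - z • 1) * t * e * t * (a - z • 1)) := by simp only [mul_assoc]
      _ = e * (a * (a - z • 1)) * t * e * t * (a - z • 1) * e := by rw [h]; simp only [mul_assoc]
      _ = e * t * e * (t * (a - z • 1)) * e := by rw [a2]; simp only [mul_assoc, mul_one, one_mul]
      _ = w := by rw [hte, hta, ← hw]; simp only [mul_assoc]
  have h2 : (a - z • 1) * t * w = w := by
    calc (a - z • 1) * t * w = (a - z • 1) * t * e * (t * (a - z • 1)) * (e * a * e) := by
          rw [hta, ← hw, hae]; simp only [mul_assoc]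
      _ = (a - z • 1) * t * e * t * (a - z • 1) * e * (a * e) := by simp only [mul_assoc]
      _ = e * (a - z • 1) * t * (e * t * ((a - z • 1) * a) * e) := by rw [← h]; simp only [mul_assoc]
      _ = e * (a - z • 1) * t * e := by rw [a1, mul_one, hte]
      _ = w := hw
  constructor
  · calc a * (t - z • 1) * w = (t - z • 1) * (a * (a - z • 1)) * t * w := by
          conv_lhs => rw [← h2]
          rw [hab]; simp only [mul_assoc]
      _ = w := by rw [a2, mul_one, t1, one_mul]
  · calc w * (a * (t - z • 1)) = w * t * ((a - z • 1) * a) * (t - z • 1) := by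
          conv_lhs => rw [← h1]
          simp only [mul_assoc]
      _ = w := by rw [a1, mul_one, mul_assoc, t2, mul_one]

theorem bc_t_sq (i : ℕ) (hi : i + 1 < r) : (BC.gen (.t i hi) : BC r s) * BC.gen (.t i hi)
    = (q - q⁻¹) • BC.gen (.t i hi) + 1 := by
  have := bc_rel (s := s) (.t_quad i hi)
  simp only [map_sub, map_mul, map_zero, map_one, mk_ft, mk_fxi, smul_mul_assoc, one_mul] at this
  rw [sub_sub, sub_eq_zero] at this
  exact this

theorem bc_tStar_sq (i : ℕ) (hi : i + 1 < s) : (BC.gen (.tStar i hi) : BC r s) * BC.gen (.tStar i hi)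
    = (q - q⁻¹) • BC.gen (.tStar i hi) + 1 := by
  have := bc_rel (r := r) (.tStar_quad i hi)
  simp only [map_sub, map_mul, map_zero, map_one, mk_ftStar, mk_fxi, smul_mul_assoc, one_mul] at this
  rw [sub_sub, sub_eq_zero] at this
  exact this

theorem bc_nest (hr : 0 + 1 < r) (hs : 0 + 1 < s) :
    bcA r s 0 * bcB r s 0 * (bcE r s * bcA r s 0 * bcB r s 0 * bcE r s)
        = bcE r s * bcA r s 0 * bcB r s 0 * bcE r s ∧
      bcE r s * bcA r s 0 * bcB r s 0 * bcE r s * (bcA r s 0 * bcB r s 0)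
        = bcE r s * bcA r s 0 * bcB r s 0 * bcE r s := by
  rw [bcE_eq (by omega) (by omega), bcA_eq (i := r - 2) (by omega) (by omega), bcB_eq hs]
  have h1 := bc_rel (.t_tStar (r := r) (s := s) (r - 2) 0 (by omega) hs)
  have h2 := bc_rel (r := r) (s := s) (.e_sq (by omega) (by omega))
  have h3 := bc_rel (r := r) (s := s) (.e_t_e (by omega) (by omega) (r - 2) (by omega) (by omega))
  have h4 := bc_rel (r := r) (s := s) (.e_tStar_e (by omega) (by omega) hs)
  have h5 := bc_rel (r := r) (s := s) (.e_t_tStar_e (by omega) (by omega) (r - 2) (by omega) (by omega) hs)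
  simp only [ftInv, map_mul, map_sub, map_zero, mk_fe, mk_ft, mk_ftStar, mk_fxi] at h1 h2 h3 h4 h5
  exact nest_absorb (bc_t_sq _ _) (bc_tStar_sq _ _) h1 h2 h3 h4 h5

theorem bc_walled (r s : ℕ) : Walled (q - q⁻¹) (-1) 1 r s (bcA r s) (bcB r s) (bcX r s) (bcY r s) (bcE r s) where
  aq j hj := by rw [bcA_eq (i := r - 2 - j) (by omega) (by omega), bc_t_sq]
  abr j hj := by
    rw [bcA_eq (i := r - 3 - j + 1) (by omega) (by omega), bcA_eq (i := r - 3 - j) (by omega) (by omega)]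
    have := bc_rel (s := s) (.t_braid (r := r) (r - 3 - j) (by omega) (by omega))
    simp only [map_mul, mk_ft] at this
    exact this.symm
  acm i j hij hj := by
    rw [bcA_eq (i := r - 2 - i) (by omega) (by omega), bcA_eq (i := r - 2 - j) (by omega) (by omega)]
    have := bc_rel (s := s) (.t_comm (r := r) (r - 2 - i) (r - 2 - j) (by omega) (by omega) (by omega))
    simpa only [map_mul, mk_ft] using this
  bq j hj := by
    rw [bcB_eq hj, sub_mul, mul_sub, bc_tStar_sq]
    simp only [mul_sub, smul_mul_assoc, mul_smul_comm, one_mul, mul_one, smul_sub, neg_smul]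
    abel
  bbr j hj := by
    rw [bcB_eq hj, bcB_eq (by omega : j + 1 < s)]
    have := bc_rel (r := r) (.tStar_braid (s := s) j (by omega) (by omega))
    simp only [map_mul, mk_ftStar] at this
    exact hecke_inv_braid (bc_tStar_sq _ _) (bc_tStar_sq _ _) this
  bcm i j hij hj := by
    rw [bcB_eq hj, bcB_eq (by omega : i + 1 < s)]
    have := bc_rel (r := r) (.tStar_comm (s := s) i j (by omega) (by omega) (by omega))
    simp only [map_mul, mk_ftStar] at this
    exact comm_sub_smul_one (comm_sub_smul_one this.symm).symm
  ab i j hi hj := by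
    rw [bcB_eq hj, bcA_eq (i := r - 2 - i) (by omega) (by omega)]
    have := bc_rel (.t_tStar (r := r) (s := s) (r - 2 - i) j (by omega) (by omega))
    simp only [map_mul, mk_ft, mk_ftStar] at this
    exact comm_sub_smul_one this
  ax j hj := by
    rw [bcA_eq (i := r - 2 - j) (by omega) (by omega), bcX_eq (i := r - 2 - j) (by omega) (by omega),
      bcX_eq (i := r - 2 - j + 1) (by omega) (by omega)]
    have := bc_rel (s := s) (.t_c (r := r) (r - 2 - j) (by omega) (by omega))
    simpa only [map_mul, mk_ft, mk_fc] using this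
  axc i j hi hj h1 h2 := by
    rw [bcA_eq (i := r - 2 - i) (by omega) (by omega), bcX_eq (i := r - 1 - j) (by omega) (by omega)]
    have := bc_rel (s := s) (.t_c_comm (r := r) (r - 2 - i) (r - 1 - j) (by omega) (by omega) (by omega) (by omega))
    simpa only [map_mul, mk_ft, mk_fc] using this
  by_ j hj := by
    rw [bcB_eq hj, bcY_eq hj, bcY_eq (by omega : j < s)]
    have := bc_rel (r := r) (.tStar_cStar (s := s) j (by omega) (by omega))
    simp only [map_mul, mk_ftStar, mk_fcStar] at this
    exact hecke_inv_conj (bc_tStar_sq _ _) this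
  byc i j hi hj h1 h2 := by
    rw [bcB_eq hi, bcY_eq hj]
    have := bc_rel (r := r) (.tStar_cStar_comm (s := s) i j (by omega) (by omega) h1 h2)
    simp only [map_mul, mk_ftStar, mk_fcStar] at this
    exact (comm_sub_smul_one this.symm).symm
  ay i j hi hj := by
    rw [bcA_eq (i := r - 2 - i) (by omega) (by omega), bcY_eq hj]
    have := bc_rel (.t_cStar (r := r) (s := s) (r - 2 - i) j (by omega) hj)
    simpa only [map_mul, mk_ft, mk_fcStar] using this
  bx i j hi hj := by
    rw [bcB_eq hi, bcX_eq (i := r - 1 - j) (by omega) (by omega)]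
    have := bc_rel (.tStar_c (r := r) (s := s) i (r - 1 - j) hi (by omega))
    simp only [map_mul, mk_ftStar, mk_fc] at this
    exact (comm_sub_smul_one this.symm).symm
  xx i j hi hj hij := by
    rw [bcX_eq (i := r - 1 - i) (by omega) (by omega), bcX_eq (i := r - 1 - j) (by omega) (by omega)]
    have := bc_rel (s := s) (.c_anti (r := r) (r - 1 - i) (r - 1 - j) (by omega) (by omega) (by omega))
    simpa only [map_mul, map_neg, mk_fc] using this
  yy i j hi hj hij := by
    rw [bcY_eq hi, bcY_eq hj]
    have := bc_rel (r := r) (.cStar_anti i j hi hj hij)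
    simpa only [map_mul, map_neg, mk_fcStar] using this
  xy i j hi hj := by
    rw [bcX_eq (i := r - 1 - i) (by omega) (by omega), bcY_eq hj]
    have := bc_rel (.c_cStar (r := r) (s := s) (r - 1 - i) j (by omega) hj)
    simpa only [map_mul, map_neg, mk_fc, mk_fcStar] using this
  xsq i hi := by
    rw [bcX_eq (i := r - 1 - i) (by omega) (by omega)]
    have := bc_rel (s := s) (.c_sq (r := r) (r - 1 - i) (by omega))
    rw [Algebra.smul_def, map_neg, map_one, mul_one]
    simpa only [map_mul, map_neg, map_one, mk_fc] using this
  ysq i hi := by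
    rw [bcY_eq hi]
    have := bc_rel (r := r) (.cStar_sq (s := s) i hi)
    simpa only [map_mul, map_one, mk_fcStar, one_smul] using this
  ee := by
    by_cases h : 0 < r ∧ 0 < s
    · rw [bcE_eq h.1 h.2]
      have := bc_rel (.e_sq h.1 h.2)
      simpa only [map_mul, map_zero, mk_fe] using this
    · rw [bcE_zero h, zero_mul]
  eae hr := by
    by_cases h : 0 < r ∧ 0 < s
    · rw [bcE_eq h.1 h.2, bcA_eq (i := r - 2) (by omega) (by omega)]
      have := bc_rel (.e_t_e h.1 h.2 (r - 2) (by omega) (by omega))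
      simpa only [map_mul, mk_fe, mk_ft] using this
    · rw [bcE_zero h, mul_zero]
  ebe hs := by
    by_cases h : 0 < r ∧ 0 < s
    · rw [bcE_eq h.1 h.2, bcB_eq hs]
      have h1 := bc_rel (.e_tStar_e h.1 h.2 hs)
      have h2 := bc_rel (.e_sq h.1 h.2)
      simp only [map_mul, map_zero, mk_fe, mk_ftStar] at h1 h2
      rw [mul_sub, sub_mul, h1, mul_smul_comm, mul_one, smul_mul_assoc, h2, smul_zero, sub_zero]
    · rw [bcE_zero h, mul_zero]
  ea j hj hj' := by
    by_cases h : 0 < r ∧ 0 < s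
    · rw [bcE_eq h.1 h.2, bcA_eq (i := r - 2 - j) (by omega) (by omega)]
      have := bc_rel (.e_t h.1 h.2 (r - 2 - j) (by omega) (by omega))
      simpa only [map_mul, mk_fe, mk_ft] using this
    · rw [bcE_zero h, mul_zero, zero_mul]
  eb j hj hj' := by
    by_cases h : 0 < r ∧ 0 < s
    · rw [bcE_eq h.1 h.2, bcB_eq hj']
      have := bc_rel (.e_tStar h.1 h.2 j hj' hj)
      simp only [map_mul, mk_fe, mk_ftStar] at this
      exact comm_sub_smul_one this
    · rw [bcE_zero h, mul_zero, zero_mul]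
  xe hr hs := by
    rw [bcE_eq hr hs, bcX_eq (i := r - 1) (by omega) (by omega), bcY_eq hs]
    have := bc_rel (.c_e hr hs (r - 1) (by omega) (by omega))
    simpa only [map_mul, mk_fe, mk_fc, mk_fcStar] using this
  ex hr hs := by
    rw [bcE_eq hr hs, bcX_eq (i := r - 1) (by omega) (by omega), bcY_eq hs]
    have := bc_rel (.e_c hr hs (r - 1) (by omega) (by omega))
    simpa only [map_mul, mk_fe, mk_fc, mk_fcStar] using this
  xec j hj hj' := by
    by_cases h : 0 < r ∧ 0 < s
    · rw [bcE_eq h.1 h.2, bcX_eq (i := r - 1 - j) (by omega) (by omega)]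
      have := bc_rel (.c_e_comm h.1 h.2 (r - 1 - j) (by omega) (by omega))
      simpa only [map_mul, mk_fe, mk_fc] using this
    · rw [bcE_zero h, mul_zero, zero_mul]
  yec j hj hj' := by
    by_cases h : 0 < r ∧ 0 < s
    · rw [bcE_eq h.1 h.2, bcY_eq hj']
      have := bc_rel (.cStar_e_comm h.1 h.2 j hj' hj)
      simpa only [map_mul, mk_fe, mk_fcStar] using this
    · rw [bcE_zero h, mul_zero, zero_mul]
  exe hr hs := by
    rw [bcE_eq hr hs, bcX_eq (i := r - 1) (by omega) (by omega)]
    have := bc_rel (.e_c_e hr hs (r - 1) (by omega) (by omega))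
    simpa only [map_mul, map_zero, mk_fe, mk_fc] using this
  nest hr hs := (bc_nest hr hs).1
  nest' hr hs := (bc_nest hr hs).2

theorem bc_adjoin (r s : ℕ) : Algebra.adjoin Cq (wgens 0 r s (bcA r s) (bcB r s) (bcX r s) (bcY r s) ∪
    {g | (0 < r ∧ 0 < s) ∧ g = bcE r s}) = ⊤ := by
  apply bc_induction
  rintro (⟨i, hi⟩ | ⟨i, hi⟩ | ⟨hr, hs⟩ | ⟨i, hi⟩ | ⟨i, hi⟩)
  · exact Algebra.subset_adjoin (Or.inl (Or.inl ⟨r - 2 - i, by omega, by omega, (bcA_eq _ (by omega)).symm⟩))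
  · rw [show BC.gen (.tStar i hi) = bcB r s i + (q - q⁻¹) • 1 by rw [bcB_eq hi, sub_add_cancel]]
    exact add_mem (Algebra.subset_adjoin (Or.inl (Or.inr (Or.inl ⟨i, by omega, hi, rfl⟩))))
      (Subalgebra.smul_mem _ (one_mem _) _)
  · exact Algebra.subset_adjoin (Or.inr ⟨⟨hr, hs⟩, (bcE_eq hr hs).symm⟩)
  · exact Algebra.subset_adjoin (Or.inl (Or.inr (Or.inr (Or.inl
      ⟨r - 1 - i, by omega, by omega, (bcX_eq _ (by omega)).symm⟩))))
  · exact Algebra.subset_adjoin (Or.inl (Or.inr (Or.inr (Or.inr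
      ⟨i, by omega, by omega, (bcY_eq _).symm⟩))))

theorem BC_dimLE (r s : ℕ) : DimLE (⊤ : Submodule Cq (BC r s)) (2 ^ (r + s) * (r + s).factorial) :=
  (bc_walled r s).dimLE (bc_adjoin r s)

end bc

/-! ### The commutant of permutations and Clifford generators on words -/

section classical
open Matrix
variable {n N : ℕ}

/-- Complex matrices of words. -/
abbrev WM (n N : ℕ) : Type := Matrix (Word n N) (Word n N) ℂ
/-- Complex matrices of letters. -/
abbrev LM (n : ℕ) : Type := Matrix (Idx n) (Idx n) ℂ

theorem sE_mul_same (m : Fin N) (i j k l : Idx n) :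
    sE ℂ m i j * sE ℂ m k l = if j = k then sE ℂ m i l else 0 := by
  rw [sE, sE, oS_mul]
  split_ifs with h
  · subst h; rw [Matrix.single_mul_single_same, mul_one, sE]
  · rw [Matrix.single_mul_single_of_ne (h := h), ← oSHom_apply, map_zero]

theorem sE_supercomm {m m' : Fin N} (hm : m ≠ m') (i j k l : Idx n) :
    sE ℂ m i j * sE ℂ m' k l = sg ℂ ((par i + par j) * (par k + par l)) • (sE ℂ m' k l * sE ℂ m i j) :=
  oS_supercomm hm (IsHom_single i j) (IsHom_single k l)

theorem HomM_sE (m : Fin N) (i j : Idx n) : HomM (sE ℂ m i j) (par i + par j) := HomM_oS (IsHom_single i j)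

theorem IsHom.mul {x y : LM n} {p p' : ZMod 2} (hx : IsHom x p) (hy : IsHom y p') : IsHom (x * y) (p + p') := by
  intro i k h
  rw [Matrix.mul_apply] at h
  obtain ⟨j, _, hj⟩ := Finset.exists_ne_zero_of_sum_ne_zero h
  rw [← hx _ _ (left_ne_zero_of_mul hj), ← hy _ _ (right_ne_zero_of_mul hj)]
  generalize par i = a, par j = b, par k = c; revert a b c; decide

theorem IsHom_one : IsHom (1 : LM n) 0 := fun i j h => by
  rcases eq_or_ne i j with rfl | e
  · exact zmod2_add_self _
  · exact absurd (one_apply_ne e) h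

theorem commute_Zd_of_even {A : WM n N} (hA : HomM A 0) (p : ZMod 2) : A * Zd n N ℂ p = Zd n N ℂ p * A := by
  rw [Zd_mul_hom hA, mul_zero, sg_zero, one_smul]

/-- The operator `x` of degree `p` at the site `m`, twisted so that it commutes with the
supercommuting operators. -/
def hat (m : Fin N) (x : LM n) (p : ZMod 2) : WM n N := oS m x * Zd n N ℂ p

theorem hat_mul_same (m : Fin N) {x y : LM n} {p p' : ZMod 2} (hy : IsHom y p') :
    hat m x p * hat m y p' = sg ℂ (p * p') • hat m (x * y) (p + p') := by
  rw [hat, hat, hat, mul_assoc, ← mul_assoc (Zd n N ℂ p), Zd_mul_hom (HomM_oS hy), smul_mul_assoc,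
    mul_smul_comm, mul_assoc, ← Zd_add, ← mul_assoc, oS_mul]

theorem hat_mul_ne {m m' : Fin N} (x : LM n) {y : LM n} {p p' : ZMod 2} (hy : IsHom y p') :
    hat m x p * hat m' y p' = sg ℂ (p * p') • (oS m x * oS m' y * Zd n N ℂ (p + p')) := by
  rw [hat, hat, mul_assoc, ← mul_assoc (Zd n N ℂ p), Zd_mul_hom (HomM_oS hy), smul_mul_assoc,
    mul_smul_comm, mul_assoc, ← Zd_add, ← mul_assoc]

theorem hat_supercomm {m m' : Fin N} (hm : m ≠ m') {x y : LM n} {p p' : ZMod 2} (hx : IsHom x p)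
    (hy : IsHom y p') : hat m x p * hat m' y p' = sg ℂ (p * p') • (hat m' y p' * hat m x p) := by
  rw [hat_mul_ne _ hy, hat_mul_ne _ hx, oS_supercomm hm hx hy, smul_mul_assoc, add_comm p', mul_comm p' p]

theorem hat_one (m : Fin N) : hat m (1 : LM n) 0 = 1 := by rw [hat, oS_one, Zd_zero, one_mul]

/-- The transposition of the letters at two sites. -/
def sw (n : ℕ) (a b : Fin N) : WM n N :=
  ∑ i, ∑ j, sg ℂ (par j) • (sE ℂ a i j * sE ℂ b j i)

theorem sw_comm {a b : Fin N} (h : a ≠ b) : sw n a b = sw n b a := by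
  rw [sw, sw, sum_comm]
  refine sum_congr rfl fun i _ => sum_congr rfl fun j _ => ?_
  rw [sE_supercomm h, smul_smul, ← sg_add]
  congr 2
  generalize par i = a, par j = b; revert a b; decide

theorem HomM_sw {a b : Fin N} : HomM (sw n a b) 0 := by
  refine HomM.sum _ fun i _ => HomM.sum _ fun j _ => HomM.smul ?_ _
  have := (HomM_sE a i j).mul (HomM_sE b j i)
  rwa [add_comm (par j), zmod2_add_self] at this

theorem oS_induction {C : LM n → Prop} (x : LM n) (h0 : C 0) (h1 : ∀ x y, C x → C y → C (x + y))
    (h2 : ∀ (k : ℂ) i j, C (k • single i j 1)) : C x := by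
  rw [matrix_eq_sum_single x]
  refine Finset.sum_induction _ C h1 h0 fun i _ => Finset.sum_induction _ C h1 h0 fun j _ => ?_
  rw [show single i j (x i j) = x i j • single i j 1 by rw [smul_single, smul_eq_mul, mul_one]]
  exact h2 _ _ _

theorem oS_zero (m : Fin N) : oS m (0 : LM n) = 0 := by rw [← oSHom_apply, map_zero]

theorem sw_mul_oS {a b : Fin N} (h : a ≠ b) (x : LM n) : sw n a b * oS a x = oS b x * sw n a b := by
  refine oS_induction (C := fun x => sw n a b * oS a x = oS b x * sw n a b) x (by simp [oS_zero])
    (fun x y hx hy => by rw [oS_add, oS_add, mul_add, add_mul, hx, hy]) fun c k l => ?_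
  rw [oS_smul, oS_smul, mul_smul_comm, smul_mul_assoc]
  congr 1
  change sw n a b * sE ℂ a k l = sE ℂ b k l * sw n a b
  rw [sw, sum_mul, mul_sum]
  refine sum_congr rfl fun i _ => ?_
  rw [sum_mul, mul_sum, sum_eq_single k, sum_eq_single l]
  · rw [smul_mul_assoc, mul_assoc, sE_supercomm h.symm, mul_smul_comm, ← mul_assoc, sE_mul_same, if_pos rfl,
      mul_smul_comm, ← mul_assoc, sE_supercomm h.symm, smul_mul_assoc, mul_assoc, sE_mul_same, if_pos rfl,
      smul_smul, smul_smul, ← sg_add, ← sg_add]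
    congr 2
    generalize par i = a, par k = b, par l = c; revert a b c; decide
  · intro j _ hj
    rw [mul_smul_comm, ← mul_assoc, sE_supercomm h.symm, smul_mul_assoc, mul_assoc, sE_mul_same, if_neg hj.symm,
      mul_zero, smul_zero, smul_zero]
  · simp
  · intro j _ hj
    rw [smul_mul_assoc, mul_assoc, sE_supercomm h.symm, mul_smul_comm, ← mul_assoc, sE_mul_same, if_neg hj,
      zero_mul, smul_zero, smul_zero]
  · simp

theorem sw_mul_oS_ne {a b m : Fin N} (ha : m ≠ a) (hb : m ≠ b) (x : LM n) :
    sw n a b * oS m x = oS m x * sw n a b := by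
  refine oS_induction (C := fun x => sw n a b * oS m x = oS m x * sw n a b) x (by simp [oS_zero])
    (fun x y hx hy => by rw [oS_add, mul_add, add_mul, hx, hy]) fun c k l => ?_
  rw [oS_smul, mul_smul_comm, smul_mul_assoc]
  congr 1
  change sw n a b * sE ℂ m k l = sE ℂ m k l * sw n a b
  simp only [sw, sum_mul, mul_sum]
  refine sum_congr rfl fun i _ => sum_congr rfl fun j _ => ?_
  rw [smul_mul_assoc, mul_assoc, sE_supercomm hb.symm, mul_smul_comm, ← mul_assoc, sE_supercomm ha.symm,
    smul_mul_assoc, mul_assoc, mul_smul_comm, smul_smul, smul_smul, ← sg_add, ← sg_add]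
  congr 2
  generalize par i = a, par j = b, par k + par l = c; revert a b c; decide

theorem sw_sq {a b : Fin N} (h : a ≠ b) : sw n a b * sw n a b = 1 := by
  have e : sw n a b * sw n a b = ∑ i, ∑ j, ∑ k, ∑ l, (sg ℂ (par j) * sg ℂ (par l)) •
      (sE ℂ b i j * sE ℂ a j i * (sE ℂ a k l * sE ℂ b l k)) := by
    nth_rewrite 1 [sw_comm h]
    rw [sw, sw]
    rw [sum_mul]
    refine sum_congr rfl fun i _ => ?_
    rw [sum_mul]
    refine sum_congr rfl fun j _ => ?_
    rw [mul_sum]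
    refine sum_congr rfl fun k _ => ?_
    rw [mul_sum]
    exact sum_congr rfl fun l _ => smul_mul_smul_comm _ _ _ _
  rw [e]
  have : ∀ i j : Idx n, ∑ k, ∑ l, (sg ℂ (par j) * sg ℂ (par l)) •
      (sE ℂ b i j * sE ℂ a j i * (sE ℂ a k l * sE ℂ b l k)) = sE ℂ a j j * sE ℂ b i i := by
    intro i j
    rw [sum_eq_single i, sum_eq_single j]
    · rw [mul_assoc, ← mul_assoc (sE ℂ a j i), sE_mul_same, if_pos rfl, ← mul_assoc, sE_supercomm h.symm,
        smul_mul_assoc, mul_assoc, sE_mul_same, if_pos rfl, smul_smul, ← sg_add, ← sg_add,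
        zmod2_add_self (par j), mul_zero, add_zero, sg_zero, one_smul]
    · intro l _ hl
      rw [mul_assoc, ← mul_assoc (sE ℂ a j i), sE_mul_same, if_pos rfl, ← mul_assoc, sE_supercomm h.symm,
        smul_mul_assoc, mul_assoc, sE_mul_same, if_neg hl.symm, mul_zero, smul_zero, smul_zero]
    · simp
    · intro k _ hk
      refine sum_eq_zero fun l _ => ?_
      rw [mul_assoc, ← mul_assoc (sE ℂ a j i), sE_mul_same, if_neg hk.symm, zero_mul, mul_zero, smul_zero]
    · simp
  have h1 : ∀ m : Fin N, ∑ i : Idx n, sE ℂ m i i = 1 := fun m => by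
    rw [← oS_one m, oS_eq_sum]
    refine sum_congr rfl fun i _ => ?_
    rw [sum_eq_single i]
    · simp
    · intro j _ hj; rw [one_apply_ne hj.symm, zero_smul]
    · simp
  simp only [this]
  rw [sum_comm]
  simp only [← mul_sum, h1, mul_one]

/-- The operator `g` permutes the sites by `σ`. -/
structure Impl (σ : Equiv.Perm (Fin N)) (g : WM n N) : Prop where
  oS : ∀ m x, g * oS m x = QWBC.oS (σ m) x * g
  even : HomM g 0
  unit : IsUnit g

theorem Impl.one : Impl 1 (1 : WM n N) := ⟨fun m x => by simp, HomM_one, isUnit_one⟩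

theorem Impl.mul {σ τ : Equiv.Perm (Fin N)} {g h : WM n N} (hg : Impl σ g) (hh : Impl τ h) : Impl (σ * τ) (g * h) :=
  ⟨fun m x => by rw [mul_assoc, hh.oS, ← mul_assoc, hg.oS, mul_assoc]; rfl,
    by simpa using hg.even.mul hh.even, hg.unit.mul hh.unit⟩

theorem Impl_sw {a b : Fin N} (h : a ≠ b) : Impl (Equiv.swap a b) (sw n a b) := by
  refine ⟨fun m x => ?_, HomM_sw, IsUnit.of_mul_eq_one _ (sw_sq h)⟩
  rcases eq_or_ne m a with rfl | ha
  · rw [Equiv.swap_apply_left, sw_mul_oS h]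
  rcases eq_or_ne m b with rfl | hb
  · rw [Equiv.swap_apply_right, sw_comm h, sw_mul_oS h.symm]
  · rw [Equiv.swap_apply_of_ne_of_ne ha hb, sw_mul_oS_ne ha hb]

theorem Impl.hat {σ : Equiv.Perm (Fin N)} {g : WM n N} (hg : Impl σ g) (m : Fin N) (x : LM n) (p : ZMod 2) :
    g * QWBC.hat m x p = QWBC.hat (σ m) x p * g := by
  rw [QWBC.hat, QWBC.hat, ← mul_assoc, hg.oS, mul_assoc, mul_assoc, commute_Zd_of_even hg.even]

theorem exists_impl (σ : Equiv.Perm (Fin N)) :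
    ∃ g ∈ Submonoid.closure {g : WM n N | ∃ a b, a ≠ b ∧ g = sw n a b}, Impl σ g := by
  induction σ using Equiv.Perm.swap_induction_on with
  | one => exact ⟨1, one_mem _, Impl.one⟩
  | swap_mul σ a b hab ih =>
    obtain ⟨g, hg, h⟩ := ih
    exact ⟨sw n a b * g, mul_mem (Submonoid.subset_closure ⟨a, b, hab, rfl⟩) hg, (Impl_sw hab).mul h⟩

/-- The ordered product of the operators `F i` at the sites `σ i`. -/
def hprod (σ : Fin N → Fin N) (F : Fin N → LM n) (d : Fin N → ZMod 2) (l : List (Fin N)) : WM n N :=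
  (l.map fun i => hat (σ i) (F i) (d i)).prod

theorem hprod_cons (σ : Fin N → Fin N) (F : Fin N → LM n) (d : Fin N → ZMod 2) (i : Fin N) (l : List (Fin N)) :
    hprod σ F d (i :: l) = hat (σ i) (F i) (d i) * hprod σ F d l := List.prod_cons

theorem hprod_congr {σ : Fin N → Fin N} {F F' : Fin N → LM n} {d d' : Fin N → ZMod 2} {l : List (Fin N)}
    (h : ∀ i ∈ l, F i = F' i ∧ d i = d' i) : hprod σ F d l = hprod σ F' d' l := by
  rw [hprod, hprod]
  congr 1
  exact List.map_congr_left fun i hi => by rw [(h i hi).1, (h i hi).2]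

theorem hprod_insert {F : Fin N → LM n} {d : Fin N → ZMod 2} (hF : ∀ i, IsHom (F i) (d i)) {G : LM n}
    {p : ZMod 2} (hG : IsHom G p) {j : Fin N} {l : List (Fin N)} (hl : l.Nodup) (hj : j ∈ l) :
    ∃ ε : ℂ, ε ≠ 0 ∧ ∀ σ : Fin N → Fin N, Function.Injective σ → hat (σ j) G p * hprod σ F d l
      = ε • hprod σ (update F j (G * F j)) (update d j (p + d j)) l := by
  induction l with
  | nil => simp at hj
  | cons i l ih =>
    rw [List.nodup_cons] at hl
    rcases eq_or_ne i j with rfl | hij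
    · refine ⟨sg ℂ (p * d i), sg_ne_zero _, fun σ hσ => ?_⟩
      rw [hprod_cons, hprod_cons, ← mul_assoc, hat_mul_same _ (hF i), update_self, update_self,
        smul_mul_assoc]
      congr 2
      refine hprod_congr fun k hk => ?_
      have : k ≠ i := by rintro rfl; exact hl.1 hk
      rw [update_of_ne this, update_of_ne this]; exact ⟨rfl, rfl⟩
    · obtain ⟨ε, hε, h⟩ := ih hl.2 (by simpa [hij.symm] using hj)
      refine ⟨sg ℂ (p * d i) * ε, mul_ne_zero (sg_ne_zero _) hε, fun σ hσ => ?_⟩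
      rw [hprod_cons, hprod_cons, ← mul_assoc, hat_supercomm (hσ.ne hij.symm) hG (hF i), smul_mul_assoc, mul_assoc,
        h σ hσ, update_of_ne hij, update_of_ne hij, mul_smul_comm, smul_smul]

/-- The matrix of the Clifford generator. -/
def phC (n : ℕ) : LM n := Matrix.of fun i j => if j = negIdx i then sg ℂ (par i) else 0

/-- The elements of degree `p` of the queer Lie superalgebra. -/
def Qn (x : LM n) (p : ZMod 2) : Prop := IsHom x p ∧ phC n * x = sg ℂ p • (x * phC n)

/-- The span of the products over all sites, of elements of the queer Lie superalgebra at the sites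
in `J`. -/
def SP (n : ℕ) (J : Finset (Fin N)) : Submodule ℂ (WM n N) :=
  Submodule.span ℂ {f | ∃ F d, (∀ i, IsHom (F i) (d i)) ∧ (∀ i ∈ J, Qn (F i) (d i)) ∧
    f = hprod id F d (finRange N)}

theorem hat_mul_SP (m : Fin N) {x : LM n} {p : ZMod 2} (hx : IsHom x p) {f : WM n N} (hf : f ∈ SP n ∅) :
    hat m x p * f ∈ SP n ∅ := by
  induction hf using span_induction with
  | zero => rw [mul_zero]; exact Submodule.zero_mem _
  | add v w _ _ hv hw => rw [mul_add]; exact Submodule.add_mem _ hv hw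
  | smul k v _ hv => rw [mul_smul_comm]; exact Submodule.smul_mem _ _ hv
  | mem w hw =>
    obtain ⟨F, d, hF, -, rfl⟩ := hw
    obtain ⟨ε, -, h⟩ := hprod_insert hF hx (List.nodup_finRange N) (List.mem_finRange m)
    have h' := h id Function.injective_id
    rw [id] at h'
    rw [h']
    refine Submodule.smul_mem _ _ (subset_span ⟨_, _, fun i => ?_, by simp, rfl⟩)
    rcases eq_or_ne i m with rfl | hi
    · rw [update_self, update_self]; exact hx.mul (hF i)
    · rw [update_of_ne hi, update_of_ne hi]; exact hF i

theorem hat_single_mul_single (m : Fin N) (i : Idx n) (u w : Word n N) :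
    hat m (single i (u m) 1) (par i + par (u m)) * single u w 1
      = (sg ℂ ((par i + par (u m)) * pre m u) * sg ℂ ((par i + par (u m)) * tot u)) •
        single (update u m i) w 1 := by
  ext v v'
  rw [Matrix.smul_apply, smul_eq_mul, single_apply]
  by_cases h : v' = w
  · subst h
    rw [Matrix.mul_single_apply_same, mul_one, hat, Zd, Matrix.mul_diagonal]
    change sE ℂ m i (u m) v u * _ = _
    rw [sE_apply]
    by_cases h' : v = update u m i
    · simp [h']
    · simp [h', Ne.symm h']
  · rw [Matrix.mul_single_apply_of_ne _ _ _ _ _ h, if_neg (fun e => h e.2.symm), mul_zero]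

theorem SP_empty : SP n (∅ : Finset (Fin N)) = ⊤ := by
  rw [eq_top_iff]
  intro f _
  have h0 : ∀ w : Word n N, single w w 1 ∈ SP n (∅ : Finset (Fin N)) := by
    intro w
    refine subset_span ⟨fun i => single (w i) (w i) 1, fun _ => 0, fun i => ?_, by simp, ?_⟩
    · have := IsHom_single (R := ℂ) (w i) (w i); rwa [zmod2_add_self] at this
    · have h1 : ∀ l : List (Fin N), hprod id (fun i => single (w i) (w i) 1) (fun _ => 0) l
          = diagonal fun u => if ∀ i ∈ l, u i = w i then (1 : ℂ) else 0 := by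
        intro l
        induction l with
        | nil => simp [hprod]
        | cons i l ih =>
          rw [hprod_cons, ih]
          have : hat (id i) (single (w i) (w i) 1 : LM n) 0
              = diagonal fun u : Word n N => if u i = w i then (1 : ℂ) else 0 := by
            rw [hat, Zd_zero, mul_one]
            change sE ℂ i (w i) (w i) = _
            ext v u
            rw [sE_apply, diagonal_apply, zmod2_add_self, zero_mul, sg_zero]
            by_cases h : u i = w i
            · rw [← h, update_eq_self]; by_cases h' : v = u
              · subst h'; simp
              · simp [h']
            · by_cases h' : v = u
              · subst h'; simp [h]
              · simp [h, h']
          rw [this, Matrix.diagonal_mul_diagonal]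
          congr 1; ext u
          by_cases h : u i = w i <;> simp [h]
      rw [h1]
      ext v u
      rw [single_apply, diagonal_apply]
      by_cases h : w = u
      · subst h; by_cases h' : v = w
        · subst h'; simp
        · simp [h', Ne.symm h']
      · have h2 : ¬ ∀ i ∈ finRange N, v i = w i ∧ v = u := fun e => by
          rcases N with _ | N
          · exact h (Subsingleton.elim _ _)
          · exact h ((funext fun i => (e i (List.mem_finRange i)).1.symm).trans (e 0 (List.mem_finRange 0)).2)
        rw [if_neg (fun e => h e.2)]
        by_cases h' : v = u
        · rw [if_pos h', if_neg (fun e => h2 fun i hi => ⟨e i hi, h'⟩)]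
        · rw [if_neg h']
  have h1 : ∀ (w' w : Word n N) (S : Finset (Fin N)), single (S.piecewise w' w) w 1 ∈ SP n (∅ : Finset (Fin N)) := by
    intro w' w S
    induction S using Finset.induction_on with
    | empty => simpa using h0 w
    | insert m S hm ih =>
      have := hat_mul_SP m (IsHom_single (w' m) ((S.piecewise w' w) m)) ih
      rw [hat_single_mul_single, ← Finset.piecewise_insert] at this
      have h2 := Submodule.smul_mem _ (sg ℂ ((par (w' m) + par ((S.piecewise w' w) m)) * pre m (S.piecewise w' w)) *
        sg ℂ ((par (w' m) + par ((S.piecewise w' w) m)) * tot (S.piecewise w' w))) this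
      rw [smul_smul, mul_mul_mul_comm, sg_mul_self, sg_mul_self, mul_one, one_smul] at h2
      exact h2
  rw [matrix_eq_sum_single f]
  refine Submodule.sum_mem _ fun w' _ => Submodule.sum_mem _ fun w _ => ?_
  rw [show single w' w (f w' w) = f w' w • single w' w 1 by
    rw [smul_single, smul_eq_mul, mul_one]]
  have := h1 w' w Finset.univ
  rw [Finset.piecewise_univ] at this
  exact Submodule.smul_mem _ _ this

theorem IsHom_phC : IsHom (phC n) 1 := fun i j h => by
  simp only [phC, of_apply] at h
  split_ifs at h with h1
  · rw [h1, par_negIdx, ← add_assoc, zmod2_add_self, zero_add]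
  · exact absurd rfl h

theorem phC_sq : phC n * phC n = -1 := by
  ext i j
  rw [Matrix.mul_apply, sum_eq_single (negIdx i)]
  · simp only [phC, of_apply, if_true, negIdx_negIdx, par_negIdx, sg_add, sg_one, Matrix.neg_apply,
      Matrix.one_apply]
    by_cases h : j = i
    · subst h; simp [mul_neg]
    · simp [h, Ne.symm h]
  · intro k _ hk; simp [phC, hk]
  · simp

theorem oS_phC_hat_ne {m l : Fin N} (h : m ≠ l) {x : LM n} {p : ZMod 2} (hx : IsHom x p) :
    oS m (phC n) * hat l x p = hat l x p * oS m (phC n) := by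
  rw [hat, ← mul_assoc, oS_supercomm h IsHom_phC hx, mul_assoc (oS l x), Zd_mul_hom (HomM_oS IsHom_phC),
    smul_mul_assoc, mul_smul_comm, mul_assoc, one_mul, mul_one]

theorem oS_phC_hat (m : Fin N) (x : LM n) (p : ZMod 2) :
    oS m (phC n) * hat m x p * oS m (phC n) = hat m (sg ℂ p • (phC n * x * phC n)) p := by
  rw [hat, hat, ← mul_assoc, mul_assoc _ (Zd n N ℂ p), Zd_mul_hom (HomM_oS IsHom_phC), mul_smul_comm, ← mul_assoc,
    oS_mul, oS_mul, mul_one, oS_smul, smul_mul_assoc]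

theorem SP_step {J : Finset (Fin N)} (m : Fin N) {f : WM n N} (hf : f ∈ SP n J)
    (hc : oS m (phC n) * f = f * oS m (phC n)) : f ∈ SP n (insert m J) := by
  have hcc : oS m (phC n) * oS m (phC n) = (-1 : WM n N) := by
    rw [oS_mul, phC_sq, ← neg_one_smul ℂ, oS_smul, oS_one, neg_one_smul]
  have h1 : f = (1 / 2 : ℂ) • (f - oS m (phC n) * f * oS m (phC n)) := by
    rw [hc, mul_assoc, hcc, mul_neg, mul_one, sub_neg_eq_add, ← two_smul ℂ f, smul_smul]; norm_num
  rw [h1]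
  clear h1 hc
  induction hf using span_induction with
  | zero => simp
  | add v w _ _ hv hw =>
    rw [mul_add, add_mul, add_sub_add_comm, smul_add]; exact Submodule.add_mem _ hv hw
  | smul k v _ hv =>
    rw [mul_smul_comm, smul_mul_assoc, ← smul_sub, smul_comm]; exact Submodule.smul_mem _ _ hv
  | mem w hw =>
    obtain ⟨F, d, hF, hQ, rfl⟩ := hw
    obtain ⟨l, l', hl⟩ := List.append_of_mem (List.mem_finRange m)
    have hnd := hl ▸ List.nodup_finRange N
    have hm : m ∉ l ∧ m ∉ l' := by
      have := (List.nodup_middle.1 hnd)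
      rw [List.nodup_cons, List.mem_append, not_or] at this; exact this.1
    have hcl : ∀ l : List (Fin N), m ∉ l → oS m (phC n) * hprod id F d l = hprod id F d l * oS m (phC n) := by
      intro l hl
      induction l with
      | nil => simp [hprod]
      | cons i l ih =>
        rw [List.mem_cons, not_or] at hl
        rw [hprod_cons, ← mul_assoc, id, oS_phC_hat_ne hl.1 (hF i), mul_assoc, ih hl.2, mul_assoc]
    set y := (1 / 2 : ℂ) • (F m - sg ℂ (d m) • (phC n * F m * phC n))
    have e : ∀ G : LM n, G = F m ∨ G = y → hprod id (update F m G) d (finRange N)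
        = hprod id F d l * hat m G (d m) * hprod id F d l' := by
      intro G _
      have : ∀ l : List (Fin N), m ∉ l → hprod id (update F m G) d l = hprod id F d l := fun l hl =>
        hprod_congr fun i hi => ⟨update_of_ne (by rintro rfl; exact hl hi) _ _, rfl⟩
      rw [hl, hprod, List.map_append, List.prod_append, List.map_cons, List.prod_cons, ← mul_assoc,
        update_self]
      change hprod id (update F m G) d l * hat m G (d m) * hprod id (update F m G) d l' = _
      rw [this l hm.1, this l' hm.2]
    have h2 := e (F m) (Or.inl rfl)
    rw [update_eq_self] at h2
    have h3 : (1 / 2 : ℂ) • (hprod id F d (finRange N) -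
        oS m (phC n) * hprod id F d (finRange N) * oS m (phC n))
        = hprod id (update F m y) d (finRange N) := by
      have h4 : hat m y (d m) = (1 / 2 : ℂ) • (hat m (F m) (d m) -
          oS m (phC n) * hat m (F m) (d m) * oS m (phC n) : WM n N) := by
        rw [oS_phC_hat, hat, hat, hat, ← sub_mul, ← smul_mul_assoc, ← oSHom_apply, ← oSHom_apply, ← oSHom_apply,
          ← map_sub, ← map_smul]
      rw [e y (Or.inr rfl), h2, h4]
      have h5 : oS m (phC n) * (hprod id F d l * hat m (F m) (d m) * hprod id F d l') * oS m (phC n)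
          = hprod id F d l * (oS m (phC n) * hat m (F m) (d m) * oS m (phC n)) * hprod id F d l' := by
        rw [← mul_assoc, ← mul_assoc, hcl l hm.1, mul_assoc _ (hprod id F d l'), ← hcl l' hm.2]
        simp only [mul_assoc]
      rw [h5, mul_smul_comm, smul_mul_assoc, mul_sub, sub_mul]
    rw [h3]
    have hy : Qn y (d m) := by
      refine ⟨fun i j h => ?_, ?_⟩
      · by_contra hp
        have hz : F m i j = 0 := not_imp_comm.1 (hF m i j) hp
        have hz' : (phC n * F m * phC n) i j = 0 := by
          refine not_imp_comm.1 (((IsHom_phC.mul (hF m)).mul IsHom_phC) i j) fun e => hp (e.trans ?_)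
          generalize d m = a; revert a; decide
        simp [y, hz, hz'] at h
      · simp only [y, mul_smul_comm, smul_mul_assoc, mul_sub, sub_mul]
        rw [← mul_assoc, ← mul_assoc, phC_sq, mul_assoc _ (phC n) (phC n), phC_sq]
        simp only [neg_mul, one_mul, mul_neg, mul_one, smul_neg, sub_neg_eq_add]
        simp only [smul_add, smul_smul]
        rw [mul_left_comm, sg_mul_self, mul_one, add_comm, mul_comm]
    refine subset_span ⟨_, _, fun i => ?_, fun i hi => ?_, rfl⟩
    · rcases eq_or_ne i m with rfl | h
      · rw [update_self]; exact hy.1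
      · rw [update_of_ne h]; exact hF i
    · rcases eq_or_ne i m with rfl | h
      · rw [update_self]; exact hy
      · rw [update_of_ne h]; exact hQ i (by simpa [h] using hi)

theorem Qn_one : Qn (1 : LM n) 0 := ⟨IsHom_one, by simp⟩

theorem Qn.mul {x y : LM n} {p p' : ZMod 2} (hx : Qn x p) (hy : Qn y p') : Qn (x * y) (p + p') :=
  ⟨hx.1.mul hy.1, by
    rw [← mul_assoc, hx.2, smul_mul_assoc, mul_assoc, hy.2, mul_smul_comm, smul_smul, ← sg_add, mul_assoc]⟩

/-- The diagonal action of `x` on words. -/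
def diagY (N : ℕ) (x : LM n) (p : ZMod 2) : WM n N := ∑ m, hat m x p

theorem sum_hprod_mem {S : Subalgebra ℂ (WM n N)} (hS : ∀ x p, Qn x p → diagY N x p ∈ S) (J : Finset (Fin N)) :
    ∀ (F : Fin N → LM n) (d : Fin N → ZMod 2), (∀ i, Qn (F i) (d i)) → (∀ i ∉ J, F i = 1 ∧ d i = 0) →
      ∑ σ : Equiv.Perm (Fin N), hprod σ F d (finRange N) ∈ S := by
  induction J using Finset.induction_on with
  | empty =>
    intro F d _ h
    refine Subalgebra.sum_mem _ fun σ _ => ?_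
    rw [hprod_congr (F' := fun _ => 1) (d' := fun _ => 0) fun i _ => h i (by simp), hprod]
    refine Subalgebra.list_prod_mem _ fun f hf => ?_
    obtain ⟨i, _, rfl⟩ := List.mem_map.1 hf
    rw [hat_one]; exact one_mem _
  | insert j0 J hj0 ih =>
    intro F d hF h1
    set F' := update F j0 1
    set d' := update d j0 0
    have hF' : ∀ i, Qn (F' i) (d' i) := fun i => by
      rcases eq_or_ne i j0 with rfl | hi
      · simp only [F', d', update_self]; exact Qn_one
      · simp only [F', d', update_of_ne hi]; exact hF i
    have h1' : ∀ i ∉ J, F' i = 1 ∧ d' i = 0 := fun i hi => by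
      rcases eq_or_ne i j0 with rfl | hi'
      · simp [F', d']
      · simp only [F', d', update_of_ne hi']; exact h1 i (by simp [hi, hi'])
    set T := fun j => ∑ σ : Equiv.Perm (Fin N), hat (σ j) (F j0) (d j0) * hprod σ F' d' (finRange N)
    have hsum : diagY N (F j0) (d j0) * ∑ σ : Equiv.Perm (Fin N), hprod σ F' d' (finRange N)
        = ∑ j, T j := by
      rw [mul_sum, sum_comm]
      refine sum_congr rfl fun σ _ => ?_
      rw [diagY, sum_mul, ← Equiv.sum_comp σ]
    have hT : ∀ j, ∃ ε : ℂ, ε ≠ 0 ∧ T j = ε • ∑ σ : Equiv.Perm (Fin N), hprod σ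
        (update F' j (F j0 * F' j)) (update d' j (d j0 + d' j)) (finRange N) := by
      intro j
      obtain ⟨ε, h0, h⟩ := hprod_insert (fun i => (hF' i).1) (hF j0).1 (List.nodup_finRange N) (List.mem_finRange j)
      refine ⟨ε, h0, ?_⟩
      rw [smul_sum]
      exact sum_congr rfl fun σ _ => h σ σ.injective
    have hTJ : ∀ j ∈ J, T j ∈ S := by
      intro j hj
      obtain ⟨ε, -, h⟩ := hT j
      rw [h]
      refine Subalgebra.smul_mem _ (ih _ _ (fun i => ?_) fun i hi => ?_) _
      · rcases eq_or_ne i j with rfl | hi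
        · rw [update_self, update_self]; exact (hF j0).mul (hF' i)
        · rw [update_of_ne hi, update_of_ne hi]; exact hF' i
      · have : i ≠ j := by rintro rfl; exact hi hj
        rw [update_of_ne this, update_of_ne this]; exact h1' i hi
    have hTn : ∀ j ∉ J, T j = T j0 := by
      intro j hj
      simp only [T]
      rw [← Equiv.sum_comp (Equiv.mulRight (Equiv.swap j j0))]
      refine sum_congr rfl fun σ _ => ?_
      simp only [Equiv.coe_mulRight, Equiv.Perm.mul_apply, Equiv.swap_apply_left]
      congr 1
      rw [hprod, hprod]
      congr 1
      refine List.map_congr_left fun i _ => ?_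
      by_cases hi : i ∈ J
      · rw [Equiv.Perm.mul_apply, Equiv.swap_apply_of_ne_of_ne (by rintro rfl; exact hj hi)
          (by rintro rfl; exact hj0 hi)]
      · rw [(h1' i hi).1, (h1' i hi).2, hat_one, hat_one]
    have hmem : ∑ j, T j ∈ S := hsum ▸ mul_mem (hS _ _ (hF j0)) (ih F' d' hF' h1')
    have hcompl : ∑ j ∈ Jᶜ, T j = Jᶜ.card • T j0 := by
      rw [sum_congr rfl (fun j hj => hTn j (Finset.mem_compl.1 hj)), Finset.sum_const]
    rw [← Finset.sum_add_sum_compl J, hcompl] at hmem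
    have h2 : (Jᶜ.card : ℂ) • T j0 ∈ S := by
      have := sub_mem hmem (Subalgebra.sum_mem S fun j hj => hTJ j hj)
      rwa [add_sub_cancel_left, ← Nat.cast_smul_eq_nsmul ℂ] at this
    obtain ⟨ε, hε, h⟩ := hT j0
    have e1 : update F' j0 (F j0 * F' j0) = F := by simp [F']
    have e2 : update d' j0 (d j0 + d' j0) = d := by simp [d']
    rw [e1, e2] at h
    rw [h, smul_smul] at h2
    have h3 : (Jᶜ.card : ℂ) * ε ≠ 0 := mul_ne_zero
      (Nat.cast_ne_zero.2 (Finset.card_ne_zero_of_mem (Finset.mem_compl.2 hj0))) hε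
    have := Subalgebra.smul_mem S h2 ((Jᶜ.card : ℂ) * ε)⁻¹
    rwa [smul_smul, inv_mul_cancel₀ h3, one_smul] at this

theorem mem_of_commute {S : Subalgebra ℂ (WM n N)} (hS : ∀ x p, Qn x p → diagY N x p ∈ S) {f : WM n N}
    (hc : ∀ m, oS m (phC n) * f = f * oS m (phC n)) (hs : ∀ a b, a ≠ b → sw n a b * f = f * sw n a b) : f ∈ S := by
  have h1 : ∀ J : Finset (Fin N), f ∈ SP n J := fun J => by
    induction J using Finset.induction_on with
    | empty => rw [SP_empty]; trivial
    | insert m J _ ih => exact SP_step m ih (hc m)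
  choose g hg hi using exists_impl (n := n) (N := N)
  have hgf : ∀ x ∈ Submonoid.closure {g : WM n N | ∃ a b, a ≠ b ∧ g = sw n a b}, x * f = f * x := fun x h => by
    induction h using Submonoid.closure_induction with
    | mem x hx => obtain ⟨a, b, hab, rfl⟩ := hx; exact hs a b hab
    | one => simp
    | mul x y _ _ hx hy => rw [mul_assoc, hy, ← mul_assoc, hx, mul_assoc]
  have h2 : (Fintype.card (Equiv.Perm (Fin N)) : ℂ) • f = ∑ σ, g σ * f * Ring.inverse (g σ) := by
    rw [sum_congr rfl fun σ _ => show g σ * f * Ring.inverse (g σ) = f by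
      rw [hgf _ (hg σ), mul_assoc, Ring.mul_inverse_cancel _ (hi σ).unit, mul_one], Finset.sum_const, Finset.card_univ,
      Nat.cast_smul_eq_nsmul]
  have h3 : ∑ σ, g σ * f * Ring.inverse (g σ) ∈ S := by
    have hf := h1 Finset.univ
    clear h2 hgf hc hs h1
    induction hf using span_induction with
    | zero => simp
    | add v w _ _ hv hw =>
      simp only [mul_add, add_mul, sum_add_distrib]; exact add_mem hv hw
    | smul k v _ hv =>
      simp only [mul_smul_comm, smul_mul_assoc, ← smul_sum]; exact Subalgebra.smul_mem _ hv _
    | mem w hw =>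
      obtain ⟨F, d, -, hQ, rfl⟩ := hw
      have e : ∀ (σ : Equiv.Perm (Fin N)) (l : List (Fin N)), g σ * hprod id F d l = hprod σ F d l * g σ := by
        intro σ l
        induction l with
        | nil => simp [hprod]
        | cons i l ih => rw [hprod_cons, hprod_cons, ← mul_assoc, (hi σ).hat, mul_assoc, ih, mul_assoc]; rfl
      rw [sum_congr rfl fun σ _ => show g σ * hprod id F d (finRange N) * Ring.inverse (g σ) = hprod σ F d (finRange N) by
        rw [e, mul_assoc, Ring.mul_inverse_cancel _ (hi σ).unit, mul_one]]
      exact sum_hprod_mem hS Finset.univ F d (fun i => hQ i (mem_univ i)) (by simp)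
  have h4 : (Fintype.card (Equiv.Perm (Fin N)) : ℂ) ≠ 0 := Nat.cast_ne_zero.2 Fintype.card_ne_zero
  have := Subalgebra.smul_mem S (h2 ▸ h3) (Fintype.card (Equiv.Perm (Fin N)) : ℂ)⁻¹
  rwa [smul_smul, inv_mul_cancel₀ h4, one_smul] at this

end classical

/-! ### The bicommutant -/

section bicommutant
open Matrix
variable {n N : ℕ}

open scoped ComplexOrder in
/-- A self-adjoint algebra of complex matrices is its own bicommutant. -/
theorem mem_of_bicommutant {W : Type} [Fintype W] [DecidableEq W] (P : Subalgebra ℂ (Matrix W W ℂ))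
    (hP : ∀ x ∈ P, xᴴ ∈ P) {f : Matrix W W ℂ}
    (hf : ∀ B : Matrix W W ℂ, (∀ x ∈ P, x * B = B * x) → f * B = B * f) : f ∈ P := by
  let B : LinearMap.BilinForm ℂ (Matrix W W ℂ) :=
    (LinearMap.mul ℂ (Matrix W W ℂ)).compr₂ (Matrix.traceLinearMap W ℂ ℂ)
  have hB : ∀ x y, B x y = (x * y).trace := fun _ _ => rfl
  have hrefl : B.IsRefl := fun x y h => by rw [hB, Matrix.trace_mul_comm, ← hB, h]
  let Q := Subalgebra.toSubmodule P
  have hnd : (B.restrict Q).Nondegenerate := by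
    have key : ∀ x ∈ P, (∀ y ∈ P, (y * x).trace = 0) → x = 0 := fun x hx h =>
      Matrix.trace_conjTranspose_mul_self_eq_zero_iff.1 (h _ (hP x hx))
    constructor
    · intro x h
      refine Subtype.ext (key x.1 x.2 fun y hy => ?_)
      rw [Matrix.trace_mul_comm]; exact h ⟨y, hy⟩
    · intro x h
      exact Subtype.ext (key x.1 x.2 fun y hy => h ⟨y, hy⟩)
  have hc := LinearMap.BilinForm.isCompl_orthogonal_of_restrict_nondegenerate hrefl hnd
  let π : Matrix W W ℂ →ₗ[ℂ] Matrix W W ℂ := Q.subtype ∘ₗ Q.projectionOnto _ hc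
  have hπ : ∀ x ∈ P, π x = x := fun x hx => by
    change ((Q.projectionOnto _ hc x : Q) : Matrix W W ℂ) = x
    exact congrArg Subtype.val (Submodule.projectionOnto_apply_left hc ⟨x, hx⟩)
  have hπm : ∀ x, π x ∈ P := fun x => (Q.projectionOnto _ hc x).2
  have hπ0 : ∀ x ∈ B.orthogonal Q, π x = 0 := fun x hx => by
    change ((Q.projectionOnto _ hc x : Q) : Matrix W W ℂ) = 0
    rw [(Submodule.projectionOnto_apply_eq_zero_iff hc).2 hx]; rfl
  have hlin : ∀ p ∈ P, ∀ x, π (p * x) = p * π x := by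
    intro p hp x
    have hx : x ∈ Q ⊔ B.orthogonal Q := by rw [hc.sup_eq_top]; trivial
    obtain ⟨y, hy, z, hz, rfl⟩ := Submodule.mem_sup.1 hx
    have hz' : p * z ∈ B.orthogonal Q := fun u hu => by
      change B u (p * z) = 0
      rw [hB, ← mul_assoc]
      exact hz (u * p) (P.mul_mem hu hp)
    rw [mul_add, map_add, map_add, hπ0 _ hz, hπ0 _ hz', hπ _ (P.mul_mem hp hy), hπ y hy, add_zero, add_zero]
  let b : W → W → Matrix W W ℂ := fun w' w => Matrix.of fun v u => π (single u w 1) v w'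
  have hb : ∀ x v w', π x v w' = ∑ w, (b w' w * x) v w := by
    intro x v w'
    conv_lhs => rw [matrix_eq_sum_single x]
    simp only [map_sum, Matrix.sum_apply, Matrix.mul_apply]
    rw [sum_comm]
    refine sum_congr rfl fun w _ => sum_congr rfl fun u _ => ?_
    rw [show single u w (x u w) = x u w • single u w 1 by
      rw [smul_single, smul_eq_mul, mul_one], map_smul, Matrix.smul_apply, smul_eq_mul, mul_comm]
    rfl
  have hcomm : ∀ w' w, f * b w' w = b w' w * f := by
    intro w' w
    refine hf _ fun p hp => ?_
    ext v u
    have h1 : (p * b w' w) v u = (p * π (single u w 1)) v w' := rfl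
    rw [h1, ← hlin p hp, hb, sum_eq_single w]
    · rw [← mul_assoc, Matrix.mul_single_apply_same, mul_one]
    · intro w2 _ h2
      rw [← mul_assoc, Matrix.mul_single_apply_of_ne _ _ _ _ _ h2]
    · simp
  have h1 : π (f * 1) = f * π 1 := by
    ext v w'
    rw [hb, Matrix.mul_apply]
    simp only [hb, mul_sum]
    rw [sum_comm]
    refine sum_congr rfl fun w _ => ?_
    rw [← mul_assoc, ← hcomm, mul_assoc, Matrix.mul_apply]
  rw [hπ 1 P.one_mem, mul_one] at h1
  exact h1 ▸ hπm f

/-- The algebra generated by the permutations of the sites and the Clifford generators. -/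
def pureAlg (n N : ℕ) : Subalgebra ℂ (WM n N) :=
  Algebra.adjoin ℂ ({x | ∃ m, x = oS m (phC n)} ∪ {x | ∃ a b, a ≠ b ∧ x = sw n a b})

theorem star_sg (p : ZMod 2) : star (sg ℂ p) = sg ℂ p := by
  rcases zmod2_cases p with rfl | rfl <;> simp

theorem sE_conjTranspose (m : Fin N) (i j : Idx n) : (sE ℂ m i j)ᴴ = sE ℂ m j i := by
  ext w' w
  rw [Matrix.conjTranspose_apply, sE_apply, sE_apply]
  by_cases h : w' m = j ∧ w = update w' m i
  · obtain ⟨rfl, rfl⟩ := h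
    simp [star_sg, pre_update, add_comm]
  · rw [if_neg h, if_neg, star_zero]
    rintro ⟨rfl, rfl⟩; simp at h

theorem oS_conjTranspose (m : Fin N) (x : LM n) : (oS m x)ᴴ = oS m xᴴ := by
  rw [oS_eq_sum, oS_eq_sum, sum_comm]
  simp only [Matrix.conjTranspose_sum, Matrix.conjTranspose_smul, sE_conjTranspose, Matrix.conjTranspose_apply]

theorem sw_conjTranspose {a b : Fin N} (h : a ≠ b) : (sw n a b)ᴴ = sw n a b := by
  conv_rhs => rw [sw_comm h]
  rw [sw, sw]
  simp only [Matrix.conjTranspose_sum, Matrix.conjTranspose_smul, Matrix.conjTranspose_mul, sE_conjTranspose, star_sg]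

theorem phC_conjTranspose : (phC n)ᴴ = -phC n := by
  ext i j
  simp only [phC, Matrix.conjTranspose_apply, of_apply, Matrix.neg_apply]
  by_cases h : i = negIdx j
  · subst h; simp [negIdx_negIdx, par_negIdx, sg_add, star_sg]
  · rw [if_neg h, if_neg (by rintro rfl; simp [negIdx_negIdx] at h), star_zero, neg_zero]

theorem pureAlg_star {x : WM n N} (hx : x ∈ pureAlg n N) : xᴴ ∈ pureAlg n N := by
  induction hx using Algebra.adjoin_induction with
  | mem x hx =>
    rcases hx with ⟨m, rfl⟩ | ⟨a, b, h, rfl⟩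
    · rw [oS_conjTranspose, phC_conjTranspose, ← oSHom_apply, map_neg]
      exact neg_mem (Algebra.subset_adjoin (Or.inl ⟨m, rfl⟩))
    · rw [sw_conjTranspose h]; exact Algebra.subset_adjoin (Or.inr ⟨a, b, h, rfl⟩)
  | algebraMap r => 
    rw [Algebra.algebraMap_eq_smul_one, Matrix.conjTranspose_smul, Matrix.conjTranspose_one]
    exact Subalgebra.smul_mem _ (one_mem _) _
  | add x y _ _ hx hy => rw [Matrix.conjTranspose_add]; exact add_mem hx hy
  | mul x y _ _ hx hy => rw [Matrix.conjTranspose_mul]; exact mul_mem hy hx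

/-- The generators of the queer Lie superalgebra. -/
def qE (a b : Idx n) : LM n := single a b 1 + single (negIdx a) (negIdx b) 1

theorem IsHom_qE (a b : Idx n) : IsHom (qE a b) (par a + par b) := fun i j h => by
  by_cases h1 : i = a ∧ j = b
  · rw [h1.1, h1.2]
  · by_cases h2 : i = negIdx a ∧ j = negIdx b
    · rw [h2.1, h2.2, par_negIdx, par_negIdx]
      generalize par a = x, par b = y; revert x y; decide
    · exfalso; apply h
      rw [qE, Matrix.add_apply, single_apply, single_apply, if_neg (fun e => h1 ⟨e.1.symm, e.2.symm⟩),
        if_neg (fun e => h2 ⟨e.1.symm, e.2.symm⟩), add_zero]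

theorem Qn.eq_sum {x : LM n} {p : ZMod 2} (hx : Qn x p) : x = (1 / 2 : ℂ) • ∑ i, ∑ j, x i j • qE i j := by
  have hneg : ∀ i j, x (negIdx i) (negIdx j) = x i j := by
    intro i j
    have h := congrFun (congrFun hx.2 (negIdx i)) j
    rw [Matrix.mul_apply, sum_eq_single i (by
        intro k _ hk
        rw [phC, of_apply, if_neg (by rwa [negIdx_negIdx]), zero_mul]) (by simp),
      Matrix.smul_apply, Matrix.mul_apply, sum_eq_single (negIdx j) (by
        intro k _ hk
        rw [phC, of_apply, if_neg (by rintro rfl; simp [negIdx_negIdx] at hk), mul_zero]) (by simp)] at h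
    simp only [phC, of_apply, negIdx_negIdx, if_true, par_negIdx, smul_eq_mul] at h
    by_cases h0 : x i j = 0
    · rw [h0, mul_zero] at h
      have := (mul_eq_zero.1 h.symm).resolve_left (sg_ne_zero _)
      rw [h0, (mul_eq_zero.1 this).resolve_right (sg_ne_zero _)]
    · rw [← hx.1 _ _ h0, mul_comm (x _ _), ← mul_assoc, ← sg_add] at h
      rw [show par i + par j + (par j + 1) = par i + 1 by
        generalize par i = x, par j = y; revert x y; decide] at h
      exact (mul_left_cancel₀ (sg_ne_zero _) h).symm
  have h1 : ∑ i, ∑ j, x i j • (single (negIdx i) (negIdx j) 1 : LM n) = x := by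
    let e : Idx n ≃ Idx n := ⟨negIdx, negIdx, negIdx_negIdx, negIdx_negIdx⟩
    conv_rhs => rw [matrix_eq_sum_single x, ← Equiv.sum_comp e]
    refine sum_congr rfl fun i _ => ?_
    conv_rhs => rw [← Equiv.sum_comp e]
    refine sum_congr rfl fun j _ => ?_
    change _ = single (negIdx i) (negIdx j) (x (negIdx i) (negIdx j))
    rw [hneg, smul_single, smul_eq_mul, mul_one]
  have h2 : ∑ i, ∑ j, x i j • (single i j 1 : LM n) = x := by
    conv_rhs => rw [matrix_eq_sum_single x]
    simp only [smul_single, smul_eq_mul, mul_one]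
  simp only [qE, smul_add, sum_add_distrib]
  rw [h1, h2, ← add_smul]; norm_num

theorem qE_sq {a b : Idx n} (h : b = negIdx a) : qE a b * qE a b = qE a a := by
  subst h
  have hne : negIdx a ≠ a := fun e => by
    have := congrArg par e; rw [par_negIdx] at this; simp at this
  rw [qE, negIdx_negIdx, mul_add, add_mul, add_mul, Matrix.single_mul_single_of_ne (h := hne),
    Matrix.single_mul_single_same, Matrix.single_mul_single_same, Matrix.single_mul_single_of_ne (h := hne.symm),
    mul_one, zero_add, add_zero, qE, add_comm]

theorem diagY_sq {x : LM n} (hx : IsHom x 1) : diagY N x 1 * diagY N x 1 = -diagY N (x * x) 0 := by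
  have hs : ∀ m, hat m x 1 * hat m x 1 = -hat (N := N) m (x * x) 0 := fun m => by
    rw [hat_mul_same m hx]; simp [show (1 + 1 : ZMod 2) = 0 from rfl]
  have h2 : diagY N x 1 * diagY N x 1 + diagY N x 1 * diagY N x 1 = -diagY N (x * x) 0 + -diagY N (x * x) 0 := by
    simp only [diagY, ← Finset.sum_neg_distrib, Finset.sum_mul_sum]
    nth_rewrite 2 [sum_comm]
    simp only [← sum_add_distrib]
    refine sum_congr rfl fun m _ => ?_
    rw [sum_eq_single m, hs]
    · intro l _ hl
      rw [hat_supercomm hl hx hx]; simp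
    · simp
  rw [← two_smul ℂ, ← two_smul ℂ] at h2
  exact smul_right_injective _ (two_ne_zero' ℂ) h2

theorem mem_pureAlg {f : WM n N} (h : ∀ a b : Idx n, a ≠ b → Commute f (diagY N (qE a b) (par a + par b))) :
    f ∈ pureAlg n N := by
  let S := Subalgebra.centralizer ℂ {f}
  have hS : ∀ {g : WM n N}, g ∈ S ↔ f * g = g * f := by simp [S, Subalgebra.mem_centralizer_iff]
  have h1 : ∀ a b : Idx n, diagY N (qE a b) (par a + par b) ∈ S := by
    intro a b
    rcases eq_or_ne a b with rfl | hab
    · have hx := IsHom_qE a (negIdx a)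
      have hne : a ≠ negIdx a := fun e => by
        have := congrArg par e; rw [par_negIdx] at this; simp at this
      have hm := hS.2 (h a (negIdx a) hne)
      rw [par_negIdx, ← add_assoc, zmod2_add_self, zero_add] at hx hm
      have := neg_mem (mul_mem hm hm)
      rwa [diagY_sq hx, qE_sq rfl, neg_neg, ← zmod2_add_self (par a)] at this
    · exact hS.2 (h a b hab)
  refine mem_of_bicommutant _ (fun x => pureAlg_star) fun B hB => ?_
  refine hS.1 (mem_of_commute (fun x p hx => ?_)
    (fun m => hB _ (Algebra.subset_adjoin (Or.inl ⟨m, rfl⟩)))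
    fun a b hab => hB _ (Algebra.subset_adjoin (Or.inr ⟨a, b, hab, rfl⟩)))
  let φ : LM n →ₗ[ℂ] WM n N := ∑ m, (LinearMap.mulRight ℂ (Zd n N ℂ p)) ∘ₗ (oSHom m).toLinearMap
  have hφ : ∀ x, φ x = diagY N x p := fun x => by simp [φ, diagY, hat, oSHom_apply]
  rw [← hφ, hx.eq_sum, map_smul, map_sum]
  refine Subalgebra.smul_mem _ (Subalgebra.sum_mem _ fun i _ => ?_) _
  rw [map_sum]
  refine Subalgebra.sum_mem _ fun j _ => ?_
  rw [map_smul]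
  by_cases h0 : x i j = 0
  · rw [h0, zero_smul]; exact zero_mem _
  · rw [hφ, ← hx.1 _ _ h0]; exact Subalgebra.smul_mem _ (h1 i j) _

end bicommutant

/-! ### Partial supertransposes -/

section transpose
open Matrix Function
variable {n N : ℕ}

theorem oS_mul_apply (m : Fin N) (x : LM n) (f : WM n N) (v' v : Word n N) : (oS m x * f) v' v
    = ∑ k, x (v' m) k * sg ℂ ((par (v' m) + par k) * pre m v') * f (update v' m k) v := by
  rw [Matrix.mul_apply]
  symm
  refine Finset.sum_of_injOn (fun k => update v' m k) (fun a _ b _ h => by simpa using congrFun h m) (by simp)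
    (fun u _ hu => ?_) fun k _ => ?_
  · rw [oS, if_neg, zero_mul]
    intro h
    exact hu ⟨u m, by simp, by funext l; rcases eq_or_ne l m with rfl | e <;> [simp; (rw [h]; simp [e])]⟩
  · rw [oS, if_pos (by simp)]; simp [pre_update]

theorem mul_oS_apply (m : Fin N) (x : LM n) (f : WM n N) (v' v : Word n N) : (f * oS m x) v' v
    = ∑ k, f v' (update v m k) * (x k (v m) * sg ℂ ((par k + par (v m)) * pre m v)) := vecMul_oS m x (f v') v

/-- The supertranspose of a matrix of letters. -/
def stC (x : LM n) : LM n := fun i j => sg ℂ ((par i + par j) * par j) * x j i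

theorem IsHom_stC {x : LM n} {p : ZMod 2} (hx : IsHom x p) : IsHom (stC x) p := fun i j h => by
  rw [add_comm]; exact hx _ _ (right_ne_zero_of_mul h)

/-- The sign of the supertranspose at a site. -/
def stS (m : Fin N) (v' v : Word n N) : ZMod 2 :=
  (par (v' m) + par (v m)) * (suf m v' + suf m v) + (par (v' m) + par (v m)) * par (v m)

/-- The supertranspose at a site. -/
def sT (m : Fin N) : WM n N →ₗ[ℂ] WM n N where
  toFun f := fun v' v => sg ℂ (stS m v' v) * f (update v' m (v m)) (update v m (v' m))
  map_add' f g := by ext v' v; exact mul_add _ _ _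
  map_smul' k f := by ext v' v; exact mul_left_comm _ _ _

theorem sT_apply (m : Fin N) (f : WM n N) (v' v : Word n N) :
    sT m f v' v = sg ℂ (stS m v' v) * f (update v' m (v m)) (update v m (v' m)) := rfl

theorem sT_four (m : Fin N) (f : WM n N) : sT m (sT m (sT m (sT m f))) = f := by
  have h2 : ∀ (f : WM n N) v' v, sT m (sT m f) v' v = sg ℂ (par (v' m) + par (v m)) * f v' v := by
    intro f v' v
    rw [sT_apply, sT_apply, ← mul_assoc, ← sg_add]
    simp only [stS, update_self, update_idem, update_eq_self, suf_update, lt_irrefl, if_false, add_zero]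
    congr 2
    generalize par (v' m) = a, par (v m) = b, suf m v' + suf m v = c; revert a b c; decide
  ext v' v
  rw [h2, h2, ← mul_assoc, sg_mul_self, one_mul]

theorem HomM_sT (m : Fin N) {f : WM n N} {d : ZMod 2} (hf : HomM f d) : HomM (sT m f) d := fun v' v h => by
  have := hf _ _ (right_ne_zero_of_mul h)
  rw [tot_update, tot_update] at this
  revert this
  generalize tot v' = a, tot v = b, par (v' m) = x, par (v m) = y
  clear hf h; revert a b x y d; decide

theorem sT_oS_mul_ne {m l : Fin N} (h : l ≠ m) (x : LM n) (f : WM n N) : sT m (oS l x * f) = oS l x * sT m f := by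
  ext v' v
  rw [sT_apply, oS_mul_apply, oS_mul_apply, mul_sum]
  refine sum_congr rfl fun k _ => ?_
  rw [sT_apply, update_of_ne h, update_of_ne h.symm, update_comm h]
  have e : sg ℂ (stS m v' v) * sg ℂ ((par (v' l) + par k) * pre l (update v' m (v m)))
      = sg ℂ ((par (v' l) + par k) * pre l v') * sg ℂ (stS m (update v' l k) v) := by
    rw [← sg_add, ← sg_add, stS, stS, pre_update, suf_update, update_of_ne h.symm]
    congr 1
    generalize par (v' m) = a, par (v m) = b, par (v' l) = c, par k = d, pre l v' = t, suf m v' = t', suf m v = u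
    rcases lt_or_gt_of_ne h with hlt | hlt
    · simp only [if_neg hlt.not_gt, add_zero]; exact add_comm _ _
    · simp only [if_pos hlt]; revert a b c d t t' u; decide
  linear_combination (x (v' l) k * f (update (update v' m (v m)) l k) (update v m (v' m))) * e

theorem sT_mul_oS_ne {m l : Fin N} (h : l ≠ m) (x : LM n) (f : WM n N) : sT m (f * oS l x) = sT m f * oS l x := by
  ext v' v
  rw [sT_apply, mul_oS_apply, mul_oS_apply, mul_sum]
  refine sum_congr rfl fun k _ => ?_
  rw [sT_apply, update_of_ne h, update_of_ne h.symm, update_comm h]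
  have e : sg ℂ (stS m v' v) * sg ℂ ((par k + par (v l)) * pre l (update v m (v' m)))
      = sg ℂ ((par k + par (v l)) * pre l v) * sg ℂ (stS m v' (update v l k)) := by
    rw [← sg_add, ← sg_add, stS, stS, pre_update, suf_update, update_of_ne h.symm]
    congr 1
    generalize par (v' m) = a, par (v m) = b, par (v l) = c, par k = d, pre l v = t, suf m v' = t', suf m v = u
    rcases lt_or_gt_of_ne h with hlt | hlt
    · simp only [if_neg hlt.not_gt, add_zero]; exact add_comm _ _
    · simp only [if_pos hlt]; revert a b c d t t' u; decide
  linear_combination (x k (v l) * f (update v' m (v m)) (update (update v m (v' m)) l k)) * e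

theorem sT_oS_mul (m : Fin N) {x : LM n} {f : WM n N} {p d : ZMod 2} (hx : IsHom x p) (hf : HomM f d) :
    sT m (oS m x * f) = sg ℂ (p * d) • (sT m f * oS m (stC x)) := by
  ext v' v
  rw [sT_apply, oS_mul_apply, Matrix.smul_apply, mul_oS_apply, mul_sum, smul_eq_mul, mul_sum]
  refine sum_congr rfl fun k _ => ?_
  rw [sT_apply, stC]
  simp only [update_self, update_idem]
  by_cases h1 : x (v m) k = 0
  · simp [h1]
  by_cases h2 : f (update v' m k) (update v m (v' m)) = 0
  · simp [h2]
  have e1 := hx _ _ h1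
  have e2 := hf _ _ h2
  rw [tot_update, tot_update, tot_eq m v', tot_eq m v] at e2
  have e : sg ℂ (stS m v' v) * sg ℂ ((par (v m) + par k) * pre m (update v' m (v m))) = sg ℂ (p * d) *
      sg ℂ (stS m v' (update v m k)) * sg ℂ ((par k + par (v m)) * par (v m)) * sg ℂ ((par k + par (v m)) * pre m v) := by
    rw [← sg_add, ← sg_add, ← sg_add, ← sg_add, stS, stS, pre_update, suf_update, if_neg (lt_irrefl _), if_neg (lt_irrefl _), update_self, ← e1]
    congr 1
    clear hf h1 h2 hx e1
    revert e2
    generalize par (v' m) = a, par (v m) = b, par k = c, pre m v' = t, pre m v = t', suf m v' = u, suf m v = u'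
    revert a b c d t t' u u'; decide
  linear_combination (x (v m) k * f (update v' m k) (update v m (v' m))) * e

theorem sT_mul_oS (m : Fin N) {x : LM n} {f : WM n N} {p d : ZMod 2} (hx : IsHom x p) (hf : HomM f d) :
    sT m (f * oS m x) = sg ℂ (p * d) • (oS m (stC x) * sT m f) := by
  ext v' v
  rw [sT_apply, mul_oS_apply, Matrix.smul_apply, oS_mul_apply, mul_sum, smul_eq_mul, mul_sum]
  refine sum_congr rfl fun k _ => ?_
  rw [sT_apply, stC]
  simp only [update_self, update_idem]
  by_cases h1 : x k (v' m) = 0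
  · simp [h1]
  by_cases h2 : f (update v' m (v m)) (update v m k) = 0
  · simp [h2]
  have e1 := hx _ _ h1
  have e2 := hf _ _ h2
  rw [tot_update, tot_update, tot_eq m v', tot_eq m v] at e2
  have e : sg ℂ (stS m v' v) * sg ℂ ((par k + par (v' m)) * pre m (update v m (v' m))) = sg ℂ (p * d) *
      sg ℂ (stS m (update v' m k) v) * sg ℂ ((par (v' m) + par k) * par k) * sg ℂ ((par (v' m) + par k) * pre m v') := by
    rw [← sg_add, ← sg_add, ← sg_add, ← sg_add, stS, stS, pre_update, suf_update, if_neg (lt_irrefl _), if_neg (lt_irrefl _), update_self, ← e1]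
    congr 1
    clear hf h1 h2 hx e1
    revert e2
    generalize par (v' m) = a, par (v m) = b, par k = c, pre m v' = t, pre m v = t', suf m v' = u, suf m v = u'
    revert a b c d t t' u u'; decide
  linear_combination (x k (v' m) * f (update v' m (v m)) (update v m k)) * e

/-- The supertranspose at the sites in a list. -/
def sTl : List (Fin N) → WM n N →ₗ[ℂ] WM n N
  | [] => LinearMap.id
  | m :: l => sT m ∘ₗ sTl l

theorem sTl_cons (m : Fin N) (l : List (Fin N)) (f : WM n N) : sTl (m :: l) f = sT m (sTl l f) := rfl

variable {l : List (Fin N)} {f : WM n N} {x : LM n} {p d : ZMod 2} {m : Fin N}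

theorem sTl_injective (l : List (Fin N)) : Injective (sTl (n := n) l) := by
  induction l with
  | nil => exact injective_id
  | cons m l ih =>
    intro f g h
    exact ih (by rw [← sT_four m (sTl l f), ← sT_four m (sTl l g), ← sTl_cons, h, sTl_cons])

theorem HomM_sTl (l : List (Fin N)) (hf : HomM f d) : HomM (sTl l f) d := by
  induction l with
  | nil => exact hf
  | cons m l ih => exact HomM_sT m ih

theorem exists_sTl_eq (l : List (Fin N)) (hf : HomM f d) : ∃ g, HomM g d ∧ sTl l g = f := by
  induction l generalizing f with
  | nil => exact ⟨f, hf, rfl⟩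
  | cons m l ih =>
    obtain ⟨g, hg, h⟩ := ih (HomM_sT m (HomM_sT m (HomM_sT m hf)))
    exact ⟨g, hg, by rw [sTl_cons, h, sT_four]⟩

theorem sTl_oS_mul_of_notMem (h : m ∉ l) (x : LM n) (f : WM n N) : sTl l (oS m x * f) = oS m x * sTl l f := by
  induction l with
  | nil => rfl
  | cons a l ih =>
    rw [List.mem_cons, not_or] at h
    rw [sTl_cons, sTl_cons, ih h.2, sT_oS_mul_ne h.1]

theorem sTl_mul_oS_of_notMem (h : m ∉ l) (x : LM n) (f : WM n N) : sTl l (f * oS m x) = sTl l f * oS m x := by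
  induction l with
  | nil => rfl
  | cons a l ih =>
    rw [List.mem_cons, not_or] at h
    rw [sTl_cons, sTl_cons, ih h.2, sT_mul_oS_ne h.1]

theorem sTl_oS_mul (hl : l.Nodup) (h : m ∈ l) (hx : IsHom x p) (hf : HomM f d) :
    sTl l (oS m x * f) = sg ℂ (p * d) • (sTl l f * oS m (stC x)) := by
  induction l with
  | nil => simp at h
  | cons a l ih =>
    rw [List.nodup_cons] at hl
    rw [sTl_cons, sTl_cons]
    rcases eq_or_ne m a with rfl | e
    · rw [sTl_oS_mul_of_notMem hl.1, sT_oS_mul m hx (HomM_sTl l hf)]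
    · rw [ih hl.2 (by simpa [e] using h), map_smul, sT_mul_oS_ne e]

theorem sTl_mul_oS (hl : l.Nodup) (h : m ∈ l) (hx : IsHom x p) (hf : HomM f d) :
    sTl l (f * oS m x) = sg ℂ (p * d) • (oS m (stC x) * sTl l f) := by
  induction l with
  | nil => simp at h
  | cons a l ih =>
    rw [List.nodup_cons] at hl
    rw [sTl_cons, sTl_cons]
    rcases eq_or_ne m a with rfl | e
    · rw [sTl_mul_oS_of_notMem hl.1, sT_mul_oS m hx (HomM_sTl l hf)]
    · rw [ih hl.2 (by simpa [e] using h), map_smul, sT_oS_mul_ne e]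

theorem commute_mul_Zd_iff {X : WM n N} (hf : HomM f d) :
    Commute f (X * Zd n N ℂ p) ↔ f * X = sg ℂ (p * d) • (X * f) := by
  have h : X * Zd n N ℂ p * f = (sg ℂ (p * d) • (X * f)) * Zd n N ℂ p := by
    rw [mul_assoc, Zd_mul_hom hf, mul_smul_comm, smul_mul_assoc, mul_assoc]
  rw [Commute, SemiconjBy, h, ← mul_assoc]
  refine ⟨fun e => ?_, fun e => by rw [e]⟩
  have hZ : Zd n N ℂ p * Zd n N ℂ p = 1 := by rw [← Zd_add, zmod2_add_self, Zd_zero]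
  have := congrArg (· * Zd n N ℂ p) e
  simpa only [mul_assoc, hZ, mul_one] using this

/-- The action of `x` on mixed words, the sites in `l` being dual. -/
def mixY (l : List (Fin N)) (x : LM n) (p : ZMod 2) : WM n N :=
  ∑ m, hat m (if m ∈ l then -stC x else x) p

theorem commute_diagY_of_mixY (hl : l.Nodup) (hx : IsHom x p) (hf : HomM f d)
    (h : Commute (sTl l f) (mixY l x p)) : Commute f (diagY N x p) := by
  have e1 : mixY l x p = (∑ m, oS m (if m ∈ l then -stC x else x)) * Zd n N ℂ p := (sum_mul _ _ _).symm
  have e2 : diagY N x p = (∑ m, oS m x) * Zd n N ℂ p := (sum_mul _ _ _).symm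
  rw [e1, commute_mul_Zd_iff (HomM_sTl l hf), ← sub_eq_zero] at h
  rw [e2, commute_mul_Zd_iff hf, ← sub_eq_zero]
  refine sTl_injective l ?_
  rw [map_zero, ← h, mul_sum, sum_mul, smul_sum, ← Finset.sum_sub_distrib, mul_sum,
    sum_mul, smul_sum, ← Finset.sum_sub_distrib, map_sum]
  refine sum_congr rfl fun m _ => ?_
  rw [map_sub, map_smul]
  split_ifs with hm
  · rw [sTl_mul_oS hl hm hx hf, sTl_oS_mul hl hm hx hf, smul_smul, sg_mul_self, one_smul, ← oSHom_apply m (-stC x),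
      map_neg, oSHom_apply, mul_neg, neg_mul, smul_neg]
    abel
  · rw [sTl_mul_oS_of_notMem hm, sTl_oS_mul_of_notMem hm]

end transpose

/-! ### The mixed algebra -/

section mixed
open Matrix Function
variable {n N : ℕ} {l : List (Fin N)} {B : Subalgebra ℂ (WM n N)}

/-- The composite of the evaluation and the coevaluation at two sites. -/
def cap (n : ℕ) (a b : Fin N) : WM n N := ∑ i, ∑ j, sg ℂ (par i * par j) • (sE ℂ a i j * sE ℂ b i j)

theorem stC_single (i j : Idx n) :
    stC (single i j 1) = sg ℂ ((par i + par j) * par i) • (single j i 1 : LM n) := by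
  ext a b
  rw [stC, Matrix.smul_apply, smul_eq_mul, single_apply, single_apply]
  by_cases h : i = b ∧ j = a
  · obtain ⟨rfl, rfl⟩ := h; simp [add_comm]
  · rw [if_neg h, if_neg (fun e => h e.symm), mul_zero, mul_zero]

theorem sTl_sE_mul (hl : l.Nodup) {m : Fin N} (h : m ∈ l) (i j : Idx n) {f : WM n N} {d : ZMod 2} (hf : HomM f d) :
    sTl l (sE ℂ m i j * f) = sg ℂ ((par i + par j) * d + (par i + par j) * par i) • (sTl l f * sE ℂ m j i) := by
  rw [sE, sTl_oS_mul hl h (IsHom_single i j) hf, stC_single, oS_smul, mul_smul_comm, smul_smul, ← sg_add, sE]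

theorem sTl_sw_mul (hl : l.Nodup) (hs : ∀ a b, a ≠ b → (a ∈ l ↔ b ∈ l) → sw n a b ∈ B)
    (he : ∀ a b, a ∉ l → b ∈ l → cap n a b ∈ B) {y z : Fin N} (hyz : y ≠ z) {g : WM n N} (hg : HomM g 0)
    (hy : ∀ x, g * oS y x = oS y x * g) (hB : sTl l g ∈ B) : sTl l (sw n y z * g) ∈ B := by
  have e : ∀ y z : Fin N, sTl l (sw n y z * g) = ∑ i, ∑ j, sg ℂ (par j) • sTl l (sE ℂ y i j * (sE ℂ z j i * g)) := by
    intro y z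
    simp only [sw, sum_mul, map_sum, smul_mul_assoc, map_smul, mul_assoc]
  have hd : ∀ (z : Fin N) (i j : Idx n), HomM (sE ℂ z j i * g) (par j + par i) := fun z i j => by
    simpa using (HomM_sE z j i).mul hg
  by_cases h1 : y ∈ l <;> by_cases h2 : z ∈ l
  · have : sTl l (sw n y z * g) = sTl l g * sw n z y := by
      rw [e, sw, mul_sum]
      refine sum_congr rfl fun i _ => ?_
      rw [mul_sum]
      refine sum_congr rfl fun j _ => ?_
      rw [sTl_sE_mul hl h1 i j (hd z i j), sTl_sE_mul hl h2 j i hg, smul_mul_assoc, smul_smul, smul_smul, ← sg_add,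
        ← sg_add, mul_smul_comm, mul_assoc]
      congr 2
      generalize par i = a, par j = b; revert a b; decide
    rw [this]; exact mul_mem hB (hs _ _ hyz.symm (by simp [h1, h2]))
  · have : sTl l (sw n y z * g) = cap n z y * sTl l g := by
      rw [sw_comm hyz, e, cap, sum_mul]
      refine sum_congr rfl fun i _ => ?_
      rw [sum_mul]
      refine sum_congr rfl fun j _ => ?_
      have h3 : sTl l g * sE ℂ y i j = sE ℂ y i j * sTl l g := by
        have h4 := congrArg (sTl l) (hy (single j i 1))
        rw [sTl_oS_mul hl h1 (IsHom_single j i) hg, sTl_mul_oS hl h1 (IsHom_single j i) hg, stC_single, oS_smul,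
          smul_mul_assoc, mul_smul_comm] at h4
        have h5 : ∀ p, Injective fun A : WM n N => sg ℂ p • A := fun p => smul_right_injective _ (sg_ne_zero _)
        exact (h5 _ (h5 _ h4)).symm
      rw [sE, sTl_oS_mul_of_notMem h2, sTl_sE_mul hl h1 j i hg, h3, mul_smul_comm, smul_smul, ← sg_add,
        smul_mul_assoc, mul_assoc, sE]
      congr 2
      generalize par i = a, par j = b; revert a b; decide
    rw [this]; exact mul_mem (he _ _ h2 h1) hB
  · have : sTl l (sw n y z * g) = sTl l g * cap n y z := by
      rw [e, cap, mul_sum]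
      refine sum_congr rfl fun i _ => ?_
      rw [mul_sum]
      refine sum_congr rfl fun j _ => ?_
      have h3 : sE ℂ y i j * sTl l g = sTl l g * sE ℂ y i j := by
        have h4 := congrArg (sTl l) (hy (single i j 1))
        rw [sTl_oS_mul_of_notMem h1, sTl_mul_oS_of_notMem h1] at h4
        exact h4.symm
      rw [sE, sTl_oS_mul_of_notMem h1, sTl_sE_mul hl h2 j i hg, mul_smul_comm, ← mul_assoc, ← sE, h3, smul_smul, ← sg_add,
        mul_smul_comm, mul_assoc]
      congr 2
      generalize par i = a, par j = b; revert a b; decide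
    rw [this]; exact mul_mem hB (he _ _ h1 h2)
  · have : sTl l (sw n y z * g) = sw n y z * sTl l g := by
      rw [e, sw, sum_mul]
      refine sum_congr rfl fun i _ => ?_
      rw [sum_mul]
      refine sum_congr rfl fun j _ => ?_
      rw [sE, sTl_oS_mul_of_notMem h1, sE, sTl_oS_mul_of_notMem h2, smul_mul_assoc, mul_assoc]
    rw [this]; exact mul_mem (hs _ _ hyz (by simp [h1, h2])) hB

theorem sTl_one (l : List (Fin N)) : sTl l (1 : WM n N) = 1 := by
  have h : ∀ m : Fin N, sT m (1 : WM n N) = 1 := fun m => by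
    ext v' v
    rw [sT_apply, Matrix.one_apply, Matrix.one_apply]
    by_cases e : v' = v
    · subst e; simp [stS, zmod2_add_self]
    · rw [if_neg e, if_neg, mul_zero]
      intro h'
      have h1 : v' m = v m := by simpa using (congrFun h' m).symm
      exact e (by rw [← update_eq_self m v', ← update_eq_self m v, ← h1]; rw [h1, h', h1])
  induction l with
  | nil => rfl
  | cons m l ih => rw [sTl_cons, ih, h]

theorem exists_impl_sTl_mem (hl : l.Nodup) (hs : ∀ a b, a ≠ b → (a ∈ l ↔ b ∈ l) → sw n a b ∈ B)
    (he : ∀ a b, a ∉ l → b ∈ l → cap n a b ∈ B) (σ : Equiv.Perm (Fin N)) : ∃ g, Impl σ g ∧ sTl l g ∈ B := by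
  induction h : σ.support.card using Nat.strong_induction_on generalizing σ with
  | _ k ih =>
    by_cases h1 : σ = 1
    · exact ⟨1, h1 ▸ Impl.one, by rw [sTl_one]; exact one_mem _⟩
    · obtain ⟨y, hy⟩ : ∃ y, σ y ≠ y := by
        by_contra hc; push Not at hc; exact h1 (Equiv.ext hc)
      obtain ⟨g, hg, hB⟩ := ih _ (h ▸ Equiv.Perm.card_support_swap_mul hy) (Equiv.swap y (σ y) * σ) rfl
      refine ⟨sw n y (σ y) * g, ?_, sTl_sw_mul hl hs he hy.symm hg.even (fun x => ?_) hB⟩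
      · have := (Impl_sw (n := n) hy.symm).mul hg
        rwa [← mul_assoc, Equiv.swap_mul_self, one_mul] at this
      · rw [hg.oS, Equiv.Perm.mul_apply, Equiv.swap_apply_right]

theorem Impl.eq_smul {σ : Equiv.Perm (Fin N)} {g g' : WM n N} (hg : Impl σ g) (hg' : Impl σ g') :
    ∃ k : ℂ, g' = k • g := by
  obtain ⟨⟨g, h, hgh, hhg⟩, rfl⟩ := hg.unit
  have hoS : ∀ m x, h * g' * QWBC.oS m x = QWBC.oS m x * (h * g') := fun m x => by
    have := hg.oS m x
    have h2 : h * QWBC.oS (σ m) x = QWBC.oS m x * h := by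
      calc h * QWBC.oS (σ m) x = h * (QWBC.oS (σ m) x * g) * h := by simp only [mul_assoc, hgh, mul_one]
        _ = QWBC.oS m x * h := by rw [← this, ← mul_assoc, hhg, one_mul]
    rw [mul_assoc, hg'.oS, ← mul_assoc, h2, mul_assoc]
  have hZ : ∀ p, h * g' * Zd n N ℂ p = Zd n N ℂ p * (h * g') := fun p => by
    have := commute_Zd_of_even hg.even p
    have h2 : h * Zd n N ℂ p = Zd n N ℂ p * h := by
      calc h * Zd n N ℂ p = h * (Zd n N ℂ p * g) * h := by simp only [mul_assoc, hgh, mul_one]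
        _ = Zd n N ℂ p * h := by rw [← this, ← mul_assoc, hhg, one_mul]
    rw [mul_assoc, commute_Zd_of_even hg'.even, ← mul_assoc, h2, mul_assoc]
  have hall : ∀ f : WM n N, f * (h * g') = h * g' * f := fun f => by
    have hf : f ∈ SP n (∅ : Finset (Fin N)) := by rw [SP_empty]; trivial
    generalize h * g' = u at hoS hZ ⊢
    induction hf using span_induction with
    | zero => simp
    | add v w _ _ hv hw => rw [mul_add, add_mul, hv, hw]
    | smul k v _ hv => rw [mul_smul_comm, smul_mul_assoc, hv]
    | mem w hw =>
      obtain ⟨F, d, -, -, rfl⟩ := hw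
      generalize finRange N = l
      induction l with
      | nil => simp [hprod]
      | cons i l ih =>
        rw [hprod_cons, mul_assoc, ih, ← mul_assoc, QWBC.hat, mul_assoc (QWBC.oS _ _), ← hZ, ← mul_assoc, ← hoS]
        simp only [mul_assoc]
  obtain ⟨k, hk⟩ := Matrix.mem_range_scalar_of_commute_single (M := h * g') fun i j _ => hall _
  refine ⟨k, ?_⟩
  have : g' = g * (h * g') := by rw [← mul_assoc, hgh, one_mul]
  rw [this, ← hk]
  change g * Matrix.scalar (Word n N) k = k • g
  rw [Matrix.scalar_apply, ← Matrix.smul_one_eq_diagonal, mul_smul_comm, mul_one]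

/-- A product of Clifford generators. -/
def cw (n : ℕ) (L : List (Fin N)) : WM n N := (L.map fun m => oS m (phC n)).prod

theorem cw_cons (m : Fin N) (L : List (Fin N)) : cw n (m :: L) = oS m (phC n) * cw n L := List.prod_cons

theorem Impl.cw {σ : Equiv.Perm (Fin N)} {g : WM n N} (hg : Impl σ g) (L : List (Fin N)) :
    g * QWBC.cw n L = QWBC.cw n (L.map σ) * g := by
  induction L with
  | nil => simp [QWBC.cw]
  | cons m L ih => rw [cw_cons, List.map_cons, cw_cons, ← mul_assoc, hg.oS, mul_assoc, ih, mul_assoc]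

theorem HomM_cw (L : List (Fin N)) : HomM (cw n L) (L.length : ZMod 2) := by
  induction L with
  | nil => simpa [cw] using HomM_one
  | cons m L ih =>
    rw [cw_cons, List.length_cons, Nat.cast_succ, add_comm]
    exact (HomM_oS IsHom_phC).mul ih

theorem pureAlg_le (n N : ℕ) : Subalgebra.toSubmodule (pureAlg n N)
    ≤ Submodule.span ℂ {f | ∃ L σ g, Impl σ g ∧ f = cw n L * g} := by
  intro f hf
  set S := Submodule.span ℂ {f : WM n N | ∃ L σ g, Impl σ g ∧ f = cw n L * g}
  have key : ∀ h ∈ S, f * h ∈ S := by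
    induction hf using Algebra.adjoin_induction with
    | mem x hx =>
      intro h hh
      induction hh using span_induction with
      | zero => rw [mul_zero]; exact zero_mem _
      | add v w _ _ hv hw => rw [mul_add]; exact add_mem hv hw
      | smul k v _ hv => rw [mul_smul_comm]; exact Submodule.smul_mem _ _ hv
      | mem w hw =>
        obtain ⟨L, σ, g, hg, rfl⟩ := hw
        refine subset_span ?_
        rcases hx with ⟨m, rfl⟩ | ⟨a, b, hab, rfl⟩
        · exact ⟨m :: L, σ, g, hg, by rw [cw_cons, mul_assoc]⟩
        · exact ⟨_, _, _, (Impl_sw hab).mul hg, by rw [← mul_assoc, (Impl_sw hab).cw, mul_assoc]⟩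
    | algebraMap r => intro h hh; rw [← Algebra.smul_def]; exact Submodule.smul_mem _ _ hh
    | add x y _ _ hx hy => intro h hh; rw [add_mul]; exact add_mem (hx h hh) (hy h hh)
    | mul x y _ _ hx hy => intro h hh; rw [mul_assoc]; exact hx _ (hy h hh)
  have := key 1 (subset_span ⟨[], 1, 1, Impl.one, by simp [cw]⟩)
  rwa [mul_one] at this

theorem sTl_pureAlg_mem (hl : l.Nodup) (hs : ∀ a b, a ≠ b → (a ∈ l ↔ b ∈ l) → sw n a b ∈ B)
    (he : ∀ a b, a ∉ l → b ∈ l → cap n a b ∈ B) (hc : ∀ m ∉ l, oS m (phC n) ∈ B)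
    (hc' : ∀ m ∈ l, oS m (stC (phC n)) ∈ B) {f : WM n N} (hf : f ∈ pureAlg n N) : sTl l f ∈ B := by
  have hf' := pureAlg_le n N hf
  clear hf
  induction hf' using span_induction with
  | zero => rw [map_zero]; exact zero_mem _
  | add v w _ _ hv hw => rw [map_add]; exact add_mem hv hw
  | smul k v _ hv => rw [map_smul]; exact Subalgebra.smul_mem _ hv _
  | mem w hw =>
    obtain ⟨L, σ, g, hg, rfl⟩ := hw
    induction L with
    | nil =>
      obtain ⟨g0, hg0, hB⟩ := exists_impl_sTl_mem hl hs he σ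
      obtain ⟨k, rfl⟩ := hg0.eq_smul hg
      rw [cw, List.map_nil, List.prod_nil, one_mul, map_smul]; exact Subalgebra.smul_mem _ hB _
    | cons m L ih =>
      rw [cw_cons, mul_assoc]
      by_cases hm : m ∈ l
      · rw [sTl_oS_mul hl hm IsHom_phC ((HomM_cw L).mul hg.even)]
        exact Subalgebra.smul_mem _ (mul_mem ih (hc' m hm)) _
      · rw [sTl_oS_mul_of_notMem hm]; exact mul_mem (hc m hm) ih

theorem Impl.apply_eq_zero {σ : Equiv.Perm (Fin N)} {g : WM n N} (hg : Impl σ g) {v w : Word n N} {m : Fin N}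
    (h : v (σ m) ≠ w m) : g v w = 0 := by
  have h1 := congrFun (congrFun (hg.oS m (single (w m) (w m) 1)) v) w
  rw [mul_oS_apply, oS_mul_apply, sum_eq_single (w m)] at h1
  · simpa [single_apply, h.symm, zmod2_add_self] using h1
  · intro k _ hk; simp [single_apply, hk.symm]
  · simp

theorem Impl.apply_ne_zero {σ : Equiv.Perm (Fin N)} {g : WM n N} (hg : Impl σ g) (w : Word n N) :
    g (fun m => w (σ⁻¹ m)) w ≠ 0 := by
  obtain ⟨⟨g, h, hgh, hhg⟩, rfl⟩ := hg.unit
  intro h0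
  have h1 := congrFun (congrFun hhg w) w
  rw [Matrix.mul_apply, Matrix.one_apply_eq, sum_eq_zero] at h1
  · exact zero_ne_one h1
  · intro u _
    by_cases hu : u = fun m => w (σ⁻¹ m)
    · rw [hu]; exact mul_eq_zero_of_right _ h0
    · obtain ⟨m, hm⟩ := Function.ne_iff.1 hu
      refine mul_eq_zero_of_right _ (hg.apply_eq_zero (m := σ⁻¹ m) ?_)
      simpa using hm

theorem cw_apply {L : List (Fin N)} (hL : L.Nodup) (v w : Word n N) : ∃ k : ℂ, k ≠ 0 ∧
    cw n L v w = if v = (fun m => if m ∈ L then negIdx (w m) else w m) then k else 0 := by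
  induction L generalizing v with
  | nil => exact ⟨1, one_ne_zero, by simp [cw, Matrix.one_apply]⟩
  | cons a L ih =>
    rw [List.nodup_cons] at hL
    rw [cw_cons, oS_mul_apply, sum_eq_single (negIdx (v a))]
    · obtain ⟨k, hk, h⟩ := ih hL.2 (update v a (negIdx (v a)))
      refine ⟨sg ℂ (par (v a)) * sg ℂ ((par (v a) + par (negIdx (v a))) * pre a v) * k,
        mul_ne_zero (mul_ne_zero (sg_ne_zero _) (sg_ne_zero _)) hk, ?_⟩
      rw [h, phC, of_apply, if_pos rfl, mul_ite, mul_zero]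
      congr 1
      refine propext ⟨fun e => funext fun m => ?_, fun e => funext fun m => ?_⟩
      · have := congrFun e m
        rcases eq_or_ne m a with rfl | hm
        · simp only [update_self, hL.1, if_false] at this
          simp [← this, negIdx_negIdx]
        · simpa [hm] using this
      · have := congrFun e m
        rcases eq_or_ne m a with rfl | hm
        · simp only [List.mem_cons, true_or, if_true] at this
          simp [this, negIdx_negIdx, hL.1]
        · simpa [hm] using this
    · intro k _ hk; simp [phC, hk]
    · simp

theorem exists_linearIndependent (h : N ≤ n) : ∃ F : Equiv.Perm (Fin N) × Finset (Fin N) → WM n N,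
    LinearIndependent ℂ F ∧ ∀ i, F i ∈ pureAlg n N := by
  choose g hg hi using exists_impl (n := n) (N := N)
  let w0 : Word n N := fun m => ⟨(m : ℤ) + 1, by
    simp only [Finset.mem_erase, Finset.mem_Icc]; have := m.2; omega⟩
  let wd : Equiv.Perm (Fin N) × Finset (Fin N) → Word n N := fun i m =>
    if m ∈ i.2 then negIdx (w0 (i.1⁻¹ m)) else w0 (i.1⁻¹ m)
  have hval : ∀ i m, (wd i m).1 = if m ∈ i.2 then -((i.1⁻¹ m : Fin N) + 1 : ℤ) else ((i.1⁻¹ m : Fin N) + 1 : ℤ) := by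
    intro i m; simp only [wd, w0]; split_ifs <;> rfl
  have hinj : Injective wd := by
    rintro ⟨σ, J⟩ ⟨τ, K⟩ e
    have h1 : ∀ m, (m ∈ J ↔ m ∈ K) ∧ σ⁻¹ m = τ⁻¹ m := fun m => by
      have := congrArg Subtype.val (congrFun e m)
      rw [hval, hval] at this
      simp only at this
      split_ifs at this with h1 h2 h2
      · exact ⟨by simp [h1, h2], Fin.ext (by omega)⟩
      · omega
      · omega
      · exact ⟨by simp [h1, h2], Fin.ext (by omega)⟩
    refine Prod.ext (inv_injective (Equiv.ext fun m => (h1 m).2)) (Finset.ext fun m => (h1 m).1)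
  let F : Equiv.Perm (Fin N) × Finset (Fin N) → WM n N := fun i => cw n i.2.toList * g i.1
  have hF : ∀ i v, ∃ k : ℂ, k ≠ 0 ∧ F i v w0 = if v = wd i then k else 0 := by
    rintro ⟨σ, J⟩ v
    obtain ⟨k, hk, h⟩ := cw_apply J.nodup_toList v (fun m => w0 (σ⁻¹ m))
    refine ⟨k * g σ (fun m => w0 (σ⁻¹ m)) w0, mul_ne_zero hk ((hi σ).apply_ne_zero w0), ?_⟩
    change (cw n J.toList * g σ) v w0 = _
    rw [Matrix.mul_apply, sum_eq_single (fun m => w0 (σ⁻¹ m)), h, ite_mul, zero_mul]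
    · simp only [Finset.mem_toList, wd]
    · intro u _ hu
      obtain ⟨m, hm⟩ := Function.ne_iff.1 hu
      exact mul_eq_zero_of_right _ ((hi σ).apply_eq_zero (m := σ⁻¹ m) (by simpa using hm))
    · simp
  refine ⟨F, Fintype.linearIndependent_iff.2 fun c hc i => ?_, fun i => mul_mem (list_prod_mem fun x hx => ?_) ?_⟩
  · have := congrFun (congrFun hc (wd i)) w0
    rw [Matrix.sum_apply, sum_eq_single i] at this
    · obtain ⟨k, hk, h⟩ := hF i (wd i)
      rw [Matrix.smul_apply, h, if_pos rfl, Matrix.zero_apply, smul_eq_mul] at this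
      exact (mul_eq_zero.1 this).resolve_right hk
    · intro j _ hj
      obtain ⟨k, hk, h⟩ := hF j (wd i)
      rw [Matrix.smul_apply, h, if_neg (fun e => hj (hinj e).symm), smul_zero]
    · simp
  · obtain ⟨m, -, rfl⟩ := List.mem_map.1 hx
    exact Algebra.subset_adjoin (Or.inl ⟨m, rfl⟩)
  · exact (Submonoid.closure_le (S := (pureAlg n N).toSubmonoid)).2
      (fun x hx => Algebra.subset_adjoin (Or.inr hx)) (hg i.1)

end mixed

/-! ### Specialization at `q = 1` -/

section specialize
open Polynomial

/-- The rational function `x` is regular at `1` with the value `c`. -/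
def Sp (x : Cq) (c : ℂ) : Prop :=
  ∃ p d : ℂ[X], d.eval 1 ≠ 0 ∧ x * algebraMap ℂ[X] Cq d = algebraMap ℂ[X] Cq p ∧ p.eval 1 = c * d.eval 1

theorem Sp_poly (p : ℂ[X]) : Sp (algebraMap ℂ[X] Cq p) (p.eval 1) := ⟨p, 1, by simp, by simp, by simp⟩

theorem Sp.add {x y : Cq} {a b : ℂ} (hx : Sp x a) (hy : Sp y b) : Sp (x + y) (a + b) := by
  obtain ⟨p, d, hd, h, h'⟩ := hx
  obtain ⟨p', d', hd', k, k'⟩ := hy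
  refine ⟨p * d' + p' * d, d * d', by simp [hd, hd'], ?_, ?_⟩
  · rw [map_add, map_mul, map_mul, map_mul, ← h, ← k]; ring
  · rw [eval_add, eval_mul, eval_mul, eval_mul, h', k']; ring

theorem Sp.mul {x y : Cq} {a b : ℂ} (hx : Sp x a) (hy : Sp y b) : Sp (x * y) (a * b) := by
  obtain ⟨p, d, hd, h, h'⟩ := hx
  obtain ⟨p', d', hd', k, k'⟩ := hy
  refine ⟨p * p', d * d', by simp [hd, hd'], ?_, ?_⟩
  · rw [map_mul, map_mul, ← h, ← k]; ring
  · rw [eval_mul, eval_mul, h', k']; ring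

theorem Sp_zero : Sp 0 0 := by simpa using Sp_poly 0

theorem Sp_one : Sp 1 1 := by simpa using Sp_poly 1

theorem Sp_const (c : ℂ) : Sp (algebraMap ℂ Cq c) c := by
  have := Sp_poly (C c)
  rwa [eval_C, ← Polynomial.algebraMap_eq, ← IsScalarTower.algebraMap_apply] at this

theorem Sp_neg_one : Sp (-1) (-1) := by simpa using Sp_const (-1)

theorem Sp_sg (p : ZMod 2) : Sp (sg Cq p) (sg ℂ p) := by
  rcases zmod2_cases p with rfl | rfl
  · simpa using Sp_one
  · simpa using Sp_neg_one

theorem Sp.eq_zero {c : ℂ} (h : Sp 0 c) : c = 0 := by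
  obtain ⟨p, d, hd, h, h'⟩ := h
  rw [zero_mul, eq_comm, map_eq_zero_iff _ (IsFractionRing.injective ℂ[X] Cq)] at h
  rw [h, eval_zero] at h'
  exact (mul_eq_zero.1 h'.symm).resolve_right hd

theorem Sp.unique {x : Cq} {a b : ℂ} (ha : Sp x a) (hb : Sp x b) : a = b := by
  have := ha.add (Sp_neg_one.mul hb)
  rw [neg_one_mul, add_neg_cancel] at this
  have := this.eq_zero
  linear_combination this

theorem Sp.sum {ι : Type} (s : Finset ι) {x : ι → Cq} {a : ι → ℂ} (h : ∀ i ∈ s, Sp (x i) (a i)) :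
    Sp (∑ i ∈ s, x i) (∑ i ∈ s, a i) := by
  classical
  induction s using Finset.induction_on with
  | empty => simpa using Sp_zero
  | insert i s hi ih =>
    rw [sum_insert hi, sum_insert hi]
    exact (h i (Finset.mem_insert_self _ _)).add (ih fun j hj => h j (Finset.mem_insert_of_mem hj))

theorem Sp_q_zpow (k : ℤ) : Sp (q ^ k) 1 := by
  have h1 : ∀ k : ℕ, Sp (q ^ k) 1 := fun k => by simpa [q] using Sp_poly (X ^ k)
  have h2 : ∀ k : ℕ, Sp (q⁻¹ ^ k) 1 := fun k => ⟨1, X ^ k, by simp, by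
    rw [map_pow, RatFunc.algebraMap_X, map_one, ← mul_pow]
    change (q⁻¹ * q) ^ k = 1
    rw [inv_mul_cancel₀ q_ne_zero, one_pow], by simp⟩
  rcases k with k | k
  · simpa using h1 k
  · simpa [zpow_negSucc] using h2 (k + 1)

theorem Sp_xi : Sp xi 0 := by
  have := (Sp_q_zpow 1).add (Sp_neg_one.mul (Sp_q_zpow (-1)))
  rw [zpow_one, zpow_neg_one, neg_one_mul, neg_one_mul, add_neg_cancel, ← sub_eq_add_neg] at this
  exact this

theorem Sp_ite {P : Prop} [Decidable P] {x y : Cq} {a b : ℂ} (hx : P → Sp x a) (hy : ¬P → Sp y b) :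
    Sp (if P then x else y) (if P then a else b) := by
  split_ifs with h
  · exact hx h
  · exact hy h

/-- A nonzero vector of rational functions has a multiple with a nonzero value at `1`. -/
theorem exists_Sp {ι : Type} [Finite ι] {x : ι → Cq} (hx : x ≠ 0) :
    ∃ (k : Cq) (c : ι → ℂ), c ≠ 0 ∧ ∀ i, Sp (k * x i) (c i) := by
  have key : ∀ (N : ℕ) (P : ι → ℂ[X]) (j : ι), P j ≠ 0 → (P j).natDegree = N →
      ∃ (k : Cq) (c : ι → ℂ), c ≠ 0 ∧ ∀ i, Sp (k * algebraMap ℂ[X] Cq (P i)) (c i) := by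
    intro N
    induction N with
    | zero =>
      intro P j hj hN
      refine ⟨1, fun i => (P i).eval 1, fun h => hj ?_, fun i => by simpa using Sp_poly (P i)⟩
      have := congrFun h j
      rw [eq_C_of_natDegree_eq_zero hN] at this ⊢
      simpa using this
    | succ N ih =>
      intro P j hj hN
      by_cases h : ∃ i, (P i).eval 1 ≠ 0
      · obtain ⟨i, hi⟩ := h
        exact ⟨1, fun i => (P i).eval 1, fun h => hi (congrFun h i), fun i => by simpa using Sp_poly (P i)⟩
      · push Not at h
        choose Q hQ using fun i => dvd_iff_isRoot.2 (h i)
        have hQj : Q j ≠ 0 := by intro e; rw [hQ j, e, mul_zero] at hj; exact hj rfl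
        have hne : (X - C (1 : ℂ)) ≠ 0 := X_sub_C_ne_zero 1
        obtain ⟨k, c, hc, h2⟩ := ih Q j hQj (by
          rw [hQ j, natDegree_mul hne hQj, natDegree_X_sub_C] at hN; omega)
        refine ⟨k * (algebraMap ℂ[X] Cq (X - C 1))⁻¹, c, hc, fun i => ?_⟩
        have h3 : algebraMap ℂ[X] Cq (X - C 1) ≠ 0 := by
          rwa [Ne, map_eq_zero_iff _ (IsFractionRing.injective ℂ[X] Cq)]
        rw [hQ i, map_mul, mul_assoc, inv_mul_cancel_left₀ h3]
        exact h2 i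
  obtain ⟨b, hb⟩ := IsLocalization.exist_integer_multiples_of_finite (nonZeroDivisors ℂ[X]) x
  choose P hP using hb
  obtain ⟨j, hj⟩ := Function.ne_iff.1 hx
  have hb0 : algebraMap ℂ[X] Cq b ≠ 0 := by
    rw [Ne, map_eq_zero_iff _ (IsFractionRing.injective ℂ[X] Cq)]
    exact nonZeroDivisors.ne_zero b.2
  have hP' : ∀ i, algebraMap ℂ[X] Cq (P i) = algebraMap ℂ[X] Cq b * x i := fun i => by
    rw [hP, Algebra.smul_def]
  obtain ⟨k, c, hc, h⟩ := key _ P j (fun e => by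
    have := hP' j
    rw [e, map_zero, eq_comm, mul_eq_zero] at this
    exact hj (this.resolve_left hb0)) rfl
  exact ⟨k * algebraMap ℂ[X] Cq b, c, hc, fun i => by rw [mul_assoc, ← hP']; exact h i⟩

variable {W : Type} [Fintype W] [DecidableEq W]

/-- The entrywise specialization of matrices. -/
def SpM (X : Matrix W W Cq) (x : Matrix W W ℂ) : Prop := ∀ v w, Sp (X v w) (x v w)

variable {X Y : Matrix W W Cq} {x y : Matrix W W ℂ}

theorem SpM.add (hX : SpM X x) (hY : SpM Y y) : SpM (X + Y) (x + y) := fun v w => (hX v w).add (hY v w)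

theorem SpM.mul (hX : SpM X x) (hY : SpM Y y) : SpM (X * Y) (x * y) := fun v w =>
  Sp.sum _ fun u _ => (hX v u).mul (hY u w)

theorem SpM.smul {k : Cq} {c : ℂ} (hk : Sp k c) (hX : SpM X x) : SpM (k • X) (c • x) := fun v w => hk.mul (hX v w)

theorem SpM_diagonal {f : W → Cq} {c : W → ℂ} (h : ∀ w, Sp (f w) (c w)) :
    SpM (diagonal f) (diagonal c) := fun v w => Sp_ite (fun _ => h v) fun _ => Sp_zero

theorem SpM_one : SpM (1 : Matrix W W Cq) 1 := SpM_diagonal fun _ => Sp_one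

theorem SpM_zero : SpM (0 : Matrix W W Cq) 0 := fun _ _ => Sp_zero

theorem SpM.sum {ι : Type} (s : Finset ι) {X : ι → Matrix W W Cq} {x : ι → Matrix W W ℂ}
    (h : ∀ i ∈ s, SpM (X i) (x i)) : SpM (∑ i ∈ s, X i) (∑ i ∈ s, x i) := fun v w => by
  rw [Matrix.sum_apply, Matrix.sum_apply]; exact Sp.sum _ fun i hi => h i hi v w

theorem SpM.unique (h : SpM X x) (h' : SpM X y) : x = y := Matrix.ext fun v w => (h v w).unique (h' v w)

theorem exists_SpM (hX : X ≠ 0) : ∃ (k : Cq) (x : Matrix W W ℂ), x ≠ 0 ∧ SpM (k • X) x := by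
  obtain ⟨k, c, hc, h⟩ := exists_Sp (x := fun i : W × W => X i.1 i.2) fun e =>
    hX (Matrix.ext fun v w => congrFun e (v, w))
  exact ⟨k, fun v w => c (v, w), fun e => hc (funext fun i => congrFun (congrFun e i.1) i.2), fun v w => h (v, w)⟩

theorem LinearIndependent.of_SpM {ι : Type} [Fintype ι] {D : ι → Matrix W W Cq} {d : ι → Matrix W W ℂ}
    (hd : LinearIndependent ℂ d) (h : ∀ i, SpM (D i) (d i)) : LinearIndependent Cq D := by
  refine Fintype.linearIndependent_iff.2 fun a ha => ?_
  by_contra hne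
  push Not at hne
  obtain ⟨k, c, hc, h2⟩ := exists_Sp (x := a) (Function.ne_iff.2 hne)
  refine hc (funext (Fintype.linearIndependent_iff.1 hd c ?_))
  have h3 := SpM.sum Finset.univ fun i _ => SpM.smul (h2 i) (h i)
  have h4 : ∑ i, (k * a i) • D i = 0 := by simp only [mul_smul, ← smul_sum, ha, smul_zero]
  rw [h4] at h3
  exact h3.unique SpM_zero

theorem finrank_le_of_SpM (U : Submodule Cq (Matrix W W Cq)) (A : Submodule ℂ (Matrix W W ℂ))
    (h : ∀ X ∈ U, ∀ x, SpM X x → x ∈ A) : Module.finrank Cq U ≤ Module.finrank ℂ A := by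
  by_contra hlt
  push Not at hlt
  obtain ⟨φ, hφ⟩ := LinearMap.exists_extend (p := A) (Module.finBasis ℂ A).equivFun.toLinearMap
  let Φ : Matrix W W Cq →ₗ[Cq] (Fin (Module.finrank ℂ A) → Cq) := LinearMap.pi fun i => ∑ v, ∑ w,
    algebraMap ℂ Cq (φ (single v w 1) i) • Matrix.entryLinearMap Cq Cq v w
  have hΦ : ∀ X x i, SpM X x → Sp (Φ X i) (φ x i) := by
    intro X x i hX
    have e : φ x i = ∑ v, ∑ w, φ (single v w 1) i * x v w := by
      conv_lhs => rw [matrix_eq_sum_single x]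
      simp only [map_sum, Finset.sum_apply]
      refine sum_congr rfl fun v _ => sum_congr rfl fun w _ => ?_
      rw [show single v w (x v w) = x v w • single v w 1 by
        rw [smul_single, smul_eq_mul, mul_one], map_smul, Pi.smul_apply, smul_eq_mul, mul_comm]
    rw [e]
    simp only [Φ, LinearMap.pi_apply, LinearMap.sum_apply, LinearMap.smul_apply, Matrix.entryLinearMap_apply, smul_eq_mul]
    exact Sp.sum _ fun v _ => Sp.sum _ fun w _ => (Sp_const _).mul (hX v w)
  have hker := LinearMap.ker_ne_bot_of_finrank_lt (f := Φ ∘ₗ U.subtype) (by simpa using hlt)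
  obtain ⟨⟨X, hX⟩, hX0, hne⟩ := (Submodule.ne_bot_iff _).1 hker
  obtain ⟨k, x, hx, hs⟩ := exists_SpM (X := X) fun e => hne (Subtype.ext e)
  have hxA := h _ (U.smul_mem k hX) x hs
  have h0 : φ x = 0 := by
    funext i
    have h1 := hΦ _ _ i hs
    rw [map_smul, show Φ X = 0 from hX0, smul_zero] at h1
    exact h1.eq_zero
  have h1 : (Module.finBasis ℂ A).equivFun ⟨x, hxA⟩ = 0 := by
    rw [← h0]; exact (LinearMap.congr_fun hφ ⟨x, hxA⟩).symm
  rw [LinearEquiv.map_eq_zero_iff] at h1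
  exact hx (congrArg Subtype.val h1)

end specialize

/-! ### Surjectivity and injectivity -/

section final
open Matrix
variable {n N : ℕ}

theorem SpM_oS (m : Fin N) {X : Matrix (Idx n) (Idx n) Cq} {x : LM n} (h : SpM X x) : SpM (oS m X) (oS m x) :=
  fun v w => Sp_ite (fun _ => (h _ _).mul (Sp_sg _)) fun _ => Sp_zero

theorem SpM_amp {V : Type} [Fintype V] [DecidableEq V] (L : Lens (Word n N) V) {X : Matrix V V Cq} {x : Matrix V V ℂ}
    (h : SpM X x) : SpM (amp L X) (amp L x) := fun _ _ => Sp_ite (fun _ => h _ _) fun _ => Sp_zero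

/-- The value at `q = 1` of the action of `u_{ij}` divided by `q - q⁻¹`. -/
def yL (n r : ℕ) (m : Fin N) (i j : Idx n) : LM n :=
  if (m : ℕ) < r then sg ℂ (par i) • qE j i else -stC (sg ℂ (par i) • qE j i)

theorem Sp_sCoeff_diag {z : Cq} (hz : ∀ k : ℤ, Sp (z ^ k) 1) (a b i : Idx n) :
    Sp (sCoeff z a b i i) ((1 : LM n) a b) := by
  rw [sCoeff_diag]; exact Sp_ite (fun _ => hz _) fun _ => Sp_zero

theorem Sp_qinv_zpow (k : ℤ) : Sp (q⁻¹ ^ k) 1 := by rw [_root_.inv_zpow']; exact Sp_q_zpow _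

theorem sCoeff_lt (z : Cq) {i j : Idx n} (h : i < j) (a b : Idx n) : sCoeff z a b i j = (z - z⁻¹) *
    (sgn (par i) * ((if a = j ∧ b = i then 1 else 0) + (if a = negIdx j ∧ b = negIdx i then 1 else 0))) := by
  rw [sCoeff, if_neg (fun e => h.ne e.2), if_pos h, zero_add, mul_assoc]

theorem Sp_qE (i j a b : Idx n) : Sp (sgn (par i) *
    ((if a = j ∧ b = i then 1 else 0) + (if a = negIdx j ∧ b = negIdx i then 1 else 0)))
    ((sg ℂ (par i) • qE j i : LM n) a b) := by
  rw [Matrix.smul_apply, qE, Matrix.add_apply, single_apply, single_apply]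
  refine (Sp_sg _).mul (Sp.add ?_ ?_) <;>
  · simp only [eq_comm (b := a), eq_comm (b := b)]
    exact Sp_ite (fun _ => Sp_one) fun _ => Sp_zero

theorem xK_kS (r : ℕ) (m : Fin N) (i j a b : Idx n) : xK (kS n r m) i j a b
    = if (m : ℕ) < r then sCoeff q a b i j else superTFirst (sCoeff q⁻¹) a b i j := by
  rw [xK, kS, of_apply]
  split_ifs
  · exact (sCoeff_eq i j a b).symm
  · exact (superT_sCoeff_eq i j a b).symm

theorem SpM_uh_diag (r : ℕ) (m : Fin N) (i : Idx n) : SpM (uh (kS n r m) m i i) 1 := by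
  rw [uh, of_apply, zmod2_add_self, Zd_zero, mul_one, ← oS_one m]
  refine SpM_oS m fun a b => ?_
  rw [xK_kS]
  split_ifs
  · exact Sp_sCoeff_diag Sp_q_zpow a b i
  · have h : (1 : LM n) a b = (1 : LM n) b a * sg ℂ ((par b + par a) * par b) := by
      rcases eq_or_ne a b with rfl | h
      · simp [zmod2_add_self]
      · rw [one_apply_ne h, one_apply_ne h.symm, zero_mul]
    rw [h]
    exact (Sp_sCoeff_diag Sp_qinv_zpow b a i).mul (Sp_sg _)

theorem SpM_uh (r : ℕ) (m : Fin N) {i j : Idx n} (h : i < j) : ∃ X, uh (kS n r m) m i j = xi • X ∧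
    SpM X (hat m (yL n r m i j) (par i + par j)) := by
  have key : ∃ X : Matrix (Idx n) (Idx n) Cq, xK (kS n r m) i j = xi • X ∧ SpM X (yL n r m i j) := by
    refine ⟨Matrix.of fun a b => if (m : ℕ) < r then sgn (par i) *
        ((if a = j ∧ b = i then 1 else 0) + (if a = negIdx j ∧ b = negIdx i then 1 else 0)) else
        -1 * (sgn ((par a + par b) * par b) * (sgn (par i) *
        ((if b = j ∧ a = i then 1 else 0) + (if b = negIdx j ∧ a = negIdx i then 1 else 0)))), ?_, fun a b => ?_⟩
    · ext a b
      rw [xK_kS, Matrix.smul_apply, of_apply, superTFirst, superT, sCoeff_lt _ h, sCoeff_lt _ h, inv_inv, add_comm (par a)]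
      split_ifs <;> simp only [xi, smul_eq_mul] <;> ring
    · rw [yL, of_apply]
      by_cases hm : (m : ℕ) < r
      · rw [if_pos hm, if_pos hm]; exact Sp_qE i j a b
      · rw [if_neg hm, if_neg hm]
        have := Sp_neg_one.mul ((Sp_sg ((par a + par b) * par b)).mul (Sp_qE i j b a))
        rwa [neg_one_mul (sg ℂ _ * _)] at this
  obtain ⟨X, e, hX⟩ := key
  refine ⟨oS m X * Zd n N Cq (par i + par j), ?_, (SpM_oS m hX).mul (SpM_diagonal fun w => Sp_sg _)⟩
  rw [uh, of_apply, e, oS_smul, smul_mul_assoc]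

theorem SpM_uprod (r : ℕ) (l : List (Fin N)) : (∀ i : Idx n, SpM (uprod (kS n r) l i i) 1) ∧
    ∀ i j : Idx n, i < j → ∃ X, uprod (kS n r) l i j = xi • X ∧
      SpM X (l.map fun m => hat m (yL n r m i j) (par i + par j)).sum := by
  induction l with
  | nil =>
    refine ⟨fun i => ?_, fun i j h => ⟨0, ?_, ?_⟩⟩
    · rw [uprod_nil, Matrix.one_apply_eq]; exact SpM_one
    · rw [uprod_nil, one_apply_ne h.ne, smul_zero]
    · simpa using SpM_zero
  | cons m l ih =>
    refine ⟨fun i => ?_, fun i j h => ?_⟩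
    · rw [uprod_cons_diag (uh_kS_lower n r), ← mul_one 1]
      exact (SpM_uh_diag r m i).mul (ih.1 i)
    · have key : ∀ k, ∃ X, uh (kS n r m) m i k * uprod (kS n r) l k j = xi • X ∧
          SpM X ((if k = i then (l.map fun m => hat m (yL n r m i j) (par i + par j)).sum else 0) +
            (if k = j then hat m (yL n r m i j) (par i + par j) else 0)) := by
        intro k
        rcases lt_trichotomy k i with hk | rfl | hk
        · refine ⟨0, by rw [uh_kS_lower n r m i k hk, zero_mul, smul_zero], ?_⟩
          rw [if_neg hk.ne, if_neg (hk.trans h).ne, add_zero]; exact SpM_zero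
        · obtain ⟨X, e, hX⟩ := ih.2 k j h
          refine ⟨_, by rw [e, mul_smul_comm], ?_⟩
          rw [if_pos rfl, if_neg h.ne, add_zero, ← one_mul (List.sum _)]
          exact (SpM_uh_diag r m k).mul hX
        · obtain ⟨Y, e, hY⟩ := SpM_uh r m hk
          rw [if_neg hk.ne', zero_add]
          rcases lt_trichotomy k j with hj | rfl | hj
          · obtain ⟨X, e', hX⟩ := ih.2 k j hj
            refine ⟨xi • (Y * X), by rw [e, e', smul_mul_smul_comm, smul_smul], ?_⟩
            have := SpM.smul Sp_xi (hY.mul hX)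
            rw [if_neg hj.ne]
            rwa [zero_smul] at this
          · refine ⟨_, by rw [e, smul_mul_assoc], ?_⟩
            rw [if_pos rfl, ← mul_one (hat _ _ _)]
            exact hY.mul (ih.1 k)
          · refine ⟨0, by rw [uprod_lower (uh_kS_lower n r) l hj, mul_zero, smul_zero], ?_⟩
            rw [if_neg hj.ne']; exact SpM_zero
      choose X e hX using key
      refine ⟨∑ k, X k, ?_, ?_⟩
      · rw [uprod_cons, Matrix.mul_apply, smul_sum]; exact sum_congr rfl fun k _ => e k
      · have := SpM.sum Finset.univ fun k _ => hX k
        rw [sum_add_distrib, Finset.sum_ite_eq' Finset.univ i, Finset.sum_ite_eq' Finset.univ j,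
          if_pos (mem_univ _), if_pos (mem_univ _), add_comm] at this
        rwa [List.map_cons, List.sum_cons]

/-- The dual sites. -/
def stars (r N : ℕ) : List (Fin N) := (finRange N).filter fun m => r ≤ (m : ℕ)

theorem mem_stars {r : ℕ} {m : Fin N} : m ∈ stars r N ↔ r ≤ (m : ℕ) := by simp [stars]

theorem nodup_stars (r N : ℕ) : (stars r N).Nodup := (List.nodup_finRange N).filter _

theorem commute_mixY_of_SpM {r s : ℕ} {X : Matrix (Word n (r + s)) (Word n (r + s)) Cq} {x : WM n (r + s)}
    (hX : SpM X x) (hc : ∀ i j, Commute X (uHat n r s i j)) {i j : Idx n} (h : i < j) :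
    Commute x (mixY (stars r (r + s)) (sg ℂ (par i) • qE j i) (par i + par j)) := by
  obtain ⟨Y, e, hY⟩ := (SpM_uprod r (finRange (r + s))).2 i j h
  have e2 : (List.map (fun m => hat m (yL n r m i j) (par i + par j)) (finRange (r + s))).sum
      = mixY (stars r (r + s)) (sg ℂ (par i) • qE j i) (par i + par j) := by
    rw [mixY, ← List.sum_toFinset _ (List.nodup_finRange _), List.toFinset_finRange]
    refine sum_congr rfl fun m _ => ?_
    simp only [yL, mem_stars]
    by_cases hm : (m : ℕ) < r
    · rw [if_pos hm, if_neg (by omega)]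
    · rw [if_neg hm, if_pos (by omega)]
  rw [e2] at hY
  have hxi : xi ≠ 0 := fun e => by
    have h1 : algebraMap (Polynomial ℂ) Cq (Polynomial.X ^ 2 - 1) = 0 := by
      rw [map_sub, map_pow, RatFunc.algebraMap_X, map_one]
      have : (q - q⁻¹) * q = 0 := by rw [← xi_eq, e, zero_mul]
      rw [sub_mul, inv_mul_cancel₀ q_ne_zero] at this
      rw [← this, sq]; rfl
    rw [map_eq_zero_iff _ (IsFractionRing.injective (Polynomial ℂ) Cq)] at h1
    simpa using congrArg (Polynomial.eval 0) h1
  have h1 : X * Y = Y * X := by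
    have := hc i j
    rw [Commute, SemiconjBy, uHat, e, mul_smul_comm, smul_mul_assoc] at this
    exact smul_right_injective _ hxi this
  exact (hX.mul hY).unique (h1 ▸ hY.mul hX)

theorem HomM_mixY (l : List (Fin N)) {x : LM n} {p : ZMod 2} (hx : IsHom x p) : HomM (mixY l x p) p := by
  refine HomM.sum _ fun m _ => ?_
  have hz : HomM (Zd n N ℂ p) 0 := fun w' w h => by
    by_cases e : w' = w
    · simp [e]
    · simp [Zd, diagonal_apply, e] at h
  have h : IsHom (if m ∈ l then -stC x else x) p := ?_
  · have := (HomM_oS (m := m) h).mul hz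
    rwa [add_zero] at this
  split_ifs
  · exact fun i j h => IsHom_stC hx i j (by simpa using h)
  · exact hx

theorem mem_map_sTl {l : List (Fin N)} (hl : l.Nodup) {x : WM n N}
    (hc : ∀ i j : Idx n, i < j → Commute x (mixY l (sg ℂ (par i) • qE j i) (par i + par j))) :
    x ∈ (Subalgebra.toSubmodule (pureAlg n N)).map (sTl l) := by
  have hq : ∀ i j : Idx n, IsHom (sg ℂ (par i) • qE j i) (par i + par j) := fun i j a b h => by
    rw [add_comm (par i)]; exact IsHom_qE j i a b (right_ne_zero_of_mul h)
  have key : ∀ d, ∀ x : WM n N, HomM x d →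
      (∀ i j : Idx n, i < j → Commute x (mixY l (sg ℂ (par i) • qE j i) (par i + par j))) →
      x ∈ (Subalgebra.toSubmodule (pureAlg n N)).map (sTl l) := by
    intro d x hx hc
    obtain ⟨g, hg, rfl⟩ := exists_sTl_eq l hx
    refine ⟨g, mem_pureAlg ?_, rfl⟩
    have h1 : ∀ i j : Idx n, i < j → Commute g (diagY N (qE j i) (par j + par i)) := fun i j h => by
      have := commute_diagY_of_mixY hl (hq i j) hg (hc i j h)
      have e : diagY N (sg ℂ (par i) • qE j i) (par i + par j) = sg ℂ (par i) • diagY N (qE j i) (par j + par i) := by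
        simp only [diagY, hat, oS_smul, smul_mul_assoc, smul_sum, add_comm]
      rw [e] at this
      have := this.smul_right (sg ℂ (par i))
      rwa [smul_smul, sg_mul_self, one_smul] at this
    intro a b hab
    rcases lt_or_gt_of_ne hab with h | h
    · have := h1 (negIdx b) (negIdx a) (by rw [Subtype.mk_lt_mk] at *; exact neg_lt_neg h)
      rw [qE, negIdx_negIdx, negIdx_negIdx, add_comm (single _ _ _), par_negIdx, par_negIdx,
        show par a + 1 + (par b + 1) = par a + par b by
          generalize par a = x, par b = y; revert x y; decide] at this
      exact this
    · exact h1 b a h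
  let Z := Zd n N ℂ 1
  have hZ : Z * Z = 1 := by rw [← Zd_add]; exact Zd_zero
  have hZx : ∀ d, HomM (x + sg ℂ d • (Z * x * Z)) d := by
    intro d w' w h
    simp only [Z, Zd, Matrix.add_apply, Matrix.smul_apply, Matrix.mul_diagonal, Matrix.diagonal_mul, one_mul] at h
    by_contra hne
    apply h
    have : d = tot w' + tot w + 1 := by
      revert hne; generalize tot w' = a, tot w = b; clear h; revert a b d; decide
    rw [this, sg_add, sg_add, sg_one, smul_eq_mul]
    linear_combination (-x w' w * (sg ℂ (tot w) * sg ℂ (tot w))) * (sg_mul_self (R := ℂ) (tot w')) -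
      x w' w * (sg_mul_self (R := ℂ) (tot w))
  have hcx : ∀ d (i j : Idx n), i < j → Commute (x + sg ℂ d • (Z * x * Z))
      (mixY l (sg ℂ (par i) • qE j i) (par i + par j)) := by
    intro d i j h
    refine (hc i j h).add_left (Commute.smul_left ?_ _)
    have h2 := hc i j h
    have hY := HomM_mixY l (hq i j)
    set Y := mixY l (sg ℂ (par i) • qE j i) (par i + par j)
    have h1 : Z * Y = sg ℂ (1 * (par i + par j)) • (Y * Z) := Zd_mul_hom hY _
    change Z * x * Z * Y = Y * (Z * x * Z)
    have h3 : Y * Z = sg ℂ (1 * (par i + par j)) • (Z * Y) := by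
      rw [h1, smul_smul, sg_mul_self, one_smul]
    calc Z * x * Z * Y = Z * x * (Z * Y) := mul_assoc _ _ _
      _ = sg ℂ (1 * (par i + par j)) • (Z * (x * Y) * Z) := by rw [h1, mul_smul_comm]; simp only [mul_assoc]
      _ = (sg ℂ (1 * (par i + par j)) • (Z * Y)) * (x * Z) := by rw [h2.eq, smul_mul_assoc]; simp only [mul_assoc]
      _ = Y * (Z * x * Z) := by rw [← h3]; simp only [mul_assoc]
  have e : x = (1 / 2 : ℂ) • ((x + sg ℂ 0 • (Z * x * Z)) + (x + sg ℂ 1 • (Z * x * Z))) := by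
    rw [sg_zero, sg_one, one_smul, neg_one_smul, add_add_add_comm, add_neg_cancel, add_zero, ← two_smul ℂ x, smul_smul]
    norm_num
  rw [e]
  exact Submodule.smul_mem _ _ (Submodule.add_mem _ (key 0 _ (hZx 0) (hcx 0)) (key 1 _ (hZx 1) (hcx 1)))

theorem Impl.sw {σ : Equiv.Perm (Fin N)} {g : WM n N} (hg : Impl σ g) (a b : Fin N) :
    g * QWBC.sw n a b = QWBC.sw n (σ a) (σ b) * g := by
  simp only [QWBC.sw, mul_sum, sum_mul, mul_smul_comm, smul_mul_assoc, sE, ← mul_assoc, hg.oS]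
  simp only [mul_assoc, hg.oS]

theorem Impl.cap {σ : Equiv.Perm (Fin N)} {g : WM n N} (hg : Impl σ g) (a b : Fin N) :
    g * QWBC.cap n a b = QWBC.cap n (σ a) (σ b) * g := by
  simp only [QWBC.cap, mul_sum, sum_mul, mul_smul_comm, smul_mul_assoc, sE, ← mul_assoc, hg.oS]
  simp only [mul_assoc, hg.oS]

theorem sw_mem {B : Subalgebra ℂ (WM n N)} {r : ℕ}
    (h : ∀ k (hk : k + 1 < N), k + 1 ≠ r → sw n ⟨k, by omega⟩ ⟨k + 1, hk⟩ ∈ B) (a b : Fin N) (hab : a ≠ b)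
    (hr : a ∈ stars r N ↔ b ∈ stars r N) : sw n a b ∈ B := by
  rw [mem_stars, mem_stars] at hr
  have key : ∀ k, ∀ a b : Fin N, (a : ℕ) + 1 + k = b → (r ≤ (a : ℕ) ↔ r ≤ (b : ℕ)) → sw n a b ∈ B := by
    intro k
    induction k with
    | zero =>
      intro a b e hr
      have := h a (by omega) (by omega)
      rwa [show (⟨a + 1, _⟩ : Fin N) = b from Fin.ext e] at this
    | succ k ih =>
      intro a b e hr
      let c : Fin N := ⟨a + 1 + k, by omega⟩
      have hcb : c ≠ b := Fin.ne_of_val_ne (by simp only [c]; omega)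
      have h1 := h c (by simp only [c]; omega) (by simp only [c]; omega)
      rw [show (⟨c + 1, _⟩ : Fin N) = b from Fin.ext e] at h1
      have h2 := (Impl_sw (n := n) hcb).sw a c
      rw [Equiv.swap_apply_left, Equiv.swap_apply_of_ne_of_ne (Fin.ne_of_val_ne (by simp only [c]; omega))
        (Fin.ne_of_val_ne (by omega))] at h2
      have := mul_mem (mul_mem h1 (ih a c rfl (by simp only [c]; omega))) h1
      rwa [h2, mul_assoc, sw_sq hcb, mul_one] at this
  rcases lt_or_gt_of_ne hab with h' | h'
  · exact key (b - a - 1) a b (by rw [Fin.lt_def] at h'; omega) hr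
  · rw [sw_comm hab]; exact key (a - b - 1) b a (by rw [Fin.lt_def] at h'; omega) hr.symm

theorem cap_mem {B : Subalgebra ℂ (WM n N)} {r : ℕ}
    (hs : ∀ a b : Fin N, a ≠ b → (a ∈ stars r N ↔ b ∈ stars r N) → sw n a b ∈ B)
    (h : ∀ k (hk : k + 1 < N), k + 1 = r → cap n ⟨k, by omega⟩ ⟨k + 1, hk⟩ ∈ B) (a b : Fin N) (ha : a ∉ stars r N)
    (hb : b ∈ stars r N) : cap n a b ∈ B := by
  have hne : ∀ {a b}, a ∉ stars r N → b ∈ stars r N → a ≠ b := fun ha hb e => ha (e ▸ hb)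
  let c : Fin N := ⟨r - 1, by rw [mem_stars] at hb; omega⟩
  let d : Fin N := ⟨r, by rw [mem_stars] at hb; omega⟩
  have hc : c ∉ stars r N := by rw [mem_stars] at ha ⊢; simp only [c]; omega
  have hd : d ∈ stars r N := by rw [mem_stars]
  have hr : r - 1 + 1 = r := by rw [mem_stars] at ha; omega
  have h1 : cap n c d ∈ B := by
    have := h (r - 1) (by rw [hr]; exact d.2) hr
    rwa [show (⟨r - 1 + 1, _⟩ : Fin N) = d from Fin.ext hr] at this
  have h2 : cap n a d ∈ B := by
    rcases eq_or_ne c a with e | e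
    · rwa [← e]
    · have h2 := (Impl_sw (n := n) e).cap c d
      rw [Equiv.swap_apply_left, Equiv.swap_apply_of_ne_of_ne (hne hc hd).symm (hne ha hd).symm] at h2
      have h3 := hs c a e (by simp [hc, ha])
      have := mul_mem (mul_mem h3 h1) h3
      rwa [h2, mul_assoc, sw_sq e, mul_one] at this
  rcases eq_or_ne d b with e | e
  · rwa [← e]
  · have h4 := (Impl_sw (n := n) e).cap a d
    rw [Equiv.swap_apply_left, Equiv.swap_apply_of_ne_of_ne (hne ha hd) (hne ha hb)] at h4
    have h3 := hs d b e (by simp [hd, hb])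
    have := mul_mem (mul_mem h3 h2) h3
    rwa [h4, mul_assoc, sw_sq e, mul_one] at this

variable (n) (r s : ℕ)

/-- The specializations of the operators of the quantum walled Brauer-Clifford superalgebra. -/
def spAlg : Subalgebra ℂ (WM n (r + s)) where
  carrier := {x | ∃ D, SpM (rhoM n r s D) x}
  mul_mem' := fun ⟨D, h⟩ ⟨D', h'⟩ => ⟨D * D', by rw [map_mul]; exact h.mul h'⟩
  add_mem' := fun ⟨D, h⟩ ⟨D', h'⟩ => ⟨D + D', by rw [map_add]; exact h.add h'⟩
  algebraMap_mem' := fun k => ⟨algebraMap ℂ Cq k • 1, by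
    rw [map_smul, map_one, Algebra.algebraMap_eq_smul_one (A := WM n (r + s))]; exact SpM.smul (Sp_const k) (SpM_one (W := Word n (r + s)))⟩

variable {n r s}

/-- The matrix of the transposition of two letters. -/
def swK (n : ℕ) : Matrix (Idx n × Idx n) (Idx n × Idx n) ℂ :=
  fun y x => if y = (x.2, x.1) then sg ℂ (par x.1 * par x.2) else 0

/-- The matrix of the composite of the evaluation and the coevaluation. -/
def capK (n : ℕ) : Matrix (Idx n × Idx n) (Idx n × Idx n) ℂ :=
  fun y x => if y.1 = y.2 ∧ x.1 = x.2 then 1 * (sg ℂ (par x.1) * 1) else 0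

theorem SpM_tM : SpM (tM (n := n)) (swK n) := by
  intro y x
  have h : ∀ (P : Prop) [Decidable P] (b : Cq), Sp b 0 → Sp (if P then b else 0) 0 := fun P _ b hb => by
    split_ifs
    · exact hb
    · exact Sp_zero
  have h1 : Sp (bet x.1 x.2) 0 := h _ _ Sp_xi
  have h2 : Sp (gam x.1 x.2) 0 := h _ _ (zero_mul (sg ℂ (par x.2)) ▸ Sp_xi.mul (Sp_sg (par x.2)))
  have h3 : Sp (alp x.1 x.2) (sg ℂ (par x.1 * par x.2)) :=
    mul_one (sg ℂ (par x.1 * par x.2)) ▸ (Sp_sg (par x.1 * par x.2)).mul (Sp_q_zpow _)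
  have := ((Sp_ite (P := y = (x.2, x.1)) (fun _ => h3) fun _ => Sp_zero).add (h (y = x) _ h1)).add (h (y = (negIdx x.1, negIdx x.2)) _ h2)
  rwa [add_zero, add_zero] at this

theorem SpM_tDM : SpM (tDM (n := n)) (swK n) := by
  intro y x
  have : swK n y x = swK n (x.2, x.1) (y.2, y.1) := by
    obtain ⟨y, y'⟩ := y; obtain ⟨x, x'⟩ := x
    simp only [swK, Prod.mk.injEq]
    by_cases h : y = x' ∧ y' = x
    · obtain ⟨rfl, rfl⟩ := h; simp
    · rw [if_neg h, if_neg (fun e => h ⟨e.1.symm, e.2.symm⟩)]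
  rw [this]
  exact SpM_tM (x.2, x.1) (y.2, y.1)

theorem SpM_eM : SpM (eM (n := n)) (capK n) := fun y x =>
  Sp_ite (fun _ => (Sp_q_zpow _).mul ((Sp_sg _).mul (Sp_q_zpow _))) fun _ => Sp_zero

theorem sw_eq_amp {k : ℕ} (hk : k + 1 < N) : sw n ⟨k, by omega⟩ ⟨k + 1, hk⟩ = amp (adj k hk) (swK n) := by
  have e : ∀ a b : Fin N, sw n a b = tS a b fun i j k l => if k = j ∧ l = i then sg ℂ (par j) else 0 := fun a b => by
    simp only [sw, tS, ite_smul, zero_smul, ite_and, Finset.sum_ite_eq', Finset.sum_ite_eq, mem_univ, if_true,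
      Finset.sum_ite_irrel, Finset.sum_const_zero]
  rw [e, tS_adjacent rfl]
  · unfold adj
    congr 1
    ext ⟨y, y'⟩ ⟨x, x'⟩
    simp only [of_apply, swK, Prod.mk.injEq]
    by_cases h1 : y' = x ∧ x' = y
    · obtain ⟨rfl, rfl⟩ := h1
      simp only [and_self, if_true, ← sg_add]
      congr 1
      generalize par y' = a, par x' = b; revert a b; decide
    · rw [if_neg h1, if_neg (fun e => h1 ⟨e.2, e.1.symm⟩), zero_mul]
  · intro i j k l h
    split_ifs at h with h1
    · rw [h1.1, h1.2, add_comm]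
    · exact absurd rfl h

theorem cap_eq_amp {k : ℕ} (hk : k + 1 < N) : cap n ⟨k, by omega⟩ ⟨k + 1, hk⟩ = amp (adj k hk) (capK n) := by
  have e : ∀ a b : Fin N, cap n a b = tS a b fun i j k l => if k = i ∧ l = j then sg ℂ (par i * par j) else 0 :=
    fun a b => by
      simp only [cap, tS, ite_smul, zero_smul, ite_and, Finset.sum_ite_eq', Finset.sum_ite_eq, mem_univ, if_true,
        Finset.sum_ite_irrel, Finset.sum_const_zero]
  rw [e, tS_adjacent rfl]
  · unfold adj
    congr 1
    ext ⟨y, y'⟩ ⟨x, x'⟩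
    simp only [of_apply, capK]
    by_cases h1 : y' = y ∧ x' = x
    · obtain ⟨rfl, rfl⟩ := h1
      simp only [and_self, if_true, ← sg_add, one_mul, mul_one]
      congr 1
      generalize par y' = a, par x' = b; revert a b; decide
    · rw [if_neg h1, if_neg (fun e => h1 ⟨e.1.symm, e.2.symm⟩), zero_mul]
  · intro i j k l h
    split_ifs at h with h1
    · rw [h1.1, h1.2]
    · exact absurd rfl h

theorem SpM_phTM : SpM (phTM n) (stC (phC n)) := fun i j => by
  have h : stC (phC n) i j = if i = negIdx j then 1 else 0 := by
    rw [stC, phC, of_apply]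
    split_ifs with h
    · rw [h, par_negIdx, ← sg_add]
      generalize par j = a; rcases zmod2_cases a with rfl | rfl <;> simp [show (1 + 1 : ZMod 2) = 0 from rfl]
    · rw [mul_zero]
  rw [h]
  exact Sp_ite (fun _ => Sp_one) fun _ => Sp_zero

theorem gen_mem_spAlg {x : WM n (r + s)} (g : BCGen r s) (h : SpM (toM n r s (bcAction n g)) x) : x ∈ spAlg n r s :=
  ⟨BC.gen g, by rwa [rhoM_gen]⟩

theorem map_sTl_le_spAlg {f : WM n (r + s)} (hf : f ∈ pureAlg n (r + s)) : sTl (stars r (r + s)) f ∈ spAlg n r s := by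
  have hs := sw_mem (n := n) (N := r + s) (B := spAlg n r s) (r := r) fun k hk hb => by
    rw [sw_eq_amp hk]
    rcases lt_or_gt_of_ne hb with hb | hb
    · exact gen_mem_spAlg (.t k hb) (toM_t (n := n) (s := s) k hb ▸ SpM_amp _ SpM_tM)
    · obtain ⟨i, rfl⟩ : ∃ i, k = r + i := ⟨k - r, by omega⟩
      exact gen_mem_spAlg (.tStar i (by omega)) (toM_tStar (n := n) (r := r) (s := s) i (by omega) ▸ SpM_amp _ SpM_tDM)
  refine sTl_pureAlg_mem (nodup_stars _ _) hs (cap_mem hs fun k hk hb => ?_) (fun m hm => ?_) (fun m hm => ?_) hf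
  · subst hb
    rw [cap_eq_amp hk]
    exact gen_mem_spAlg (.e (by omega) (by omega)) (toM_e (n := n) (r := k + 1) (s := s) (by omega) (by omega) ▸ SpM_amp _ SpM_eM)
  · rw [mem_stars, not_le] at hm
    refine gen_mem_spAlg (.c m hm) ?_
    rw [toM_c]
    exact SpM_oS m fun i j => Sp_ite (fun _ => Sp_sg _) fun _ => Sp_zero
  · rw [mem_stars] at hm
    refine gen_mem_spAlg (.cStar (m - r) (by omega)) ?_
    rw [toM_cStar, show (⟨r + (m - r), _⟩ : Fin (r + s)) = m from Fin.ext (by simp; omega)]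
    exact SpM_oS m SpM_phTM

theorem mem_range_of_commute {X : Matrix (Word n (r + s)) (Word n (r + s)) Cq}
    (hX : ∀ i j, Commute X (uHat n r s i j)) : X ∈ LinearMap.range (rhoM n r s).toLinearMap := by
  let U : Submodule Cq (Matrix (Word n (r + s)) (Word n (r + s)) Cq) :=
    Subalgebra.toSubmodule (Subalgebra.centralizer Cq {u | ∃ i j, u = uHat n r s i j})
  have hU : ∀ Y, Y ∈ U ↔ ∀ i j, Commute Y (uHat n r s i j) := fun Y => by
    change (∀ u ∈ {u | ∃ i j, u = uHat n r s i j}, u * Y = Y * u) ↔ _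
    exact ⟨fun h i j => (h _ ⟨i, j, rfl⟩).symm, fun h u ⟨i, j, e⟩ => e ▸ (h i j).symm⟩
  let A := (Subalgebra.toSubmodule (pureAlg n (r + s))).map (sTl (stars r (r + s)))
  have hle : LinearMap.range (rhoM n r s).toLinearMap ≤ U := by
    rintro _ ⟨D, rfl⟩
    rw [hU]
    have h : rhoEnd n r s D ∈ centPart (tau n r s) 0 ⊔ centPart (tau n r s) 1 := rhoEnd_mem n r s D
    obtain ⟨f, hf, g, hg, e⟩ := Submodule.mem_sup.1 h
    intro i j
    have e2 : rhoM n r s D = toM n r s f + toM n r s g := by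
      rw [← map_add, e]; exact ((toM n r s).apply_symm_apply _).symm
    change Commute (rhoM n r s D) _
    rw [e2]
    exact (((mem_centPart_iff n r s f 0).1 hf).2 i j).add_left (((mem_centPart_iff n r s g 1).1 hg).2 i j)
  have h1 : Module.finrank Cq U ≤ Module.finrank ℂ A := finrank_le_of_SpM U A fun Y hY y hs =>
    mem_map_sTl (nodup_stars _ _) fun i j h => commute_mixY_of_SpM hs ((hU Y).1 hY) h
  have h2 : Module.finrank ℂ A ≤ Module.finrank Cq (LinearMap.range (rhoM n r s).toLinearMap) := by
    have hA : ∀ a : A, ∃ D, SpM (rhoM n r s D) a := fun ⟨a, f, hf, e⟩ => by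
      obtain ⟨D, hD⟩ := map_sTl_le_spAlg (r := r) (s := s) hf
      exact ⟨D, by rwa [e] at hD⟩
    choose D hD using fun i => hA (Module.finBasis ℂ A i)
    have hli : LinearIndependent ℂ fun i => (Module.finBasis ℂ A i : WM n (r + s)) :=
      (Module.finBasis ℂ A).linearIndependent.map' A.subtype (Submodule.ker_subtype A)
    have h3 := LinearIndependent.of_SpM hli hD
    have h4 : LinearIndependent Cq fun i =>
        (⟨rhoM n r s (D i), D i, rfl⟩ : LinearMap.range (rhoM n r s).toLinearMap) :=
      LinearIndependent.of_comp (Submodule.subtype _) h3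
    simpa using h4.fintype_card_le_finrank
  rw [Submodule.eq_of_le_of_finrank_le hle (h1.trans h2), hU]
  exact hX

theorem rho_surjective (n r s : ℕ) : Function.Surjective (rho n r s) := by
  rintro ⟨F, hF⟩
  obtain ⟨f, hf, g, hg, rfl⟩ := Submodule.mem_sup.1 (show F ∈ centPart (tau n r s) 0 ⊔ centPart (tau n r s) 1 from hF)
  obtain ⟨D, hD⟩ := mem_range_of_commute (n := n) (r := r) (s := s) (X := toM n r s (f + g)) fun i j => by
    rw [map_add]
    exact (((mem_centPart_iff n r s f 0).1 hf).2 i j).add_left (((mem_centPart_iff n r s g 1).1 hg).2 i j)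
  exact ⟨D, Subtype.ext ((toM n r s).symm_apply_eq.2 hD)⟩

theorem rho_injective {n r s : ℕ} (h : r + s ≤ n) : Function.Injective (rho n r s) := by
  classical
  obtain ⟨F, hF, hm⟩ := exists_linearIndependent h
  choose D hD using fun i => map_sTl_le_spAlg (r := r) (s := s) (hm i)
  have h1 := LinearIndependent.of_SpM (hF.map' (sTl (stars r (r + s)))
    (LinearMap.ker_eq_bot.2 (sTl_injective _))) hD
  obtain ⟨b, hb⟩ := BC_dimLE r s
  have hspan : Submodule.span Cq (Set.range b) = ⊤ := top_le_iff.1 hb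
  have : Module.Finite Cq (BC r s) := ⟨⟨Finset.univ.image b, by simpa using hspan⟩⟩
  have h2 : Module.finrank Cq (BC r s) ≤ 2 ^ (r + s) * (r + s).factorial := by
    have := finrank_range_le_card (R := Cq) b
    rwa [Set.finrank, hspan, finrank_top, Fintype.card_fin] at this
  have h3 : LinearIndependent Cq fun i => (⟨rhoM n r s (D i), D i, rfl⟩ : LinearMap.range (rhoM n r s).toLinearMap) :=
    LinearIndependent.of_comp (Submodule.subtype _) h1
  have h4 := h3.fintype_card_le_finrank
  rw [Fintype.card_prod, Fintype.card_perm, Fintype.card_finset, Fintype.card_fin, mul_comm] at h4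
  have h5 := LinearMap.finrank_range_add_finrank_ker (rhoM n r s).toLinearMap
  have hker : LinearMap.ker (rhoM n r s).toLinearMap = ⊥ := Submodule.finrank_eq_zero.1 (by omega)
  intro x y e
  refine LinearMap.ker_eq_bot.1 hker ((toM n r s).symm.injective ?_)
  exact congrArg Subtype.val e

end final

end

end QWBC

theorem mainTheorem1 (n r s : ℕ) :
    ∃ τ : QWBC.Uq n →ₐ[QWBC.Cq] QWBC.EndMixed n r s,
      (∀ x : QWBC.UGen n, τ (QWBC.Uq.gen x) = QWBC.uAction n r s x.1.1 x.1.2) ∧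
      ∃ ρ : QWBC.BC r s →ₐ[QWBC.Cq] QWBC.superCentralizer τ,
        (∀ g : QWBC.BCGen r s, (ρ (QWBC.BC.gen g) : QWBC.EndMixed n r s) = QWBC.bcAction n g) ∧
        (∀ p : ZMod 2, ∀ x ∈ QWBC.BC.part r s p,
          (ρ x : QWBC.EndMixed n r s) ∈ QWBC.endPart n r s p) ∧
        Function.Surjective ρ ∧
        (r + s ≤ n → Function.Bijective ρ) :=
  ⟨QWBC.tau n r s, QWBC.tau_gen n r s, QWBC.rho n r s, QWBC.rhoEnd_gen n r s,
    fun p _ hx => (QWBC.rhoEnd_part n r s p hx).1, QWBC.rho_surjective n r s,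
    fun h => ⟨QWBC.rho_injective h, QWBC.rho_surjective n r s⟩⟩
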